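/- **Notation.** $h(x)=-x\log_2x-(1-x)\log_2(1-x)$ is the binary entropy; $\tau=\delta_{\rm GV}(R)$ is the $\tau\in[0,\tfrac12]$ with $h(\tau)=1-R$; $K_w^n(u)=\sum_{j=0}^w(-1)^j\binom uj\binom{n-u}{w-j}$ is the Krawtchouk polynomial. For $x,\omega\in[0,\frac12]$ put $D=(1-2x)^2-4\omega(1-\omega)$, $z=\frac{1-2x-\sqrt D}{2(1-\omega)}$ and $$\tilde\varepsilon(x,\omega)=\begin{cases}2\big(x\log_2(1-z)+(1-x)\log_2(1+z)-\omega\log_2z-h(\omega)\big)&\text{if }x\le\frac12-\sqrt{\omega(1-\omega)},\\ 1-h(x)-h(\omega)&\text{otherwise,}\end{cases}$$ extended to $[0,1]^2$ by $\tilde\varepsilon(x,\omega)=\tilde\varepsilon(1-x,\omega)=\tilde\varepsilon(x,1-\omega)$. Terms $0\cdot h(0/0)$, $0\cdot\tilde\varepsilon(0/0,0/0)$ and $0\cdot\log_20$ are $0$. **The decoder.** Let $e\in\mathbb F_2^n$ be an error of weight $t$ on a code of length $n$ and dimension $k$. The parameters are nonnegative integers $s,\ell,\ell_1,\ell_2,p_1,p_2,w_1,w_2,u_1,u_2,N_{\rm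 iter}$; put $m=n-k+\ell$ and $r=k-\ell-s$. They are *valid* if $k\le n$, $\ell+s\le k$, $\ell_1\le\ell_2\le\ell$, $w_1=r/2$, $p_1,p_2,w_2$ are even, $p_1\le p_2\le w_2\le m$, $p_2\le2p_1$, $w_2\le2p_2$, $u_1\le r$, $u_2\le m$, $t-s\le u_1+u_2\le t$, and (representation constraints) $$\ell_1=\Big\lfloor\log_2\tbinom{p_2}{p_2/2}\tbinom{m-p_2}{p_1-p_2/2}\Big\rfloor,\qquad \ell_2=\Big\lfloor\log_2\tbinom{w_2}{w_2/2}\tbinom{m-w_2}{p_2-w_2/2}\Big\rfloor .$$ Each of the $N_{\rm iter}$ iterations splits the positions uniformly at random into $\mathscr P,\mathscr N_1,\mathscr N_2$ of sizes $s,r,m$. The code then has a generator matrix $\begin{pmatrix}I&M\\0&H\end{pmatrix}$, with the identity on $\mathscr P\cup\mathscr N_1$; the entries of $M$ and of the $\ell\times m$ matrix $H$ are modelled as independent uniform bits. Let $H_1,H_2,H_3$ be the blocks of $\ell_1,\ \ell_2-\ell_1,\ \ell-\ell_2$ consecutive rows of $H$. For $L,L'\subseteq\mathbb F_2^m$ let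 $\mathrm{Merge}(L,L',w,A)=\{x+x':x\in L,\ x'\in L',\ Ax=Ax',\ |x+x'|=w\}$, which takes $\#L+\#L'+\#\{(x,x')\in L\times L':Ax=Ax'\}$ steps. Let $L_1^0$ and $L_2^0$ be the sets of all words of weight $p_1/2$ supported in the first, respectively second, half of the $m$ positions, and let $L^1=\mathrm{Merge}(L_1^0,L_2^0,p_1,H_1)$, $L^2=\mathrm{Merge}(L^1,L^1,p_2,H_2)$, $L^3=\mathrm{Merge}(L^2,L^2,w_2,H_3)$. The produced parity-checks are the $c\in\mathbb F_2^n$ with $\begin{pmatrix}I&M\\0&H\end{pmatrix}c=0$, $c_{\mathscr N_2}\in L^3$ and $|c_{\mathscr N_1}|=w_1$. Let $N$ be their expected number, $T_{\rm eq}$ the expected total number of steps ($\#L^0_1+\#L^0_2$ plus the three merges), $P_{\rm succ}$ the probability that $|e_{\mathscr N_1}|=u_1$ and $|e_{\mathscr N_2}|=u_2$, and $\delta=\frac{K_{w_1}^{r}(u_1)}{\binom{r}{w_1}}\cdot\frac{K_{w_2}^{m}(u_2)}{\binom{m}{w_2}}$ the bias of the LPN noise. With a fast Fourier transform on $\mathbb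 F_2^s$ in each iteration, the running time is $T=N_{\rm iter}\,(T_{\rm eq}+s2^s)$. **Asymptotic exponent.** Let $0<R<1$, and for each $n$ let $k_n$ be a dimension and $e_n\in\mathbb F_2^n$ an error with $k_n/n\to R$ and $|e_n|/n\to\delta_{\rm GV}(R)$. A family of parameters, one choice for each $n$, is *admissible* if it is valid for all large $n$; the ratios $\frac sn,\frac{u_1}n,\frac{u_2}n,\frac\ell n,\frac{\ell_1}n,\frac{\ell_2}n,\frac{p_1}n,\frac{p_2}n,\frac{w_1}n,\frac{w_2}n$ converge to limits $\sigma,\nu_1,\nu_2,\lambda,\lambda_1,\lambda_2,\pi_1,\pi_2,\omega_1,\omega_2$ with $\pi_2<\lambda_1$, $\omega_2<\lambda_2$, $\pi_1<1-R+\lambda$; and the conditions for recovering $e_{\mathscr P}$ hold, $N=\omega(n/\delta^2)$ and $N_{\rm iter}=\omega(1/P_{\rm succ})$. The asymptotic complexity exponent $\alpha_{\rm BJMM}(R)$ of the RLPN decoder based on this three-level technique is the infimum of $\limsup_n\frac1n\log_2T$ over all admissible families. **Proposition.** $\alpha_{\rm BJMM}(R)$ is a real number that does not depend on the choice of $(k_n)$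 and $(e_n)$, and $$\alpha_{\rm BJMM}(R)=\inf_{(\sigma,\nu_1,\nu_2,\lambda,\lambda_1,\lambda_2,\pi_1,\pi_2,\omega_1,\omega_2)\in\mathscr R}\beta,\qquad \beta=\max(\sigma,\nu)+\rho,\qquad \nu=\max(\gamma_1,\gamma_2,\gamma_3),$$ where $$\gamma_1=\max\Big(\tfrac{1-R+\lambda}2h\big(\tfrac{\pi_1}{1-R+\lambda}\big),\ (1-R+\lambda)h\big(\tfrac{\pi_1}{1-R+\lambda}\big)-\lambda_1\Big),$$ $$\gamma_2=2(1-R+\lambda)h\big(\tfrac{\pi_1}{1-R+\lambda}\big)-\lambda_1-\lambda_2,\qquad \gamma_3=2(1-R+\lambda)h\big(\tfrac{\pi_2}{1-R+\lambda}\big)-\lambda-\lambda_2,$$ $$\rho=1-R-\sigma h\big(\tfrac{\tau-\nu_1-\nu_2}\sigma\big)-(R-\lambda-\sigma)h\big(\tfrac{\nu_1}{R-\lambda-\sigma}\big)-(1-R+\lambda)h\big(\tfrac{\nu_2}{1-R+\lambda}\big),$$ and the (non-empty) region $\mathscr R$ is the set of nonnegative tuples such that $$\sigma\le R-\lambda,\quad\lambda_1\le\lambda_2\le\lambda,\quad\pi_1\le\pi_2\le\omega_2,\quad\nu_1\le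 R-\lambda-\sigma,\quad\nu_2\le1-R+\lambda,\quad\tau-\sigma\le\nu_1+\nu_2\le\tau,$$ $$\pi_1\ge\tfrac{\pi_2}2,\quad\pi_2\ge\tfrac{\omega_2}2,\quad\pi_2<\lambda_1,\quad\omega_2<\lambda_2,\quad\pi_1<1-R+\lambda,\quad\omega_1=\tfrac{R-\lambda-\sigma}2,$$ $$\lambda_1=\pi_2+(1-R+\lambda-\pi_2)\,h\Big(\tfrac{\pi_1-\pi_2/2}{1-R+\lambda-\pi_2}\Big),\qquad\lambda_2=\omega_2+(1-R+\lambda-\omega_2)\,h\Big(\tfrac{\pi_2-\omega_2/2}{1-R+\lambda-\omega_2}\Big),$$ $$(1-R+\lambda)h\big(\tfrac{\omega_2}{1-R+\lambda}\big)-\lambda=-(R-\lambda-\sigma)\,\tilde\varepsilon\big(\tfrac{\nu_1}{R-\lambda-\sigma},\tfrac{\omega_1}{R-\lambda-\sigma}\big)-(1-R+\lambda)\,\tilde\varepsilon\big(\tfrac{\nu_2}{1-R+\lambda},\tfrac{\omega_2}{1-R+\lambda}\big).$$ -/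

import Mathlib

open Filter Topology
open scoped BigOperators

noncomputable section

namespace RLPN

/-! ### Entropy, Gilbert–Varshamov distance, Krawtchouk polynomials -/

/-- Binary entropy, in bits. -/
def h (x : ℝ) : ℝ := Real.binEntropy x / Real.log 2

/-- Relative Gilbert–Varshamov distance `h⁻¹(1 - R)`, where `h⁻¹` takes values in `[0, 1/2]`. -/
def deltaGV (R : ℝ) : ℝ := Function.invFunOn h (Set.Icc 0 (1 / 2)) (1 - R)

/-- Value at the integer `u ≤ n` of the Krawtchouk polynomial of order `n` and degree `w`. -/
def krawtchouk (n w u : ℕ) : ℤ :=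
  ∑ j ∈ Finset.range (w + 1), (-1) ^ j * (u.choose j : ℤ) * ((n - u).choose (w - j) : ℤ)

/-- The bias `K_w^n(u) / binom(n, w)` of `⟨e, x⟩` for a fixed `e` of weight `u` and a uniformly
random `x` of weight `w` in `𝔽₂ⁿ`. -/
def bias (n w u : ℕ) : ℝ := (krawtchouk n w u : ℝ) / (n.choose w : ℝ)

/-- The exponent of the squared bias for relative weights `τ, ω ∈ [0, 1/2]`. -/
def biasExponentCore (τ ω : ℝ) : ℝ :=
  let D := (1 - 2 * τ) ^ 2 - 4 * ω * (1 - ω)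
  let z := (1 - 2 * τ - √D) / (2 * (1 - ω))
  if τ ≤ 1 / 2 - √(ω * (1 - ω)) then
    2 * (τ * Real.logb 2 (1 - z) + (1 - τ) * Real.logb 2 (1 + z) - ω * Real.logb 2 z - h ω)
  else 1 - h τ - h ω

/-- The exponent of the squared bias for relative weights `τ, ω ∈ [0, 1]`: since
`|K_w^n(n - u)| = |K_w^n(u)| = |K_{n-w}^n(u)|`, it is symmetric in both variables about `1/2`. -/
def biasExponent (τ ω : ℝ) : ℝ := biasExponentCore (min τ (1 - τ)) (min ω (1 - ω))

/-! ### The optimization problem -/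

/-- Relative parameters `(σ, ν₁, ν₂, λ, λ₁, λ₂, π₁, π₂, ω₁, ω₂)`. -/
structure RelParams where
  σ : ℝ
  ν₁ : ℝ
  ν₂ : ℝ
  lam : ℝ
  lam₁ : ℝ
  lam₂ : ℝ
  π₁ : ℝ
  π₂ : ℝ
  ω₁ : ℝ
  ω₂ : ℝ

/-- First merge and initial lists. -/
def gamma₁ (R : ℝ) (x : RelParams) : ℝ :=
  max ((1 - R + x.lam) / 2 * h (x.π₁ / (1 - R + x.lam)))
    ((1 - R + x.lam) * h (x.π₁ / (1 - R + x.lam)) - x.lam₁)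

/-- Second merge. -/
def gamma₂ (R : ℝ) (x : RelParams) : ℝ :=
  2 * (1 - R + x.lam) * h (x.π₁ / (1 - R + x.lam)) - x.lam₁ - x.lam₂

/-- Third merge. -/
def gamma₃ (R : ℝ) (x : RelParams) : ℝ :=
  2 * (1 - R + x.lam) * h (x.π₂ / (1 - R + x.lam)) - x.lam - x.lam₂

/-- Exponent of the cost of producing the parity-checks. -/
def nu (R : ℝ) (x : RelParams) : ℝ := max (gamma₁ R x) (max (gamma₂ R x) (gamma₃ R x))

/-- Exponent of the inverse of the probability that the bet on the error is fulfilled. -/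
def rho (R : ℝ) (x : RelParams) : ℝ :=
  1 - R - x.σ * h ((deltaGV R - x.ν₁ - x.ν₂) / x.σ)
    - (R - x.lam - x.σ) * h (x.ν₁ / (R - x.lam - x.σ))
    - (1 - R + x.lam) * h (x.ν₂ / (1 - R + x.lam))

/-- The objective function. -/
def beta (R : ℝ) (x : RelParams) : ℝ := max x.σ (nu R x) + rho R x

/-- The constraint region. -/
structure InRegion (R : ℝ) (x : RelParams) : Prop where
  nonneg : 0 ≤ x.σ ∧ 0 ≤ x.ν₁ ∧ 0 ≤ x.ν₂ ∧ 0 ≤ x.lam ∧ 0 ≤ x.lam₁ ∧ 0 ≤ x.lam₂ ∧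
    0 ≤ x.π₁ ∧ 0 ≤ x.π₂ ∧ 0 ≤ x.ω₁ ∧ 0 ≤ x.ω₂
  σ_le : x.σ ≤ R - x.lam
  lam₁_le : x.lam₁ ≤ x.lam₂
  lam₂_le : x.lam₂ ≤ x.lam
  π₁_le : x.π₁ ≤ x.π₂
  π₂_le : x.π₂ ≤ x.ω₂
  ν₁_le : x.ν₁ ≤ R - x.lam - x.σ
  ν₂_le : x.ν₂ ≤ 1 - R + x.lam
  le_ν : deltaGV R - x.σ ≤ x.ν₁ + x.ν₂
  ν_le : x.ν₁ + x.ν₂ ≤ deltaGV R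
  le_π₁ : x.π₂ / 2 ≤ x.π₁
  le_π₂ : x.ω₂ / 2 ≤ x.π₂
  π₂_lt : x.π₂ < x.lam₁
  ω₂_lt : x.ω₂ < x.lam₂
  π₁_lt : x.π₁ < 1 - R + x.lam
  ω₁_eq : x.ω₁ = (R - x.lam - x.σ) / 2
  lam₁_eq : x.lam₁ = x.π₂ +
    (1 - R + x.lam - x.π₂) * h ((x.π₁ - x.π₂ / 2) / (1 - R + x.lam - x.π₂))
  lam₂_eq : x.lam₂ = x.ω₂ +
    (1 - R + x.lam - x.ω₂) * h ((x.π₂ - x.ω₂ / 2) / (1 - R + x.lam - x.ω₂))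
  samples_eq : (1 - R + x.lam) * h (x.ω₂ / (1 - R + x.lam)) - x.lam =
    -(R - x.lam - x.σ) *
        biasExponent (x.ν₁ / (R - x.lam - x.σ)) (x.ω₁ / (R - x.lam - x.σ))
      - (1 - R + x.lam) *
        biasExponent (x.ν₂ / (1 - R + x.lam)) (x.ω₂ / (1 - R + x.lam))

def region (R : ℝ) : Set RelParams := {x | InRegion R x}

/-! ### The three-level list construction -/

/-- Binary words of length `m`. -/
abbrev Word (m : ℕ) := Fin m → ZMod 2

/-- Binary matrices with `a` rows and `m` columns. -/
abbrev BMat (a m : ℕ) := Matrix (Fin a) (Fin m) (ZMod 2)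

/-- All words of weight `p` supported in the first half of the positions. -/
def leftList (m p : ℕ) : Finset (Word m) :=
  Finset.univ.filter fun x => hammingNorm x = p ∧ ∀ i : Fin m, m / 2 ≤ (i : ℕ) → x i = 0

/-- All words of weight `p` supported in the second half of the positions. -/
def rightList (m p : ℕ) : Finset (Word m) :=
  Finset.univ.filter fun x => hammingNorm x = p ∧ ∀ i : Fin m, (i : ℕ) < m / 2 → x i = 0

/-- The pairs that collide in the hash table, i.e. the pairs with the same syndrome. -/
def collisions {a m : ℕ} (L L' : Finset (Word m)) (H : BMat a m) : Finset (Word m × Word m) :=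
  (L ×ˢ L').filter fun x => H.mulVec x.1 = H.mulVec x.2

/-- The merge of two lists: all sums of colliding pairs that have weight `w`. -/
def merge {a m : ℕ} (L L' : Finset (Word m)) (w : ℕ) (H : BMat a m) : Finset (Word m) :=
  ((collisions L L' H).filter fun x => hammingNorm (x.1 + x.2) = w).image fun x => x.1 + x.2

/-- Number of steps of a merge: one step for each insertion into the hash table, one for each
look-up, one for each colliding pair that is examined. -/
def mergeSteps {a m : ℕ} (L L' : Finset (Word m)) (H : BMat a m) : ℕ :=
  L.card + L'.card + (collisions L L' H).card

/-- Level 1: words of weight `p₁` in the kernel of `H₁`, each of whose halves has weight `p₁/2`. -/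
def list₁ {a₁ m : ℕ} (p₁ : ℕ) (H₁ : BMat a₁ m) : Finset (Word m) :=
  merge (leftList m (p₁ / 2)) (rightList m (p₁ / 2)) p₁ H₁

/-- Level 2: the first list merged with itself. -/
def list₂ {a₁ a₂ m : ℕ} (p₁ p₂ : ℕ) (H₁ : BMat a₁ m) (H₂ : BMat a₂ m) : Finset (Word m) :=
  merge (list₁ p₁ H₁) (list₁ p₁ H₁) p₂ H₂

/-- Level 3: the second list merged with itself. -/
def list₃ {a₁ a₂ a₃ m : ℕ} (p₁ p₂ p₃ : ℕ) (H₁ : BMat a₁ m) (H₂ : BMat a₂ m) (H₃ : BMat a₃ m) :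
    Finset (Word m) :=
  merge (list₂ p₁ p₂ H₁ H₂) (list₂ p₁ p₂ H₁ H₂) p₃ H₃

/-- Number of steps of the whole construction: the initial lists and the three merges. -/
def listSteps {a₁ a₂ a₃ m : ℕ} (p₁ p₂ : ℕ) (H₁ : BMat a₁ m) (H₂ : BMat a₂ m) (H₃ : BMat a₃ m) :
    ℕ :=
  (leftList m (p₁ / 2)).card + (rightList m (p₁ / 2)).card
    + mergeSteps (leftList m (p₁ / 2)) (rightList m (p₁ / 2)) H₁
    + mergeSteps (list₁ p₁ H₁) (list₁ p₁ H₁) H₂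
    + mergeSteps (list₂ p₁ p₂ H₁ H₂) (list₂ p₁ p₂ H₁ H₂) H₃

/-! ### Decoding with parity-checks obtained from these lists

The `n` positions are split into `𝒫` (`s` positions), `𝒩₁` (`r` positions) and `𝒩₂` (`m`
positions). A code of dimension `k = s + r + ℓ` for which `𝒫 ∪ 𝒩₁` is part of an information set
has a generator matrix `G = (I M; 0 H)`, where the identity stands on `𝒫 ∪ 𝒩₁` and `H`, with `ℓ`
rows, is split into the three blocks `H₁, H₂, H₃`. For a random code `M` and `H` are uniformly
random. The parity-checks of the code are the words `c` with `G c = 0`. -/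

/-- The generator matrix `(I M; 0 H)`. -/
def generator {s r m a₁ a₂ a₃ : ℕ} (M : Matrix (Fin s ⊕ Fin r) (Fin m) (ZMod 2))
    (H₁ : BMat a₁ m) (H₂ : BMat a₂ m) (H₃ : BMat a₃ m) :
    Matrix ((Fin s ⊕ Fin r) ⊕ (Fin a₁ ⊕ (Fin a₂ ⊕ Fin a₃))) ((Fin s ⊕ Fin r) ⊕ Fin m) (ZMod 2) :=
  Matrix.fromBlocks 1 M 0 (Matrix.fromRows H₁ (Matrix.fromRows H₂ H₃))

/-- The parity-checks that are produced: those whose restriction to `𝒩₂` is in the final list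
(which consists of words of weight `w₂`) and whose restriction to `𝒩₁` has weight `w₁`. -/
def createdChecks {s r m a₁ a₂ a₃ : ℕ} (p₁ p₂ w₁ w₂ : ℕ)
    (M : Matrix (Fin s ⊕ Fin r) (Fin m) (ZMod 2))
    (H₁ : BMat a₁ m) (H₂ : BMat a₂ m) (H₃ : BMat a₃ m) :
    Finset ((Fin s ⊕ Fin r) ⊕ Fin m → ZMod 2) :=
  Finset.univ.filter fun c =>
    (generator M H₁ H₂ H₃).mulVec c = 0 ∧
    hammingNorm (fun i : Fin r => c (Sum.inl (Sum.inr i))) = w₁ ∧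
    (fun i : Fin m => c (Sum.inr i)) ∈ list₃ p₁ p₂ w₂ H₁ H₂ H₃

/-- Parameters of the decoder for a fixed length: `s = #𝒫`, the numbers `ℓ`, `ℓ₁`, `ℓ₂` of rows of
`H`, `H₁`, `(H₁; H₂)`, the weights `p₁`, `p₂`, `p₃ = w₂` of the three levels, the weights `w₁, w₂` of
the parity-checks and `u₁, u₂` of the error on `𝒩₁, 𝒩₂`, and the number of iterations. -/
structure Params where
  s : ℕ
  ell : ℕ
  ell₁ : ℕ
  ell₂ : ℕ
  p₁ : ℕ
  p₂ : ℕ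
  w₁ : ℕ
  w₂ : ℕ
  u₁ : ℕ
  u₂ : ℕ
  iter : ℕ

/-- Size `n - k + ℓ` of `𝒩₂`. -/
def Params.m (θ : Params) (n k : ℕ) : ℕ := n - k + θ.ell

/-- Size `k - ℓ - s` of `𝒩₁`. -/
def Params.r (θ : Params) (k : ℕ) : ℕ := k - θ.ell - θ.s

/-- The conditions on the parameters for a code of length `n` and dimension `k` and an error of
weight `t`. The last two are the representation constraints
`2^ℓ₁ = binom(p₂, p₂/2) binom(m - p₂, p₁ - p₂/2)` and
`2^ℓ₂ = binom(w₂, w₂/2) binom(m - w₂, p₂ - w₂/2)`, up to rounding of `ℓ₁`, `ℓ₂` to integers. -/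
structure Params.Valid (θ : Params) (n k t : ℕ) : Prop where
  k_le : k ≤ n
  s_le : θ.ell + θ.s ≤ k
  ell₁_le : θ.ell₁ ≤ θ.ell₂
  ell₂_le : θ.ell₂ ≤ θ.ell
  w₁_eq : 2 * θ.w₁ = θ.r k
  even_p₁ : Even θ.p₁
  even_p₂ : Even θ.p₂
  even_w₂ : Even θ.w₂
  p₁_le : θ.p₁ ≤ θ.p₂
  p₂_le : θ.p₂ ≤ θ.w₂
  le_p₁ : θ.p₂ ≤ 2 * θ.p₁
  le_p₂ : θ.w₂ ≤ 2 * θ.p₂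
  w₂_le : θ.w₂ ≤ θ.m n k
  u₁_le : θ.u₁ ≤ θ.r k
  u₂_le : θ.u₂ ≤ θ.m n k
  u_le : θ.u₁ + θ.u₂ ≤ t
  le_u : t ≤ θ.s + θ.u₁ + θ.u₂
  ell₁_eq : θ.ell₁ = Nat.log 2
    (θ.p₂.choose (θ.p₂ / 2) * (θ.m n k - θ.p₂).choose (θ.p₁ - θ.p₂ / 2))
  ell₂_eq : θ.ell₂ = Nat.log 2
    (θ.w₂.choose (θ.w₂ / 2) * (θ.m n k - θ.w₂).choose (θ.p₂ - θ.w₂ / 2))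

/-- Expected number of steps for producing the parity-checks. -/
def Params.createTime (θ : Params) (n k : ℕ) : ℝ :=
  𝔼 H : BMat θ.ell₁ (θ.m n k) × BMat (θ.ell₂ - θ.ell₁) (θ.m n k) ×
      BMat (θ.ell - θ.ell₂) (θ.m n k),
    (listSteps θ.p₁ θ.p₂ H.1 H.2.1 H.2.2 : ℝ)

/-- Expected number of parity-checks that are produced. -/
def Params.numChecks (θ : Params) (n k : ℕ) : ℝ :=
  𝔼 H : Matrix (Fin θ.s ⊕ Fin (θ.r k)) (Fin (θ.m n k)) (ZMod 2) ×
      BMat θ.ell₁ (θ.m n k) × BMat (θ.ell₂ - θ.ell₁) (θ.m n k) ×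
      BMat (θ.ell - θ.ell₂) (θ.m n k),
    ((createdChecks θ.p₁ θ.p₂ θ.w₁ θ.w₂ H.1 H.2.1 H.2.2.1 H.2.2.2).card : ℝ)

/-- Bias of the LPN noise: the product of the biases on `𝒩₁` and on `𝒩₂`. -/
def Params.lpnBias (θ : Params) (n k : ℕ) : ℝ :=
  bias (θ.r k) θ.w₁ θ.u₁ * bias (θ.m n k) θ.w₂ θ.u₂

/-- The possible choices of `(𝒩₁, 𝒩₂)`; the set `𝒫` is the rest. -/
def Params.splittings (θ : Params) (n k : ℕ) : Finset (Finset (Fin n) × Finset (Fin n)) :=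
  Finset.univ.filter fun N =>
    Disjoint N.1 N.2 ∧ N.1.card = θ.r k ∧ N.2.card = θ.m n k

/-- Probability, over a uniformly random choice of `(𝒩₁, 𝒩₂)`, that the error `e` has weight `u₁` on
`𝒩₁` and weight `u₂` on `𝒩₂`. -/
def Params.succProb (θ : Params) (n k : ℕ) (e : Word n) : ℝ :=
  (((θ.splittings n k).filter fun N =>
      (N.1.filter fun i => e i ≠ 0).card = θ.u₁ ∧
      (N.2.filter fun i => e i ≠ 0).card = θ.u₂).card : ℝ) / ((θ.splittings n k).card : ℝ)

/-- Running time of the decoder: each iteration produces parity-checks and then performs a fast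
Fourier transform on `𝔽₂ˢ`, in `s 2ˢ` steps. -/
def Params.time (θ : Params) (n k : ℕ) : ℝ :=
  θ.iter * (θ.createTime n k + θ.s * 2 ^ θ.s)

/-- The parameters `θ n` are asymptotically proportional to `n`, with ratios `x`. -/
structure HasRatios (θ : ℕ → Params) (x : RelParams) : Prop where
  σ : Tendsto (fun n => ((θ n).s : ℝ) / n) atTop (𝓝 x.σ)
  ν₁ : Tendsto (fun n => ((θ n).u₁ : ℝ) / n) atTop (𝓝 x.ν₁)
  ν₂ : Tendsto (fun n => ((θ n).u₂ : ℝ) / n) atTop (𝓝 x.ν₂)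
  lam : Tendsto (fun n => ((θ n).ell : ℝ) / n) atTop (𝓝 x.lam)
  lam₁ : Tendsto (fun n => ((θ n).ell₁ : ℝ) / n) atTop (𝓝 x.lam₁)
  lam₂ : Tendsto (fun n => ((θ n).ell₂ : ℝ) / n) atTop (𝓝 x.lam₂)
  π₁ : Tendsto (fun n => ((θ n).p₁ : ℝ) / n) atTop (𝓝 x.π₁)
  π₂ : Tendsto (fun n => ((θ n).p₂ : ℝ) / n) atTop (𝓝 x.π₂)
  ω₁ : Tendsto (fun n => ((θ n).w₁ : ℝ) / n) atTop (𝓝 x.ω₁)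
  ω₂ : Tendsto (fun n => ((θ n).w₂ : ℝ) / n) atTop (𝓝 x.ω₂)

/-- Admissible families of parameters for codes of length `n` and dimension `k n` and errors `e n`:
the parameters are valid and asymptotically proportional to `n`, the representation technique is
used in a non-degenerate way (`π₂ < λ₁`, `ω₂ < λ₂`, `π₁ < 1 - R + λ`), the number of parity-checks
is `ω(n / δ²)`, where `δ` is the bias of the LPN noise, and the number of iterations is `ω(1 / P)`,
where `P` is the success probability of the bet on the error. -/
structure Admissible (R : ℝ) (k : ℕ → ℕ) (e : ∀ n, Word n) (θ : ℕ → Params) : Prop where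
  valid : ∀ᶠ n in atTop, (θ n).Valid n (k n) (hammingNorm (e n))
  regime : ∃ x : RelParams, HasRatios θ x ∧
    x.π₂ < x.lam₁ ∧ x.ω₂ < x.lam₂ ∧ x.π₁ < 1 - R + x.lam
  samples : Tendsto
    (fun n => (θ n).numChecks n (k n) * (θ n).lpnBias n (k n) ^ 2 / (n : ℝ)) atTop atTop
  iterations : Tendsto
    (fun n => ((θ n).iter : ℝ) * (θ n).succProb n (k n) (e n)) atTop atTop

/-- The asymptotic complexity exponent of the decoder: the infimum, over all admissible families of
parameters, of `limsup (log₂ T(n)) / n`, where `T(n)` is the running time. -/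
def complexityExponent (R : ℝ) (k : ℕ → ℕ) (e : ∀ n, Word n) : EReal :=
  sInf {a | ∃ θ : ℕ → Params, Admissible R k e θ ∧
    a = limsup (fun n => ((Real.logb 2 ((θ n).time n (k n)) / n : ℝ) : EReal)) atTop}

end RLPN

end

/-! Every quantity of the decoder grows like 2^(c n + o(n)), where c is a continuous function of the
limiting ratios. The proof computes these exponents and then compares the ratio tuples reached by
admissible families with the region. Throughout, μ = 1 − R + λ and `ent a b` stands for a h(b/a).

Lists and checks. For a family with limiting ratios (`Regime`), list construction has exponent `nu`,
the expected number of checks has exponent ent(μ, ω₂) − λ, and the success probability has exponent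
−ρ. The upper bounds for lists and checks are first moments: a uniform matrix with a rows kills a
subspace W with probability 2^(−a dim W) (`prob_kill`). For the lower bounds one must know that a
word killed by the relevant blocks is actually produced. The representation constraints make 2^ℓ₁
and 2^ℓ₂ comparable to the numbers of representations. The second moment method, restricted to words
balanced on the two halves of the positions, then shows that the loss is subexponential
(`le_prob_representable_pair`, `le_expect_list₃`).

Bias. The upper bound holds for every family: orthogonality of the Krawtchouk polynomials in the
oscillatory regime, a saddle point bound in the exponential one (`expLE_bias_sq`). Krawtchouk
polynomials have zeros, so a matching lower bound is only claimed for suitable sequences with the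
prescribed ratios (`exists_expGE_bias_sq`). In the exponential regime the three-term recurrence
propagates a lower bound on consecutive quotients. In the oscillatory regime a truncated plane wave
is an approximate eigenvector of the Jacobi matrix of the recurrence, which forces a large value
near the prescribed place.

Lower bound for the complexity. An admissible family yields a point satisfying all constraints but
the sample equation (`Feasible`), with `slack` ≥ 0, where `slack` is the exponent of N δ². Moving σ
to 0 and spreading the error proportionally does not increase β and ends with `slack` ≤ 0. So a
point with `slack` = 0, a point of the region, lies on the way (`exists_inRegion_of_feasible`).

Upper bound. Each point of the region is approximated, up to ε in β, by one with strict inequalities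
and positive `slack` (`exists_interior_of_inRegion`); rounding it to integers gives an admissible
family (`Interior.exists_admissible`). The approximation first replaces π₂ > μ/2 by μ − π₂, then
lowers π₁ and π₂. It gains samples by moving ω₂ towards μ/2 (exponential regime) or by trading λ for
σ (oscillatory regime), and finally mixes in a point that satisfies the remaining inequalities
strictly. -/

namespace RLPN

/-! ### The perspective of the entropy function -/

/-- The perspective `a h(b / a)` of the entropy, written so that it is visibly continuous. -/
noncomputable def ent (a b : ℝ) : ℝ :=
  (Real.negMulLog b + Real.negMulLog (a - b) - Real.negMulLog a) / Real.log 2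

lemma log_two_pos : 0 < Real.log 2 := Real.log_pos one_lt_two

/-- No sign conditions are needed: the logarithm is that of the absolute value, and for a = 0 both
sides vanish. All exponents can therefore be rewritten with `ent`, which is continuous also at a =
0. -/
lemma mul_h_div (a b : ℝ) : a * h (b / a) = ent a b := by
  unfold h ent
  rw [Real.binEntropy_eq_negMulLog_add_negMulLog_one_sub, ← mul_div_assoc]
  congr 1
  rcases eq_or_ne a 0 with rfl | ha
  · simp [Real.negMulLog]
  have e1 : Real.negMulLog (b / a) = (Real.negMulLog b + b * Real.log a) / a := by
    rcases eq_or_ne b 0 with rfl | hb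
    · simp
    · rw [Real.negMulLog, Real.log_div hb ha, Real.negMulLog]; field_simp; ring
  have e2 : Real.negMulLog (1 - b / a) =
      (Real.negMulLog (a - b) + (a - b) * Real.log a) / a := by
    rcases eq_or_ne (a - b) 0 with hb | hb
    · have : b = a := by linarith
      subst this; simp [ha]
    · have h1 : 1 - b / a = (a - b) / a := by field_simp
      rw [h1, Real.negMulLog, Real.log_div hb ha, Real.negMulLog]; field_simp; ring
  rw [e1, e2, Real.negMulLog.eq_1 a]
  field_simp
  ring

lemma tendsto_ent {α : Type*} {l : Filter α} {f g : α → ℝ} {a b : ℝ}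
    (hf : Tendsto f l (𝓝 a)) (hg : Tendsto g l (𝓝 b)) :
    Tendsto (fun x => ent (f x) (g x)) l (𝓝 (ent a b)) := by
  have c := Real.continuous_negMulLog
  exact (((c.tendsto _).comp hg).add ((c.tendsto _).comp (hf.sub hg)) |>.sub
    ((c.tendsto _).comp hf)).div_const _

lemma ent_mul (c a b : ℝ) : ent (c * a) (c * b) = c * ent a b := by
  unfold ent
  rw [← mul_sub, Real.negMulLog_mul, Real.negMulLog_mul, Real.negMulLog_mul]
  ring

@[simp] lemma ent_zero_right (a : ℝ) : ent a 0 = 0 := by simp [ent]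

@[simp] lemma ent_self (a : ℝ) : ent a a = 0 := by simp [ent]

@[simp] lemma ent_zero_left (b : ℝ) : ent 0 b = 0 := by rw [← mul_h_div]; simp

lemma ent_sub (a b : ℝ) : ent a (a - b) = ent a b := by
  unfold ent
  rw [sub_sub_cancel, add_comm (Real.negMulLog (a - b))]

lemma h_half : h (1 / 2) = 1 := by
  unfold h
  rw [one_div, Real.binEntropy_two_inv, div_self log_two_pos.ne']

lemma h_zero : h 0 = 0 := by simp [h]

lemma h_one_sub (x : ℝ) : h (1 - x) = h x := by simp [h]

lemma ent_one (b : ℝ) : ent 1 b = h b := by rw [← mul_h_div]; simp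

lemma ent_half (a : ℝ) : ent a (a / 2) = a := by
  rcases eq_or_ne a 0 with rfl | ha
  · simp
  · rw [← mul_h_div, show a / 2 / a = 1 / 2 by field_simp, h_half, mul_one]

lemma h_pos {x : ℝ} (h0 : 0 < x) (h1 : x < 1) : 0 < h x :=
  div_pos (Real.binEntropy_pos h0 h1) log_two_pos

lemma continuous_h : Continuous h := by unfold h; fun_prop

lemma concaveOn_h : ConcaveOn ℝ (Set.Icc 0 1) h := by
  have := Real.strictConcave_binEntropy.concaveOn.smul (inv_nonneg.2 log_two_pos.le)
  refine this.congr fun x _ => ?_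
  simp [h, div_eq_inv_mul]

lemma ent_pos {a b : ℝ} (hb : 0 < b) (hba : b < a) : 0 < ent a b := by
  rw [← mul_h_div]
  have ha : 0 < a := hb.trans hba
  exact mul_pos ha (h_pos (div_pos hb ha) ((div_lt_one ha).2 hba))

/-- The perspective of the entropy is superadditive. -/
lemma ent_add_le {a b a' b' : ℝ} (hb : 0 ≤ b) (hba : b ≤ a) (hb' : 0 ≤ b') (hba' : b' ≤ a') :
    ent a b + ent a' b' ≤ ent (a + a') (b + b') := by
  rcases (hb.trans hba).eq_or_lt with rfl | ha
  · have : b = 0 := le_antisymm hba hb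
    simp [this]
  rcases (hb'.trans hba').eq_or_lt with rfl | ha'
  · have : b' = 0 := le_antisymm hba' hb'
    simp [this]
  have hs : 0 < a + a' := add_pos ha ha'
  rw [← mul_h_div, ← mul_h_div, ← mul_h_div]
  have h1 : b / a ∈ Set.Icc (0 : ℝ) 1 := ⟨by positivity, div_le_one_of_le₀ hba ha.le⟩
  have h2 : b' / a' ∈ Set.Icc (0 : ℝ) 1 := ⟨by positivity, div_le_one_of_le₀ hba' ha'.le⟩
  have h3 : 0 ≤ a / (a + a') := by positivity
  have h4 : 0 ≤ a' / (a + a') := by positivity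
  have h5 : a / (a + a') + a' / (a + a') = 1 := by field_simp
  have := concaveOn_h.2 h1 h2 h3 h4 h5
  have e : (a / (a + a')) • (b / a) + (a' / (a + a')) • (b' / a') = (b + b') / (a + a') := by
    simp only [smul_eq_mul]; field_simp
  rw [e] at this
  simp only [smul_eq_mul] at this
  calc a * h (b / a) + a' * h (b' / a')
      = (a + a') * (a / (a + a') * h (b / a) + a' / (a + a') * h (b' / a')) := by field_simp
    _ ≤ _ := by gcongr

lemma ent_convex_comb_le {a b a' b' t : ℝ} (hb : 0 ≤ b) (hba : b ≤ a) (hb' : 0 ≤ b')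
    (hba' : b' ≤ a') (ht : 0 ≤ t) (ht' : t ≤ 1) :
    (1 - t) * ent a b + t * ent a' b' ≤
      ent ((1 - t) * a + t * a') ((1 - t) * b + t * b') := by
  have h1 : 0 ≤ 1 - t := by linarith
  rw [← ent_mul, ← ent_mul]
  exact ent_add_le (mul_nonneg h1 hb) (by gcongr) (by positivity) (by gcongr)

lemma ent_strictMonoOn {a b b' : ℝ} (hb : 0 ≤ b) (hbb' : b < b') (hb' : b' ≤ a / 2) :
    ent a b < ent a b' := by
  have ha : 0 < a := by linarith
  rw [← mul_h_div, ← mul_h_div]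
  refine mul_lt_mul_of_pos_left ?_ ha
  unfold h
  refine div_lt_div_of_pos_right (Real.binEntropy_strictMonoOn ⟨by positivity, ?_⟩
    ⟨div_nonneg (hb.trans hbb'.le) ha.le, ?_⟩ ?_) log_two_pos
  · rw [div_le_iff₀ ha]; linarith
  · rw [div_le_iff₀ ha]; linarith
  · gcongr

/-- The tangent inequality for the entropy at `y`. -/
lemma h_le_tangent {x y : ℝ} (hx : 0 ≤ x) (hx' : x ≤ 1) (hy : 0 < y) (hy' : y < 1) :
    h x ≤ -(x * Real.logb 2 y) - (1 - x) * Real.logb 2 (1 - y) := by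
  -- Gibbs' inequality. Each of the two terms is bounded through log x ≤ x − 1, and the two error
  -- terms y − x and (1 − y) − (1 − x) cancel.
  have key : ∀ {u v : ℝ}, 0 ≤ u → 0 < v → Real.negMulLog u + u * Real.log v ≤ v - u := by
    intro u v hu hv
    rcases hu.eq_or_lt with rfl | hu
    · simpa using hv.le
    have := Real.log_le_sub_one_of_pos (div_pos hv hu)
    rw [Real.log_div hv.ne' hu.ne'] at this
    have h2 := mul_le_mul_of_nonneg_left this hu.le
    rw [mul_sub, mul_sub, mul_div_cancel₀ _ hu.ne'] at h2
    rw [Real.negMulLog]; linarith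
  have k1 := key hx hy
  have k2 := key (sub_nonneg.2 hx') (sub_pos.2 hy')
  unfold h Real.logb
  rw [Real.binEntropy_eq_negMulLog_add_negMulLog_one_sub, div_le_iff₀ log_two_pos, sub_mul,
    neg_mul, mul_assoc, mul_assoc, div_mul_cancel₀ _ log_two_pos.ne',
    div_mul_cancel₀ _ log_two_pos.ne']
  linarith

/-! ### The Gilbert–Varshamov distance -/

lemma deltaGV_spec {R : ℝ} (h0 : 0 < R) (h1 : R < 1) :
    h (deltaGV R) = 1 - R ∧ 0 < deltaGV R ∧ deltaGV R < 1 / 2 := by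
  have hex : ∃ a ∈ Set.Icc (0 : ℝ) (1 / 2), h a = 1 - R := by
    have := intermediate_value_Icc (show (0 : ℝ) ≤ 1 / 2 by norm_num) continuous_h.continuousOn
    rw [h_zero, h_half] at this
    exact this ⟨by linarith, by linarith⟩
  have e : h (deltaGV R) = 1 - R := Function.invFunOn_eq hex
  have m : deltaGV R ∈ Set.Icc (0 : ℝ) (1 / 2) := Function.invFunOn_mem hex
  refine ⟨e, m.1.lt_of_ne fun hz => ?_, m.2.lt_of_ne fun hz => ?_⟩
  · rw [← hz, h_zero] at e; linarith
  · rw [hz, h_half] at e; linarith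

/-- Strict concavity puts h above its chord from 0 to 1/2, the line 2x. The consequence is ν₂ ≤ τ <
μ/2, so the error on 𝒩₂ always has relative weight below 1/2. -/
lemma two_mul_deltaGV_lt {R : ℝ} (h0 : 0 < R) (h1 : R < 1) : 2 * deltaGV R < 1 - R := by
  obtain ⟨e, hp, hl⟩ := deltaGV_spec h0 h1
  rw [← e]
  have m0 : (0 : ℝ) ∈ Set.Icc (0 : ℝ) 1 := by simp
  have m1 : (2⁻¹ : ℝ) ∈ Set.Icc (0 : ℝ) 1 := by constructor <;> norm_num
  have m2 : 0 < 1 - 2 * deltaGV R := by linarith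
  have m3 : 0 < 2 * deltaGV R := by linarith
  have hc := Real.strictConcave_binEntropy.2 m0 m1 (by norm_num) m2 m3 (by ring)
  simp only [smul_eq_mul, mul_zero, zero_add, Real.binEntropy_zero, Real.binEntropy_two_inv] at hc
  rw [show 2 * deltaGV R * 2⁻¹ = deltaGV R by ring] at hc
  unfold h
  rwa [lt_div_iff₀ log_two_pos]

/-- The entropy is at most `log₂ (1 + 2 √(x (1 - x)))`, hence below `1/2 + √(x (1 - x))`. -/
lemma h_lt_half_add_sqrt {x : ℝ} (hx : 0 < x) (hx' : x < 1 / 2) :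
    h x < 1 / 2 + √(x * (1 - x)) := by
  have h1x : 0 < 1 - x := by linarith
  set p := √x with hp
  set q := √(1 - x) with hq
  have hp0 : 0 < p := Real.sqrt_pos.2 hx
  have hq0 : 0 < q := Real.sqrt_pos.2 h1x
  have hpp : p ^ 2 = x := Real.sq_sqrt hx.le
  have hqq : q ^ 2 = 1 - x := Real.sq_sqrt h1x.le
  have hsq : √(x * (1 - x)) = p * q := Real.sqrt_mul hx.le _
  have hpq : p < q := Real.sqrt_lt_sqrt hx.le (by linarith)
  set v := (p + q) ^ 2 with hv
  have hv1 : v = 1 + 2 * (p * q) := by rw [hv]; nlinarith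
  have hv0 : 0 < v := by positivity
  have hv2 : v < 2 := by nlinarith [sq_pos_of_pos (sub_pos.2 hpq)]
  -- With y proportional to √x the right-hand side of the tangent inequality becomes h(x)/2 + log₂(p
  -- + q), so h(x) ≤ log₂ (p + q)² = log₂ v.
  have ht := h_le_tangent hx.le (by linarith) (y := p / (p + q)) (by positivity)
    (by rw [div_lt_one (by positivity)]; linarith)
  have e1 : 1 - p / (p + q) = q / (p + q) := by field_simp; ring
  have lp : Real.logb 2 p = Real.logb 2 x / 2 := by
    rw [← hpp, Real.logb_pow]; push_cast; ring
  have lq : Real.logb 2 q = Real.logb 2 (1 - x) / 2 := by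
    rw [← hqq, Real.logb_pow]; push_cast; ring
  have lv : Real.logb 2 v = 2 * Real.logb 2 (p + q) := by
    rw [hv, Real.logb_pow]; push_cast; ring
  rw [e1, Real.logb_div hp0.ne' (by positivity), Real.logb_div hq0.ne' (by positivity), lp, lq]
    at ht
  have hh : h x = -(x * Real.logb 2 x) - (1 - x) * Real.logb 2 (1 - x) := by
    unfold h Real.logb
    rw [Real.binEntropy_eq_negMulLog_add_negMulLog_one_sub, Real.negMulLog, Real.negMulLog]
    ring
  have hle : h x ≤ Real.logb 2 v := by rw [lv]; linarith
  -- The concave function log₂ agrees with the line v/2 at 2 and 4, hence lies strictly below it for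
  -- v < 2; here 2 is written as a convex combination of v and 4.
  have hlt : Real.logb 2 v < v / 2 := by
    have h4v : 0 < 4 - v := by linarith
    have m1 : v ∈ Set.Ioi (0 : ℝ) := hv0
    have m2 : (4 : ℝ) ∈ Set.Ioi (0 : ℝ) := by norm_num
    have m3 : 0 < 2 / (4 - v) := by positivity
    have m4 : 0 < (2 - v) / (4 - v) := div_pos (by linarith) h4v
    have m5 : 2 / (4 - v) + (2 - v) / (4 - v) = 1 := by
      rw [← add_div, div_eq_one_iff_eq h4v.ne']; ring
    have hs := strictConcaveOn_log_Ioi.2 m1 m2 (by linarith) m3 m4 m5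
    have e2 : (2 / (4 - v)) • v + ((2 - v) / (4 - v)) • (4 : ℝ) = 2 := by
      simp only [smul_eq_mul]; field_simp; ring
    rw [e2] at hs
    simp only [smul_eq_mul] at hs
    have l4 : Real.log 4 = 2 * Real.log 2 := by
      rw [show (4 : ℝ) = 2 ^ 2 by norm_num, Real.log_pow]; norm_num
    rw [l4] at hs
    have h5 := mul_lt_mul_of_pos_left hs h4v
    rw [mul_add, ← mul_assoc, ← mul_assoc, mul_div_cancel₀ _ h4v.ne',
      mul_div_cancel₀ _ h4v.ne'] at h5
    unfold Real.logb
    rw [div_lt_iff₀ log_two_pos]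
    linarith
  rw [hsq]
  linarith

/-! ### Exponential growth rates -/

/-- `f n ≤ 2 ^ (a n + o(n))`. -/
def ExpLE (f : ℕ → ℝ) (a : ℝ) : Prop :=
  ∀ ε > 0, ∀ᶠ n : ℕ in atTop, f n ≤ (2 : ℝ) ^ ((a + ε) * n)

/-- `f n ≥ 2 ^ (a n - o(n))`. -/
def ExpGE (f : ℕ → ℝ) (a : ℝ) : Prop :=
  ∀ ε > 0, ∀ᶠ n : ℕ in atTop, (2 : ℝ) ^ ((a - ε) * n) ≤ f n

lemma ExpLE.mono {f g : ℕ → ℝ} {a b : ℝ} (hf : ExpLE f a) (hg : ∀ᶠ n in atTop, g n ≤ f n)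
    (hab : a ≤ b) : ExpLE g b := by
  intro ε hε
  filter_upwards [hf ε hε, hg] with n h1 h2
  refine h2.trans (h1.trans ?_)
  gcongr
  norm_num

lemma ExpGE.mono {f g : ℕ → ℝ} {a b : ℝ} (hf : ExpGE f a) (hg : ∀ᶠ n in atTop, f n ≤ g n)
    (hab : b ≤ a) : ExpGE g b := by
  intro ε hε
  filter_upwards [hf ε hε, hg] with n h1 h2
  refine le_trans ?_ (h1.trans h2)
  gcongr
  norm_num

lemma ExpGE.pos {f : ℕ → ℝ} {a : ℝ} (hf : ExpGE f a) : ∀ᶠ n in atTop, 0 < f n := by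
  filter_upwards [hf 1 one_pos] with n hn
  exact lt_of_lt_of_le (by positivity) hn

lemma ExpLE.mul {f g : ℕ → ℝ} {a b : ℝ} (hf : ExpLE f a) (hg : ExpLE g b)
    (hf0 : ∀ᶠ n in atTop, 0 ≤ f n) (hg0 : ∀ᶠ n in atTop, 0 ≤ g n) :
    ExpLE (fun n => f n * g n) (a + b) := by
  intro ε hε
  filter_upwards [hf (ε / 2) (by positivity), hg (ε / 2) (by positivity), hf0, hg0]
    with n h1 h2 h3 h4
  calc f n * g n ≤ (2 : ℝ) ^ ((a + ε / 2) * n) * (2 : ℝ) ^ ((b + ε / 2) * n) := by gcongr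
    _ = _ := by rw [← Real.rpow_add two_pos]; ring_nf

lemma ExpGE.mul {f g : ℕ → ℝ} {a b : ℝ} (hf : ExpGE f a) (hg : ExpGE g b) :
    ExpGE (fun n => f n * g n) (a + b) := by
  intro ε hε
  filter_upwards [hf (ε / 2) (by positivity), hg (ε / 2) (by positivity), hf.pos]
    with n h1 h2 h3
  calc _ = (2 : ℝ) ^ ((a - ε / 2) * n) * (2 : ℝ) ^ ((b - ε / 2) * n) := by
        rw [← Real.rpow_add two_pos]; ring_nf
    _ ≤ _ := by gcongr

lemma ExpGE.inv {f : ℕ → ℝ} {a : ℝ} (hf : ExpGE f a) : ExpLE (fun n => (f n)⁻¹) (-a) := by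
  intro ε hε
  filter_upwards [hf ε hε] with n h1
  calc (f n)⁻¹ ≤ ((2 : ℝ) ^ ((a - ε) * n))⁻¹ := by gcongr
    _ = _ := by rw [← Real.rpow_neg two_pos.le]; ring_nf

lemma ExpLE.inv {f : ℕ → ℝ} {a : ℝ} (hf : ExpLE f a) (hf0 : ∀ᶠ n in atTop, 0 < f n) :
    ExpGE (fun n => (f n)⁻¹) (-a) := by
  intro ε hε
  filter_upwards [hf ε hε, hf0] with n h1 h2
  calc _ = ((2 : ℝ) ^ ((a + ε) * n))⁻¹ := by rw [← Real.rpow_neg two_pos.le]; ring_nf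
    _ ≤ _ := by gcongr

lemma tendsto_log_natCast_div : Tendsto (fun n : ℕ => Real.log n / n) atTop (𝓝 0) :=
  (Real.isLittleO_log_id_atTop.tendsto_div_nhds_zero).comp tendsto_natCast_atTop_atTop

lemma eventually_mul_pow_le (C : ℝ) (j : ℕ) {ε : ℝ} (hε : 0 < ε) :
    ∀ᶠ n : ℕ in atTop, C * (n : ℝ) ^ j ≤ (2 : ℝ) ^ (ε * n) := by
  have hr : 1 < (2 : ℝ) ^ ε := Real.one_lt_rpow one_lt_two hε
  have h1 := (tendsto_pow_const_div_const_pow_of_one_lt j hr).const_mul C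
  rw [mul_zero] at h1
  filter_upwards [h1.eventually_lt_const one_pos] with n hn
  rw [Real.rpow_mul two_pos.le, Real.rpow_natCast]
  have hp : 0 < ((2 : ℝ) ^ ε) ^ n := by positivity
  rw [← mul_div_assoc, div_lt_one hp] at hn
  exact hn.le

/-- Polynomial factors do not change the growth rate. -/
lemma expLE_poly (C : ℝ) (j : ℕ) : ExpLE (fun n => C * (n : ℝ) ^ j) 0 := by
  intro ε hε
  simpa using eventually_mul_pow_le C j hε

lemma expLE_const (C : ℝ) : ExpLE (fun _ => C) 0 := by simpa using expLE_poly C 0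

lemma expGE_const {C : ℝ} (hC : 0 < C) : ExpGE (fun _ => C) 0 := by
  simpa using (expLE_const C⁻¹).inv (Eventually.of_forall fun _ => by positivity)

lemma ExpLE.add {f g : ℕ → ℝ} {a b : ℝ} (hf : ExpLE f a) (hg : ExpLE g b) :
    ExpLE (fun n => f n + g n) (max a b) := by
  intro ε hε
  filter_upwards [hf (ε / 2) (by positivity), hg (ε / 2) (by positivity),
    expLE_const 2 (ε / 2) (by positivity)] with n h1 h2 h3
  have k1 : f n ≤ (2 : ℝ) ^ ((max a b + ε / 2) * n) :=
    h1.trans (by gcongr; norm_num; exact le_max_left _ _)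
  have k2 : g n ≤ (2 : ℝ) ^ ((max a b + ε / 2) * n) :=
    h2.trans (by gcongr; norm_num; exact le_max_right _ _)
  calc f n + g n ≤ 2 * (2 : ℝ) ^ ((max a b + ε / 2) * n) := by linarith
    _ ≤ (2 : ℝ) ^ ((0 + ε / 2) * n) * (2 : ℝ) ^ ((max a b + ε / 2) * n) := by gcongr
    _ = _ := by rw [← Real.rpow_add two_pos]; ring_nf

lemma ExpGE.max {f g t : ℕ → ℝ} {a b : ℝ} (hf : ExpGE f a) (hg : ExpGE g b)
    (hft : ∀ᶠ n in atTop, f n ≤ t n) (hgt : ∀ᶠ n in atTop, g n ≤ t n) :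
    ExpGE t (max a b) := by
  rcases le_total a b with hab | hab
  · rw [max_eq_right hab]; exact hg.mono hgt le_rfl
  · rw [max_eq_left hab]; exact hf.mono hft le_rfl

lemma expLE_of_tendsto {f : ℕ → ℝ} {a : ℝ} (hf0 : ∀ᶠ n in atTop, 0 < f n)
    (hf : Tendsto (fun n => Real.logb 2 (f n) / n) atTop (𝓝 a)) : ExpLE f a := by
  intro ε hε
  filter_upwards [hf0, hf.eventually_lt_const (show a < a + ε by linarith),
    eventually_gt_atTop 0] with n h1 h2 h3
  have hn : (0 : ℝ) < n := by exact_mod_cast h3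
  rw [← Real.logb_le_iff_le_rpow one_lt_two h1]
  rw [div_lt_iff₀ hn] at h2
  exact h2.le

lemma expGE_of_tendsto {f : ℕ → ℝ} {a : ℝ} (hf0 : ∀ᶠ n in atTop, 0 < f n)
    (hf : Tendsto (fun n => Real.logb 2 (f n) / n) atTop (𝓝 a)) : ExpGE f a := by
  intro ε hε
  filter_upwards [hf0, hf.eventually_const_lt (show a - ε < a by linarith),
    eventually_gt_atTop 0] with n h1 h2 h3
  have hn : (0 : ℝ) < n := by exact_mod_cast h3
  rw [← Real.le_logb_iff_rpow_le one_lt_two h1]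
  rw [lt_div_iff₀ hn] at h2
  exact h2.le

lemma ExpLE.le_of_expGE {f : ℕ → ℝ} {a b : ℝ} (hf : ExpLE f a) (hg : ExpGE f b) : b ≤ a := by
  by_contra! hab
  obtain ⟨n, h1, h2, h3⟩ := ((hf ((b - a) / 3) (by linarith)).and
    ((hg ((b - a) / 3) (by linarith)).and (eventually_gt_atTop 0))).exists
  have h4 := h2.trans h1
  rw [Real.rpow_le_rpow_left_iff one_lt_two] at h4
  have hn : (0 : ℝ) < n := by exact_mod_cast h3
  have := le_of_mul_le_mul_right h4 hn
  linarith

lemma expLE_two_pow {a : ℕ → ℕ} {α : ℝ}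
    (ha : Tendsto (fun n => (a n : ℝ) / n) atTop (𝓝 α)) : ExpLE (fun n => (2 : ℝ) ^ a n) α :=
  expLE_of_tendsto (Eventually.of_forall fun _ => by positivity) (by
    refine ha.congr fun n => ?_
    rw [Real.logb_pow, Real.logb_self_eq_one one_lt_two, mul_one])

lemma expGE_two_pow {a : ℕ → ℕ} {α : ℝ}
    (ha : Tendsto (fun n => (a n : ℝ) / n) atTop (𝓝 α)) : ExpGE (fun n => (2 : ℝ) ^ a n) α :=
  expGE_of_tendsto (Eventually.of_forall fun _ => by positivity) (by
    refine ha.congr fun n => ?_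
    rw [Real.logb_pow, Real.logb_self_eq_one one_lt_two, mul_one])

/-! ### Growth rate of binomial coefficients -/

/-- Crude Stirling bounds suffice, since logarithmic errors vanish in the exponent. The induction
step is n log(1 + 1/n) ≤ 1 ≤ (n + 1) log(1 + 1/n). -/
lemma log_factorial_bounds (n : ℕ) :
    -Real.negMulLog n - n ≤ Real.log n.factorial ∧
      Real.log n.factorial ≤ -Real.negMulLog n - n + Real.log n + 1 := by
  have hneg : ∀ x : ℝ, -Real.negMulLog x = x * Real.log x := fun x => by
    rw [Real.negMulLog]; ring
  induction n with
  | zero => simp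
  | succ n ih =>
    rw [Nat.factorial_succ]
    push_cast
    rw [hneg] at ih ⊢
    have hn1 : (0 : ℝ) < (n : ℝ) + 1 := by positivity
    rw [Real.log_mul hn1.ne' (by exact_mod_cast n.factorial_ne_zero)]
    rcases Nat.eq_zero_or_pos n with rfl | hn
    · simp
    have hn0 : (0 : ℝ) < n := by exact_mod_cast hn
    have a1 := Real.log_le_sub_one_of_pos (div_pos hn1 hn0)
    have a2 := Real.log_le_sub_one_of_pos (div_pos hn0 hn1)
    rw [Real.log_div hn1.ne' hn0.ne'] at a1
    rw [Real.log_div hn0.ne' hn1.ne'] at a2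
    have b1 : (n : ℝ) * (Real.log (n + 1) - Real.log n) ≤ 1 := by
      calc _ ≤ (n : ℝ) * (((n : ℝ) + 1) / n - 1) := by gcongr
        _ = 1 := by field_simp; ring
    have b2 : 1 ≤ ((n : ℝ) + 1) * (Real.log (n + 1) - Real.log n) := by
      have : ((n : ℝ) + 1) * (Real.log n - Real.log (n + 1)) ≤
          ((n : ℝ) + 1) * ((n : ℝ) / (n + 1) - 1) := by gcongr
      have e : ((n : ℝ) + 1) * ((n : ℝ) / (n + 1) - 1) = -1 := by field_simp; ring
      linarith
    constructor
    · linarith [ih.1]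
    · linarith [ih.2]

lemma abs_log_choose_sub_le {a b : ℕ} (hb : b ≤ a) :
    |Real.logb 2 (a.choose b) - ent a b| ≤ (2 * Real.log (a + 1) + 2) / Real.log 2 := by
  have hc : Real.log (a.choose b) =
      Real.log a.factorial - Real.log b.factorial - Real.log (a - b).factorial := by
    rw [Nat.cast_choose ℝ hb, Real.log_div (by positivity) (by positivity),
      Real.log_mul (by positivity) (by positivity)]
    ring
  have ha := log_factorial_bounds a
  have hb' := log_factorial_bounds b
  have hab := log_factorial_bounds (a - b)
  rw [Nat.cast_sub hb] at hab
  have hba : (b : ℝ) ≤ a := by exact_mod_cast hb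
  have hb0 : (0 : ℝ) ≤ b := by positivity
  have hl : ∀ x : ℝ, 0 ≤ x → x ≤ a → Real.log x ≤ Real.log (a + 1) := by
    intro x hx hxa
    rcases hx.eq_or_lt with rfl | hx
    · rw [Real.log_zero]; exact Real.log_nonneg (by linarith)
    · exact Real.log_le_log hx (by linarith)
  have l1 := hl b hb0 hba
  have l2 := hl (a - b) (by linarith) (by linarith)
  have l4 := hl a (by linarith) le_rfl
  have l3 : 0 ≤ Real.log ((a : ℝ) + 1) := Real.log_nonneg (by
    have : (0 : ℝ) ≤ a := by positivity
    linarith)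
  unfold Real.logb ent
  rw [← sub_div, abs_div, abs_of_pos log_two_pos]
  gcongr
  rw [hc, abs_le]
  constructor
  · linarith
  · linarith

lemma tendsto_log_choose_div {a b : ℕ → ℕ} {α β : ℝ}
    (ha : Tendsto (fun n => (a n : ℝ) / n) atTop (𝓝 α))
    (hb : Tendsto (fun n => (b n : ℝ) / n) atTop (𝓝 β)) (hab : ∀ᶠ n in atTop, b n ≤ a n) :
    Tendsto (fun n => Real.logb 2 ((a n).choose (b n)) / n) atTop (𝓝 (ent α β)) := by
  have h1 := tendsto_ent ha hb
  have herr : Tendsto (fun n : ℕ => (2 * Real.log (a n + 1) + 2) / Real.log 2 / n) atTop (𝓝 0) := by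
    have c1 : Tendsto (fun n : ℕ => (2 * (Real.log (|α| + 2) / n + Real.log n / n) + 2 / n)
        / Real.log 2) atTop (𝓝 0) := by
      have := (((tendsto_const_div_atTop_nhds_zero_nat (Real.log (|α| + 2))).add
        tendsto_log_natCast_div).const_mul 2).add (tendsto_const_div_atTop_nhds_zero_nat 2)
      simpa using this.div_const (Real.log 2)
    refine squeeze_zero' ?_ ?_ c1
    · refine Eventually.of_forall fun n => ?_
      have : 0 ≤ Real.log ((a n : ℝ) + 1) := Real.log_nonneg (by
        have : (0 : ℝ) ≤ a n := by positivity
        linarith)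
      have := log_two_pos
      positivity
    · filter_upwards [ha.eventually_lt_const (show α < |α| + 1 by linarith [le_abs_self α]),
        eventually_gt_atTop 0] with n hn hn0
      have hn1 : (1 : ℝ) ≤ n := by exact_mod_cast hn0
      have hn2 : (0 : ℝ) < n := by linarith
      rw [div_lt_iff₀ hn2] at hn
      have : Real.log (a n + 1) ≤ Real.log (|α| + 2) + Real.log n := by
        rw [← Real.log_mul (by positivity) hn2.ne']
        exact Real.log_le_log (by positivity) (by nlinarith [abs_nonneg α])
      have hl := log_two_pos
      rw [div_right_comm]
      gcongr
      rw [← add_div, ← mul_div_assoc, ← add_div]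
      gcongr
  have h2 : Tendsto (fun n => Real.logb 2 ((a n).choose (b n)) / n -
      ent (a n / n) (b n / n)) atTop (𝓝 0) := by
    refine squeeze_zero_norm' ?_ herr
    filter_upwards [hab] with n hn
    have e : ent ((a n : ℝ) / n) (b n / n) = ent (a n) (b n) / n := by
      rw [div_eq_inv_mul, div_eq_inv_mul, ent_mul, div_eq_inv_mul]
    rw [e, ← sub_div, Real.norm_eq_abs, abs_div, Nat.abs_cast]
    gcongr
    exact abs_log_choose_sub_le hn
  simpa using h2.add h1

lemma eventually_choose_pos {a b : ℕ → ℕ} (hab : ∀ᶠ n in atTop, b n ≤ a n) :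
    ∀ᶠ n in atTop, (0 : ℝ) < (a n).choose (b n) := by
  filter_upwards [hab] with n hn
  exact_mod_cast Nat.choose_pos hn

lemma expLE_choose {a b : ℕ → ℕ} {α β : ℝ}
    (ha : Tendsto (fun n => (a n : ℝ) / n) atTop (𝓝 α))
    (hb : Tendsto (fun n => (b n : ℝ) / n) atTop (𝓝 β)) (hab : ∀ᶠ n in atTop, b n ≤ a n) :
    ExpLE (fun n => (a n).choose (b n)) (ent α β) :=
  expLE_of_tendsto (eventually_choose_pos hab) (tendsto_log_choose_div ha hb hab)

lemma expGE_choose {a b : ℕ → ℕ} {α β : ℝ}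
    (ha : Tendsto (fun n => (a n : ℝ) / n) atTop (𝓝 α))
    (hb : Tendsto (fun n => (b n : ℝ) / n) atTop (𝓝 β)) (hab : ∀ᶠ n in atTop, b n ≤ a n) :
    ExpGE (fun n => (a n).choose (b n)) (ent α β) :=
  expGE_of_tendsto (eventually_choose_pos hab) (tendsto_log_choose_div ha hb hab)

/-! ### Counting words with prescribed weights on blocks -/

/-- A set is determined by its independent traces on the colour classes of `c`. The later counts of
words, representations and splittings are instances for different colourings. -/
lemma card_finsets_blocks {α ι : Type*} [Fintype α] [DecidableEq α] [Fintype ι] [DecidableEq ι]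
    (c : α → ι) (k : ι → ℕ) :
    (Finset.univ.filter fun S : Finset α => ∀ i, (S.filter fun x => c x = i).card = k i).card =
      ∏ i, ((Finset.univ.filter fun x => c x = i).card).choose (k i) := by
  have h1 : ∀ i, ((Finset.univ.filter fun x => c x = i).card).choose (k i) =
      (((Finset.univ.filter fun x => c x = i).powersetCard (k i))).card := fun i => by
    rw [Finset.card_powersetCard]
  simp_rw [h1]
  rw [← Fintype.card_piFinset]
  refine Finset.card_bij' (fun S _ i => S.filter fun x => c x = i)
    (fun F _ => Finset.univ.filter fun x => x ∈ F (c x)) ?_ ?_ ?_ ?_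
  · intro S hS
    simp only [Finset.mem_filter, Finset.mem_univ, true_and] at hS
    simp only [Fintype.mem_piFinset, Finset.mem_powersetCard]
    exact fun i => ⟨Finset.filter_subset_filter _ (Finset.subset_univ _), hS i⟩
  · intro F hF
    simp only [Fintype.mem_piFinset, Finset.mem_powersetCard] at hF
    simp only [Finset.mem_filter, Finset.mem_univ, true_and]
    intro i
    rw [← (hF i).2]
    congr 1
    ext x
    simp only [Finset.mem_filter, Finset.mem_univ, true_and]
    constructor
    · rintro ⟨h, rfl⟩; exact h
    · intro h
      have := (hF i).1 h
      simp only [Finset.mem_filter, Finset.mem_univ, true_and] at this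
      subst this
      exact ⟨h, rfl⟩
  · intro S _
    ext x
    simp
  · intro F hF
    simp only [Fintype.mem_piFinset, Finset.mem_powersetCard] at hF
    funext i
    ext x
    simp only [Finset.mem_filter, Finset.mem_univ, true_and]
    constructor
    · rintro ⟨h, rfl⟩; exact h
    · intro h
      have := (hF i).1 h
      simp only [Finset.mem_filter, Finset.mem_univ, true_and] at this
      subst this
      exact ⟨h, rfl⟩

/-- The weight of `x` on the positions in `T`. -/
def wtOn {m : ℕ} (T : Finset (Fin m)) (x : Word m) : ℕ := (T.filter fun i => x i ≠ 0).card

lemma card_words_blocks {m : ℕ} {ι : Type*} [Fintype ι] [DecidableEq ι] (c : Fin m → ι)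
    (k : ι → ℕ) :
    (Finset.univ.filter fun x : Word m =>
        ∀ i, wtOn (Finset.univ.filter fun j => c j = i) x = k i).card =
      ∏ i, ((Finset.univ.filter fun x => c x = i).card).choose (k i) := by
  rw [← card_finsets_blocks]
  refine Finset.card_bij' (fun x _ => Finset.univ.filter fun j => x j ≠ 0)
    (fun S _ j => if j ∈ S then 1 else 0) ?_ ?_ ?_ ?_
  · intro x hx
    simp only [Finset.mem_filter, Finset.mem_univ, true_and] at hx ⊢
    intro i
    rw [← hx i, wtOn, Finset.filter_filter, Finset.filter_filter]
    simp_rw [and_comm]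
  · intro S hS
    simp only [Finset.mem_filter, Finset.mem_univ, true_and] at hS ⊢
    intro i
    rw [← hS i, wtOn, Finset.filter_filter]
    congr 1
    ext j
    simp [and_comm]
  · intro x _
    funext j
    simp only [Finset.mem_filter, Finset.mem_univ, true_and]
    have : ∀ y : ZMod 2, (if y ≠ 0 then (1 : ZMod 2) else 0) = y := by decide
    exact this _
  · intro S _
    ext j
    simp

/-- Over 𝔽₂ the support of u + v is the symmetric difference of the supports, so common positions
are lost twice. -/
lemma wtOn_add {m : ℕ} (T : Finset (Fin m)) (u v : Word m) :
    wtOn T (u + v) + 2 * wtOn (T.filter fun i => v i ≠ 0) u = wtOn T u + wtOn T v := by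
  unfold wtOn
  simp only [Finset.card_filter, Finset.sum_filter, Finset.mul_sum, ← Finset.sum_add_distrib]
  refine Finset.sum_congr rfl fun i _ => ?_
  have : ∀ a b : ZMod 2, (if a + b ≠ 0 then 1 else 0) +
      2 * (if b ≠ 0 then (if a ≠ 0 then 1 else 0) else 0) =
      (if a ≠ 0 then 1 else 0) + (if b ≠ 0 then 1 else 0) := by decide
  simpa using this (u i) (v i)

lemma wtOn_filter_add_filter_not {m : ℕ} (T : Finset (Fin m)) (p : Fin m → Prop)
    [DecidablePred p] (u : Word m) :
    wtOn (T.filter p) u + wtOn (T.filter fun i => ¬ p i) u = wtOn T u := by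
  unfold wtOn
  rw [Finset.filter_comm, Finset.filter_comm (p := fun i => ¬ p i)]
  exact Finset.card_filter_add_card_filter_not _

lemma wtOn_univ {m : ℕ} (u : Word m) : wtOn Finset.univ u = hammingNorm u := by
  simp [wtOn, hammingNorm]

lemma card_filter_val_lt (m : ℕ) :
    (Finset.univ.filter fun i : Fin m => (i : ℕ) < m / 2).card = m / 2 := by
  rw [Fin.card_filter_val_lt]; omega

lemma card_filter_not_val_lt (m : ℕ) :
    (Finset.univ.filter fun i : Fin m => ¬ (i : ℕ) < m / 2).card = m - m / 2 := by
  have := Finset.card_filter_add_card_filter_not (s := Finset.univ)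
    (fun i : Fin m => (i : ℕ) < m / 2)
  rw [card_filter_val_lt, Finset.card_univ, Fintype.card_fin] at this
  omega

/-- Words of weight `j` on the first half and weight `j'` on the second half. -/
def halves (m j j' : ℕ) : Finset (Word m) :=
  Finset.univ.filter fun x =>
    wtOn (Finset.univ.filter fun i : Fin m => (i : ℕ) < m / 2) x = j ∧
    wtOn (Finset.univ.filter fun i : Fin m => ¬ (i : ℕ) < m / 2) x = j'

lemma mem_halves {m j j' : ℕ} {x : Word m} : x ∈ halves m j j' ↔
    wtOn (Finset.univ.filter fun i : Fin m => (i : ℕ) < m / 2) x = j ∧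
    wtOn (Finset.univ.filter fun i : Fin m => ¬ (i : ℕ) < m / 2) x = j' := by
  simp [halves]

lemma hammingNorm_of_mem_halves {m j j' : ℕ} {x : Word m} (hx : x ∈ halves m j j') :
    hammingNorm x = j + j' := by
  rw [mem_halves] at hx
  rw [← wtOn_univ, ← wtOn_filter_add_filter_not Finset.univ (fun i => (i : ℕ) < m / 2), hx.1, hx.2]

lemma card_halves (m j j' : ℕ) :
    (halves m j j').card = (m / 2).choose j * (m - m / 2).choose j' := by
  have := card_words_blocks (fun i : Fin m => decide ((i : ℕ) < m / 2))
    (fun b => if b then j else j')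
  rw [Fintype.prod_bool] at this
  simp only [Bool.forall_bool, decide_eq_true_eq, decide_eq_false_iff_not, card_filter_val_lt,
    card_filter_not_val_lt, if_true, Bool.false_eq_true, if_false] at this
  rw [← this]
  congr 1
  ext x
  simp [halves, and_comm]

lemma card_hammingNorm_eq (m w : ℕ) :
    (Finset.univ.filter fun x : Word m => hammingNorm x = w).card = m.choose w := by
  have := card_words_blocks (fun _ : Fin m => ()) (fun _ => w)
  simpa [wtOn_univ] using this

/-- Number of ways to write a word of weight `2 α` as a sum of two words of weight `β`. -/
lemma card_representations {m α β : ℕ} {v : Word m} (hv : hammingNorm v = 2 * α) (hαβ : α ≤ β) :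
    (Finset.univ.filter fun u : Word m => hammingNorm u = β ∧ hammingNorm (u + v) = β).card =
      (2 * α).choose α * (m - 2 * α).choose (β - α) := by
  have hcard : (Finset.univ.filter fun i => v i ≠ 0).card = 2 * α := hv
  have hcard' : (Finset.univ.filter fun i => ¬ v i ≠ 0).card = m - 2 * α := by
    have := Finset.card_filter_add_card_filter_not (s := Finset.univ) (fun i => v i ≠ 0)
    rw [hcard, Finset.card_univ, Fintype.card_fin] at this
    omega
  -- Both u and u + v have weight β exactly when u covers half of the support of v and has β − α
  -- ones outside it.
  have := card_words_blocks (fun i : Fin m => decide (v i ≠ 0))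
    (fun b => if b then α else β - α)
  rw [Fintype.prod_bool] at this
  simp only [Bool.forall_bool, decide_eq_true_eq, decide_eq_false_iff_not,
    if_true, Bool.false_eq_true, if_false, hcard, hcard'] at this
  rw [← this]
  congr 1
  ext u
  simp only [Finset.mem_filter, Finset.mem_univ, true_and]
  have h1 := wtOn_add Finset.univ u v
  have h2 := wtOn_filter_add_filter_not Finset.univ (fun i => v i ≠ 0) u
  rw [wtOn_univ] at h2
  rw [wtOn_univ, wtOn_univ, wtOn_univ, hv] at h1
  omega

/-- Number of ways to write a word with half weights `2 α, 2 α'` as a sum of two words with half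
weights `β, β'`. -/
lemma card_representations_halves {m α α' β β' : ℕ} {v : Word m}
    (hv : v ∈ halves m (2 * α) (2 * α')) (hαβ : α ≤ β) (hαβ' : α' ≤ β') :
    ((halves m β β').filter fun u => u + v ∈ halves m β β').card =
      ((2 * α).choose α * (m / 2 - 2 * α).choose (β - α)) *
      ((2 * α').choose α' * (m - m / 2 - 2 * α').choose (β' - α')) := by
  rw [mem_halves] at hv
  set A := Finset.univ.filter fun i : Fin m => (i : ℕ) < m / 2 with hA
  set B := Finset.univ.filter fun i : Fin m => ¬ (i : ℕ) < m / 2 with hB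
  have cA : A.card = m / 2 := card_filter_val_lt m
  have cB : B.card = m - m / 2 := card_filter_not_val_lt m
  have c1 : (A.filter fun i => v i ≠ 0).card = 2 * α := hv.1
  have c3 : (B.filter fun i => v i ≠ 0).card = 2 * α' := hv.2
  have c2 : (A.filter fun i => ¬ v i ≠ 0).card = m / 2 - 2 * α := by
    have := Finset.card_filter_add_card_filter_not (s := A) (fun i => v i ≠ 0)
    omega
  have c4 : (B.filter fun i => ¬ v i ≠ 0).card = m - m / 2 - 2 * α' := by
    have := Finset.card_filter_add_card_filter_not (s := B) (fun i => v i ≠ 0)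
    omega
  have := card_words_blocks (fun i : Fin m => (decide ((i : ℕ) < m / 2), decide (v i ≠ 0)))
    (fun b => if b.1 then (if b.2 then α else β - α) else (if b.2 then α' else β' - α'))
  rw [Fintype.prod_prod_type, Fintype.prod_bool, Fintype.prod_bool, Fintype.prod_bool] at this
  simp only [Prod.forall, Bool.forall_bool, Prod.mk.injEq, decide_eq_true_eq,
    decide_eq_false_iff_not,
    if_true, Bool.false_eq_true, if_false] at this
  simp only [← Finset.filter_filter, ← hA, ← hB, c1, c2, c3, c4] at this
  rw [← this]
  congr 1
  ext u
  simp only [Finset.mem_filter, Finset.mem_univ, true_and, mem_halves, ← hA, ← hB]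
  have h1 := wtOn_add A u v
  have h2 := wtOn_filter_add_filter_not A (fun i => v i ≠ 0) u
  have h3 := wtOn_add B u v
  have h4 := wtOn_filter_add_filter_not B (fun i => v i ≠ 0) u
  rw [hv.1] at h1
  rw [hv.2] at h3
  omega

/-! ### Probabilities over finite uniform spaces -/

open Classical in
/-- Probability of an event over a finite type with the uniform distribution. -/
noncomputable def prob {Ω : Type*} [Fintype Ω] (p : Ω → Prop) : ℝ :=
  𝔼 ω, if p ω then 1 else 0

section prob

variable {Ω Ω' : Type*} [Fintype Ω] [Fintype Ω']

lemma prob_nonneg (p : Ω → Prop) : 0 ≤ prob p :=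
  Finset.expect_nonneg fun _ _ => by split_ifs <;> norm_num

lemma prob_mono {p q : Ω → Prop} (h : ∀ ω, p ω → q ω) : prob p ≤ prob q := by
  refine Finset.expect_le_expect fun ω _ => ?_
  by_cases hp : p ω
  · simp [hp, h ω hp]
  · rw [if_neg hp]; split_ifs <;> norm_num

lemma prob_congr {p q : Ω → Prop} (h : ∀ ω, p ω ↔ q ω) : prob p = prob q := by
  rw [funext fun ω => propext (h ω)]

lemma prob_eq_card_div (p : Ω → Prop) [DecidablePred p] :
    prob p = (Finset.univ.filter p).card / Fintype.card Ω := by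
  unfold prob
  rw [Fintype.expect_eq_sum_div_card, Finset.card_filter]
  push_cast
  congr 1
  exact Finset.sum_congr rfl fun ω _ => by by_cases h : p ω <;> simp [h]

lemma expect_card {β : Type*} [Fintype β] [DecidableEq β] (S : Ω → Finset β) :
    𝔼 ω, ((S ω).card : ℝ) = ∑ b, prob fun ω => b ∈ S ω := by
  unfold prob
  rw [← Finset.expect_sum_comm]
  refine Finset.expect_congr rfl fun ω _ => ?_
  rw [← Finset.filter_univ_mem (S ω), Finset.card_filter]
  push_cast
  exact Finset.sum_congr rfl fun b _ => by by_cases h : b ∈ S ω <;> simp [h]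

lemma expect_card_le {β : Type*} [Fintype β] [DecidableEq β] (S : Ω → Finset β) (T : Finset β)
    {q : ℝ} (hST : ∀ ω, S ω ⊆ T) (hq : ∀ b ∈ T, prob (fun ω => b ∈ S ω) ≤ q) :
    𝔼 ω, ((S ω).card : ℝ) ≤ T.card * q := by
  rw [expect_card, ← Finset.sum_subset (Finset.subset_univ T), ← nsmul_eq_mul]
  · exact Finset.sum_le_card_nsmul _ _ _ hq
  · intro b _ hb
    exact Finset.expect_eq_zero fun ω _ => if_neg fun h => hb (hST ω h)

lemma le_expect_card {β : Type*} [Fintype β] [DecidableEq β] (S : Ω → Finset β) (T : Finset β)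
    {q : ℝ} (hq : ∀ b ∈ T, q ≤ prob (fun ω => b ∈ S ω)) :
    T.card * q ≤ 𝔼 ω, ((S ω).card : ℝ) := by
  rw [expect_card, ← nsmul_eq_mul]
  exact (Finset.card_nsmul_le_sum _ _ _ hq).trans
    (Finset.sum_le_sum_of_subset_of_nonneg (Finset.subset_univ T) fun _ _ _ => prob_nonneg _)

lemma prob_prod (p : Ω → Prop) (q : Ω' → Prop) :
    prob (fun ω : Ω × Ω' => p ω.1 ∧ q ω.2) = prob p * prob q := by
  unfold prob
  rw [Fintype.expect_mul_expect, ← Finset.univ_product_univ, Finset.expect_product]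
  refine Finset.expect_congr rfl fun ω _ => Finset.expect_congr rfl fun ω' _ => ?_
  by_cases h1 : p ω <;> by_cases h2 : q ω' <;> simp [h1, h2]

/-- The second moment method. -/
lemma sq_sum_prob_le {ι : Type*} (I : Finset ι) (p : ι → Ω → Prop) (q : Ω → Prop)
    (hpq : ∀ i ∈ I, ∀ ω, p i ω → q ω) :
    (∑ i ∈ I, prob (p i)) ^ 2 ≤
      prob q * ∑ i ∈ I, ∑ j ∈ I, prob fun ω => p i ω ∧ p j ω := by
  classical
  set Z : Ω → ℝ := fun ω => ∑ i ∈ I, if p i ω then 1 else 0 with hZ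
  set Q : Ω → ℝ := fun ω => if q ω then 1 else 0 with hQ
  -- The counting variable Z vanishes where q fails, so Z = Q Z; the claim is the Cauchy–Schwarz
  -- inequality for the product Q Z, with Q² = Q.
  have h1 : ∑ i ∈ I, prob (p i) = 𝔼 ω, Q ω * Z ω := by
    unfold prob
    rw [← Finset.expect_sum_comm]
    refine Finset.expect_congr rfl fun ω _ => ?_
    rw [hZ, Finset.mul_sum]
    refine Finset.sum_congr rfl fun i hi => ?_
    by_cases hp : p i ω
    · rw [hQ]; simp [hp, hpq i hi ω hp]
    · simp [hp]
  have h2 : ∑ i ∈ I, ∑ j ∈ I, prob (fun ω => p i ω ∧ p j ω) = 𝔼 ω, Z ω ^ 2 := by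
    unfold prob
    simp_rw [← Finset.expect_sum_comm]
    refine Finset.expect_congr rfl fun ω _ => ?_
    rw [hZ, sq, Finset.sum_mul_sum]
    refine Finset.sum_congr rfl fun i _ => Finset.sum_congr rfl fun j _ => ?_
    by_cases h1 : p i ω <;> by_cases h2 : p j ω <;> simp [h1, h2]
  have h3 : prob q = 𝔼 ω, Q ω ^ 2 := by
    unfold prob
    refine Finset.expect_congr rfl fun ω _ => ?_
    rw [hQ]; by_cases hq : q ω <;> simp [hq]
  rw [h1, h2, h3, Fintype.expect_eq_sum_div_card, Fintype.expect_eq_sum_div_card,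
    Fintype.expect_eq_sum_div_card, div_pow, div_mul_div_comm, ← sq]
  gcongr
  exact Finset.sum_mul_sq_le_sq_mul_sq _ _ _

end prob

/-! ### Uniformly random matrices -/

open Module

/-- Restricting linear maps from 𝔽₂^m to W is surjective onto the linear maps on W, so the matrices
that kill W form a subspace of codimension a · dim W. -/
lemma prob_kill {a m : ℕ} (W : Submodule (ZMod 2) (Word m)) :
    prob (fun H : BMat a m => ∀ w ∈ W, H.mulVec w = 0) = (1 / 2 : ℝ) ^ (a * finrank (ZMod 2) W) := by
  classical
  let φ : (Word m →ₗ[ZMod 2] Word a) →ₗ[ZMod 2] (W →ₗ[ZMod 2] Word a) :=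
    LinearMap.lcomp (ZMod 2) (Word a) W.subtype
  have hφ : Function.Surjective φ := by
    intro g
    obtain ⟨f, hf⟩ := LinearMap.exists_extend g
    exact ⟨f, hf⟩
  have hdim := LinearMap.finrank_range_add_finrank_ker φ
  rw [LinearMap.range_eq_top.2 hφ, finrank_top, Module.finrank_linearMap, Module.finrank_linearMap,
    Module.finrank_fin_fun, Module.finrank_fin_fun] at hdim
  have hker : Nat.card (LinearMap.ker φ) = 2 ^ finrank (ZMod 2) (LinearMap.ker φ) := by
    rw [Module.natCard_eq_pow_finrank (K := ZMod 2), Nat.card_zmod]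
  have hcard : (Finset.univ.filter fun H : BMat a m => ∀ w ∈ W, H.mulVec w = 0).card =
      Nat.card (LinearMap.ker φ) := by
    rw [← Fintype.card_subtype, ← Nat.card_eq_fintype_card]
    refine Nat.card_congr ((Matrix.toLin' : BMat a m ≃ₗ[ZMod 2] _).toEquiv.subtypeEquiv ?_)
    intro H
    rw [LinearMap.mem_ker, LinearMap.ext_iff]
    simp [φ]
  have htot : Fintype.card (BMat a m) = 2 ^ (m * a) := by
    rw [Module.card_eq_pow_finrank (K := ZMod 2), ZMod.card, Module.finrank_matrix]
    simp [mul_comm]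
  rw [prob_eq_card_div, htot]
  have hf : ((Finset.univ.filter fun H : BMat a m => ∀ w ∈ W, H.mulVec w = 0).card : ℝ) =
      (2 : ℝ) ^ finrank (ZMod 2) (LinearMap.ker φ) := by
    rw [hcard, hker]; norm_num
  rw [hf, ← hdim, Nat.mul_comm a, pow_add]
  push_cast
  rw [one_div, inv_pow]
  field_simp

lemma finrank_sup_span_of_notMem {m : ℕ} {W : Submodule (ZMod 2) (Word m)} {v : Word m}
    (hv : v ∉ W) : finrank (ZMod 2) ↥(W ⊔ Submodule.span (ZMod 2) {v}) =
      finrank (ZMod 2) W + 1 := by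
  have h1 := Submodule.finrank_sup_add_finrank_inf_eq W (Submodule.span (ZMod 2) {v})
  have hv0 : v ≠ 0 := fun h => hv (h ▸ W.zero_mem)
  have h2 : W ⊓ Submodule.span (ZMod 2) {v} = ⊥ :=
    disjoint_iff.1 ((Submodule.disjoint_span_singleton' hv0).2 hv)
  rw [h2, finrank_bot, finrank_span_singleton hv0] at h1
  omega

lemma finrank_sup_span_le {m : ℕ} (W : Submodule (ZMod 2) (Word m)) (v : Word m) :
    finrank (ZMod 2) ↥(W ⊔ Submodule.span (ZMod 2) {v}) ≤ finrank (ZMod 2) W + 1 := by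
  by_cases hv : v ∈ W
  · rw [sup_eq_left.2 ((Submodule.span_singleton_le_iff_mem _ _).2 hv)]; omega
  · exact (finrank_sup_span_of_notMem hv).le

/-- Summing the probability that a random matrix kills one more word: the words inside `W` cost
nothing but are few, the others cost a factor `2 ^ a`. -/
lemma sum_kill_le {m : ℕ} (a : ℕ) (A : Finset (Word m)) {d : ℕ} {C : ℝ}
    (W : Submodule (ZMod 2) (Word m)) (hd : finrank (ZMod 2) W ≤ d) (hA : (A.card : ℝ) ≤ C * 2 ^ a) :
    ∑ v ∈ A, (1 / 2 : ℝ) ^ (a * finrank (ZMod 2) ↥(W ⊔ Submodule.span (ZMod 2) {v})) ≤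
      (C + 2 ^ d) * (1 / 2 : ℝ) ^ (a * finrank (ZMod 2) W) := by
  classical
  rw [← Finset.sum_filter_add_sum_filter_not A (· ∉ W), add_mul]
  have hW : Fintype.card W = 2 ^ finrank (ZMod 2) W := by
    rw [Module.card_eq_pow_finrank (K := ZMod 2), ZMod.card]
  refine add_le_add ?_ ?_
  · have h1 : ∀ v ∈ A.filter (· ∉ W),
        (1 / 2 : ℝ) ^ (a * finrank (ZMod 2) ↥(W ⊔ Submodule.span (ZMod 2) {v})) =
          (1 / 2) ^ a * (1 / 2) ^ (a * finrank (ZMod 2) W) := by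
      intro v hv
      rw [finrank_sup_span_of_notMem (Finset.mem_filter.1 hv).2, mul_add, mul_one, pow_add, mul_comm]
    rw [Finset.sum_congr rfl h1, Finset.sum_const, nsmul_eq_mul, ← mul_assoc]
    gcongr
    calc ((A.filter (· ∉ W)).card : ℝ) * (1 / 2) ^ a ≤ C * 2 ^ a * (1 / 2) ^ a := by
          gcongr
          exact le_trans (by exact_mod_cast Finset.card_filter_le _ _) hA
      _ = C := by rw [mul_assoc, ← mul_pow]; norm_num
  · have h1 : ∀ v ∈ A.filter (fun v => ¬ v ∉ W),
        (1 / 2 : ℝ) ^ (a * finrank (ZMod 2) ↥(W ⊔ Submodule.span (ZMod 2) {v})) =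
          (1 / 2) ^ (a * finrank (ZMod 2) W) := by
      intro v hv
      have hv' := not_not.1 (Finset.mem_filter.1 hv).2
      rw [sup_eq_left.2 ((Submodule.span_singleton_le_iff_mem _ _).2 hv')]
    rw [Finset.sum_congr rfl h1, Finset.sum_const, nsmul_eq_mul]
    gcongr
    have h2 : (A.filter (fun v => ¬ v ∉ W)).card ≤ Fintype.card W := by
      rw [← Finset.card_univ, ← Finset.card_map (Function.Embedding.subtype (· ∈ W))]
      refine Finset.card_le_card fun v hv => ?_
      simpa using not_not.1 (Finset.mem_filter.1 hv).2
    calc ((A.filter (fun v => ¬ v ∉ W)).card : ℝ) ≤ (2 : ℝ) ^ finrank (ZMod 2) W := by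
          rw [hW] at h2; exact_mod_cast h2
      _ ≤ 2 ^ d := by gcongr; norm_num

open Module

/-! ### Membership in the lists -/

lemma word_add_self {m : ℕ} (x : Word m) : x + x = 0 := by
  funext i
  have : ∀ a : ZMod 2, a + a = 0 := by decide
  exact this _

lemma word_add_eq_zero {m : ℕ} {x y : Word m} : x + y = 0 ↔ x = y := by
  constructor
  · intro hxy
    have := congrArg (· + y) hxy
    simpa [add_assoc, word_add_self] using this
  · rintro rfl
    exact word_add_self x

lemma word_add_add_cancel {m : ℕ} (x y : Word m) : x + (x + y) = y := by
  rw [← add_assoc, word_add_self, zero_add]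

lemma mulVec_eq_iff {a m : ℕ} (H : BMat a m) (x y : Word m) :
    H.mulVec x = H.mulVec y ↔ H.mulVec (x + y) = 0 := by
  rw [Matrix.mulVec_add, word_add_eq_zero]

lemma leftList_eq (m p : ℕ) : leftList m p = halves m p 0 := by
  ext x
  simp only [leftList, Finset.mem_filter, Finset.mem_univ, true_and, mem_halves]
  rw [← wtOn_univ, ← wtOn_filter_add_filter_not Finset.univ (fun i => (i : ℕ) < m / 2)]
  have : wtOn (Finset.univ.filter fun i : Fin m => ¬ (i : ℕ) < m / 2) x = 0 ↔
      ∀ i : Fin m, m / 2 ≤ (i : ℕ) → x i = 0 := by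
    simp [wtOn, Finset.filter_eq_empty_iff]
  rw [← this]
  omega

lemma rightList_eq (m p : ℕ) : rightList m p = halves m 0 p := by
  ext x
  simp only [rightList, Finset.mem_filter, Finset.mem_univ, true_and, mem_halves]
  rw [← wtOn_univ, ← wtOn_filter_add_filter_not Finset.univ (fun i => (i : ℕ) < m / 2)]
  have : wtOn (Finset.univ.filter fun i : Fin m => (i : ℕ) < m / 2) x = 0 ↔
      ∀ i : Fin m, (i : ℕ) < m / 2 → x i = 0 := by
    simp [wtOn, Finset.filter_eq_empty_iff]
  rw [← this]
  omega

lemma add_mem_halves {m j j' : ℕ} {x y : Word m} (hx : x ∈ halves m j 0) (hy : y ∈ halves m 0 j') :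
    x + y ∈ halves m j j' := by
  rw [mem_halves] at *
  have key : ∀ T : Finset (Fin m), wtOn T x = 0 ∨ wtOn T y = 0 →
      wtOn (T.filter fun i => y i ≠ 0) x = 0 := by
    intro T hT
    rcases hT with h | h
    · exact Nat.eq_zero_of_le_zero
        (h ▸ Finset.card_le_card (Finset.filter_subset_filter _ (Finset.filter_subset _ _)))
    · rw [wtOn, Finset.card_eq_zero] at h
      rw [h]; rfl
  have h1 := wtOn_add (Finset.univ.filter fun i : Fin m => (i : ℕ) < m / 2) x y
  have h2 := wtOn_add (Finset.univ.filter fun i : Fin m => ¬ (i : ℕ) < m / 2) x y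
  rw [key _ (Or.inr hy.1)] at h1
  rw [key _ (Or.inl hx.2)] at h2
  omega

/-- The initial lists live on disjoint positions, so a word has only one candidate decomposition,
its restrictions to the two halves. Level 1 therefore loses nothing and can be described exactly,
unlike levels 2 and 3. -/
lemma mem_list₁ {a m q : ℕ} {H : BMat a m} {x : Word m} :
    x ∈ list₁ (2 * q) H ↔ x ∈ halves m q q ∧ H.mulVec x = 0 := by
  simp only [list₁, merge, collisions, Finset.mem_image, Finset.mem_filter, Finset.mem_product,
    leftList_eq, rightList_eq, Nat.mul_div_cancel_left _ two_pos, Prod.exists]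
  constructor
  · rintro ⟨l, r, ⟨⟨⟨hl, hr⟩, he⟩, _⟩, rfl⟩
    exact ⟨add_mem_halves hl hr, (mulVec_eq_iff H l r).1 he⟩
  · rintro ⟨hx, he⟩
    refine ⟨fun i => if (i : ℕ) < m / 2 then x i else 0,
      fun i => if (i : ℕ) < m / 2 then 0 else x i, ?_⟩
    have hs : (fun i : Fin m => if (i : ℕ) < m / 2 then x i else 0) +
        (fun i : Fin m => if (i : ℕ) < m / 2 then 0 else x i) = x := by
      funext i
      simp only [Pi.add_apply]
      split_ifs <;> simp
    refine ⟨⟨⟨⟨?_, ?_⟩, ?_⟩, ?_⟩, hs⟩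
    · rw [mem_halves] at hx ⊢
      refine ⟨hx.1 ▸ ?_, ?_⟩
      · unfold wtOn
        congr 1
        ext i
        simp +contextual
      · simp [wtOn, Finset.filter_eq_empty_iff]
        intro i h1 h2
        omega
    · rw [mem_halves] at hx ⊢
      refine ⟨?_, hx.2 ▸ ?_⟩
      · simp +contextual [wtOn, Finset.filter_eq_empty_iff]
      · unfold wtOn
        congr 1
        ext i
        simp only [Finset.mem_filter, Finset.mem_univ, true_and]
        refine and_congr_right fun hi => ?_
        rw [if_neg hi]
    · rw [mulVec_eq_iff, hs, he]
    · rw [hs, hammingNorm_of_mem_halves hx]; ring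

lemma of_mem_merge {a m w : ℕ} {L L' : Finset (Word m)} {H : BMat a m} {x : Word m}
    (hx : x ∈ merge L L' w H) :
    hammingNorm x = w ∧ H.mulVec x = 0 ∧ ∃ y ∈ L, ∃ y' ∈ L', y + y' = x := by
  simp only [merge, collisions, Finset.mem_image, Finset.mem_filter, Finset.mem_product,
    Prod.exists] at hx
  obtain ⟨l, r, ⟨⟨⟨hl, hr⟩, he⟩, hw⟩, rfl⟩ := hx
  exact ⟨hw, (mulVec_eq_iff H l r).1 he, l, hl, r, hr, rfl⟩

lemma mem_merge {a m w : ℕ} {L L' : Finset (Word m)} {H : BMat a m} {x y : Word m}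
    (hy : y ∈ L) (hy' : y + x ∈ L') (hx : hammingNorm x = w) (hH : H.mulVec x = 0) :
    x ∈ merge L L' w H := by
  simp only [merge, collisions, Finset.mem_image, Finset.mem_filter, Finset.mem_product,
    Prod.exists]
  refine ⟨y, y + x, ⟨⟨⟨hy, hy'⟩, ?_⟩, ?_⟩, word_add_add_cancel y x⟩
  · rw [mulVec_eq_iff, word_add_add_cancel, hH]
  · rw [word_add_add_cancel, hx]

section lists

variable {m a₁ a₂ a₃ q p₂ w : ℕ} {H₁ : BMat a₁ m} {H₂ : BMat a₂ m} {H₃ : BMat a₃ m}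

lemma of_mem_list₂ {x : Word m} (hx : x ∈ list₂ (2 * q) p₂ H₁ H₂) :
    hammingNorm x = p₂ ∧ H₁.mulVec x = 0 ∧ H₂.mulVec x = 0 := by
  obtain ⟨h1, h2, y, hy, y', hy', rfl⟩ := of_mem_merge hx
  refine ⟨h1, ?_, h2⟩
  rw [Matrix.mulVec_add, (mem_list₁.1 hy).2, (mem_list₁.1 hy').2, add_zero]

lemma of_mem_list₃ {x : Word m} (hx : x ∈ list₃ (2 * q) p₂ w H₁ H₂ H₃) :
    hammingNorm x = w ∧ H₁.mulVec x = 0 ∧ H₂.mulVec x = 0 ∧ H₃.mulVec x = 0 := by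
  obtain ⟨h1, h2, y, hy, y', hy', rfl⟩ := of_mem_merge hx
  obtain ⟨-, k1, k2⟩ := of_mem_list₂ hy
  obtain ⟨-, k1', k2'⟩ := of_mem_list₂ hy'
  refine ⟨h1, ?_, ?_, h2⟩
  · rw [Matrix.mulVec_add, k1, k1', add_zero]
  · rw [Matrix.mulVec_add, k2, k2', add_zero]

/-- The word `x` is a sum of two words of the first list. -/
def Representable (q : ℕ) (H₁ : BMat a₁ m) (x : Word m) : Prop :=
  ∃ a ∈ halves m q q, a + x ∈ halves m q q ∧ H₁.mulVec a = 0 ∧ H₁.mulVec x = 0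

lemma Representable.mem_list₂ {x : Word m} (hx : Representable q H₁ x)
    (hw : hammingNorm x = p₂) (h₂ : H₂.mulVec x = 0) : x ∈ list₂ (2 * q) p₂ H₁ H₂ := by
  obtain ⟨a, ha, hax, h1, h2⟩ := hx
  refine mem_merge (y := a) (mem_list₁.2 ⟨ha, h1⟩) (mem_list₁.2 ⟨hax, ?_⟩) hw h₂
  rw [Matrix.mulVec_add, h1, h2, add_zero]

end lists

/-! ### Random matrices and pairs of words -/

abbrev line {m : ℕ} (x : Word m) : Submodule (ZMod 2) (Word m) := Submodule.span (ZMod 2) {x}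

lemma kill_line {a m : ℕ} {H : BMat a m} {x : Word m} :
    (∀ w ∈ line x, H.mulVec w = 0) ↔ H.mulVec x = 0 := by
  constructor
  · exact fun h => h x (Submodule.mem_span_singleton_self x)
  · intro h w hw
    obtain ⟨c, rfl⟩ := Submodule.mem_span_singleton.1 hw
    rw [Matrix.mulVec_smul, h, smul_zero]

lemma kill_sup {a m : ℕ} {H : BMat a m} {V W : Submodule (ZMod 2) (Word m)} :
    (∀ w ∈ V ⊔ W, H.mulVec w = 0) ↔ (∀ w ∈ V, H.mulVec w = 0) ∧ ∀ w ∈ W, H.mulVec w = 0 := by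
  constructor
  · exact fun h => ⟨fun w hw => h w (Submodule.mem_sup_left hw),
      fun w hw => h w (Submodule.mem_sup_right hw)⟩
  · rintro ⟨h1, h2⟩ w hw
    obtain ⟨y, hy, z, hz, rfl⟩ := Submodule.mem_sup.1 hw
    rw [Matrix.mulVec_add, h1 y hy, h2 z hz, add_zero]

lemma finrank_line {m : ℕ} {x : Word m} (hx : x ≠ 0) : finrank (ZMod 2) (line x) = 1 :=
  finrank_span_singleton hx

lemma finrank_line_sup_line {m : ℕ} {x y : Word m} (hx : x ≠ 0) (hy : y ≠ 0) (hxy : x ≠ y) :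
    finrank (ZMod 2) ↥(line x ⊔ line y) = 2 := by
  rw [finrank_sup_span_of_notMem, finrank_line hx]
  intro h
  obtain ⟨c, rfl⟩ := Submodule.mem_span_singleton.1 h
  have : ∀ c : ZMod 2, c = 0 ∨ c = 1 := by decide
  rcases this c with rfl | rfl
  · exact hy (zero_smul _ _)
  · exact hxy (one_smul _ _).symm

lemma ne_zero_of_hammingNorm_pos {m : ℕ} {x : Word m} (hx : 0 < hammingNorm x) : x ≠ 0 := by
  rintro rfl
  simp at hx

/-- Triples of independent uniformly random matrices. -/
abbrev Triple (a₁ a₂ a₃ m : ℕ) := BMat a₁ m × BMat a₂ m × BMat a₃ m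

lemma prob_kill_triple {a₁ a₂ a₃ m : ℕ} (W₁ W₂ W₃ : Submodule (ZMod 2) (Word m)) :
    prob (fun H : Triple a₁ a₂ a₃ m => (∀ w ∈ W₁, H.1.mulVec w = 0) ∧
      (∀ w ∈ W₂, H.2.1.mulVec w = 0) ∧ ∀ w ∈ W₃, H.2.2.mulVec w = 0) =
      (1 / 2 : ℝ) ^ (a₁ * finrank (ZMod 2) W₁ + a₂ * finrank (ZMod 2) W₂
        + a₃ * finrank (ZMod 2) W₃) := by
  rw [prob_prod (fun H : BMat a₁ m => ∀ w ∈ W₁, H.mulVec w = 0)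
    (fun H : BMat a₂ m × BMat a₃ m => (∀ w ∈ W₂, H.1.mulVec w = 0) ∧ ∀ w ∈ W₃, H.2.mulVec w = 0),
    prob_prod (fun H : BMat a₂ m => ∀ w ∈ W₂, H.mulVec w = 0)
    (fun H : BMat a₃ m => ∀ w ∈ W₃, H.mulVec w = 0), prob_kill, prob_kill, prob_kill, pow_add,
    pow_add, mul_assoc]

/-- A pair (x, x) collides for every matrix and escapes the first moment bound. There are only #L
such pairs, so they are split off. -/
lemma collisions_self_card_le {a m : ℕ} (L : Finset (Word m)) (H : BMat a m) :
    (collisions L L H).card ≤ L.card + ((collisions L L H).filter fun x => x.1 ≠ x.2).card := by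
  rw [← Finset.card_filter_add_card_filter_not (fun x : Word m × Word m => x.1 ≠ x.2), add_comm]
  refine Nat.add_le_add_right ?_ _
  refine Finset.card_le_card_of_injOn Prod.fst ?_ ?_
  · intro x hx
    simp only [Finset.coe_filter, collisions, Finset.mem_filter, Finset.mem_product,
      Set.mem_ofPred_eq] at hx
    exact hx.1.1.1
  · intro x hx y hy hxy
    simp only [Finset.coe_filter, Set.mem_ofPred_eq, not_not] at hx hy
    exact Prod.ext hxy (by rw [← hx.2, ← hy.2, hxy])

lemma card_merge_le {a m w : ℕ} (L L' : Finset (Word m)) (H : BMat a m) :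
    (merge L L' w H).card ≤ (collisions L L' H).card :=
  Finset.card_image_le.trans (Finset.card_filter_le _ _)

/-! ### Moments of the numbers of collisions. -/

section moments

variable {m a₁ a₂ a₃ q p₂ w : ℕ}

/-- The two words have disjoint supports and positive weight, so their sum is nonzero and each pair
collides with probability exactly 2^(−a₁). -/
lemma expect_collisions_zero (hq : 0 < q) :
    𝔼 H : Triple a₁ a₂ a₃ m, ((collisions (leftList m q) (rightList m q) H.1).card : ℝ) =
      (leftList m q).card * (rightList m q).card * (1 / 2 : ℝ) ^ a₁ := by
  have hp : ∀ b ∈ leftList m q ×ˢ rightList m q,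
      prob (fun H : Triple a₁ a₂ a₃ m => b ∈ collisions (leftList m q) (rightList m q) H.1) =
        (1 / 2 : ℝ) ^ a₁ := by
    rintro ⟨x, y⟩ hxy
    have h1 := prob_kill_triple (a₁ := a₁) (a₂ := a₂) (a₃ := a₃) (line (x + y)) ⊥ ⊥
    have h0 : x + y ≠ 0 := by
      rw [Finset.mem_product, leftList_eq, rightList_eq] at hxy
      refine ne_zero_of_hammingNorm_pos ?_
      rw [hammingNorm_of_mem_halves (add_mem_halves hxy.1 hxy.2)]
      omega
    rw [finrank_line h0] at h1
    simp only [finrank_bot, mul_zero, add_zero, mul_one] at h1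
    rw [← h1]
    refine prob_congr fun H => ?_
    rw [kill_line, collisions, Finset.mem_filter, mulVec_eq_iff]
    simp [hxy]
  have hsub : ∀ H : Triple a₁ a₂ a₃ m, collisions (leftList m q) (rightList m q) H.1 ⊆
      leftList m q ×ˢ rightList m q := fun H => Finset.filter_subset _ _
  have e : ((leftList m q ×ˢ rightList m q).card : ℝ) =
      (leftList m q).card * (rightList m q).card := by
    rw [Finset.card_product]; push_cast; ring
  rw [← e]
  exact le_antisymm (expect_card_le _ _ hsub fun b hb => (hp b hb).le)
    (le_expect_card _ _ fun b hb => (hp b hb).ge)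

/-- Two distinct nonzero words of the first list span a plane killed by H₁, and H₂ kills their sum:
exponent 2 a₁ + a₂. -/
lemma expect_collisions_one_le :
    𝔼 H : Triple a₁ a₂ a₃ m,
      (((collisions (list₁ (2 * q) H.1) (list₁ (2 * q) H.1) H.2.1).filter
        fun x => x.1 ≠ x.2).card : ℝ) ≤
      (m.choose (2 * q) : ℝ) ^ 2 * (1 / 2 : ℝ) ^ (2 * a₁ + a₂) := by
  -- For q = 0 only the zero word can occur, so there is no pair of distinct words.
  rcases Nat.eq_zero_or_pos q with rfl | hq
  · refine le_trans (expect_card_le _ ∅ (q := 0) ?_ ?_) ?_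
    · rintro H ⟨x, y⟩ hxy
      simp only [collisions, Finset.mem_filter, Finset.mem_product, mem_list₁] at hxy
      have h1 := hammingNorm_of_mem_halves hxy.1.1.1.1
      have h2 := hammingNorm_of_mem_halves hxy.1.1.2.1
      rw [add_zero, hammingNorm_eq_zero] at h1 h2
      exact absurd (h1.trans h2.symm) hxy.2
    · simp
    · simp
  set T := Finset.univ.filter fun x : Word m => hammingNorm x = 2 * q with hT
  have hle := expect_card_le (fun H : Triple a₁ a₂ a₃ m =>
      (collisions (list₁ (2 * q) H.1) (list₁ (2 * q) H.1) H.2.1).filter fun x => x.1 ≠ x.2)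
    (T ×ˢ T) (q := (1 / 2 : ℝ) ^ (2 * a₁ + a₂)) ?_ ?_
  · rw [Finset.card_product, hT, card_hammingNorm_eq] at hle
    refine hle.trans_eq ?_
    push_cast; ring
  · rintro H ⟨x, y⟩ hxy
    simp only [collisions, Finset.mem_filter, Finset.mem_product, mem_list₁] at hxy
    simp only [hT, Finset.mem_product, Finset.mem_filter, Finset.mem_univ, true_and]
    rw [hammingNorm_of_mem_halves hxy.1.1.1.1, hammingNorm_of_mem_halves hxy.1.1.2.1]
    omega
  · rintro ⟨x, y⟩ hxy
    simp only [hT, Finset.mem_product, Finset.mem_filter, Finset.mem_univ, true_and] at hxy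
    by_cases hne : x = y
    · subst hne
      refine le_trans (prob_mono (q := fun _ => False) fun H hH => ?_) ?_
      · simp at hH
      · simp [prob]
    have hx0 : x ≠ 0 := ne_zero_of_hammingNorm_pos (by omega)
    have hy0 : y ≠ 0 := ne_zero_of_hammingNorm_pos (by omega)
    have h1 := prob_kill_triple (a₁ := a₁) (a₂ := a₂) (a₃ := a₃) (line x ⊔ line y) (line (x + y)) ⊥
    rw [finrank_line_sup_line hx0 hy0 hne, finrank_line (mt word_add_eq_zero.1 hne), finrank_bot,
      mul_zero, add_zero, mul_one, mul_comm a₁] at h1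
    rw [← h1]
    refine prob_mono fun H hH => ?_
    simp only [collisions, Finset.mem_filter, Finset.mem_product, mem_list₁] at hH
    rw [kill_sup, kill_line, kill_line, kill_line, ← mulVec_eq_iff]
    exact ⟨⟨hH.1.1.1.2, hH.1.1.2.2⟩, hH.1.2, by simp⟩

lemma expect_collisions_two_le (hp₂ : 0 < p₂) :
    𝔼 H : Triple a₁ a₂ a₃ m,
      (((collisions (list₂ (2 * q) p₂ H.1 H.2.1) (list₂ (2 * q) p₂ H.1 H.2.1) H.2.2).filter
        fun x => x.1 ≠ x.2).card : ℝ) ≤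
      (m.choose p₂ : ℝ) ^ 2 * (1 / 2 : ℝ) ^ (2 * a₁ + 2 * a₂ + a₃) := by
  set T := Finset.univ.filter fun x : Word m => hammingNorm x = p₂ with hT
  have hle := expect_card_le (fun H : Triple a₁ a₂ a₃ m =>
      (collisions (list₂ (2 * q) p₂ H.1 H.2.1) (list₂ (2 * q) p₂ H.1 H.2.1) H.2.2).filter
        fun x => x.1 ≠ x.2)
    (T ×ˢ T) (q := (1 / 2 : ℝ) ^ (2 * a₁ + 2 * a₂ + a₃)) ?_ ?_
  · rw [Finset.card_product, hT, card_hammingNorm_eq] at hle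
    refine hle.trans_eq ?_
    push_cast; ring
  · rintro H ⟨x, y⟩ hxy
    simp only [collisions, Finset.mem_filter, Finset.mem_product] at hxy
    simp only [hT, Finset.mem_product, Finset.mem_filter, Finset.mem_univ, true_and]
    exact ⟨(of_mem_list₂ hxy.1.1.1).1, (of_mem_list₂ hxy.1.1.2).1⟩
  · rintro ⟨x, y⟩ hxy
    simp only [hT, Finset.mem_product, Finset.mem_filter, Finset.mem_univ, true_and] at hxy
    by_cases hne : x = y
    · subst hne
      refine le_trans (prob_mono (q := fun _ => False) fun H hH => ?_) ?_
      · simp at hH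
      · simp [prob]
    have hx0 : x ≠ 0 := ne_zero_of_hammingNorm_pos (by omega)
    have hy0 : y ≠ 0 := ne_zero_of_hammingNorm_pos (by omega)
    have h1 := prob_kill_triple (a₁ := a₁) (a₂ := a₂) (a₃ := a₃) (line x ⊔ line y)
      (line x ⊔ line y) (line (x + y))
    rw [finrank_line_sup_line hx0 hy0 hne, finrank_line (mt word_add_eq_zero.1 hne),
      mul_one, mul_comm a₁, mul_comm a₂] at h1
    rw [← h1]
    refine prob_mono fun H hH => ?_
    simp only [collisions, Finset.mem_filter, Finset.mem_product] at hH
    obtain ⟨-, k1, k2⟩ := of_mem_list₂ hH.1.1.1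
    obtain ⟨-, l1, l2⟩ := of_mem_list₂ hH.1.1.2
    rw [kill_sup, kill_line, kill_line, kill_sup, kill_line, kill_line, kill_line, ← mulVec_eq_iff]
    exact ⟨⟨k1, l1⟩, ⟨k2, l2⟩, hH.1.2⟩

lemma expect_list₃_le (hw : 0 < w) :
    𝔼 H : Triple a₁ a₂ a₃ m, ((list₃ (2 * q) p₂ w H.1 H.2.1 H.2.2).card : ℝ) ≤
      (m.choose w : ℝ) * (1 / 2 : ℝ) ^ (a₁ + a₂ + a₃) := by
  rw [← card_hammingNorm_eq]
  refine expect_card_le _ _ ?_ ?_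
  · intro H x hx
    simpa using (of_mem_list₃ hx).1
  · intro x hx
    have hx0 : x ≠ 0 := ne_zero_of_hammingNorm_pos (by simp at hx; omega)
    have h1 := prob_kill_triple (a₁ := a₁) (a₂ := a₂) (a₃ := a₃) (line x) (line x) (line x)
    rw [finrank_line hx0, mul_one, mul_one, mul_one] at h1
    rw [← h1]
    refine prob_mono fun H hH => ?_
    obtain ⟨-, k1, k2, k3⟩ := of_mem_list₃ hH
    rw [kill_line, kill_line, kill_line]
    exact ⟨k1, k2, k3⟩

/-- For balanced words membership in the first list is equivalent to being killed by H₁, so the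
first moment computation is an equality on such pairs. -/
lemma le_expect_collisions_one (hq : 0 < q) :
    ((halves m q q).card : ℝ) * ((halves m q q).card - 1) * (1 / 2 : ℝ) ^ (2 * a₁ + a₂) ≤
      𝔼 H : Triple a₁ a₂ a₃ m,
        ((collisions (list₁ (2 * q) H.1) (list₁ (2 * q) H.1) H.2.1).card : ℝ) := by
  have hc : ((halves m q q).offDiag.card : ℝ) =
      ((halves m q q).card : ℝ) * ((halves m q q).card - 1) := by
    rw [Finset.offDiag_card, Nat.cast_sub (Nat.le_mul_self _)]; push_cast; ring
  rw [← hc]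
  refine le_expect_card _ _ ?_
  rintro ⟨x, y⟩ hxy
  rw [Finset.mem_offDiag] at hxy
  obtain ⟨hx, hy, hne⟩ := hxy
  have hx0 : x ≠ 0 := ne_zero_of_hammingNorm_pos (by rw [hammingNorm_of_mem_halves hx]; omega)
  have hy0 : y ≠ 0 := ne_zero_of_hammingNorm_pos (by rw [hammingNorm_of_mem_halves hy]; omega)
  have h1 := prob_kill_triple (a₁ := a₁) (a₂ := a₂) (a₃ := a₃) (line x ⊔ line y) (line (x + y)) ⊥
  rw [finrank_line_sup_line hx0 hy0 hne, finrank_line (mt word_add_eq_zero.1 hne), finrank_bot,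
    mul_zero, add_zero, mul_one, mul_comm a₁] at h1
  rw [← h1]
  refine prob_mono fun H hH => ?_
  rw [kill_sup, kill_line, kill_line, kill_line, ← mulVec_eq_iff] at hH
  simp only [collisions, Finset.mem_filter, Finset.mem_product, mem_list₁]
  exact ⟨⟨⟨hx, hH.1.1⟩, hy, hH.1.2⟩, hH.2.1⟩

end moments

open Module

/-! ### Second moment bounds for the lists of levels 2 and 3. -/

section secondMoment

variable {m a₁ a₂ a₃ q p₂ w : ℕ}

/-- Two independent words with many representations are simultaneously representable with a
probability close to that of being killed by the random matrix. -/
lemma le_prob_representable_pair {N : ℕ} {x x' : Word m} (hx : x ≠ 0) (hx' : x' ≠ 0)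
    (hne : x ≠ x')
    (hN : ((halves m q q).filter fun u => u + x ∈ halves m q q).card = N)
    (hN' : ((halves m q q).filter fun u => u + x' ∈ halves m q q).card = N)
    (hle : (N : ℝ) ≤ 2 * 2 ^ a₁) :
    (N : ℝ) ^ 4 * (1 / 2 : ℝ) ^ (6 * a₁) ≤
      36720 * prob fun H : BMat a₁ m => Representable q H x ∧ Representable q H x' := by
  set A := (halves m q q).filter fun u => u + x ∈ halves m q q with hA
  set A' := (halves m q q).filter fun u => u + x' ∈ halves m q q with hA'
  set W := line x ⊔ line x' with hW
  have dW : finrank (ZMod 2) W = 2 := finrank_line_sup_line hx hx' hne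
  have hAc : (A.card : ℝ) ≤ 2 * 2 ^ a₁ := by rw [hN]; exact hle
  have hAc' : (A'.card : ℝ) ≤ 2 * 2 ^ a₁ := by rw [hN']; exact hle
  have d1 : ∀ a, finrank (ZMod 2) ↥(W ⊔ line a) ≤ 3 := fun a =>
    (finrank_sup_span_le W a).trans (by omega)
  have d2 : ∀ a b, finrank (ZMod 2) ↥(W ⊔ line a ⊔ line b) ≤ 4 := fun a b =>
    (finrank_sup_span_le _ b).trans (Nat.succ_le_succ (d1 a))
  have d3 : ∀ a b c, finrank (ZMod 2) ↥(W ⊔ line a ⊔ line b ⊔ line c) ≤ 5 := fun a b c =>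
    (finrank_sup_span_le _ c).trans (Nat.succ_le_succ (d2 a b))
  -- The second moment method runs over pairs of representations, a of x and b of x'. Killing x, x',
  -- a, b makes both words representable.
  have key := sq_sum_prob_le (A ×ˢ A')
    (fun i (H : BMat a₁ m) => ∀ w ∈ W ⊔ line i.1 ⊔ line i.2, H.mulVec w = 0)
    (fun H => Representable q H x ∧ Representable q H x') ?_
  swap
  · rintro ⟨a, b⟩ hab H hH
    rw [Finset.mem_product, hA, hA', Finset.mem_filter, Finset.mem_filter] at hab
    simp only [kill_sup, hW, kill_line] at hH
    exact ⟨⟨a, hab.1.1, hab.1.2, hH.1.2, hH.1.1.1⟩, b, hab.2.1, hab.2.2, hH.2, hH.1.1.2⟩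
  -- The span of x, x', a, b has dimension at most 4, and a smaller dimension only raises the
  -- probability.
  have lower : (N : ℝ) ^ 2 * (1 / 2 : ℝ) ^ (4 * a₁) ≤ ∑ i ∈ A ×ˢ A',
      prob (fun H : BMat a₁ m => ∀ w ∈ W ⊔ line i.1 ⊔ line i.2, H.mulVec w = 0) := by
    have := Finset.card_nsmul_le_sum (A ×ˢ A')
      (fun i => prob (fun H : BMat a₁ m => ∀ w ∈ W ⊔ line i.1 ⊔ line i.2, H.mulVec w = 0))
      ((1 / 2 : ℝ) ^ (4 * a₁)) ?_
    · rw [nsmul_eq_mul, Finset.card_product, hN, hN'] at this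
      refine le_of_eq_of_le ?_ this
      push_cast; ring
    · rintro ⟨a, b⟩ _
      rw [prob_kill, mul_comm 4]
      exact pow_le_pow_of_le_one (by norm_num) (by norm_num) (Nat.mul_le_mul_left _ (d2 a b))
  have upper : ∑ i ∈ A ×ˢ A', ∑ j ∈ A ×ˢ A', prob (fun H : BMat a₁ m =>
      (∀ w ∈ W ⊔ line i.1 ⊔ line i.2, H.mulVec w = 0) ∧
      ∀ w ∈ W ⊔ line j.1 ⊔ line j.2, H.mulVec w = 0) ≤ 36720 * (1 / 2 : ℝ) ^ (2 * a₁) := by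
    have e : ∀ a b c d : Word m, prob (fun H : BMat a₁ m =>
        (∀ w ∈ W ⊔ line a ⊔ line b, H.mulVec w = 0) ∧
        ∀ w ∈ W ⊔ line c ⊔ line d, H.mulVec w = 0) =
        (1 / 2 : ℝ) ^ (a₁ * finrank (ZMod 2) ↥(W ⊔ line a ⊔ line b ⊔ line c ⊔ line d)) := by
      intro a b c d
      rw [← prob_kill]
      refine prob_congr fun H => ?_
      simp only [kill_sup]
      tauto
    simp only [Finset.sum_product, e]
    -- The four words are removed one at a time, last one first, from spaces of dimension at most 5,
    -- 4, 3 and 2. Each removal costs 2 + 2^d, where the 2 comes from N ≤ 2 · 2^a₁. The product 34 ·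
    -- 18 · 10 · 6 is 36720.
    calc _ ≤ ∑ a ∈ A, ∑ b ∈ A', ∑ c ∈ A, (2 + 2 ^ 5) *
          (1 / 2 : ℝ) ^ (a₁ * finrank (ZMod 2) ↥(W ⊔ line a ⊔ line b ⊔ line c)) := by
          refine Finset.sum_le_sum fun a _ => Finset.sum_le_sum fun b _ =>
            Finset.sum_le_sum fun c _ => sum_kill_le a₁ A' _ (d3 a b c) hAc'
      _ ≤ ∑ a ∈ A, ∑ b ∈ A', (2 + 2 ^ 5) * ((2 + 2 ^ 4) *
          (1 / 2 : ℝ) ^ (a₁ * finrank (ZMod 2) ↥(W ⊔ line a ⊔ line b))) := by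
          refine Finset.sum_le_sum fun a _ => Finset.sum_le_sum fun b _ => ?_
          rw [← Finset.mul_sum]
          gcongr
          exact sum_kill_le a₁ A _ (d2 a b) hAc
      _ ≤ ∑ a ∈ A, (2 + 2 ^ 5) * ((2 + 2 ^ 4) * ((2 + 2 ^ 3) *
          (1 / 2 : ℝ) ^ (a₁ * finrank (ZMod 2) ↥(W ⊔ line a)))) := by
          refine Finset.sum_le_sum fun a _ => ?_
          rw [← Finset.mul_sum, ← Finset.mul_sum]
          gcongr
          exact sum_kill_le a₁ A' _ (d1 a) hAc'
      _ ≤ (2 + 2 ^ 5) * ((2 + 2 ^ 4) * ((2 + 2 ^ 3) * ((2 + 2 ^ 2) *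
          (1 / 2 : ℝ) ^ (a₁ * finrank (ZMod 2) W)))) := by
          rw [← Finset.mul_sum, ← Finset.mul_sum, ← Finset.mul_sum]
          gcongr
          exact sum_kill_le a₁ A _ dW.le hAc
      _ = _ := by rw [dW, mul_comm a₁]; ring
  set P := prob fun H : BMat a₁ m => Representable q H x ∧ Representable q H x' with hP
  have hP0 : 0 ≤ P := prob_nonneg _
  have h1 : ((N : ℝ) ^ 2 * (1 / 2 : ℝ) ^ (4 * a₁)) ^ 2 ≤ P * (36720 * (1 / 2 : ℝ) ^ (2 * a₁)) :=
    (pow_le_pow_left₀ (by positivity) lower 2).trans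
      (key.trans (mul_le_mul_of_nonneg_left upper hP0))
  have hpos : (0 : ℝ) < (1 / 2 : ℝ) ^ (2 * a₁) := by positivity
  refine le_of_mul_le_mul_right ?_ hpos
  calc (N : ℝ) ^ 4 * (1 / 2 : ℝ) ^ (6 * a₁) * (1 / 2 : ℝ) ^ (2 * a₁)
      = ((N : ℝ) ^ 2 * (1 / 2 : ℝ) ^ (4 * a₁)) ^ 2 := by
        rw [mul_pow, ← pow_mul, ← pow_mul, mul_assoc, ← pow_add]; ring_nf
    _ ≤ _ := h1
    _ = _ := by ring

variable {i i' j j' : ℕ}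

/-- The number of representations of a word with half weights `2 j, 2 j'` by words with half weights
`q, q'`. -/
def repCount (m j j' q q' : ℕ) : ℕ :=
  ((2 * j).choose j * (m / 2 - 2 * j).choose (q - j)) *
    ((2 * j').choose j' * (m - m / 2 - 2 * j').choose (q' - j'))

/-- Representations with prescribed half weights are among all representations of the same word.
This links `repCount` to the product of binomials in the representation constraints; a word x is
needed to compare the two counts. -/
lemma repCount_le (hx : (halves m (2 * j) (2 * j')).Nonempty) {q' : ℕ} (hj : j ≤ q)
    (hj' : j' ≤ q') :
    repCount m j j' q q' ≤ (2 * (j + j')).choose (j + j') *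
      (m - 2 * (j + j')).choose (q + q' - (j + j')) := by
  obtain ⟨x, hx⟩ := hx
  have hn : hammingNorm x = 2 * (j + j') := by rw [hammingNorm_of_mem_halves hx]; ring
  rw [repCount, ← card_representations_halves hx hj hj',
    ← card_representations hn (show j + j' ≤ q + q' by omega)]
  refine Finset.card_le_card fun u hu => ?_
  rw [Finset.mem_filter] at hu
  simp only [Finset.mem_filter, Finset.mem_univ, true_and]
  exact ⟨hammingNorm_of_mem_halves hu.1, hammingNorm_of_mem_halves hu.2⟩

/-- Only pairs of distinct balanced words are counted. Three independent events are required: H₁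
makes both words representable, H₂ kills both, H₃ kills their sum. -/
lemma le_expect_collisions_two (hj : 0 < j) (hjq : j ≤ q) (hj'q : j' ≤ q)
    (hp₂ : 2 * j + 2 * j' = p₂)
    (hle : (repCount m j j' q q : ℝ) ≤ 2 * 2 ^ a₁) :
    ((halves m (2 * j) (2 * j')).card : ℝ) * ((halves m (2 * j) (2 * j')).card - 1) *
      ((repCount m j j' q q : ℝ) ^ 4 * (1 / 2 : ℝ) ^ (6 * a₁ + 2 * a₂ + a₃) / 36720) ≤
      𝔼 H : Triple a₁ a₂ a₃ m, ((collisions (list₂ (2 * q) p₂ H.1 H.2.1)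
        (list₂ (2 * q) p₂ H.1 H.2.1) H.2.2).card : ℝ) := by
  set X := halves m (2 * j) (2 * j') with hX
  have hc : (X.offDiag.card : ℝ) = (X.card : ℝ) * (X.card - 1) := by
    rw [Finset.offDiag_card, Nat.cast_sub (Nat.le_mul_self _)]; push_cast; ring
  rw [← hc]
  refine le_expect_card _ _ ?_
  rintro ⟨x, y⟩ hxy
  rw [Finset.mem_offDiag] at hxy
  obtain ⟨hx, hy, hne⟩ := hxy
  have hxn := hammingNorm_of_mem_halves hx
  have hyn := hammingNorm_of_mem_halves hy
  have hx0 : x ≠ 0 := ne_zero_of_hammingNorm_pos (by rw [hxn]; omega)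
  have hy0 : y ≠ 0 := ne_zero_of_hammingNorm_pos (by rw [hyn]; omega)
  have h1 := le_prob_representable_pair (a₁ := a₁) hx0 hy0 hne
    (card_representations_halves hx hjq hj'q) (card_representations_halves hy hjq hj'q) hle
  have h2 := prob_kill (a := a₂) (line x ⊔ line y)
  have h3 := prob_kill (a := a₃) (line (x + y))
  rw [finrank_line_sup_line hx0 hy0 hne] at h2
  rw [finrank_line (mt word_add_eq_zero.1 hne)] at h3
  have h4 := prob_prod (fun H : BMat a₁ m => Representable q H x ∧ Representable q H y)
    (fun H : BMat a₂ m × BMat a₃ m => (∀ w ∈ line x ⊔ line y, H.1.mulVec w = 0) ∧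
      ∀ w ∈ line (x + y), H.2.mulVec w = 0)
  rw [prob_prod (fun H : BMat a₂ m => ∀ w ∈ line x ⊔ line y, H.mulVec w = 0)
      (fun H : BMat a₃ m => ∀ w ∈ line (x + y), H.mulVec w = 0), h2, h3] at h4
  calc _ = (repCount m j j' q q : ℝ) ^ 4 * (1 / 2 : ℝ) ^ (6 * a₁) / 36720 *
        ((1 / 2 : ℝ) ^ (a₂ * 2) * (1 / 2 : ℝ) ^ (a₃ * 1)) := by
        rw [pow_add, pow_add]; ring
    _ ≤ prob (fun H : BMat a₁ m => Representable q H x ∧ Representable q H y) *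
        ((1 / 2 : ℝ) ^ (a₂ * 2) * (1 / 2 : ℝ) ^ (a₃ * 1)) := by
        gcongr
        rw [div_le_iff₀ (by norm_num), mul_comm (prob _)]
        exact h1
    _ = _ := h4.symm
    _ ≤ _ := by
      refine prob_mono fun H hH => ?_
      rw [kill_sup, kill_line, kill_line, kill_line, ← mulVec_eq_iff] at hH
      simp only [collisions, Finset.mem_filter, Finset.mem_product]
      exact ⟨⟨hH.1.1.mem_list₂ (hxn.trans hp₂) hH.2.1.1,
        hH.1.2.mem_list₂ (hyn.trans hp₂) hH.2.1.2⟩, hH.2.2⟩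

/-- A second moment argument for each balanced y, over its decompositions x + (x + y) into two
balanced words of level 2. When the two values of `repCount` are of order 2^a₁ and 2^(a₁ + a₂), the
bound is of the order of the number of such y times 2^(−(a₁ + a₂ + a₃)). -/
lemma le_expect_list₃ (hi : 0 < i) (hij : i ≤ 2 * j) (hij' : i' ≤ 2 * j') (hj : 0 < j)
    (hjq : j ≤ q) (hj'q : j' ≤ q) (hp₂ : 2 * j + 2 * j' = p₂) (hw : 2 * i + 2 * i' = w)
    (hle₁ : (repCount m j j' q q : ℝ) ≤ 2 * 2 ^ a₁)
    (hle₂ : (repCount m i i' (2 * j) (2 * j') : ℝ) ≤ 2 * 2 ^ (a₁ + a₂)) :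
    ((halves m (2 * i) (2 * i')).card : ℝ) *
      (((repCount m i i' (2 * j) (2 * j') : ℝ) * ((repCount m j j' q q : ℝ) ^ 4 / 36720)) ^ 2 / 24 *
        (1 / 2 : ℝ) ^ (11 * a₁ + 3 * a₂ + a₃)) ≤
      𝔼 H : Triple a₁ a₂ a₃ m, ((list₃ (2 * q) p₂ w H.1 H.2.1 H.2.2).card : ℝ) := by
  refine le_expect_card _ _ fun y hy => ?_
  have hyn := hammingNorm_of_mem_halves hy
  have hy0 : y ≠ 0 := ne_zero_of_hammingNorm_pos (by omega)
  set X := (halves m (2 * j) (2 * j')).filter fun x => x + y ∈ halves m (2 * j) (2 * j') with hX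
  have hXc : X.card = repCount m i i' (2 * j) (2 * j') := card_representations_halves hy hij hij'
  set N₁ := repCount m j j' q q with hN₁
  set N₂ := repCount m i i' (2 * j) (2 * j') with hN₂
  have key := sq_sum_prob_le X
    (fun x (H : Triple a₁ a₂ a₃ m) => (Representable q H.1 x ∧ Representable q H.1 (x + y)) ∧
      (∀ w ∈ line y ⊔ line x, H.2.1.mulVec w = 0) ∧ ∀ w ∈ line y, H.2.2.mulVec w = 0)
    (fun H => y ∈ list₃ (2 * q) p₂ w H.1 H.2.1 H.2.2) ?_
  swap
  · intro x hx H hH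
    rw [hX, Finset.mem_filter] at hx
    rw [kill_sup, kill_line, kill_line, kill_line] at hH
    refine mem_merge (y := x) ?_ ?_ (hyn.trans hw) hH.2.2
    · exact hH.1.1.mem_list₂ ((hammingNorm_of_mem_halves hx.1).trans hp₂) hH.2.1.2
    · refine hH.1.2.mem_list₂ ((hammingNorm_of_mem_halves hx.2).trans hp₂) ?_
      rw [Matrix.mulVec_add, hH.2.1.1, hH.2.1.2, add_zero]
  -- Both summands must be representable at level 1, so the bound for pairs enters, with the fourth
  -- power of N₁. Then H₂ must kill a plane and H₃ a line.
  have lower : (N₂ : ℝ) * ((N₁ : ℝ) ^ 4 / 36720 * (1 / 2 : ℝ) ^ (6 * a₁ + 2 * a₂ + a₃)) ≤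
      ∑ x ∈ X, prob (fun H : Triple a₁ a₂ a₃ m =>
        (Representable q H.1 x ∧ Representable q H.1 (x + y)) ∧
        (∀ w ∈ line y ⊔ line x, H.2.1.mulVec w = 0) ∧ ∀ w ∈ line y, H.2.2.mulVec w = 0) := by
    rw [← hXc, ← nsmul_eq_mul]
    refine Finset.card_nsmul_le_sum _ _ _ fun x hx => ?_
    rw [hX, Finset.mem_filter] at hx
    have hxn := hammingNorm_of_mem_halves hx.1
    have hxyn := hammingNorm_of_mem_halves hx.2
    have hx0 : x ≠ 0 := ne_zero_of_hammingNorm_pos (by omega)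
    have hxy0 : x + y ≠ 0 := ne_zero_of_hammingNorm_pos (by omega)
    have hne : x ≠ x + y := fun h => hy0 (by simpa using h)
    have hne' : y ≠ x := fun h => hxy0 (by rw [h, word_add_self])
    have h1 := le_prob_representable_pair (a₁ := a₁) hx0 hxy0 hne
      (card_representations_halves hx.1 hjq hj'q) (card_representations_halves hx.2 hjq hj'q) hle₁
    have h2 := prob_kill (a := a₂) (line y ⊔ line x)
    have h3 := prob_kill (a := a₃) (line y)
    rw [finrank_line_sup_line hy0 hx0 hne'] at h2
    rw [finrank_line hy0] at h3
    rw [prob_prod (fun H : BMat a₁ m => Representable q H x ∧ Representable q H (x + y))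
      (fun H : BMat a₂ m × BMat a₃ m => (∀ w ∈ line y ⊔ line x, H.1.mulVec w = 0) ∧
        ∀ w ∈ line y, H.2.mulVec w = 0),
      prob_prod (fun H : BMat a₂ m => ∀ w ∈ line y ⊔ line x, H.mulVec w = 0)
      (fun H : BMat a₃ m => ∀ w ∈ line y, H.mulVec w = 0), h2, h3]
    calc _ = (N₁ : ℝ) ^ 4 * (1 / 2 : ℝ) ^ (6 * a₁) / 36720 *
          ((1 / 2 : ℝ) ^ (a₂ * 2) * (1 / 2 : ℝ) ^ (a₃ * 1)) := by
          rw [pow_add, pow_add]; ring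
      _ ≤ _ := by
          gcongr
          rw [div_le_iff₀ (by norm_num), mul_comm (prob _)]
          exact h1
  have upper : ∑ x ∈ X, ∑ x' ∈ X, prob (fun H : Triple a₁ a₂ a₃ m =>
      ((Representable q H.1 x ∧ Representable q H.1 (x + y)) ∧
        (∀ w ∈ line y ⊔ line x, H.2.1.mulVec w = 0) ∧ ∀ w ∈ line y, H.2.2.mulVec w = 0) ∧
      ((Representable q H.1 x' ∧ Representable q H.1 (x' + y)) ∧
        (∀ w ∈ line y ⊔ line x', H.2.1.mulVec w = 0) ∧ ∀ w ∈ line y, H.2.2.mulVec w = 0)) ≤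
      24 * (1 / 2 : ℝ) ^ (a₁ + a₂ + a₃) := by
    -- For the upper bound representability is weakened to being killed by H₁. Then H₁ and H₂ act on
    -- the span of y, x, x' like one matrix with a₁ + a₂ rows, and summation over x' and x gives the
    -- factors 2 + 2² and 2 + 2¹, that is 24.
    have e : ∀ x x' : Word m, prob (fun H : Triple a₁ a₂ a₃ m =>
      ((Representable q H.1 x ∧ Representable q H.1 (x + y)) ∧
        (∀ w ∈ line y ⊔ line x, H.2.1.mulVec w = 0) ∧ ∀ w ∈ line y, H.2.2.mulVec w = 0) ∧
      ((Representable q H.1 x' ∧ Representable q H.1 (x' + y)) ∧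
        (∀ w ∈ line y ⊔ line x', H.2.1.mulVec w = 0) ∧ ∀ w ∈ line y, H.2.2.mulVec w = 0)) ≤
        (1 / 2 : ℝ) ^ ((a₁ + a₂) * finrank (ZMod 2) ↥(line y ⊔ line x ⊔ line x')) *
          (1 / 2 : ℝ) ^ a₃ := by
      intro x x'
      have := prob_kill_triple (a₁ := a₁) (a₂ := a₂) (a₃ := a₃) (line y ⊔ line x ⊔ line x')
        (line y ⊔ line x ⊔ line x') (line y)
      rw [finrank_line hy0, mul_one, ← add_mul, pow_add _ _ a₃] at this
      rw [← this]
      refine prob_mono fun H hH => ?_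
      simp only [kill_sup, kill_line] at hH ⊢
      obtain ⟨⟨⟨⟨_, _, _, _, k1⟩, ⟨_, _, _, _, k2⟩⟩, ⟨k3, k4⟩, k5⟩, ⟨⟨_, _, _, _, k6⟩, _⟩, ⟨_, k7⟩, _⟩ :=
        hH
      rw [Matrix.mulVec_add, k1, zero_add] at k2
      exact ⟨⟨⟨k2, k1⟩, k6⟩, ⟨⟨k3, k4⟩, k7⟩, k5⟩
    have hXc' : (X.card : ℝ) ≤ 2 * 2 ^ (a₁ + a₂) := by rw [hXc]; exact hle₂
    calc _ ≤ ∑ x ∈ X, ∑ x' ∈ X, (1 / 2 : ℝ) ^ ((a₁ + a₂) *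
            finrank (ZMod 2) ↥(line y ⊔ line x ⊔ line x')) * (1 / 2 : ℝ) ^ a₃ :=
          Finset.sum_le_sum fun x _ => Finset.sum_le_sum fun x' _ => e x x'
      _ ≤ ∑ x ∈ X, (2 + 2 ^ 2) * (1 / 2 : ℝ) ^ ((a₁ + a₂) *
            finrank (ZMod 2) ↥(line y ⊔ line x)) * (1 / 2 : ℝ) ^ a₃ := by
          refine Finset.sum_le_sum fun x _ => ?_
          rw [← Finset.sum_mul]
          gcongr
          refine sum_kill_le _ X _ ?_ hXc'
          exact (finrank_sup_span_le _ x).trans (by rw [finrank_line hy0])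
      _ ≤ (2 + 2 ^ 2) * ((2 + 2 ^ 1) * (1 / 2 : ℝ) ^ ((a₁ + a₂) *
            finrank (ZMod 2) ↥(line y))) * (1 / 2 : ℝ) ^ a₃ := by
          rw [← Finset.sum_mul, ← Finset.mul_sum]
          gcongr
          exact sum_kill_le _ X _ (finrank_line hy0).le hXc'
      _ = _ := by rw [finrank_line hy0, mul_one, pow_add _ (a₁ + a₂)]; ring
  set P := prob fun H : Triple a₁ a₂ a₃ m => y ∈ list₃ (2 * q) p₂ w H.1 H.2.1 H.2.2 with hP
  have hP0 : 0 ≤ P := prob_nonneg _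
  have h1 := (pow_le_pow_left₀ (by positivity) lower 2).trans
      (key.trans (mul_le_mul_of_nonneg_left upper hP0))
  have hpos : (0 : ℝ) < 24 * (1 / 2 : ℝ) ^ (a₁ + a₂ + a₃) := by positivity
  refine le_of_mul_le_mul_right (le_of_eq_of_le ?_ h1) hpos
  have e : (1 / 2 : ℝ) ^ (11 * a₁ + 3 * a₂ + a₃) * (1 / 2 : ℝ) ^ (a₁ + a₂ + a₃) =
      ((1 / 2 : ℝ) ^ (6 * a₁ + 2 * a₂ + a₃)) ^ 2 := by
    rw [← pow_add, ← pow_mul]; ring_nf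
  calc _ = ((N₂ : ℝ) * ((N₁ : ℝ) ^ 4 / 36720)) ^ 2 *
        ((1 / 2 : ℝ) ^ (11 * a₁ + 3 * a₂ + a₃) * (1 / 2 : ℝ) ^ (a₁ + a₂ + a₃)) := by ring
    _ = _ := by rw [e]; ring

end secondMoment

/-! ### Expected number of steps and of parity-checks -/

section expectations

variable {m a₁ a₂ a₃ q p₂ w : ℕ}

lemma expect_listSteps_le (hq : 0 < q) (hp₂ : 0 < p₂) :
    𝔼 H : Triple a₁ a₂ a₃ m, (listSteps (2 * q) p₂ H.1 H.2.1 H.2.2 : ℝ) ≤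
      12 * ((leftList m q).card + (rightList m q).card +
        (leftList m q).card * (rightList m q).card * (1 / 2 : ℝ) ^ a₁ +
        (m.choose (2 * q) : ℝ) ^ 2 * (1 / 2 : ℝ) ^ (2 * a₁ + a₂) +
        (m.choose p₂ : ℝ) ^ 2 * (1 / 2 : ℝ) ^ (2 * a₁ + 2 * a₂ + a₃)) := by
  have h0 := expect_collisions_zero (m := m) (a₁ := a₁) (a₂ := a₂) (a₃ := a₃) hq
  have h1 := expect_collisions_one_le (m := m) (a₁ := a₁) (a₂ := a₂) (a₃ := a₃) (q := q)
  have h2 := expect_collisions_two_le (m := m) (a₁ := a₁) (a₂ := a₂) (a₃ := a₃) (q := q) hp₂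
  set c : Triple a₁ a₂ a₃ m → ℝ := fun H =>
    ((collisions (leftList m q) (rightList m q) H.1).card : ℝ)
  set d : Triple a₁ a₂ a₃ m → ℝ := fun H =>
    (((collisions (list₁ (2 * q) H.1) (list₁ (2 * q) H.1) H.2.1).filter
        fun x => x.1 ≠ x.2).card : ℝ)
  set e : Triple a₁ a₂ a₃ m → ℝ := fun H =>
    (((collisions (list₂ (2 * q) p₂ H.1 H.2.1) (list₂ (2 * q) p₂ H.1 H.2.1) H.2.2).filter
        fun x => x.1 ≠ x.2).card : ℝ)
  have hpt : ∀ H : Triple a₁ a₂ a₃ m, (listSteps (2 * q) p₂ H.1 H.2.1 H.2.2 : ℝ) ≤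
      2 * ((leftList m q).card + (rightList m q).card) + (7 * c H + (4 * d H + e H)) := by
    intro H
    have k1 := collisions_self_card_le (list₁ (2 * q) H.1) H.2.1
    have k2 := collisions_self_card_le (list₂ (2 * q) p₂ H.1 H.2.1) H.2.2
    have k3 : (list₁ (2 * q) H.1).card ≤ (collisions (leftList m q) (rightList m q) H.1).card := by
      have := card_merge_le (w := 2 * q) (leftList m q) (rightList m q) H.1
      rwa [list₁, Nat.mul_div_cancel_left _ two_pos]
    have k4 : (list₂ (2 * q) p₂ H.1 H.2.1).card ≤ _ :=
      card_merge_le (w := p₂) (list₁ (2 * q) H.1) (list₁ (2 * q) H.1) H.2.1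
    -- Each list is at most as long as the set of collisions that produces it, and diagonal
    -- collisions at the next level number at most the length of that list. Substituting upwards
    -- gives the coefficients 7, 4 and 1.
    have k5 : listSteps (2 * q) p₂ H.1 H.2.1 H.2.2 ≤
        2 * ((leftList m q).card + (rightList m q).card) +
        (7 * (collisions (leftList m q) (rightList m q) H.1).card +
        (4 * ((collisions (list₁ (2 * q) H.1) (list₁ (2 * q) H.1) H.2.1).filter
          fun x => x.1 ≠ x.2).card +
        ((collisions (list₂ (2 * q) p₂ H.1 H.2.1) (list₂ (2 * q) p₂ H.1 H.2.1) H.2.2).filter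
          fun x => x.1 ≠ x.2).card)) := by
      unfold listSteps mergeSteps
      rw [Nat.mul_div_cancel_left _ two_pos]
      omega
    simp only [c, d, e]
    exact_mod_cast k5
  refine (Finset.expect_le_expect fun H _ => hpt H).trans ?_
  rw [Finset.expect_add_distrib, Finset.expect_add_distrib, Finset.expect_add_distrib,
    ← Finset.mul_expect _ c, ← Finset.mul_expect _ d, Fintype.expect_const, h0]
  change _ + (_ + (4 * Finset.univ.expect d + Finset.univ.expect e)) ≤ _
  have l1 : (0 : ℝ) ≤ (leftList m q).card := by positivity
  have l2 : (0 : ℝ) ≤ (rightList m q).card := by positivity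
  have l3 : (0 : ℝ) ≤ (leftList m q).card * (rightList m q).card * (1 / 2 : ℝ) ^ a₁ := by positivity
  have l4 : (0 : ℝ) ≤ (m.choose (2 * q) : ℝ) ^ 2 * (1 / 2 : ℝ) ^ (2 * a₁ + a₂) := by positivity
  have l5 : (0 : ℝ) ≤ (m.choose p₂ : ℝ) ^ 2 * (1 / 2 : ℝ) ^ (2 * a₁ + 2 * a₂ + a₃) := by positivity
  linarith

lemma le_expect_listSteps_left :
    ((leftList m q).card : ℝ) ≤
      𝔼 H : Triple a₁ a₂ a₃ m, (listSteps (2 * q) p₂ H.1 H.2.1 H.2.2 : ℝ) := by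
  rw [← Fintype.expect_const (ι := Triple a₁ a₂ a₃ m) ((leftList m q).card : ℝ)]
  refine Finset.expect_le_expect fun H _ => ?_
  simp only [listSteps, mergeSteps, Nat.mul_div_cancel_left _ two_pos]
  norm_cast
  omega

lemma expect_le_expect_listSteps {c : Triple a₁ a₂ a₃ m → ℕ}
    (hc : ∀ H, c H = (collisions (leftList m q) (rightList m q) H.1).card ∨
      c H = (collisions (list₁ (2 * q) H.1) (list₁ (2 * q) H.1) H.2.1).card ∨
      c H = (collisions (list₂ (2 * q) p₂ H.1 H.2.1) (list₂ (2 * q) p₂ H.1 H.2.1) H.2.2).card) :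
    𝔼 H : Triple a₁ a₂ a₃ m, (c H : ℝ) ≤
      𝔼 H : Triple a₁ a₂ a₃ m, (listSteps (2 * q) p₂ H.1 H.2.1 H.2.2 : ℝ) := by
  refine Finset.expect_le_expect fun H _ => ?_
  have := hc H
  simp only [listSteps, mergeSteps, Nat.mul_div_cancel_left _ two_pos]
  norm_cast
  omega

end expectations

/-! ### From words of the final list to parity-checks. -/

section checks

variable {s r m a₁ a₂ a₃ q p₂ w₁ w₂ : ℕ}

/-- Words of the final list are already killed by H, so the lower rows of `generator` impose nothing
more. The upper rows determine the rest of the check from its part on 𝒩₂. -/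
lemma mem_createdChecks {M : Matrix (Fin s ⊕ Fin r) (Fin m) (ZMod 2)}
    {H : Triple a₁ a₂ a₃ m} {c : (Fin s ⊕ Fin r) ⊕ Fin m → ZMod 2} :
    c ∈ createdChecks (2 * q) p₂ w₁ w₂ M H.1 H.2.1 H.2.2 ↔
      (∀ i, c (Sum.inl i) = M.mulVec (fun i => c (Sum.inr i)) i) ∧
      hammingNorm (fun i : Fin r => c (Sum.inl (Sum.inr i))) = w₁ ∧
      (fun i => c (Sum.inr i)) ∈ list₃ (2 * q) p₂ w₂ H.1 H.2.1 H.2.2 := by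
  unfold createdChecks
  rw [Finset.mem_filter]
  simp only [Finset.mem_univ, true_and, generator]
  have hc : c = Sum.elim (fun i => c (Sum.inl i)) (fun i => c (Sum.inr i)) := by
    funext i; cases i <;> rfl
  set y : Word m := fun i => c (Sum.inr i) with hy
  have hneg : ∀ a b : ZMod 2, a + b = 0 ↔ a = b := by decide
  constructor
  · rintro ⟨h1, h2, h3⟩
    refine ⟨fun i => ?_, h2, h3⟩
    rw [hc, Matrix.fromBlocks_mulVec] at h1
    have := congrFun h1 (Sum.inl i)
    simp only [Sum.elim_inl, Matrix.one_mulVec, Pi.add_apply, Pi.zero_apply] at this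
    exact (hneg _ _).1 this
  · rintro ⟨h1, h2, h3⟩
    refine ⟨?_, h2, h3⟩
    obtain ⟨-, k1, k2, k3⟩ := of_mem_list₃ h3
    rw [hc, Matrix.fromBlocks_mulVec]
    funext i
    rcases i with i | i
    · simp only [Sum.elim_inl, Matrix.one_mulVec, Pi.add_apply, Pi.zero_apply]
      exact (hneg _ _).2 (h1 i)
    · have e : (Sum.elim (fun i => c (Sum.inl i)) y ∘ Sum.inr : Word m) = y := rfl
      simp only [Sum.elim_inr, Matrix.zero_mulVec, zero_add, e, Matrix.fromRows_mulVec, k1, k2, k3]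
      rcases i with i | i | i <;> rfl

lemma card_createdChecks (M : Matrix (Fin s ⊕ Fin r) (Fin m) (ZMod 2)) (H : Triple a₁ a₂ a₃ m) :
    (createdChecks (2 * q) p₂ w₁ w₂ M H.1 H.2.1 H.2.2).card =
      ((list₃ (2 * q) p₂ w₂ H.1 H.2.1 H.2.2).filter fun y =>
        hammingNorm (fun i : Fin r => M.mulVec y (Sum.inr i)) = w₁).card := by
  refine Finset.card_bij' (fun c _ i => c (Sum.inr i)) (fun y _ => Sum.elim (M.mulVec y) y)
    ?_ ?_ ?_ ?_
  · intro c hc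
    rw [mem_createdChecks] at hc
    rw [Finset.mem_filter]
    refine ⟨hc.2.2, ?_⟩
    rw [← hc.2.1]
    simp_rw [hc.1]
  · intro y hy
    rw [Finset.mem_filter] at hy
    rw [mem_createdChecks]
    exact ⟨fun i => rfl, hy.2, hy.1⟩
  · intro c hc
    rw [mem_createdChecks] at hc
    funext i
    rcases i with i | i
    · exact (hc.1 i).symm
    · rfl
  · intro y _
    rfl

/-- For y ≠ 0 the map from M to the 𝒩₁ part of M y is a surjective homomorphism, so all its fibres
have the same size and this part is uniform in 𝔽₂^r. -/
lemma prob_hammingNorm_mulVec {y : Word m} (hy : y ≠ 0) :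
    prob (fun M : Matrix (Fin s ⊕ Fin r) (Fin m) (ZMod 2) =>
      hammingNorm (fun i : Fin r => M.mulVec y (Sum.inr i)) = w₁) = (r.choose w₁ : ℝ) / 2 ^ r := by
  obtain ⟨j, hj⟩ := Function.ne_iff.1 hy
  have hj1 : y j = 1 := by
    have : ∀ a : ZMod 2, a ≠ 0 → a = 1 := by decide
    exact this _ hj
  let f : Matrix (Fin s ⊕ Fin r) (Fin m) (ZMod 2) →+ Word r :=
    { toFun := fun M i => M.mulVec y (Sum.inr i)
      map_zero' := by funext i; simp
      map_add' := fun M M' => by funext i; simp [Matrix.add_mulVec] }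
  have hf : Function.Surjective f := by
    intro c
    refine ⟨Matrix.of fun i k => if k = j then Sum.elim 0 c i else 0, ?_⟩
    funext i
    simp [f, Matrix.mulVec, dotProduct, hj1]
  have hfib : ∀ c : Word r, (Finset.univ.filter fun M => f M = c).card =
      (Finset.univ.filter fun M => f M = 0).card := fun c =>
    AddMonoidHom.card_fiber_eq_of_mem_range f (hf c) (hf 0)
  set F := (Finset.univ.filter fun M => f M = 0).card with hF
  have htot : Fintype.card (Matrix (Fin s ⊕ Fin r) (Fin m) (ZMod 2)) = 2 ^ r * F := by
    rw [← Finset.card_univ, Finset.card_eq_sum_card_fiberwise (f := f) (t := Finset.univ)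
      (fun _ _ => Finset.mem_coe.2 (Finset.mem_univ _)), Finset.sum_congr rfl fun c _ => hfib c,
      Finset.sum_const, Finset.card_univ]
    simp [ZMod.card]
  have hnum : (Finset.univ.filter fun M => hammingNorm (f M) = w₁).card = r.choose w₁ * F := by
    rw [Finset.card_eq_sum_card_fiberwise (f := f)
      (t := Finset.univ.filter fun c : Word r => hammingNorm c = w₁)
      (fun M hM => by simpa using hM), Finset.sum_congr rfl fun c hc => ?_, Finset.sum_const,
      card_hammingNorm_eq, smul_eq_mul]
    rw [← hfib c, Finset.filter_filter]
    congr 1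
    ext M
    simp only [Finset.mem_filter, Finset.mem_univ, true_and] at hc ⊢
    constructor
    · exact fun h => h.2
    · exact fun h => ⟨by rw [h, hc], h⟩
  have hF0 : (F : ℝ) ≠ 0 := by
    intro h
    have h' : F = 0 := by exact_mod_cast h
    rw [h', mul_zero] at htot
    exact Fintype.card_ne_zero htot
  rw [prob_eq_card_div, htot]
  change ((Finset.univ.filter fun M => hammingNorm (f M) = w₁).card : ℝ) / _ = _
  rw [hnum]
  push_cast
  field_simp

lemma expect_createdChecks (hw₂ : 0 < w₂) :
    𝔼 H : Matrix (Fin s ⊕ Fin r) (Fin m) (ZMod 2) × Triple a₁ a₂ a₃ m,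
      ((createdChecks (2 * q) p₂ w₁ w₂ H.1 H.2.1 H.2.2.1 H.2.2.2).card : ℝ) =
    (r.choose w₁ : ℝ) / 2 ^ r *
      𝔼 H : Triple a₁ a₂ a₃ m, ((list₃ (2 * q) p₂ w₂ H.1 H.2.1 H.2.2).card : ℝ) := by
  rw [← Finset.univ_product_univ, Finset.expect_product, Finset.expect_comm, Finset.mul_expect]
  refine Finset.expect_congr rfl fun H _ => ?_
  simp_rw [card_createdChecks]
  rw [expect_card]
  rw [← Finset.sum_subset (Finset.subset_univ (list₃ (2 * q) p₂ w₂ H.1 H.2.1 H.2.2))]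
  · rw [Finset.sum_congr rfl fun y hy => ?_, Finset.sum_const, nsmul_eq_mul, mul_comm]
    have hy0 : y ≠ 0 := ne_zero_of_hammingNorm_pos (by rw [(of_mem_list₃ hy).1]; exact hw₂)
    rw [← prob_hammingNorm_mulVec (s := s) (w₁ := w₁) hy0]
    refine prob_congr fun M => ?_
    rw [Finset.mem_filter]
    exact and_iff_right hy
  · intro y _ hy
    exact Finset.expect_eq_zero fun M _ => if_neg fun h => hy (Finset.mem_filter.1 h).1

end checks

/-! ### Krawtchouk polynomials -/

section krawtchouk

open Polynomial

/-- The generating polynomial of the values `K_w^n(u)`. -/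
noncomputable def krawtchoukGen (n u : ℕ) : ℤ[X] := (1 - X) ^ u * (1 + X) ^ (n - u)

lemma coeff_one_sub_X_pow (u j : ℕ) : ((1 - X : ℤ[X]) ^ u).coeff j = (-1) ^ j * (u.choose j : ℤ) := by
  have : (1 - X : ℤ[X]) ^ u = ((1 + X) ^ u).comp (C (-1) * X) := by
    simp [sub_eq_add_neg]
  rw [this, comp_C_mul_X_coeff, coeff_one_add_X_pow, mul_comm]

lemma coeff_krawtchoukGen (n w u : ℕ) : (krawtchoukGen n u).coeff w = krawtchouk n w u := by
  rw [krawtchoukGen, coeff_mul, Finset.Nat.sum_antidiagonal_eq_sum_range_succ_mk]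
  simp only [coeff_one_sub_X_pow, coeff_one_add_X_pow]
  rfl

lemma natDegree_krawtchoukGen_le {n u : ℕ} (hu : u ≤ n) : (krawtchoukGen n u).natDegree ≤ n := by
  rw [krawtchoukGen]
  refine natDegree_mul_le.trans ?_
  have h1 : ((1 - X : ℤ[X]) ^ u).natDegree ≤ u := by
    refine natDegree_pow_le.trans ?_
    have : (1 - X : ℤ[X]).natDegree ≤ 1 := by compute_degree
    simpa using Nat.mul_le_mul_left u this
  have h2 : ((1 + X : ℤ[X]) ^ (n - u)).natDegree ≤ n - u := by
    refine natDegree_pow_le.trans ?_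
    have : (1 + X : ℤ[X]).natDegree ≤ 1 := by compute_degree
    simpa using Nat.mul_le_mul_left (n - u) this
  omega

lemma krawtchouk_zero_right (n w : ℕ) : krawtchouk n w 0 = n.choose w := by
  rw [← coeff_krawtchoukGen, krawtchoukGen, pow_zero, one_mul, Nat.sub_zero, coeff_one_add_X_pow]

lemma krawtchouk_sub_right {n u : ℕ} (w : ℕ) (hu : u ≤ n) :
    krawtchouk n w (n - u) = (-1) ^ w * krawtchouk n w u := by
  rw [← coeff_krawtchoukGen, ← coeff_krawtchoukGen]
  have : krawtchoukGen n (n - u) = (krawtchoukGen n u).comp (C (-1) * X) := by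
    rw [krawtchoukGen, krawtchoukGen, Nat.sub_sub_self hu]
    simp [sub_eq_add_neg, mul_comm]
  rw [this, comp_C_mul_X_coeff, mul_comm]

/-- Three-term recurrence in the argument. -/
lemma krawtchouk_recurrence {n u : ℕ} (w : ℕ) (hu : u < n) :
    ((n : ℤ) - u) * krawtchouk n w (u + 1) =
      ((n : ℤ) - 2 * w) * krawtchouk n w u - u * krawtchouk n w (u - 1) := by
  obtain ⟨v, rfl⟩ : ∃ v, n = u + v + 1 := ⟨n - u - 1, by omega⟩
  -- This is the logarithmic derivative of (1 − X)^u (1 + X)^(n − u), rewritten through the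
  -- quotients of neighbouring generating polynomials. On coefficients X d/dX is multiplication by
  -- w. For u = 0 the index u − 1 truncates to 0, but its coefficient u vanishes.
  have hpoly : 2 * (X * derivative (krawtchoukGen (u + v + 1) u)) =
      (u : ℤ[X]) * (krawtchoukGen (u + v + 1) u - krawtchoukGen (u + v + 1) (u - 1)) +
      ((v : ℤ[X]) + 1) *
        (krawtchoukGen (u + v + 1) u - krawtchoukGen (u + v + 1) (u + 1)) := by
    unfold krawtchoukGen
    rw [show u + v + 1 - u = v + 1 by omega, show u + v + 1 - (u + 1) = v by omega]
    rcases u with _ | u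
    · simp [derivative_pow]
      ring
    · rw [show u + 1 + v + 1 - (u + 1 - 1) = v + 2 by omega, Nat.add_sub_cancel]
      simp [derivative_pow, derivative_mul]
      ring
  have hc := congrArg (fun p => coeff p w) hpoly
  have hX : (X * derivative (krawtchoukGen (u + v + 1) u)).coeff w =
      w * krawtchouk (u + v + 1) w u := by
    rcases w with _ | w
    · simp
    · rw [coeff_X_mul, coeff_derivative, coeff_krawtchoukGen]; push_cast; ring
  have e1 : (2 : ℤ[X]) = C 2 := rfl
  have e2 : (u : ℤ[X]) = C (u : ℤ) := by simp
  have e3 : (v : ℤ[X]) + 1 = C ((v : ℤ) + 1) := by simp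
  simp only [e1, e2, e3, coeff_add, coeff_C_mul, hX, coeff_sub, coeff_krawtchoukGen] at hc
  push_cast
  linarith

lemma sum_coeff_one_add_mul {S : Type*} [CommRing S] {p : ℤ[X]} {n : ℕ} (hp : p.natDegree ≤ n)
    (c : ℤ) (a b : S) :
    ∑ w ∈ Finset.range (n + 2), (((1 + C c * X) * p).coeff w : S) * (a ^ w * b ^ (n + 1 - w)) =
      (b + c * a) * ∑ w ∈ Finset.range (n + 1), (p.coeff w : S) * (a ^ w * b ^ (n - w)) := by
  have h0 : ∀ w, ((1 + C c * X) * p).coeff w = p.coeff w + c * (X * p).coeff w := by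
    intro w
    rw [add_mul, one_mul, coeff_add, mul_assoc, coeff_C_mul]
  simp only [h0]
  simp only [Int.cast_add, Int.cast_mul, add_mul, Finset.sum_add_distrib]
  congr 1
  · rw [Finset.sum_range_succ, coeff_eq_zero_of_natDegree_lt (by omega : p.natDegree < n + 1),
      Int.cast_zero, zero_mul, add_zero, Finset.mul_sum]
    refine Finset.sum_congr rfl fun w hw => ?_
    rw [Finset.mem_range] at hw
    rw [show n + 1 - w = n - w + 1 by omega, pow_succ]
    ring
  · rw [Finset.sum_range_succ', coeff_X_mul_zero, Int.cast_zero, mul_zero, zero_mul, add_zero,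
      Finset.mul_sum]
    refine Finset.sum_congr rfl fun w _ => ?_
    rw [coeff_X_mul, show n + 1 - (w + 1) = n - w by omega, pow_succ]
    ring

/-- The homogenised generating identity. It is stated over an arbitrary ring so that polynomials can
be substituted: a = 1 − X and b = 1 + X yield the involution property. -/
lemma sum_krawtchouk_mul {S : Type*} [CommRing S] {n u : ℕ} (hu : u ≤ n) (a b : S) :
    ∑ w ∈ Finset.range (n + 1), (krawtchouk n w u : S) * (a ^ w * b ^ (n - w)) =
      (b - a) ^ u * (b + a) ^ (n - u) := by
  obtain ⟨v, rfl⟩ : ∃ v, n = u + v := ⟨n - u, by omega⟩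
  simp only [← coeff_krawtchoukGen]
  induction u with
  | zero =>
    induction v with
    | zero => simp [krawtchoukGen]
    | succ v ih =>
      have hg : krawtchoukGen (0 + (v + 1)) 0 = (1 + C 1 * X) * krawtchoukGen (0 + v) 0 := by
        simp [krawtchoukGen, pow_succ, mul_comm]
      rw [hg]
      have := sum_coeff_one_add_mul (natDegree_krawtchoukGen_le (Nat.zero_le (0 + v))) 1 a b
      rw [show 0 + (v + 1) = 0 + v + 1 by ring, this, ih (by omega)]
      simp [pow_succ, mul_comm]
  | succ u ih =>
    have hg : krawtchoukGen (u + 1 + v) (u + 1) = (1 + C (-1) * X) * krawtchoukGen (u + v) u := by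
      unfold krawtchoukGen
      rw [show u + 1 + v - (u + 1) = v by omega, show u + v - u = v by omega]
      simp only [map_neg, map_one]
      ring
    rw [hg]
    have := sum_coeff_one_add_mul (natDegree_krawtchoukGen_le (Nat.le_add_right u v)) (-1) a b
    rw [show u + 1 + v = u + v + 1 by ring, this, ih (by omega),
      show u + v + 1 - (u + 1) = v by omega, show u + v - u = v by omega]
    push_cast
    ring

/-- The Krawtchouk matrix is an involution up to the factor `2 ^ n`. -/
lemma sum_krawtchouk_mul_krawtchouk {n u u' : ℕ} (hu : u ≤ n) :
    ∑ w ∈ Finset.range (n + 1), krawtchouk n w u * krawtchouk n u' w =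
      if u' = u then 2 ^ n else 0 := by
  have h1 := sum_krawtchouk_mul hu (1 - X : ℤ[X]) (1 + X)
  have h2 := congrArg (fun p => coeff p u') h1
  have e : ((1 + X : ℤ[X]) - (1 - X)) ^ u * (1 + X + (1 - X)) ^ (n - u) = C (2 ^ n) * X ^ u := by
    rw [show (1 + X : ℤ[X]) - (1 - X) = C 2 * X by
      rw [show (C 2 : ℤ[X]) = 2 from rfl]; ring, show (1 + X : ℤ[X]) + (1 - X) = C 2 by
      rw [show (C 2 : ℤ[X]) = 2 from rfl]; ring, mul_pow, ← C_pow, ← C_pow, mul_right_comm, ← C_mul,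
      ← pow_add, Nat.add_sub_cancel' hu]
  simp only [e, finsetSum_coeff, coeff_C_mul_X_pow] at h2
  rw [← h2]
  refine Finset.sum_congr rfl fun w _ => ?_
  rw [← coeff_krawtchoukGen n u' w, krawtchoukGen, ← coeff_C_mul]
  simp

lemma choose_mul_choose_comm (N a b : ℕ) :
    N.choose a * (N - a).choose b = N.choose b * (N - b).choose a := by
  have h1 := Nat.choose_mul (n := N) (Nat.le_add_right a b)
  have h2 := Nat.choose_mul (n := N) (Nat.le_add_left b a)
  rw [Nat.add_sub_cancel_left] at h1
  rw [Nat.add_sub_cancel_right] at h2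
  rw [← h1, ← h2, Nat.choose_symm_add]

/-- The symmetry holds term by term: up to sign, the j-th terms on both sides are the multinomial
coefficient for parts j, u − j, w − j and the remainder. -/
lemma choose_mul_krawtchouk {n u w : ℕ} (hu : u ≤ n) (hw : w ≤ n) :
    (n.choose u : ℤ) * krawtchouk n w u = n.choose w * krawtchouk n u w := by
  have hr : ∀ u w : ℕ, krawtchouk n w u = ∑ j ∈ Finset.range (min u w + 1),
      (-1) ^ j * (u.choose j : ℤ) * ((n - u).choose (w - j) : ℤ) := by
    intro u w
    unfold krawtchouk
    symm
    refine Finset.sum_subset (Finset.range_mono (by omega)) fun j hj hj' => ?_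
    rw [Finset.mem_range] at hj hj'
    rw [Nat.choose_eq_zero_of_lt (by omega : u < j)]
    simp
  rw [hr, hr, min_comm w u, Finset.mul_sum, Finset.mul_sum]
  refine Finset.sum_congr rfl fun j hj => ?_
  rw [Finset.mem_range] at hj
  have hju : j ≤ u := by omega
  have hjw : j ≤ w := by omega
  have h1 := Nat.choose_mul (n := n) hju
  have h2 := Nat.choose_mul (n := n) hjw
  have h3 := choose_mul_choose_comm (n - j) (u - j) (w - j)
  rw [show n - j - (u - j) = n - u by omega, show n - j - (w - j) = n - w by omega] at h3
  zify at h1 h2 h3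
  linear_combination (-1) ^ j * ((n - u).choose (w - j) : ℤ) * h1
    - (-1) ^ j * ((n - w).choose (u - j) : ℤ) * h2 + (-1) ^ j * (n.choose j : ℤ) * h3

lemma krawtchouk_sub_left {n u w : ℕ} (hu : u ≤ n) (hw : w ≤ n) :
    krawtchouk n (n - w) u = (-1) ^ u * krawtchouk n w u := by
  have h1 := choose_mul_krawtchouk hu (Nat.sub_le n w)
  have h2 := choose_mul_krawtchouk hu hw
  rw [krawtchouk_sub_right u hw, Nat.choose_symm hw] at h1
  have h3 : (n.choose u : ℤ) ≠ 0 := by exact_mod_cast (Nat.choose_pos hu).ne'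
  refine mul_left_cancel₀ h3 ?_
  linear_combination h1 - (-1) ^ u * h2

/-- Orthogonality of the Krawtchouk polynomials, in the argument. -/
lemma sum_krawtchouk_mul_div {n u u' : ℕ} (hu : u ≤ n) (hu' : u' ≤ n) :
    ∑ w ∈ Finset.range (n + 1), (krawtchouk n w u : ℝ) * krawtchouk n w u' / (n.choose w : ℝ) =
      if u = u' then 2 ^ n / (n.choose u : ℝ) else 0 := by
  have h1 := sum_krawtchouk_mul_krawtchouk (u' := u') hu
  have hc : (n.choose u' : ℝ) ≠ 0 := by exact_mod_cast (Nat.choose_pos hu').ne'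
  have h2 : ∀ w ∈ Finset.range (n + 1), (krawtchouk n w u : ℝ) * krawtchouk n w u' /
      (n.choose w : ℝ) = ((krawtchouk n w u * krawtchouk n u' w : ℤ) : ℝ) / n.choose u' := by
    intro w hw
    have hw' : w ≤ n := by rw [Finset.mem_range] at hw; omega
    have hcw : (n.choose w : ℝ) ≠ 0 := by exact_mod_cast (Nat.choose_pos hw').ne'
    have h3 := choose_mul_krawtchouk hu' hw'
    have h3' : (n.choose u' : ℝ) * krawtchouk n w u' = n.choose w * krawtchouk n u' w := by
      exact_mod_cast h3
    rw [div_eq_div_iff hcw hc]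
    push_cast
    linear_combination (krawtchouk n w u : ℝ) * h3'
  rw [Finset.sum_congr rfl h2, ← Finset.sum_div, ← Int.cast_sum, h1]
  by_cases h : u = u'
  · subst h; simp
  · rw [if_neg h, if_neg (Ne.symm h)]; simp

/-- A single term of the diagonal orthogonality sum is at most the whole sum. This is the upper
bound that is sharp on the exponential scale in the oscillatory regime. -/
lemma choose_mul_krawtchouk_sq_le {n u w : ℕ} (hu : u ≤ n) (hw : w ≤ n) :
    (n.choose u : ℝ) * (krawtchouk n w u : ℝ) ^ 2 ≤ 2 ^ n * n.choose w := by
  have h1 := sum_krawtchouk_mul_div hu hu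
  rw [if_pos rfl] at h1
  have hcw : (0 : ℝ) < n.choose w := by exact_mod_cast Nat.choose_pos hw
  have hcu : (0 : ℝ) < n.choose u := by exact_mod_cast Nat.choose_pos hu
  have h2 : (krawtchouk n w u : ℝ) * krawtchouk n w u / (n.choose w : ℝ) ≤
      2 ^ n / (n.choose u : ℝ) := by
    rw [← h1]
    refine Finset.single_le_sum (f := fun w => (krawtchouk n w u : ℝ) * krawtchouk n w u /
      (n.choose w : ℝ)) (fun w _ => ?_) (Finset.mem_range.2 (by omega))
    exact div_nonneg (mul_self_nonneg _) (by positivity)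
  rw [div_le_div_iff₀ hcw hcu] at h2
  linarith

/-- The saddle point bound. -/
lemma abs_krawtchouk_mul_pow_le {n u w : ℕ} (hu : u ≤ n) {z : ℝ} (hz : 0 < z) (hz1 : z < 1)
    (huz : (u : ℝ) * (1 + z) ^ 2 ≤ ((n : ℝ) - u) * (1 - z) ^ 2) :
    |(krawtchouk n w u : ℝ)| * z ^ w ≤ (1 - z) ^ u * (1 + z) ^ (n - u) := by
  set P : ℂ[X] := ((krawtchoukGen n u).map (Int.castRingHom ℂ)).comp (C (z : ℂ) * X) with hP
  set B : ℝ := (1 - z) ^ u * (1 + z) ^ (n - u) with hB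
  have hz' : 0 < 1 - z := by linarith
  have hB0 : 0 < B := by positivity
  have hcoef : P.coeff w = (krawtchouk n w u : ℂ) * z ^ w := by
    rw [hP, comp_C_mul_X_coeff, coeff_map, coeff_krawtchoukGen]; simp
  have hnorm : ‖P.coeff w‖ = |(krawtchouk n w u : ℝ)| * z ^ w := by
    rw [hcoef, norm_mul, norm_pow, Complex.norm_real, Real.norm_of_nonneg hz.le, Complex.norm_intCast]
  have heval : ∀ x : ℂ, P.eval x = (1 - z * x) ^ u * (1 + z * x) ^ (n - u) := by
    intro x
    rw [hP, eval_comp, krawtchoukGen]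
    simp
  -- Under `huz` the modulus of P on the unit circle is largest at x = 1.
  have hbound : ∀ x ∈ Metric.sphere (0 : ℂ) |1|, ‖P.eval x‖ ^ 2 ≤ B ^ 2 := by
    intro x hx
    have hx1 : ‖x‖ = 1 := by simpa using hx
    have hsq : x.re ^ 2 + x.im ^ 2 = 1 := by
      have := Complex.sq_norm x
      rw [hx1, Complex.normSq_apply] at this
      nlinarith
    set c := x.re with hc
    have hc1 : c ≤ 1 := by nlinarith [sq_nonneg x.im]
    have hc2 : -1 ≤ c := by nlinarith [sq_nonneg x.im]
    have n1 : ‖1 - z * x‖ ^ 2 = 1 + z ^ 2 - 2 * z * c := by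
      rw [Complex.sq_norm, Complex.normSq_apply]
      simp
      linear_combination z ^ 2 * hsq
    have n2 : ‖1 + z * x‖ ^ 2 = 1 + z ^ 2 + 2 * z * c := by
      rw [Complex.sq_norm, Complex.normSq_apply]
      simp
      linear_combination z ^ 2 * hsq
    rw [heval, norm_mul, norm_pow, norm_pow, mul_pow, ← pow_mul, ← pow_mul, mul_comm u,
      mul_comm (n - u), pow_mul, pow_mul, n1, n2, hB, mul_pow, ← pow_mul, ← pow_mul, mul_comm u,
      mul_comm (n - u), pow_mul, pow_mul]
    have p1 : 0 < (1 - z) ^ 2 := by positivity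
    have p2 : 0 < (1 + z) ^ 2 := by positivity
    -- t is what |1 − z x|² gains, and |1 + z x|² loses, compared with x = 1. Both factors are
    -- bounded by 1 + y ≤ exp y, and `huz` says that the total exponent is nonpositive.
    set t := 2 * z * (1 - c) with ht
    have ht0 : 0 ≤ t := by
      have : 0 ≤ 1 - c := by linarith
      positivity
    have q1 : 1 + z ^ 2 - 2 * z * c = (1 - z) ^ 2 * (1 + t / (1 - z) ^ 2) := by
      field_simp; rw [ht]; ring
    have q2 : 1 + z ^ 2 + 2 * z * c = (1 + z) ^ 2 * (1 - t / (1 + z) ^ 2) := by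
      field_simp; rw [ht]; ring
    have q3 : 0 ≤ 1 - t / (1 + z) ^ 2 := by
      rw [sub_nonneg, div_le_one p2]
      nlinarith
    rw [q1, q2, mul_pow, mul_pow]
    have k1 : (1 + t / (1 - z) ^ 2) ^ u ≤ Real.exp (u * (t / (1 - z) ^ 2)) := by
      rw [Real.exp_nat_mul]
      gcongr
      rw [add_comm]
      exact Real.add_one_le_exp _
    have k2 : (1 - t / (1 + z) ^ 2) ^ (n - u) ≤ Real.exp ((n - u : ℕ) * (-(t / (1 + z) ^ 2))) := by
      rw [Real.exp_nat_mul]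
      gcongr
      have := Real.add_one_le_exp (-(t / (1 + z) ^ 2))
      linarith
    have k3 : (1 + t / (1 - z) ^ 2) ^ u * (1 - t / (1 + z) ^ 2) ^ (n - u) ≤ 1 := by
      calc _ ≤ Real.exp (u * (t / (1 - z) ^ 2)) *
            Real.exp ((n - u : ℕ) * (-(t / (1 + z) ^ 2))) := by gcongr
        _ = Real.exp (t * (u / (1 - z) ^ 2 - (n - u : ℕ) / (1 + z) ^ 2)) := by
            rw [← Real.exp_add]; congr 1; ring
        _ ≤ 1 := by
          rw [Real.exp_le_one_iff]
          refine mul_nonpos_of_nonneg_of_nonpos ht0 ?_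
          rw [sub_nonpos, div_le_div_iff₀ p1 p2, Nat.cast_sub hu]
          exact huz
    calc _ = ((1 - z) ^ 2) ^ u * ((1 + z) ^ 2) ^ (n - u) *
          ((1 + t / (1 - z) ^ 2) ^ u * (1 - t / (1 + z) ^ 2) ^ (n - u)) := by ring
      _ ≤ ((1 - z) ^ 2) ^ u * ((1 + z) ^ 2) ^ (n - u) * 1 := by gcongr
      _ = _ := mul_one _
  have hint : CircleIntegrable (fun θ => ‖P.eval θ‖ ^ 2) 0 1 := by
    apply ContinuousOn.circleIntegrable'
    exact (by fun_prop : Continuous fun θ : ℂ => ‖P.eval θ‖ ^ 2).continuousOn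
  -- By Parseval the mean of |P|² over the circle is the sum of the squared moduli of the
  -- coefficients, so each coefficient is at most B in modulus.
  have havg := Real.circleAverage_mono_on_of_le_circle hint hbound
  rw [← sum_sq_norm_coeff_eq_circleAverage] at havg
  have hone : ‖P.coeff w‖ ^ 2 ≤ B ^ 2 := by
    by_cases hw : w ∈ P.support
    · exact (Finset.single_le_sum (f := fun i => ‖P.coeff i‖ ^ 2) (fun _ _ => by positivity)
        hw).trans havg
    · rw [notMem_support_iff.1 hw]; simp; positivity
  rw [← hnorm]
  exact le_of_sq_le_sq hone hB0.le

end krawtchouk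

/-! ### The oscillatory regime of the Krawtchouk polynomials -/

section oscillatory

/-- The orthonormal Krawtchouk functions. -/
noncomputable def kfun (n w u : ℕ) : ℝ :=
  √((n.choose u : ℝ) / (2 ^ n * n.choose w)) * krawtchouk n w u

/-- Off-diagonal entries of the Jacobi matrix of the Krawtchouk functions. -/
noncomputable def kcoef (n u : ℕ) : ℝ := √((u : ℝ) * ((n : ℝ) + 1 - u))

lemma kcoef_zero (n : ℕ) : kcoef n 0 = 0 := by simp [kcoef]

lemma kcoef_succ_self (n : ℕ) : kcoef n (n + 1) = 0 := by simp [kcoef]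

lemma kcoef_nonneg (n u : ℕ) : 0 ≤ kcoef n u := Real.sqrt_nonneg _

lemma kcoef_le {n u : ℕ} (hu : u ≤ n + 1) : kcoef n u ≤ n + 1 := by
  have h1 : (u : ℝ) ≤ n + 1 := by exact_mod_cast hu
  have h0 : (0 : ℝ) ≤ u := by positivity
  rw [kcoef, Real.sqrt_le_left (by positivity)]
  nlinarith

lemma abs_sqrt_sub_sqrt_le {a b : ℝ} (ha : 0 ≤ a) (hb : 0 ≤ b) : |√a - √b| ≤ √|a - b| := by
  apply Real.le_sqrt_of_sq_le
  rw [sq_abs]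
  have h1 := Real.sq_sqrt ha
  have h2 := Real.sq_sqrt hb
  have h3 := Real.sqrt_nonneg a
  have h4 := Real.sqrt_nonneg b
  rcases le_total a b with h | h
  · rw [abs_of_nonpos (by linarith)]
    nlinarith [Real.sqrt_le_sqrt h]
  · rw [abs_of_nonneg (by linarith)]
    nlinarith [Real.sqrt_le_sqrt h]

lemma abs_kcoef_sub_le {n A u K : ℕ} (hA : A ≤ u) (hu : u ≤ A + K) (hn : A + K ≤ n + 1) :
    |kcoef n u - kcoef n A| ≤ √(K * (n + 1)) := by
  have a1 : (A : ℝ) ≤ u := by exact_mod_cast hA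
  have a2 : (u : ℝ) ≤ A + K := by exact_mod_cast hu
  have a3 : (A : ℝ) + K ≤ n + 1 := by exact_mod_cast hn
  have a4 : (0 : ℝ) ≤ A := by positivity
  have a5 : (0 : ℝ) ≤ K := by positivity
  refine (abs_sqrt_sub_sqrt_le (by apply mul_nonneg <;> linarith)
    (by apply mul_nonneg <;> linarith)).trans ?_
  apply Real.sqrt_le_sqrt
  rw [show (u : ℝ) * (n + 1 - u) - A * (n + 1 - A) = (u - A) * (n + 1 - u - A) by ring, abs_mul]
  gcongr
  · rw [abs_of_nonneg (by linarith)]; linarith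
  · rw [abs_le]; constructor <;> linarith

lemma sqrt_choose_mul (n u : ℕ) (hu : u < n) :
    √(n.choose u : ℝ) * ((n : ℝ) - u) = √(n.choose (u + 1) : ℝ) * kcoef n (u + 1) := by
  have h1 : (0 : ℝ) ≤ (n : ℝ) - u := by
    have : (u : ℝ) ≤ n := by exact_mod_cast hu.le
    linarith
  have h2 := Nat.choose_succ_right_eq n u
  have h3 : (n.choose (u + 1) : ℝ) * (u + 1) = n.choose u * ((n : ℝ) - u) := by
    rw [← Nat.cast_sub hu.le]; exact_mod_cast h2
  rw [kcoef, ← Real.sqrt_mul (by positivity)]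
  have : (n : ℝ) - u = √(((n : ℝ) - u) ^ 2) := (Real.sqrt_sq h1).symm
  rw [this, ← Real.sqrt_mul (by positivity)]
  congr 1
  push_cast
  linear_combination -((n : ℝ) - u) * h3

lemma sqrt_choose_mul' (n u : ℕ) (hu : u ≤ n) :
    √(n.choose u : ℝ) * u = √(n.choose (u - 1) : ℝ) * kcoef n u := by
  rcases u with _ | u
  · simp [kcoef_zero]
  have h1 := sqrt_choose_mul n u (by omega)
  have h2 := Nat.choose_succ_right_eq n u
  have h3 : (n.choose (u + 1) : ℝ) * (u + 1) = n.choose u * ((n : ℝ) - u) := by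
    rw [← Nat.cast_sub (by omega : u ≤ n)]; exact_mod_cast h2
  have h4 : (0 : ℝ) ≤ (n : ℝ) - u := by
    have : (u : ℝ) ≤ n := by exact_mod_cast (by omega : u ≤ n)
    linarith
  rw [Nat.add_sub_cancel, kcoef, ← Real.sqrt_mul (by positivity)]
  have : ((u + 1 : ℕ) : ℝ) = √(((u + 1 : ℕ) : ℝ) ^ 2) := (Real.sqrt_sq (by positivity)).symm
  nth_rewrite 1 [this]
  rw [← Real.sqrt_mul (by positivity)]
  congr 1
  push_cast
  linear_combination ((u : ℝ) + 1) * h3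

lemma kfun_eq (n w u : ℕ) :
    kfun n w u = √(n.choose u : ℝ) * (krawtchouk n w u / √(2 ^ n * n.choose w : ℝ)) := by
  rw [kfun, Real.sqrt_div (by positivity)]
  ring

/-- The normalisation makes the three-term recurrence symmetric: as a function of u, `kfun n w` is
an eigenvector of a real Jacobi matrix with zero diagonal, with eigenvalue n − 2 w. -/
lemma kfun_recurrence {n u : ℕ} (w : ℕ) (hu : u ≤ n) :
    kcoef n (u + 1) * kfun n w (u + 1) + kcoef n u * kfun n w (u - 1) =
      ((n : ℝ) - 2 * w) * kfun n w u := by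
  simp only [kfun_eq]
  set s := √(2 ^ n * n.choose w : ℝ)
  have h2 := sqrt_choose_mul' n u hu
  rcases hu.lt_or_eq with hlt | rfl
  · have h1 := sqrt_choose_mul n u hlt
    have h3 := krawtchouk_recurrence w hlt
    have h3' : ((n : ℝ) - u) * krawtchouk n w (u + 1) =
      ((n : ℝ) - 2 * w) * krawtchouk n w u - u * krawtchouk n w (u - 1) := by exact_mod_cast h3
    linear_combination (-(krawtchouk n w (u + 1) / s : ℝ)) * h1
      - (krawtchouk n w (u - 1) / s : ℝ) * h2 + √(n.choose u : ℝ) / s * h3'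
  -- At the right end u = n the recurrence is obtained from the one at 0 by the reflection of the
  -- argument.
  · rw [kcoef_succ_self, zero_mul, zero_add]
    have h3 : (u : ℝ) * krawtchouk u w (u - 1) = ((u : ℝ) - 2 * w) * krawtchouk u w u := by
      rcases u with _ | u
      · rcases w with _ | w
        · simp
        · simp [krawtchouk, Finset.sum_range_succ', Nat.choose_eq_zero_of_lt]
      · have e1 := krawtchouk_sub_right (n := u + 1) (u := 1) w (by omega)
        have e2 := krawtchouk_sub_right (n := u + 1) (u := 0) w (by omega)
        have e3 := krawtchouk_recurrence (n := u + 1) (u := 0) w (by omega)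
        simp only [Nat.sub_zero, Nat.cast_zero, zero_mul, sub_zero, zero_add] at e2 e3
        rw [e1, e2]
        have e3' : ((u + 1 : ℕ) : ℝ) * krawtchouk (u + 1) w 1 =
          (((u + 1 : ℕ) : ℝ) - 2 * w) * krawtchouk (u + 1) w 0 := by exact_mod_cast e3
        push_cast at e3' ⊢
        linear_combination (-1 : ℝ) ^ w * e3'
    linear_combination √(u.choose u : ℝ) / s * h3 - (krawtchouk u w (u - 1) / s : ℝ) * h2

lemma sum_kfun_mul_kfun {n u u' : ℕ} (hu : u ≤ n) (hu' : u' ≤ n) :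
    ∑ w ∈ Finset.range (n + 1), kfun n w u * kfun n w u' = if u = u' then 1 else 0 := by
  have h1 := sum_krawtchouk_mul_div hu hu'
  have h2 : ∀ w ∈ Finset.range (n + 1), kfun n w u * kfun n w u' =
      √(n.choose u : ℝ) * √(n.choose u' : ℝ) / 2 ^ n *
        ((krawtchouk n w u : ℝ) * krawtchouk n w u' / (n.choose w : ℝ)) := by
    intro w hw
    have hcw : (n.choose w : ℝ) ≠ 0 := by
      rw [Finset.mem_range] at hw
      exact_mod_cast (Nat.choose_pos (by omega : w ≤ n)).ne'
    rw [kfun_eq, kfun_eq]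
    have h3 := Real.mul_self_sqrt (by positivity : (0 : ℝ) ≤ 2 ^ n * n.choose w)
    have h4 : √(2 ^ n * n.choose w : ℝ) ≠ 0 := by
      intro h0; rw [h0] at h3; simp [hcw] at h3
    set a := √(2 ^ n * n.choose w : ℝ) with ha
    calc _ = √(n.choose u : ℝ) * √(n.choose u' : ℝ) *
          (krawtchouk n w u * krawtchouk n w u' / (a * a)) := by
          field_simp
      _ = _ := by rw [h3]; field_simp
  rw [Finset.sum_congr rfl h2, ← Finset.mul_sum, h1]
  split_ifs with h
  · subst h
    have hcu : (n.choose u : ℝ) ≠ 0 := by exact_mod_cast (Nat.choose_pos hu).ne'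
    rw [Real.mul_self_sqrt (by positivity)]
    field_simp
  · simp

lemma kfun_sub_right {n u : ℕ} (w : ℕ) (hu : u ≤ n) :
    kfun n w (n - u) = (-1) ^ w * kfun n w u := by
  rw [kfun, kfun, krawtchouk_sub_right w hu, Nat.choose_symm hu]
  push_cast; ring

/-- Expansion of a function on `{0, …, n}` in Krawtchouk functions. -/
noncomputable def ktrans (n : ℕ) (f : ℕ → ℂ) (w : ℕ) : ℂ :=
  ∑ u ∈ Finset.range (n + 1), f u * kfun n w u

lemma sum_ktrans_mul_conj (n : ℕ) (f g : ℕ → ℂ) :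
    ∑ w ∈ Finset.range (n + 1), ktrans n f w * (starRingEnd ℂ) (ktrans n g w) =
      ∑ u ∈ Finset.range (n + 1), f u * (starRingEnd ℂ) (g u) := by
  simp only [ktrans, map_sum, map_mul, Complex.conj_ofReal, Finset.sum_mul_sum]
  rw [Finset.sum_comm]
  refine Finset.sum_congr rfl fun u hu => ?_
  rw [Finset.sum_comm]
  have : ∀ u' ∈ Finset.range (n + 1), ∑ w ∈ Finset.range (n + 1),
      f u * (kfun n w u : ℂ) * ((starRingEnd ℂ) (g u') * kfun n w u') =
        if u = u' then f u * (starRingEnd ℂ) (g u) else 0 := by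
    intro u' hu'
    rw [Finset.mem_range] at hu hu'
    have h1 := sum_kfun_mul_kfun (n := n) (u := u) (u' := u') (by omega) (by omega)
    calc _ = f u * (starRingEnd ℂ) (g u') *
          ((∑ w ∈ Finset.range (n + 1), kfun n w u * kfun n w u' : ℝ) : ℂ) := by
          push_cast; rw [Finset.mul_sum]; exact Finset.sum_congr rfl fun w _ => by ring
      _ = _ := by rw [h1]; split_ifs with h <;> simp [h]
  rw [Finset.sum_congr rfl this, Finset.sum_ite_eq, if_pos hu]

lemma sum_norm_ktrans_sq (n : ℕ) (f : ℕ → ℂ) :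
    ∑ w ∈ Finset.range (n + 1), ‖ktrans n f w‖ ^ 2 = ∑ u ∈ Finset.range (n + 1), ‖f u‖ ^ 2 := by
  have h := sum_ktrans_mul_conj n f f
  simp only [Complex.mul_conj, Complex.normSq_eq_norm_sq] at h
  exact_mod_cast h

/-- Summation by parts, without boundary terms because `kcoef` vanishes at 0 and n + 1. The
transform diagonalises the Jacobi matrix shifted by b, so an approximate eigenvector concentrates on
degrees with n − 2 w close to b. -/
lemma ktrans_jacobi (n : ℕ) (f : ℕ → ℂ) (b : ℝ) (w : ℕ) :
    ktrans n (fun u => kcoef n u * f (u - 1) + kcoef n (u + 1) * f (u + 1) - b * f u) w =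
      ((n - 2 * w - b : ℝ) : ℂ) * ktrans n f w := by
  have h1 : ∑ u ∈ Finset.range (n + 1), (kcoef n u * f (u - 1)) * (kfun n w u : ℂ) =
      ∑ u ∈ Finset.range (n + 1), f u * (kcoef n (u + 1) * kfun n w (u + 1)) := by
    rw [Finset.sum_range_succ', Finset.sum_range_succ _ n, kcoef_succ_self, kcoef_zero]
    simp only [Nat.add_sub_cancel, Complex.ofReal_zero, zero_mul, mul_zero, add_zero]
    exact Finset.sum_congr rfl fun u _ => by ring
  have h2 : ∑ u ∈ Finset.range (n + 1), f u * (kcoef n u * kfun n w (u - 1)) =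
      ∑ u ∈ Finset.range (n + 1), (kcoef n (u + 1) * f (u + 1)) * (kfun n w u : ℂ) := by
    rw [Finset.sum_range_succ', Finset.sum_range_succ _ n, kcoef_succ_self, kcoef_zero]
    simp only [Nat.add_sub_cancel, Complex.ofReal_zero, zero_mul, mul_zero, add_zero]
    exact Finset.sum_congr rfl fun u _ => by ring
  simp only [ktrans, sub_mul, add_mul, Finset.sum_sub_distrib, Finset.sum_add_distrib]
  rw [h1, ← h2, ← Finset.sum_add_distrib, ← Finset.sum_sub_distrib, Finset.mul_sum]
  refine Finset.sum_congr rfl fun u hu => ?_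
  rw [Finset.mem_range] at hu
  have h3 := kfun_recurrence w (by omega : u ≤ n)
  have h3' : (kcoef n (u + 1) : ℂ) * kfun n w (u + 1) + kcoef n u * kfun n w (u - 1) =
      ((n : ℂ) - 2 * w) * kfun n w u := by exact_mod_cast h3
  push_cast
  linear_combination f u * h3'

lemma ktrans_reflect (n : ℕ) (f : ℕ → ℂ) (w : ℕ) :
    ktrans n (fun u => f (n - u)) w = (-1) ^ w * ktrans n f w := by
  have h := Finset.sum_range_reflect (fun u => f (n - u) * (kfun n w u : ℂ)) (n + 1)
  rw [ktrans, ← h, ktrans, Finset.mul_sum]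
  refine Finset.sum_congr rfl fun u hu => ?_
  rw [Finset.mem_range] at hu
  rw [show n + 1 - 1 - u = n - u by omega, kfun_sub_right w (by omega), Nat.sub_sub_self (by omega)]
  push_cast; ring

/-- A function supported in the left half has half of its mass on even degrees. -/
lemma sum_even_norm_ktrans_sq (n : ℕ) (f : ℕ → ℂ) (hf : ∀ u, n ≤ 2 * u → f u = 0) :
    2 * ∑ w ∈ (Finset.range (n + 1)).filter Even, ‖ktrans n f w‖ ^ 2 =
      ∑ u ∈ Finset.range (n + 1), ‖f u‖ ^ 2 := by
  have h := sum_ktrans_mul_conj n (fun u => f (n - u)) f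
  have h0 : ∑ u ∈ Finset.range (n + 1), f (n - u) * (starRingEnd ℂ) (f u) = 0 := by
    refine Finset.sum_eq_zero fun u hu => ?_
    by_cases h : n ≤ 2 * u
    · rw [hf u h]; simp
    · rw [hf (n - u) (by omega)]; simp
  rw [h0] at h
  simp only [ktrans_reflect, mul_assoc, Complex.mul_conj, Complex.normSq_eq_norm_sq] at h
  have h' : ∑ w ∈ Finset.range (n + 1), (-1 : ℝ) ^ w * ‖ktrans n f w‖ ^ 2 = 0 := by
    exact_mod_cast h
  have h2 : 2 * ∑ w ∈ (Finset.range (n + 1)).filter Even, ‖ktrans n f w‖ ^ 2 =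
      ∑ w ∈ Finset.range (n + 1), ‖ktrans n f w‖ ^ 2 +
        ∑ w ∈ Finset.range (n + 1), (-1 : ℝ) ^ w * ‖ktrans n f w‖ ^ 2 := by
    rw [← Finset.sum_add_distrib, Finset.mul_sum, Finset.sum_filter]
    refine Finset.sum_congr rfl fun w _ => ?_
    split_ifs with hw
    · rw [hw.neg_one_pow]; ring
    · rw [(Nat.not_even_iff_odd.1 hw).neg_one_pow]; ring
  rw [h2, h', add_zero, sum_norm_ktrans_sq]

/-- A plane wave with phase `θ`, cut off to the window `[A, A + K)`. -/
noncomputable def wave (A K : ℕ) (θ : ℝ) (u : ℕ) : ℂ :=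
  if A ≤ u ∧ u < A + K then Complex.exp (θ * u * Complex.I) else 0

lemma norm_wave_le (A K : ℕ) (θ : ℝ) (u : ℕ) : ‖wave A K θ u‖ ≤ 1 := by
  unfold wave
  split_ifs
  · rw [← Complex.ofReal_natCast, ← Complex.ofReal_mul, Complex.norm_exp_ofReal_mul_I]
  · simp

lemma sum_norm_wave_sq {A K n : ℕ} (θ : ℝ) (h : A + K ≤ n + 1) :
    ∑ u ∈ Finset.range (n + 1), ‖wave A K θ u‖ ^ 2 = K := by
  have h1 : ∀ u, ‖wave A K θ u‖ ^ 2 = if u ∈ Finset.Ico A (A + K) then 1 else 0 := by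
    intro u
    rw [wave]
    simp only [Finset.mem_Ico]
    split_ifs
    · rw [← Complex.ofReal_natCast, ← Complex.ofReal_mul, Complex.norm_exp_ofReal_mul_I, one_pow]
    · simp
  simp only [h1]
  rw [← Finset.sum_filter, Finset.sum_const, Finset.filter_mem_eq_inter,
    Finset.inter_eq_right.2 (by intro u; simp only [Finset.mem_Ico, Finset.mem_range]; omega)]
  simp

/-- The wave is an approximate eigenvector of the Jacobi matrix. -/
lemma sum_norm_jacobi_wave_sq_le {n A K : ℕ} {θ : ℝ} (hA : 1 ≤ A) (hn : A + K < n) :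
    ∑ u ∈ Finset.range (n + 1), ‖kcoef n u * wave A K θ (u - 1) +
      kcoef n (u + 1) * wave A K θ (u + 1) -
      ((2 * kcoef n A * Real.cos θ : ℝ) : ℂ) * wave A K θ u‖ ^ 2 ≤
      64 * ((n : ℝ) + 1) ^ 2 + 4 * K ^ 2 * (n + 1) := by
  have key : ∀ u ∈ Finset.range (n + 1), ‖kcoef n u * wave A K θ (u - 1) +
      kcoef n (u + 1) * wave A K θ (u + 1) -
      ((2 * kcoef n A * Real.cos θ : ℝ) : ℂ) * wave A K θ u‖ ^ 2 ≤
      -- At these four points the truncation may be felt, and only the trivial bound 4 (n + 1) is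
      -- used. In the interior of the window the plane wave would be an exact eigenvector if `kcoef`
      -- were constant, and `kcoef` varies by at most √(K (n + 1)).
      (if u ∈ ({A - 1, A, A + K - 1, A + K} : Finset ℕ) then 16 * ((n : ℝ) + 1) ^ 2 else 0) +
      (if u ∈ Finset.Ico A (A + K) then 4 * (K : ℝ) * (n + 1) else 0) := by
    intro u hu
    rw [Finset.mem_range] at hu
    by_cases hb : u ∈ ({A - 1, A, A + K - 1, A + K} : Finset ℕ)
    · rw [if_pos hb]
      have p0 : (0 : ℝ) ≤ if u ∈ Finset.Ico A (A + K) then 4 * (K : ℝ) * (n + 1) else 0 := by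
        split_ifs <;> positivity
      refine le_add_of_le_of_nonneg ?_ p0
      rw [show 16 * ((n : ℝ) + 1) ^ 2 = (4 * (n + 1)) ^ 2 by ring]
      gcongr
      have q1 : ‖(kcoef n u : ℂ) * wave A K θ (u - 1)‖ ≤ n + 1 := by
        rw [norm_mul, Complex.norm_real, Real.norm_of_nonneg (kcoef_nonneg _ _)]
        exact (mul_le_of_le_one_right (kcoef_nonneg _ _) (norm_wave_le _ _ _ _)).trans
          (kcoef_le (by omega))
      have q2 : ‖(kcoef n (u + 1) : ℂ) * wave A K θ (u + 1)‖ ≤ n + 1 := by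
        rw [norm_mul, Complex.norm_real, Real.norm_of_nonneg (kcoef_nonneg _ _)]
        exact (mul_le_of_le_one_right (kcoef_nonneg _ _) (norm_wave_le _ _ _ _)).trans
          (kcoef_le (by omega))
      have q3 : ‖((2 * kcoef n A * Real.cos θ : ℝ) : ℂ) * wave A K θ u‖ ≤ 2 * (n + 1) := by
        rw [norm_mul, Complex.norm_real]
        refine (mul_le_of_le_one_right (norm_nonneg _) (norm_wave_le _ _ _ _)).trans ?_
        rw [norm_mul, norm_mul, Real.norm_of_nonneg (kcoef_nonneg _ _), Real.norm_eq_abs,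
          Real.norm_eq_abs]
        refine (mul_le_of_le_one_right (by have := kcoef_nonneg n A; positivity)
          (Real.abs_cos_le_one θ)).trans ?_
        rw [abs_two]
        have := kcoef_le (by omega : A ≤ n + 1)
        linarith
      refine (norm_sub_le _ _).trans ?_
      have := norm_add_le ((kcoef n u : ℂ) * wave A K θ (u - 1))
        (kcoef n (u + 1) * wave A K θ (u + 1))
      linarith
    · rw [if_neg hb, zero_add]
      simp only [Finset.mem_insert, Finset.mem_singleton, not_or] at hb
      by_cases hi : u ∈ Finset.Ico A (A + K)
      · rw [if_pos hi]
        rw [Finset.mem_Ico] at hi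
        have w0 : wave A K θ u = Complex.exp (θ * u * Complex.I) := by
          rw [wave, if_pos (by omega)]
        have w1 : wave A K θ (u - 1) =
            Complex.exp (θ * u * Complex.I) * Complex.exp (-(θ * Complex.I)) := by
          rw [wave, if_pos (by omega), ← Complex.exp_add, Nat.cast_sub (by omega)]
          congr 1; push_cast; ring
        have w2 : wave A K θ (u + 1) =
            Complex.exp (θ * u * Complex.I) * Complex.exp (θ * Complex.I) := by
          rw [wave, if_pos (by omega), ← Complex.exp_add]
          congr 1; push_cast; ring
        have hcos : ((2 * kcoef n A * Real.cos θ : ℝ) : ℂ) = kcoef n A *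
            (Complex.exp (θ * Complex.I) + Complex.exp (-(θ * Complex.I))) := by
          push_cast
          rw [Complex.cos]
          ring_nf
        have e : kcoef n u * wave A K θ (u - 1) + kcoef n (u + 1) * wave A K θ (u + 1) -
            ((2 * kcoef n A * Real.cos θ : ℝ) : ℂ) * wave A K θ u =
            Complex.exp (θ * u * Complex.I) *
            (((kcoef n u - kcoef n A : ℝ) : ℂ) * Complex.exp (-(θ * Complex.I)) +
            ((kcoef n (u + 1) - kcoef n A : ℝ) : ℂ) * Complex.exp (θ * Complex.I)) := by
          rw [w0, w1, w2, hcos]; push_cast; ring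
        have n1 : ‖Complex.exp (θ * u * Complex.I)‖ = 1 := by
          rw [← Complex.ofReal_natCast, ← Complex.ofReal_mul, Complex.norm_exp_ofReal_mul_I]
        have n2 : ‖Complex.exp (-(θ * Complex.I))‖ = 1 := by
          rw [← neg_mul, ← Complex.ofReal_neg, Complex.norm_exp_ofReal_mul_I]
        have b1 := abs_kcoef_sub_le (n := n) (A := A) (u := u) (K := K) (by omega) (by omega)
          (by omega)
        have b2 := abs_kcoef_sub_le (n := n) (A := A) (u := u + 1) (K := K) (by omega) (by omega)
          (by omega)
        have s1 := Real.sq_sqrt (by positivity : (0 : ℝ) ≤ K * (n + 1))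
        rw [show 4 * (K : ℝ) * (n + 1) = (2 * √(K * (n + 1))) ^ 2 by rw [mul_pow, s1]; ring]
        gcongr
        rw [e, norm_mul, n1, one_mul]
        refine (norm_add_le _ _).trans ?_
        rw [norm_mul, norm_mul, n2, Complex.norm_exp_ofReal_mul_I, Complex.norm_real,
          Complex.norm_real, Real.norm_eq_abs, Real.norm_eq_abs]
        linarith
      · rw [if_neg hi]
        rw [Finset.mem_Ico] at hi
        have w0 : wave A K θ u = 0 := by rw [wave, if_neg (by omega)]
        have w1 : wave A K θ (u - 1) = 0 := by rw [wave, if_neg (by omega)]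
        have w2 : wave A K θ (u + 1) = 0 := by rw [wave, if_neg (by omega)]
        rw [w0, w1, w2]; simp
  refine (Finset.sum_le_sum key).trans ?_
  rw [Finset.sum_add_distrib, ← Finset.sum_filter, ← Finset.sum_filter, Finset.sum_const,
    Finset.sum_const]
  have c1 : ((Finset.range (n + 1)).filter (· ∈ ({A - 1, A, A + K - 1, A + K} : Finset ℕ))).card
      ≤ 4 := by
    refine (Finset.card_le_card (t := {A - 1, A, A + K - 1, A + K}) ?_).trans Finset.card_le_four
    intro u hu; exact (Finset.mem_filter.1 hu).2
  have c2 : ((Finset.range (n + 1)).filter (· ∈ Finset.Ico A (A + K))).card ≤ K := by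
    refine (Finset.card_le_card (t := Finset.Ico A (A + K)) ?_).trans (by simp)
    intro u hu; exact (Finset.mem_filter.1 hu).2
  rw [nsmul_eq_mul, nsmul_eq_mul]
  have c1' : (((Finset.range (n + 1)).filter
    (· ∈ ({A - 1, A, A + K - 1, A + K} : Finset ℕ))).card : ℝ) ≤ 4 := by exact_mod_cast c1
  have c2' : (((Finset.range (n + 1)).filter (· ∈ Finset.Ico A (A + K))).card : ℝ) ≤ K := by
    exact_mod_cast c2
  refine (add_le_add (mul_le_mul_of_nonneg_right c1' (by positivity))
    (mul_le_mul_of_nonneg_right c2' (by positivity))).trans (le_of_eq (by ring))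

/-- A large value of a Krawtchouk function close to a prescribed place. -/
lemma exists_kfun_sq_ge {n A K : ℕ} {θ κ : ℝ} (hA : 1 ≤ A) (hK : 0 < K) (hn : 2 * (A + K) ≤ n)
    (hκ : 0 < κ) (hres : 4 * (64 * ((n : ℝ) + 1) ^ 2 + 4 * K ^ 2 * (n + 1)) ≤ K * κ ^ 2) :
    ∃ u w : ℕ, A ≤ u ∧ u < A + K ∧ w ≤ n ∧ Even w ∧
      |(n : ℝ) - 2 * w - 2 * kcoef n A * Real.cos θ| < κ ∧
      1 ≤ 4 * ((n : ℝ) + 1) ^ 2 * kfun n w u ^ 2 := by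
  set b : ℝ := 2 * kcoef n A * Real.cos θ with hb
  set f := wave A K θ with hf
  have hK' : (0 : ℝ) < K := by exact_mod_cast hK
  have hmass := sum_even_norm_ktrans_sq n f (fun u hu => by
    rw [hf, wave, if_neg (by omega)])
  rw [sum_norm_wave_sq θ (by omega)] at hmass
  have hjac := sum_norm_jacobi_wave_sq_le (n := n) (K := K) (θ := θ) hA (by omega)
  rw [← sum_norm_ktrans_sq, ← hb, ← hf] at hjac
  simp only [ktrans_jacobi, norm_mul, Complex.norm_real, mul_pow, Real.norm_eq_abs, sq_abs] at hjac
  set E := (Finset.range (n + 1)).filter Even with hE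
  set near := E.filter fun w : ℕ => |(n : ℝ) - 2 * w - b| < κ with hnear
  -- Chebyshev's inequality: by `hres` the residual allows at most K/4 of mass away from b. The even
  -- degrees carry K/2, so at least K/4 remains on even degrees near b.
  have hfar : ∑ w ∈ E.filter (fun w : ℕ => ¬ |(n : ℝ) - 2 * w - b| < κ), ‖ktrans n f w‖ ^ 2 ≤ K / 4 := by
    have h1 : κ ^ 2 * ∑ w ∈ E.filter (fun w : ℕ => ¬ |(n : ℝ) - 2 * w - b| < κ), ‖ktrans n f w‖ ^ 2 ≤
        ∑ w ∈ Finset.range (n + 1), ((n : ℝ) - 2 * w - b) ^ 2 * ‖ktrans n f w‖ ^ 2 := by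
      rw [Finset.mul_sum]
      refine (Finset.sum_le_sum (g := fun w : ℕ =>
        ((n : ℝ) - 2 * w - b) ^ 2 * ‖ktrans n f w‖ ^ 2) fun w hw => ?_).trans
        (Finset.sum_le_sum_of_subset_of_nonneg ?_ fun w _ _ => by positivity)
      · have := (Finset.mem_filter.1 hw).2
        rw [not_lt] at this
        refine mul_le_mul_of_nonneg_right ?_ (by positivity)
        rw [← sq_abs ((n : ℝ) - 2 * w - b)]
        gcongr
      · exact (Finset.filter_subset _ _).trans (Finset.filter_subset _ _)
    have h2 : κ ^ 2 * ∑ w ∈ E.filter (fun w : ℕ => ¬ |(n : ℝ) - 2 * w - b| < κ),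
        ‖ktrans n f w‖ ^ 2 ≤ κ ^ 2 * (K / 4) := by
      refine (h1.trans hjac).trans ?_
      linarith
    exact le_of_mul_le_mul_left h2 (by positivity)
  have hsplit := Finset.sum_filter_add_sum_filter_not E
    (fun w : ℕ => |(n : ℝ) - 2 * w - b| < κ) (fun w => ‖ktrans n f w‖ ^ 2)
  have hnearmass : (K : ℝ) / 4 ≤ ∑ w ∈ near, ‖ktrans n f w‖ ^ 2 := by linarith
  obtain ⟨w, hw, hwmass⟩ : ∃ w ∈ near, (K : ℝ) / (4 * (n + 1)) ≤ ‖ktrans n f w‖ ^ 2 := by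
    by_contra! hcon
    have hne : near.Nonempty := by
      rw [Finset.nonempty_iff_ne_empty]
      intro h0; rw [h0] at hnearmass; simp at hnearmass; linarith
    have h3 := Finset.sum_lt_sum_of_nonempty hne hcon
    rw [Finset.sum_const, nsmul_eq_mul] at h3
    have h4 : (near.card : ℝ) ≤ n + 1 := by
      have : near.card ≤ n + 1 :=
        ((Finset.card_filter_le _ _).trans (Finset.card_filter_le _ _)).trans (by simp)
      exact_mod_cast this
    have h5 : (near.card : ℝ) * (K / (4 * (n + 1))) ≤ (n + 1) * (K / (4 * (n + 1))) := by gcongr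
    have h6 : ((n : ℝ) + 1) * (K / (4 * (n + 1))) = K / 4 := by field_simp
    linarith
  rw [hnear, Finset.mem_filter, hE, Finset.mem_filter, Finset.mem_range] at hw
  have htr : ktrans n f w = ∑ u ∈ Finset.Ico A (A + K), f u * kfun n w u := by
    rw [ktrans]
    symm
    refine Finset.sum_subset (by
      intro u; simp only [Finset.mem_Ico, Finset.mem_range]; omega) fun u _ hu => ?_
    rw [Finset.mem_Ico] at hu
    rw [hf, wave, if_neg (by omega), zero_mul]
  -- If all values in the window were small, the transform at w would be below K/(2 (n + 1)) in
  -- modulus, and K < n + 1 contradicts the mass found at w.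
  obtain ⟨u, hu, huval⟩ : ∃ u ∈ Finset.Ico A (A + K), 1 ≤ 4 * ((n : ℝ) + 1) ^ 2 * kfun n w u ^ 2 := by
    by_contra! hcon
    have hb1 : ∀ u ∈ Finset.Ico A (A + K), ‖f u * (kfun n w u : ℂ)‖ ≤ 1 / (2 * (n + 1)) := by
      intro u hu
      have h1 := hcon u hu
      rw [norm_mul, Complex.norm_real]
      refine (mul_le_of_le_one_left (norm_nonneg _) (norm_wave_le _ _ _ _)).trans ?_
      rw [Real.norm_eq_abs]
      refine abs_le_of_sq_le_sq ?_ (by positivity)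
      rw [div_pow, le_div_iff₀ (by positivity)]
      nlinarith
    have h2 : ‖ktrans n f w‖ ≤ K * (1 / (2 * (n + 1))) := by
      rw [htr]
      refine (norm_sum_le _ _).trans ((Finset.sum_le_card_nsmul _ _ _ hb1).trans ?_)
      simp
    have h3 : ‖ktrans n f w‖ ^ 2 ≤ (K * (1 / (2 * (n + 1)))) ^ 2 := by gcongr
    have h4 : (K * (1 / (2 * ((n : ℝ) + 1)))) ^ 2 < K / (4 * (n + 1)) := by
      have : (K : ℝ) < n + 1 := by exact_mod_cast (by omega : K < n + 1)
      rw [mul_pow, div_pow, one_pow, mul_one_div, div_lt_div_iff₀ (by positivity) (by positivity)]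
      have h7 : 0 < (K : ℝ) * (n + 1) := by positivity
      nlinarith
    linarith
  rw [Finset.mem_Ico] at hu
  exact ⟨u, w, hu.1, hu.2, by omega, hw.1.2, hw.2, huval⟩

/-- In the oscillatory regime 1 − 2ω = 2 √(x(1 − x)) cos θ for some θ. A wave of phase θ in a window
of fixed length at about x n therefore concentrates on degrees close to ω n. -/
lemma exists_kfun_near {x ω η : ℝ} (hx0 : 0 < x) (hx : x < 1 / 2)
    (hω : (1 - 2 * ω) ^ 2 ≤ 4 * x * (1 - x)) (hη : 0 < η) :
    ∀ᶠ n : ℕ in atTop, ∃ u w : ℕ, |(u : ℝ) / n - x| < η ∧ |(w : ℝ) / n - ω| < η ∧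
      u ≤ n ∧ w ≤ n ∧ Even w ∧ 1 ≤ 4 * ((n : ℝ) + 1) ^ 2 * kfun n w u ^ 2 := by
  set q := √(x * (1 - x)) with hq
  have hxx : 0 < x * (1 - x) := mul_pos hx0 (by linarith)
  have hq0 : 0 < q := Real.sqrt_pos.2 hxx
  have hq2 : q ^ 2 = x * (1 - x) := Real.sq_sqrt hxx.le
  set t := (1 - 2 * ω) / (2 * q) with ht
  have ht1 : t ^ 2 ≤ 1 := by
    rw [ht, div_pow, div_le_one (by positivity), mul_pow, hq2]; linarith
  have ht2 := abs_le.1 (abs_le_of_sq_le_sq (by linarith : t ^ 2 ≤ 1 ^ 2) zero_le_one)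
  have hcos : Real.cos (Real.arccos t) = t := Real.cos_arccos ht2.1 ht2.2
  -- The residual is at most 1024 n² + 32 K² n and has to be at most K η² n². As K stays fixed while
  -- n grows, any K with K η² > 1024 would do eventually.
  obtain ⟨K, hK⟩ := exists_nat_gt (2048 / η ^ 2 + 1)
  have hKpos : (1 : ℝ) < K := by
    have : 0 < 2048 / η ^ 2 := by positivity
    linarith
  have hK0 : 0 < K := by
    have : (0 : ℝ) < K := by linarith
    exact_mod_cast this
  have hK2 : 2048 < K * η ^ 2 := by
    have : 2048 / η ^ 2 < K := by linarith
    rwa [div_lt_iff₀ (by positivity)] at this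
  set A : ℕ → ℕ := fun n => ⌊x * n⌋₊ with hA
  have hAlim : Tendsto (fun n : ℕ => (A n : ℝ) / n) atTop (𝓝 x) :=
    (tendsto_nat_floor_mul_div_atTop hx0.le).comp tendsto_natCast_atTop_atTop
  have hAinf : Tendsto A atTop atTop :=
    tendsto_nat_floor_atTop.comp (tendsto_natCast_atTop_atTop.const_mul_atTop hx0)
  have hone : Tendsto (fun n : ℕ => (1 : ℝ) / n) atTop (𝓝 0) := tendsto_one_div_atTop_nhds_zero_nat
  have hkc : Tendsto (fun n : ℕ => 2 * kcoef n (A n) * t / n) atTop (𝓝 (1 - 2 * ω)) := by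
    have h1 : Tendsto (fun n : ℕ => √((A n : ℝ) / n * (1 + 1 / n - (A n : ℝ) / n))) atTop
        (𝓝 (√(x * (1 + 0 - x)))) :=
      (hAlim.mul ((hone.const_add 1).sub hAlim)).sqrt
    have h2 := h1.const_mul (2 * t)
    rw [add_zero, ← hq] at h2
    have h3 : 2 * t * q = 1 - 2 * ω := by rw [ht]; field_simp
    rw [h3] at h2
    refine h2.congr' ?_
    filter_upwards [eventually_gt_atTop 0] with n hn
    have hn' : (0 : ℝ) < n := by exact_mod_cast hn
    have : (A n : ℝ) / n * (1 + 1 / n - (A n : ℝ) / n) = (A n * ((n : ℝ) + 1 - A n)) / (n : ℝ) ^ 2 := by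
      field_simp
    rw [this, Real.sqrt_div' _ (by positivity), Real.sqrt_sq hn'.le, kcoef]
    ring
  have hKn : Tendsto (fun n : ℕ => (K : ℝ) / n) atTop (𝓝 0) := tendsto_const_div_atTop_nhds_zero_nat _
  have e1 : ∀ᶠ n : ℕ in atTop, (A n : ℝ) / n + K / n < 1 / 2 := by
    have := hAlim.add hKn
    rw [add_zero] at this
    exact this.eventually_lt_const hx
  have e2 : ∀ᶠ n : ℕ in atTop, |(A n : ℝ) / n - x| < η / 2 := by
    have := Metric.tendsto_nhds.1 hAlim (η / 2) (by positivity)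
    simpa [Real.dist_eq] using this
  have e3 : ∀ᶠ n : ℕ in atTop, (K : ℝ) / n < η / 2 := hKn.eventually_lt_const (by positivity)
  have e4 : ∀ᶠ n : ℕ in atTop, |2 * kcoef n (A n) * t / n - (1 - 2 * ω)| < η := by
    have := Metric.tendsto_nhds.1 hkc η hη
    simpa only [Real.dist_eq] using this
  have e5 : ∀ᶠ n : ℕ in atTop, 32 * (K : ℝ) ^ 2 / n < K * η ^ 2 - 1024 := by
    have : Tendsto (fun n : ℕ => 32 * (K : ℝ) ^ 2 / n) atTop (𝓝 0) :=
      tendsto_const_div_atTop_nhds_zero_nat _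
    exact this.eventually_lt_const (by linarith)
  filter_upwards [e1, e2, e3, e4, e5, eventually_gt_atTop 0, hAinf.eventually_ge_atTop 1]
    with n e1 e2 e3 e4 e5 hn0 hA1
  have hn' : (0 : ℝ) < n := by exact_mod_cast hn0
  have hn1 : (1 : ℝ) ≤ n := by exact_mod_cast hn0
  have hAK : 2 * (A n + K) ≤ n := by
    rw [← add_div, div_lt_iff₀ hn'] at e1
    have : (2 : ℝ) * (A n + K) ≤ n := by linarith
    exact_mod_cast this
  have hres : 4 * (64 * ((n : ℝ) + 1) ^ 2 + 4 * K ^ 2 * (n + 1)) ≤ K * (η * n) ^ 2 := by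
    rw [div_lt_iff₀ hn'] at e5
    have h1 : ((n : ℝ) + 1) ^ 2 ≤ 4 * (n : ℝ) ^ 2 := by nlinarith
    have h2 : 32 * (K : ℝ) ^ 2 * n ≤ (K * η ^ 2 - 1024) * n * n := by
      exact mul_le_mul_of_nonneg_right e5.le hn'.le
    have h3 : 16 * (K : ℝ) ^ 2 * (n + 1) ≤ 32 * (K : ℝ) ^ 2 * n := by
      have : (0 : ℝ) ≤ (K : ℝ) ^ 2 := by positivity
      nlinarith
    nlinarith
  obtain ⟨u, w, h1, h2, h3, h4, h5, h6⟩ :=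
    exists_kfun_sq_ge (θ := Real.arccos t) hA1 hK0 hAK (by positivity : 0 < η * n) hres
  rw [hcos] at h5
  have h1' : (A n : ℝ) ≤ u := by exact_mod_cast h1
  have h2' : (u : ℝ) ≤ A n + K := by exact_mod_cast h2.le
  refine ⟨u, w, ?_, ?_, by omega, h3, h4, h6⟩
  · have a1 : (A n : ℝ) / n ≤ u / n := by gcongr
    have a2 : (u : ℝ) / n ≤ A n / n + K / n := by rw [← add_div]; gcongr
    rw [abs_lt] at e2 ⊢
    constructor <;> linarith
  · have a1 : |1 - 2 * ((w : ℝ) / n) - 2 * kcoef n (A n) * t / n| < η := by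
      have : 1 - 2 * ((w : ℝ) / n) - 2 * kcoef n (A n) * t / n =
          ((n : ℝ) - 2 * w - 2 * kcoef n (A n) * t) / n := by field_simp
      rw [this, abs_div, abs_of_pos hn', div_lt_iff₀ hn']
      exact h5
    rw [abs_lt] at a1 e4 ⊢
    constructor <;> linarith

/-- Diagonal choice of sequences with prescribed ratios. -/
lemma exists_seq_of_forall_near {P : ℕ → ℕ → ℕ → Prop} {x y : ℝ}
    (h : ∀ η > 0, ∀ᶠ n : ℕ in atTop, ∃ u w : ℕ,
      |(u : ℝ) / n - x| < η ∧ |(w : ℝ) / n - y| < η ∧ P n u w) :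
    ∃ U W : ℕ → ℕ, Tendsto (fun n => (U n : ℝ) / n) atTop (𝓝 x) ∧
      Tendsto (fun n => (W n : ℝ) / n) atTop (𝓝 y) ∧ ∀ᶠ n in atTop, P n (U n) (W n) := by
  let d : ℕ → ℕ × ℕ → ℝ := fun n p => max |(p.1 : ℝ) / n - x| |(p.2 : ℝ) / n - y|
  have hd : ∀ n p, 0 ≤ d n p := fun n p => le_max_of_le_left (abs_nonneg _)
  have hex : ∀ n, ∃ p : ℕ × ℕ, (∃ u w, P n u w) → P n p.1 p.2 ∧
      ∀ p' : ℕ × ℕ, P n p'.1 p'.2 → d n p ≤ d n p' + 1 / ((n : ℝ) + 1) := by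
    intro n
    by_cases hP : ∃ u w, P n u w
    · obtain ⟨u, w, huw⟩ := hP
      set S := d n '' {p | P n p.1 p.2} with hS
      have hne : S.Nonempty := ⟨_, (u, w), huw, rfl⟩
      have hbdd : BddBelow S := ⟨0, by rintro _ ⟨p, -, rfl⟩; exact hd n p⟩
      -- For every n a pair is chosen whose distance to (x, y) is within 1/(n + 1) of the infimum;
      -- this one choice serves all η at once.
      obtain ⟨_, ⟨p, hp, rfl⟩, hlt⟩ := exists_lt_of_csInf_lt hne
        (lt_add_of_pos_right (sInf S) (by positivity : (0 : ℝ) < 1 / ((n : ℝ) + 1)))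
      refine ⟨p, fun _ => ⟨hp, fun p' hp' => hlt.le.trans ?_⟩⟩
      gcongr
      exact csInf_le hbdd ⟨p', hp', rfl⟩
    · exact ⟨(0, 0), fun h => absurd h hP⟩
  choose p hp using hex
  have hzero : Tendsto (fun n => d n (p n)) atTop (𝓝 0) := by
    rw [Metric.tendsto_nhds]
    intro ε hε
    have h0 : ∀ᶠ n : ℕ in atTop, 1 / ((n : ℝ) + 1) < ε / 2 :=
      tendsto_one_div_add_atTop_nhds_zero_nat.eventually_lt_const (by positivity)
    filter_upwards [h (ε / 2) (by positivity), h0] with n ⟨u, w, h1, h2, h3⟩ h4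
    have h5 := (hp n ⟨u, w, h3⟩).2 (u, w) h3
    have h6 : d n (u, w) < ε / 2 := max_lt h1 h2
    rw [Real.dist_eq, sub_zero, abs_of_nonneg (hd _ _)]
    linarith
  refine ⟨fun n => (p n).1, fun n => (p n).2, ?_, ?_, ?_⟩
  · rw [tendsto_iff_dist_tendsto_zero]
    exact squeeze_zero (fun _ => dist_nonneg) (fun n => le_max_left _ _) hzero
  · rw [tendsto_iff_dist_tendsto_zero]
    exact squeeze_zero (fun _ => dist_nonneg) (fun n => le_max_right _ _) hzero
  · filter_upwards [h 1 one_pos] with n ⟨u, w, _, _, h3⟩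
    exact (hp n ⟨u, w, h3⟩).1

end oscillatory

/-! ### The exponent of the bias -/

section exponent

/-- The phase function, in natural units. -/
noncomputable def phase (x ω z : ℝ) : ℝ :=
  x * Real.log (1 - z) + (1 - x) * Real.log (1 + z) - ω * Real.log z

/-- The smaller root of `(1 - ω) z² - (1 - 2 x) z + ω`. -/
noncomputable def saddle (x ω : ℝ) : ℝ :=
  (1 - 2 * x - √((1 - 2 * x) ^ 2 - 4 * ω * (1 - ω))) / (2 * (1 - ω))

lemma le_half_sub_sqrt_iff {x ω : ℝ} (hx : x ≤ 1 / 2) :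
    x ≤ 1 / 2 - √(ω * (1 - ω)) ↔ 4 * ω * (1 - ω) ≤ (1 - 2 * x) ^ 2 := by
  rw [show x ≤ 1 / 2 - √(ω * (1 - ω)) ↔ √(ω * (1 - ω)) ≤ (1 - 2 * x) / 2 by
    constructor <;> intro h <;> linarith, Real.sqrt_le_left (by linarith)]
  constructor <;> intro h <;> nlinarith

lemma saddle_eq {x ω : ℝ} (hω1 : ω < 1) (hD : 4 * ω * (1 - ω) ≤ (1 - 2 * x) ^ 2) :
    (1 - ω) * saddle x ω ^ 2 - (1 - 2 * x) * saddle x ω + ω = 0 := by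
  have h1 := Real.sq_sqrt (by linarith : 0 ≤ (1 - 2 * x) ^ 2 - 4 * ω * (1 - ω))
  have h2 : (1 - ω) ≠ 0 := by linarith
  rw [saddle]
  set s := √((1 - 2 * x) ^ 2 - 4 * ω * (1 - ω))
  field_simp
  linear_combination h1

lemma one_sub_two_mul_pos {x ω : ℝ} (hω0 : 0 < ω) (hω1 : ω < 1) (hx : x ≤ 1 / 2)
    (hD : 4 * ω * (1 - ω) ≤ (1 - 2 * x) ^ 2) : 0 < 1 - 2 * x := by
  have h1 : 0 < ω * (1 - ω) := mul_pos hω0 (by linarith)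
  rcases (by linarith : 0 ≤ 1 - 2 * x).eq_or_lt with h | h
  · rw [← h] at hD; nlinarith
  · exact h

lemma saddle_pos {x ω : ℝ} (hω0 : 0 < ω) (hω1 : ω < 1) (hx : x < 1 / 2) : 0 < saddle x ω := by
  rw [saddle]
  refine div_pos ?_ (by linarith)
  have := (Real.sqrt_lt' (by linarith : 0 < 1 - 2 * x)).2
    (by nlinarith : (1 - 2 * x) ^ 2 - 4 * ω * (1 - ω) < (1 - 2 * x) ^ 2)
  linarith

/-- The two roots have product ω/(1 − ω), so the smaller one is at most their geometric mean. -/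
lemma mul_saddle_sq_le {x ω : ℝ} (hω0 : 0 < ω) (hω1 : ω < 1) (hx : x ≤ 1 / 2)
    (hD : 4 * ω * (1 - ω) ≤ (1 - 2 * x) ^ 2) : (1 - ω) * saddle x ω ^ 2 ≤ ω := by
  have h1 := saddle_eq hω1 hD
  have h2 := saddle_pos (x := x) hω0 hω1 (by linarith [one_sub_two_mul_pos hω0 hω1 hx hD])
  have h3 : 2 * (1 - ω) * saddle x ω ≤ 1 - 2 * x := by
    rw [saddle, mul_div_cancel₀ _ (by linarith)]
    linarith [Real.sqrt_nonneg ((1 - 2 * x) ^ 2 - 4 * ω * (1 - ω))]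
  nlinarith

lemma mul_saddle_sq_lt {x ω : ℝ} (hω0 : 0 < ω) (hω1 : ω < 1) (hx : x ≤ 1 / 2)
    (hD : 4 * ω * (1 - ω) < (1 - 2 * x) ^ 2) : (1 - ω) * saddle x ω ^ 2 < ω := by
  have h1 := saddle_eq hω1 hD.le
  have h2 := saddle_pos (x := x) hω0 hω1 (by linarith [one_sub_two_mul_pos hω0 hω1 hx hD.le])
  have h3 : 2 * (1 - ω) * saddle x ω < 1 - 2 * x := by
    rw [saddle, mul_div_cancel₀ _ (by linarith)]
    linarith [Real.sqrt_pos.2 (by linarith : 0 < (1 - 2 * x) ^ 2 - 4 * ω * (1 - ω))]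
  nlinarith

lemma saddle_lt_one {x ω : ℝ} (hω0 : 0 < ω) (hω1 : ω < 1 / 2) (hx : x ≤ 1 / 2)
    (hD : 4 * ω * (1 - ω) ≤ (1 - 2 * x) ^ 2) : saddle x ω < 1 := by
  have h1 := mul_saddle_sq_le hω0 (by linarith) hx hD
  by_contra! h
  nlinarith

lemma saddle_mono {x x' ω : ℝ} (hω1 : ω < 1) (hxx' : x ≤ x') (hx' : x' ≤ 1 / 2)
    (hD : 4 * ω * (1 - ω) ≤ (1 - 2 * x') ^ 2) (hω0 : 0 < ω) : saddle x ω ≤ saddle x' ω := by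
  have hy' := one_sub_two_mul_pos hω0 hω1 hx' hD
  unfold saddle
  have h2 : 0 < 2 * (1 - ω) := by linarith
  refine div_le_div_of_nonneg_right ?_ h2.le
  set k := 4 * ω * (1 - ω) with hk
  have hk0 : 0 ≤ k := by rw [hk]; nlinarith
  set y := 1 - 2 * x with hy
  set y' := 1 - 2 * x' with hy'
  have hyy : y' ≤ y := by rw [hy, hy']; linarith
  have s1 := Real.sq_sqrt (by nlinarith : 0 ≤ y ^ 2 - k)
  have s2 := Real.sq_sqrt (by linarith : 0 ≤ y' ^ 2 - k)
  have p1 := Real.sqrt_nonneg (y ^ 2 - k)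
  have p2 := Real.sqrt_nonneg (y' ^ 2 - k)
  have p3 : √(y ^ 2 - k) ≤ y := (Real.sqrt_le_left (by linarith)).2 (by linarith)
  have p4 : √(y' ^ 2 - k) ≤ y' := (Real.sqrt_le_left (by linarith)).2 (by linarith)
  have p5 : √(y' ^ 2 - k) ≤ √(y ^ 2 - k) := Real.sqrt_le_sqrt (by nlinarith)
  nlinarith

/-- The derivative has the sign opposite to that of the quadratic which defines `saddle`, so the
saddle is a critical point of the phase. -/
lemma hasDerivAt_phase {x ω z : ℝ} (hz0 : 0 < z) (hz1 : z < 1) :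
    HasDerivAt (phase x ω) (-((1 - ω) * z ^ 2 - (1 - 2 * x) * z + ω) / (z * (1 - z ^ 2))) z := by
  have h1 : HasDerivAt (fun z : ℝ => Real.log (1 - z)) (-1 / (1 - z)) z :=
    ((hasDerivAt_id z).const_sub 1).log (by simp only [id]; linarith)
  have h2 : HasDerivAt (fun z : ℝ => Real.log (1 + z)) (1 / (1 + z)) z :=
    ((hasDerivAt_id z).const_add 1).log (by simp only [id]; linarith)
  have h3 := Real.hasDerivAt_log hz0.ne'
  refine (((h1.const_mul x).add (h2.const_mul (1 - x))).sub (h3.const_mul ω)).congr_deriv ?_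
  have q1 : 1 - z ≠ 0 := by linarith
  have q2 : 1 + z ≠ 0 := by linarith
  have q3 : 1 - z ^ 2 ≠ 0 := by nlinarith
  field_simp
  ring

/-- The factorisation of the quadratic with roots s and ω/((1 − ω) s), cleared of denominators. -/
lemma quad_eq {x ω z s : ℝ} (hs : (1 - ω) * s ^ 2 - (1 - 2 * x) * s + ω = 0) :
    s * ((1 - ω) * z ^ 2 - (1 - 2 * x) * z + ω) = (z - s) * ((1 - ω) * z * s - ω) := by
  linear_combination z * hs

/-- Left of the saddle point the phase decreases. -/
lemma phase_saddle_le_of_le {x ω z : ℝ} (hω0 : 0 < ω) (hω1 : ω < 1 / 2) (hx : x ≤ 1 / 2)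
    (hD : 4 * ω * (1 - ω) ≤ (1 - 2 * x) ^ 2) (hz0 : 0 < z) (hz : z ≤ saddle x ω) :
    phase x ω (saddle x ω) ≤ phase x ω z := by
  have hs1 := saddle_lt_one hω0 hω1 hx hD
  have hs := saddle_eq (by linarith) hD
  have hs2 := mul_saddle_sq_le hω0 (by linarith) hx hD
  set s := saddle x ω with hsd
  have hanti : AntitoneOn (phase x ω) (Set.Icc z s) := by
    refine antitoneOn_of_deriv_nonpos (convex_Icc _ _) (fun y hy => ?_) (fun y hy => ?_)
      (fun y hy => ?_)
    · exact (hasDerivAt_phase (by linarith [hy.1]) (by linarith [hy.2])).continuousAt.continuousWithinAt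
    · rw [interior_Icc] at hy
      exact (hasDerivAt_phase (by linarith [hy.1]) (by linarith
        [hy.2])).differentiableAt.differentiableWithinAt
    · rw [interior_Icc] at hy
      have y0 : 0 < y := by linarith [hy.1]
      rw [(hasDerivAt_phase y0 (by linarith [hy.2])).deriv]
      refine div_nonpos_of_nonpos_of_nonneg ?_ (mul_nonneg y0.le (by nlinarith [hy.2]))
      have h1 := quad_eq (z := y) hs
      have h2 : 0 ≤ (y - s) * ((1 - ω) * y * s - ω) := by
        refine mul_nonneg_of_nonpos_of_nonpos (by linarith [hy.2]) ?_
        have : (1 - ω) * y * s ≤ (1 - ω) * s * s :=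
          mul_le_mul_of_nonneg_right (mul_le_mul_of_nonneg_left hy.2.le (by linarith))
            (by linarith [hy.2])
        nlinarith
      rw [← h1] at h2
      have := nonneg_of_mul_nonneg_right h2 (by linarith [hy.2] : 0 < s)
      linarith
  exact hanti ⟨le_refl z, hz⟩ ⟨hz, le_refl s⟩ hz

/-- Right of the saddle point, up to the geometric mean of the two roots, the phase increases. -/
lemma phase_saddle_le_of_ge {x ω z : ℝ} (hω0 : 0 < ω) (hω1 : ω < 1 / 2) (hx : x ≤ 1 / 2)
    (hD : 4 * ω * (1 - ω) ≤ (1 - 2 * x) ^ 2) (hz : saddle x ω ≤ z) (hz2 : (1 - ω) * z ^ 2 ≤ ω) :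
    phase x ω (saddle x ω) ≤ phase x ω z := by
  have hs := saddle_eq (by linarith) hD
  have hs0 := saddle_pos (x := x) hω0 (by linarith)
    (by linarith [one_sub_two_mul_pos hω0 (by linarith) hx hD])
  set s := saddle x ω with hsd
  have hz1 : z < 1 := by by_contra! h; nlinarith
  have hmono : MonotoneOn (phase x ω) (Set.Icc s z) := by
    refine monotoneOn_of_deriv_nonneg (convex_Icc _ _) (fun y hy => ?_) (fun y hy => ?_)
      (fun y hy => ?_)
    · exact (hasDerivAt_phase (by linarith [hy.1]) (by linarith [hy.2])).continuousAt.continuousWithinAt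
    · rw [interior_Icc] at hy
      exact (hasDerivAt_phase (by linarith [hy.1]) (by linarith
        [hy.2])).differentiableAt.differentiableWithinAt
    · rw [interior_Icc] at hy
      have y0 : 0 < y := by linarith [hy.1]
      rw [(hasDerivAt_phase y0 (by linarith [hy.2])).deriv]
      refine div_nonneg ?_ (mul_nonneg y0.le (by nlinarith [hy.2]))
      have h1 := quad_eq (z := y) hs
      have h2 : (y - s) * ((1 - ω) * y * s - ω) ≤ 0 := by
        refine mul_nonpos_of_nonneg_of_nonpos (by linarith [hy.1]) ?_
        have : (1 - ω) * y * s ≤ (1 - ω) * z * z := by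
          have : 0 < 1 - ω := by linarith
          have a1 := hy.1
          have a2 := hy.2
          have a3 : 0 < z := by linarith
          gcongr
        nlinarith
      rw [← h1] at h2
      have := nonpos_of_mul_nonpos_right h2 hs0
      linarith
  exact hmono ⟨le_refl s, hz⟩ ⟨hz, le_refl z⟩ hz

lemma h_eq_log (ω : ℝ) :
    h ω = (-(ω * Real.log ω) - (1 - ω) * Real.log (1 - ω)) / Real.log 2 := by
  rw [h, Real.binEntropy_eq_negMulLog_add_negMulLog_one_sub, Real.negMulLog, Real.negMulLog]
  ring

lemma biasExponentCore_eq (x ω : ℝ) : biasExponentCore x ω =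
    if x ≤ 1 / 2 - √(ω * (1 - ω)) then 2 * (phase x ω (saddle x ω) / Real.log 2 - h ω)
    else 1 - h x - h ω := by
  have : biasExponentCore x ω = if x ≤ 1 / 2 - √(ω * (1 - ω)) then
      2 * (x * Real.logb 2 (1 - saddle x ω) + (1 - x) * Real.logb 2 (1 + saddle x ω) -
        ω * Real.logb 2 (saddle x ω) - h ω) else 1 - h x - h ω := rfl
  rw [this]
  split_ifs
  · simp only [Real.logb, phase]; ring
  · rfl

/-- At the geometric mean of the roots the phase is, up to normalization, the tangent of the
entropy at `1/2 - √(ω(1-ω))`. -/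
lemma phase_sqrt {x ω : ℝ} (hω0 : 0 < ω) (hω1 : ω < 1 / 2) :
    2 * (phase x ω (√(ω * (1 - ω)) / (1 - ω)) / Real.log 2 - h ω) =
      1 - (-(x * Real.logb 2 (1 / 2 - √(ω * (1 - ω)))) -
        (1 - x) * Real.logb 2 (1 - (1 / 2 - √(ω * (1 - ω))))) - h ω := by
  have h1 : 0 < 1 - ω := by linarith
  have hp : 0 < ω * (1 - ω) := by positivity
  set s := √(ω * (1 - ω)) with hs
  have hs0 : 0 < s := Real.sqrt_pos.2 hp
  have hs2 : s ^ 2 = ω * (1 - ω) := Real.sq_sqrt hp.le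
  have hs3 : s < 1 - ω := by nlinarith
  have hs4 : s < 1 / 2 := by nlinarith [sq_nonneg (1 - 2 * ω)]
  have e1 : 1 / 2 - s = (1 - s / (1 - ω)) ^ 2 * (1 - ω) / 2 := by
    field_simp
    linear_combination -hs2
  have e2 : 1 - (1 / 2 - s) = (1 + s / (1 - ω)) ^ 2 * (1 - ω) / 2 := by
    field_simp
    linear_combination -hs2
  have p1 : 1 - s / (1 - ω) ≠ 0 := by
    have : s / (1 - ω) < 1 := (div_lt_one h1).2 hs3
    linarith
  have p2 : 1 + s / (1 - ω) ≠ 0 := by positivity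
  rw [e2, e1, Real.logb, Real.logb, Real.log_div (by positivity) two_ne_zero,
    Real.log_div (by positivity) two_ne_zero, Real.log_mul (by positivity) h1.ne',
    Real.log_mul (by positivity) h1.ne', Real.log_pow, Real.log_pow, phase,
    Real.log_div hs0.ne' h1.ne', hs, Real.log_sqrt hp.le, Real.log_mul hω0.ne' h1.ne', h_eq_log]
  have := log_two_pos.ne'
  field_simp
  push_cast
  ring

lemma saddle_le_sqrt {x ω : ℝ} (hω0 : 0 < ω) (hω1 : ω < 1) (hx : x ≤ 1 / 2)
    (hD : 4 * ω * (1 - ω) ≤ (1 - 2 * x) ^ 2) : saddle x ω ≤ √(ω * (1 - ω)) / (1 - ω) := by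
  have h1 := mul_saddle_sq_le hω0 hω1 hx hD
  have h2 : 0 < 1 - ω := by linarith
  rw [le_div_iff₀ h2]
  refine Real.le_sqrt_of_sq_le ?_
  nlinarith

lemma biasExponentCore_half {x : ℝ} (hx0 : 0 ≤ x) : biasExponentCore x (1 / 2) = -h x := by
  have hs : √((1 / 2 : ℝ) * (1 - 1 / 2)) = 1 / 2 := by
    rw [show (1 / 2 : ℝ) * (1 - 1 / 2) = (1 / 2) ^ 2 by norm_num, Real.sqrt_sq (by norm_num)]
  rw [biasExponentCore_eq, hs]
  split_ifs with hc
  · have : x = 0 := by linarith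
    subst this
    have h0 : saddle 0 (1 / 2) = 1 := by rw [saddle]; norm_num
    rw [h0, phase, h_half, h_zero]
    have := log_two_pos.ne'
    norm_num
  · rw [h_half]; ring

lemma biasExponent_half {x : ℝ} (hx0 : 0 ≤ x) (hx1 : x ≤ 1) : biasExponent x (1 / 2) = -h x := by
  rw [biasExponent, show min (1 / 2 : ℝ) (1 - 1 / 2) = 1 / 2 by norm_num,
    biasExponentCore_half (le_min hx0 (by linarith))]
  rcases min_choice x (1 - x) with h | h <;> rw [h]
  rw [h_one_sub]

/-- In the exponential regime the phase at the saddle is at most its value at the geometric mean of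
the roots. That value corresponds to a tangent of h, which lies above h by concavity. -/
lemma biasExponentCore_le {x ω : ℝ} (hx0 : 0 ≤ x) (hx : x ≤ 1 / 2) (hω0 : 0 < ω) (hω : ω ≤ 1 / 2) :
    biasExponentCore x ω ≤ 1 - h x - h ω := by
  rcases hω.eq_or_lt with rfl | hω1
  · rw [biasExponentCore_half hx0, h_half]; linarith
  rw [biasExponentCore_eq]
  split_ifs with hc
  · rw [le_half_sub_sqrt_iff hx] at hc
    have h1 : 0 < 1 - ω := by linarith
    have hp : 0 < ω * (1 - ω) := by positivity
    have hs2 := Real.sq_sqrt hp.le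
    have h2 := phase_saddle_le_of_ge hω0 hω1 hx hc (saddle_le_sqrt hω0 (by linarith) hx hc)
      (by rw [div_pow, hs2]; field_simp; rfl)
    have h3 := phase_sqrt (x := x) hω0 hω1
    have hs4 : √(ω * (1 - ω)) < 1 / 2 := by
      nlinarith [sq_nonneg (1 - 2 * ω), Real.sqrt_nonneg (ω * (1 - ω)), mul_pos (by linarith : 0 < 1 - 2 * ω) (by linarith : 0 < 1 - 2 * ω)]
    have h4 := h_le_tangent hx0 (by linarith) (by linarith : 0 < 1 / 2 - √(ω * (1 - ω)))
      (by linarith [Real.sqrt_nonneg (ω * (1 - ω))])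
    have h5 := div_le_div_of_nonneg_right h2 log_two_pos.le
    linarith
  · exact le_rfl

lemma biasExponent_le {x ω : ℝ} (hx0 : 0 ≤ x) (hx1 : x ≤ 1) (hω0 : 0 < ω) (hω1 : ω < 1) :
    biasExponent x ω ≤ 1 - h x - h ω := by
  have h1 := biasExponentCore_le (x := min x (1 - x)) (ω := min ω (1 - ω))
    (le_min hx0 (by linarith)) (by rcases le_total x (1 - x) with h | h <;> simp [h] <;> linarith)
    (lt_min hω0 (by linarith)) (by rcases le_total ω (1 - ω) with h | h <;> simp [h] <;> linarith)
  have h2 : h (min x (1 - x)) = h x := by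
    rcases min_choice x (1 - x) with h | h <;> rw [h]; rw [h_one_sub]
  have h3 : h (min ω (1 - ω)) = h ω := by
    rcases min_choice ω (1 - ω) with h | h <;> rw [h]; rw [h_one_sub]
  rw [h2, h3] at h1
  exact h1

/-- The two branches of the exponent agree at the common end point. -/
lemma phase_saddle_eq {x ω : ℝ} (hω0 : 0 < ω) (hω : ω < 1 / 2)
    (hx : x = 1 / 2 - √(ω * (1 - ω))) :
    2 * (phase x ω (saddle x ω) / Real.log 2 - h ω) = 1 - h x - h ω := by
  have h1 : 0 < 1 - ω := by linarith
  have hp : 0 < ω * (1 - ω) := by positivity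
  have hs2 := Real.sq_sqrt hp.le
  have e : saddle x ω = √(ω * (1 - ω)) / (1 - ω) := by
    rw [saddle, hx]
    have : (1 - 2 * (1 / 2 - √(ω * (1 - ω)))) ^ 2 - 4 * ω * (1 - ω) = 0 := by
      linear_combination 4 * hs2
    rw [this, Real.sqrt_zero]
    field_simp
    ring
  rw [e, phase_sqrt hω0 hω, ← hx, h_eq_log x, Real.logb, Real.logb]
  ring

/-- In the oscillatory regime, end point included, the exponent is given by the entropies. -/
lemma biasExponent_of_osc {x ω : ℝ} (hx0 : 0 ≤ x) (hx : x ≤ 1 / 2) (hω0 : 0 < ω) (hω1 : ω < 1)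
    (hD : (1 - 2 * x) ^ 2 ≤ 4 * ω * (1 - ω)) : biasExponent x ω = 1 - h x - h ω := by
  have hm : min x (1 - x) = x := min_eq_left (by linarith)
  have h3 : h (min ω (1 - ω)) = h ω := by
    rcases min_choice ω (1 - ω) with h | h <;> rw [h]; rw [h_one_sub]
  have h4 : 4 * min ω (1 - ω) * (1 - min ω (1 - ω)) = 4 * ω * (1 - ω) := by
    rcases min_choice ω (1 - ω) with h | h <;> rw [h]; ring
  rw [biasExponent, hm]
  rw [← h3]
  rw [← h4] at hD
  have hw0 : 0 < min ω (1 - ω) := lt_min hω0 (by linarith)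
  have hw1 : min ω (1 - ω) ≤ 1 / 2 := by rcases le_total ω (1 - ω) with h | h <;> simp [h] <;> linarith
  generalize min ω (1 - ω) = w at *
  rcases hw1.eq_or_lt with rfl | hw2
  · rw [biasExponentCore_half hx0, h_half]; ring
  rw [biasExponentCore_eq]
  split_ifs with hc
  · refine phase_saddle_eq hw0 hw2 (le_antisymm hc ?_)
    have : (1 - 2 * x) / 2 ≤ √(w * (1 - w)) := Real.le_sqrt_of_sq_le (by linarith)
    linarith
  · rfl

lemma biasExponent_of_exp {x ω : ℝ} (hx : x ≤ 1 / 2) (hω1 : ω ≤ 1 / 2)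
    (hD : 4 * ω * (1 - ω) ≤ (1 - 2 * x) ^ 2) :
    biasExponent x ω = 2 * (phase x ω (saddle x ω) / Real.log 2 - h ω) := by
  rw [biasExponent, min_eq_left (by linarith : x ≤ 1 - x), min_eq_left (by linarith : ω ≤ 1 - ω),
    biasExponentCore_eq, if_pos ((le_half_sub_sqrt_iff hx).2 hD)]

lemma biasExponent_one_sub_right (x ω : ℝ) : biasExponent x (1 - ω) = biasExponent x ω := by
  rw [biasExponent, biasExponent, sub_sub_cancel, min_comm (1 - ω)]

lemma continuousAt_saddle {p : ℝ × ℝ} (hω : p.2 ≠ 1) :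
    ContinuousAt (fun p : ℝ × ℝ => saddle p.1 p.2) p := by
  unfold saddle
  refine ContinuousAt.div (by fun_prop) (by fun_prop) ?_
  intro h0
  apply hω
  linarith

lemma continuousAt_phase_saddle {p : ℝ × ℝ} (hω0 : 0 < p.2) (hω1 : p.2 < 1 / 2) (hx : p.1 ≤ 1 / 2)
    (hD : 4 * p.2 * (1 - p.2) ≤ (1 - 2 * p.1) ^ 2) :
    ContinuousAt (fun p : ℝ × ℝ => phase p.1 p.2 (saddle p.1 p.2)) p := by
  have h0 := saddle_pos hω0 (by linarith)
    (by linarith [one_sub_two_mul_pos hω0 (by linarith) hx hD] : p.1 < 1 / 2)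
  have h1 := saddle_lt_one hω0 hω1 hx hD
  have hs := continuousAt_saddle (p := p) (by linarith)
  unfold phase
  refine ContinuousAt.sub (ContinuousAt.add (ContinuousAt.mul (by fun_prop)
    (ContinuousAt.log (by fun_prop) (by linarith))) (ContinuousAt.mul (by fun_prop)
    (ContinuousAt.log (by fun_prop) (by linarith)))) (ContinuousAt.mul (by fun_prop)
    (ContinuousAt.log hs (by linarith)))

lemma continuousOn_biasExponent {ω : ℝ} (hω0 : 0 < ω) (hω1 : ω < 1) :
    ContinuousOn (fun x => biasExponent x ω) (Set.Icc 0 (1 / 2)) := by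
  have hw0 : 0 < min ω (1 - ω) := lt_min hω0 (by linarith)
  have hw1 : min ω (1 - ω) ≤ 1 / 2 := by rcases le_total ω (1 - ω) with h | h <;> simp [h] <;> linarith
  have e : Set.EqOn (fun x => biasExponent x ω) (fun x => biasExponentCore x (min ω (1 - ω)))
      (Set.Icc 0 (1 / 2)) := by
    intro x hx
    simp only [biasExponent]
    rw [min_eq_left (by linarith [hx.2] : x ≤ 1 - x)]
  refine ContinuousOn.congr ?_ e
  clear e
  generalize min ω (1 - ω) = w at *
  rcases hw1.eq_or_lt with rfl | hw2
  · exact continuous_h.neg.continuousOn.congr fun x hx => biasExponentCore_half hx.1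
  set c := 1 / 2 - √(w * (1 - w)) with hc
  have hc2 : c ≤ 1 / 2 := by linarith [Real.sqrt_nonneg (w * (1 - w))]
  -- The two branches agree at c. Freezing each one beyond c with min and max writes the function as
  -- a sum of continuous terms, without a case distinction.
  have e2 : Set.EqOn (fun x => biasExponentCore x w)
      (fun x => 2 * (phase (min x c) w (saddle (min x c) w) / Real.log 2 - h w) +
        (1 - h (max x c) - h w) - (1 - h c - h w)) (Set.Icc 0 (1 / 2)) := by
    intro x hx
    simp only [biasExponentCore_eq]
    split_ifs with hxc
    · rw [min_eq_left hxc, max_eq_right hxc]; ring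
    · rw [not_le] at hxc
      rw [min_eq_right hxc.le, max_eq_left hxc.le, phase_saddle_eq hw0 hw2 hc]; ring
  refine ContinuousOn.congr ?_ e2
  refine ContinuousOn.sub (ContinuousOn.add (ContinuousOn.mul continuousOn_const
    (ContinuousOn.sub (ContinuousOn.div_const ?_ _) continuousOn_const)) ?_) continuousOn_const
  · intro x _
    have hcont := continuousAt_phase_saddle (p := (min x c, w)) hw0 hw2
      ((min_le_right _ _).trans hc2) ((le_half_sub_sqrt_iff ((min_le_right _ _).trans hc2)).1
        (min_le_right _ _))
    have hin : ContinuousAt (fun x : ℝ => ((min x c, w) : ℝ × ℝ)) x := by fun_prop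
    exact (ContinuousAt.comp (f := fun x : ℝ => ((min x c, w) : ℝ × ℝ)) hcont
      hin).continuousWithinAt
  · exact (((continuous_const.sub (continuous_h.comp (by fun_prop))).sub
      continuous_const)).continuousOn

end exponent

/-! ### Asymptotics of the bias -/

section bias

lemma phase_add {x x' ω z : ℝ} (hz0 : 0 < z) (hz1 : z < 1) :
    phase x' ω z = phase x ω z + (x' - x) * Real.log ((1 - z) / (1 + z)) := by
  rw [Real.log_div (by linarith) (by linarith), phase, phase]
  ring

lemma phase_saddle_zero {ω : ℝ} (hω0 : 0 < ω) (hω1 : ω < 1 / 2) :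
    phase 0 ω (saddle 0 ω) = h ω * Real.log 2 := by
  have h1 : 0 < 1 - ω := by linarith
  have e : saddle 0 ω = ω / (1 - ω) := by
    rw [saddle, show (1 - 2 * (0 : ℝ)) ^ 2 - 4 * ω * (1 - ω) = (1 - 2 * ω) ^ 2 by ring,
      Real.sqrt_sq (by linarith)]
    field_simp
    ring
  have e2 : 1 + ω / (1 - ω) = (1 - ω)⁻¹ := by field_simp; ring
  rw [phase, e, e2, Real.log_inv, Real.log_div hω0.ne' h1.ne', h_eq_log]
  have := log_two_pos.ne'
  field_simp
  ring

/-- With z the saddle, the quotient ρ = (1 − z)/(1 + z) solves the characteristic equation of the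
three-term recurrence in u with coefficients frozen at x. It also is the predicted quotient of
consecutive Krawtchouk values. -/
lemma saddle_ratio {x ω : ℝ} (hω0 : 0 < ω) (hω1 : ω < 1) (hx : x ≤ 1 / 2)
    (hD : 4 * ω * (1 - ω) ≤ (1 - 2 * x) ^ 2) :
    (1 - x) * ((1 - saddle x ω) / (1 + saddle x ω)) ^ 2
      - (1 - 2 * ω) * ((1 - saddle x ω) / (1 + saddle x ω)) + x = 0 := by
  have h1 := saddle_eq hω1 hD
  have h2 := saddle_pos (x := x) hω0 hω1 (by linarith [one_sub_two_mul_pos hω0 hω1 hx hD])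
  have h3 : 1 + saddle x ω ≠ 0 := by linarith
  field_simp
  linear_combination 2 * h1

/-- Lower bound for the bias in the exponential regime. -/
lemma exp_phase_le_bias {m w u : ℕ} (hw0 : 0 < w) (hw : 2 * w < m) (hu : 2 * u ≤ m)
    (hD : 4 * ((w : ℝ) / m) * (1 - (w : ℝ) / m) ≤ (1 - 2 * ((u : ℝ) / m)) ^ 2) :
    Real.exp (m * (phase ((u : ℝ) / m) ((w : ℝ) / m) (saddle ((u : ℝ) / m) ((w : ℝ) / m))
      - h ((w : ℝ) / m) * Real.log 2)) ≤ bias m w u := by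
  have hm : (0 : ℝ) < m := by exact_mod_cast (by omega : 0 < m)
  set ω : ℝ := (w : ℝ) / m with hω
  have hω0 : 0 < ω := div_pos (by exact_mod_cast hw0) hm
  have hω1 : ω < 1 / 2 := by
    rw [hω, div_lt_iff₀ hm]
    have : (2 : ℝ) * w < m := by exact_mod_cast hw
    linarith
  have hC : (0 : ℝ) < m.choose w := by exact_mod_cast Nat.choose_pos (by omega)
  have hhalf : ∀ v ≤ u, (v : ℝ) / m ≤ 1 / 2 := by
    intro v hv
    rw [div_le_iff₀ hm]
    have : (2 : ℝ) * v ≤ m := by exact_mod_cast (by omega : 2 * v ≤ m)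
    linarith
  have hDv : ∀ v ≤ u, 4 * ω * (1 - ω) ≤ (1 - 2 * ((v : ℝ) / m)) ^ 2 := by
    intro v hv
    refine hD.trans ?_
    have h1 := hhalf u le_rfl
    have h2 : (v : ℝ) / m ≤ u / m := by gcongr
    have : 0 ≤ 1 - 2 * ((u : ℝ) / m) := by linarith
    gcongr
  set z : ℕ → ℝ := fun v => saddle ((v : ℝ) / m) ω with hz
  set ρ : ℕ → ℝ := fun v => (1 - z v) / (1 + z v) with hρ
  have hz0 : ∀ v ≤ u, 0 < z v := fun v hv => saddle_pos hω0 (by linarith)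
    (by linarith [one_sub_two_mul_pos hω0 (by linarith) (hhalf v hv) (hDv v hv)])
  have hz1 : ∀ v ≤ u, z v < 1 := fun v hv => saddle_lt_one hω0 hω1 (hhalf v hv) (hDv v hv)
  have hρ0 : ∀ v ≤ u, 0 < ρ v := fun v hv =>
    div_pos (by linarith [hz1 v hv]) (by linarith [hz0 v hv])
  have hzmono : ∀ v, v + 1 ≤ u → z v ≤ z (v + 1) := fun v hv =>
    saddle_mono (by linarith) (by gcongr; simp) (hhalf _ hv) (hDv _ hv) hω0
  have hρmono : ∀ v, v + 1 ≤ u → ρ (v + 1) ≤ ρ v := by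
    intro v hv
    have a1 := hzmono v hv
    have a2 := hz0 v (by omega)
    have a3 := hz1 v (by omega)
    simp only [hρ]
    rw [div_le_div_iff₀ (by linarith) (by linarith)]
    nlinarith
  set E : ℕ → ℝ := fun v => m.choose w * Real.exp (m * (phase ((v : ℝ) / m) ω (z v) -
    h ω * Real.log 2)) with hE
  -- The saddle at v lies left of the saddle at v + 1, so the phase at v + 1 evaluated there is an
  -- upper bound; the phase is affine in x with slope log ρ.
  have hEstep : ∀ v, v + 1 ≤ u → E (v + 1) ≤ ρ v * E v := by
    intro v hv
    simp only [hE]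
    rw [← Real.exp_log (hρ0 v (by omega)), mul_left_comm, ← Real.exp_add]
    gcongr
    have a1 := phase_saddle_le_of_le hω0 hω1 (hhalf _ hv) (hDv _ hv) (hz0 v (by omega))
      (hzmono v hv)
    rw [phase_add (x := (v : ℝ) / m) (hz0 v (by omega)) (hz1 v (by omega))] at a1
    have a2 : ((v + 1 : ℕ) : ℝ) / m - (v : ℝ) / m = 1 / m := by push_cast; ring
    rw [a2] at a1
    have a3 := mul_le_mul_of_nonneg_left a1 hm.le
    have a4 : (m : ℝ) * (phase ((v : ℝ) / m) ω (z v) + 1 / m * Real.log ((1 - z v) / (1 + z v))) =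
      m * phase ((v : ℝ) / m) ω (z v) + Real.log ((1 - z v) / (1 + z v)) := by field_simp
    rw [a4] at a3
    simp only [hz, hρ] at a3 ⊢
    linarith
  -- The two statements are proved together. A lower bound ρ v for one quotient is at least ρ (v +
  -- 1), and inserted in the recurrence it gives, by the quadratic equation for ρ (v + 1), the lower
  -- bound ρ (v + 1) for the next quotient. The estimate on values follows with `hEstep`.
  have key : ∀ v ≤ u, E v ≤ krawtchouk m w v ∧
      (v < u → ρ v * krawtchouk m w v ≤ krawtchouk m w (v + 1)) := by
    intro v
    induction v with
    | zero =>
      intro _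
      have b0 : E 0 ≤ krawtchouk m w 0 := by
        simp only [hE, hz]
        rw [Nat.cast_zero, zero_div, phase_saddle_zero hω0 hω1, sub_self, mul_zero, Real.exp_zero,
          mul_one, krawtchouk_zero_right]
        simp
      refine ⟨b0, fun h0 => ?_⟩
      have hr := krawtchouk_recurrence (n := m) (u := 0) w (by omega)
      have hr' : (m : ℝ) * krawtchouk m w 1 = ((m : ℝ) - 2 * w) * krawtchouk m w 0 := by
        have : ((m : ℤ)) * krawtchouk m w 1 = ((m : ℤ) - 2 * w) * krawtchouk m w 0 := by
          simpa using hr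
        exact_mod_cast this
      have hq := saddle_ratio hω0 (by linarith) (hhalf 0 (by omega)) (hDv 0 (by omega))
      have hρ' := hρ0 0 (by omega)
      simp only [Nat.cast_zero, zero_div] at hq
      have hρe : ρ 0 = 1 - 2 * ω := by
        have : ρ 0 = (1 - saddle 0 ω) / (1 + saddle 0 ω) := by simp only [hρ, hz]; simp
        rw [← this] at hq
        have : ρ 0 * (ρ 0 - (1 - 2 * ω)) = 0 := by linear_combination hq
        rcases mul_eq_zero.1 this with h | h <;> linarith
      rw [hρe]
      refine le_of_eq ?_
      rw [zero_add, hω]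
      field_simp
      linarith
    | succ v ih =>
      intro hv
      obtain ⟨i1, i2⟩ := ih (by omega)
      have i2 := i2 (by omega)
      have hKv : 0 < (krawtchouk m w v : ℝ) := lt_of_lt_of_le (by positivity) i1
      have hK1 : 0 < (krawtchouk m w (v + 1) : ℝ) :=
        lt_of_lt_of_le (mul_pos (hρ0 v (by omega)) hKv) i2
      refine ⟨(hEstep v hv).trans ((mul_le_mul_of_nonneg_left i1 (hρ0 v (by omega)).le).trans i2),
        fun hlt => ?_⟩
      have hr := krawtchouk_recurrence (n := m) (u := v + 1) w (by omega)
      rw [Nat.add_sub_cancel] at hr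
      have hr' : ((m : ℝ) - (v + 1 : ℕ)) * krawtchouk m w (v + 1 + 1) =
          ((m : ℝ) - 2 * w) * krawtchouk m w (v + 1) - (v + 1 : ℕ) * krawtchouk m w v := by
        exact_mod_cast hr
      have hq := saddle_ratio hω0 (by linarith) (hhalf _ hv) (hDv _ hv)
      change (1 - ((v + 1 : ℕ) : ℝ) / m) * ρ (v + 1) ^ 2 - (1 - 2 * ω) * ρ (v + 1) +
        ((v + 1 : ℕ) : ℝ) / m = 0 at hq
      have hρv := hρ0 (v + 1) hv
      have hle : ρ (v + 1) * krawtchouk m w v ≤ krawtchouk m w (v + 1) :=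
        (mul_le_mul_of_nonneg_right (hρmono v hv) hKv.le).trans i2
      set x : ℝ := ((v + 1 : ℕ) : ℝ) with hx
      have hxm : x < m := by rw [hx]; exact_mod_cast (by omega : v + 1 < m)
      have hx0 : 0 ≤ x := by positivity
      have hq' : ((m : ℝ) - x) * ρ (v + 1) ^ 2 = (m - 2 * w) * ρ (v + 1) - x := by
        rw [hω] at hq
        field_simp at hq
        linarith
      have hfin : ((m : ℝ) - x) * ρ (v + 1) * (ρ (v + 1) * krawtchouk m w (v + 1)) ≤
          ((m : ℝ) - x) * ρ (v + 1) * krawtchouk m w (v + 1 + 1) := by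
        have e1 : ((m : ℝ) - x) * ρ (v + 1) * (ρ (v + 1) * krawtchouk m w (v + 1)) =
            ((m - 2 * w) * ρ (v + 1) - x) * krawtchouk m w (v + 1) := by
          rw [← hq']; ring
        have e2 : ((m : ℝ) - x) * ρ (v + 1) * krawtchouk m w (v + 1 + 1) = ρ (v + 1) *
            (((m : ℝ) - 2 * w) * krawtchouk m w (v + 1) - x * krawtchouk m w v) := by
          rw [← hr']; ring
        rw [e1, e2]
        have := mul_le_mul_of_nonneg_left hle hx0
        linarith
      exact le_of_mul_le_mul_left hfin (mul_pos (by linarith) hρv)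
  have := (key u le_rfl).1
  rw [bias, le_div_iff₀ hC, mul_comm]
  exact this

lemma bias_sub_left_sq {m w u : ℕ} (hu : u ≤ m) (hw : w ≤ m) :
    bias m (m - w) u ^ 2 = bias m w u ^ 2 := by
  rw [bias, bias, krawtchouk_sub_left hu hw, Nat.choose_symm hw]
  push_cast
  rw [mul_div_assoc, mul_pow, ← pow_mul, mul_comm u 2, pow_mul]
  simp

lemma bias_sq_le {m w u : ℕ} (hu : u ≤ m) (hw : w ≤ m) :
    bias m w u ^ 2 ≤ 2 ^ m * ((m.choose u : ℝ))⁻¹ * ((m.choose w : ℝ))⁻¹ := by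
  have h1 := choose_mul_krawtchouk_sq_le hu hw
  have hcw : (0 : ℝ) < m.choose w := by exact_mod_cast Nat.choose_pos hw
  have hcu : (0 : ℝ) < m.choose u := by exact_mod_cast Nat.choose_pos hu
  rw [bias, div_pow, div_le_iff₀ (by positivity)]
  calc _ = (m.choose u * (krawtchouk m w u : ℝ) ^ 2) * ((m.choose u : ℝ))⁻¹ := by field_simp
    _ ≤ (2 ^ m * m.choose w) * ((m.choose u : ℝ))⁻¹ := by gcongr
    _ = _ := by field_simp

lemma bias_sq_eq_kfun {m w u : ℕ} (hu : u ≤ m) (hw : w ≤ m) :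
    bias m w u ^ 2 = kfun m w u ^ 2 * (2 ^ m * ((m.choose u : ℝ))⁻¹ * ((m.choose w : ℝ))⁻¹) := by
  have hcw : (0 : ℝ) < m.choose w := by exact_mod_cast Nat.choose_pos hw
  have hcu : (0 : ℝ) < m.choose u := by exact_mod_cast Nat.choose_pos hu
  rw [kfun, mul_pow, Real.sq_sqrt (by positivity), bias]
  field_simp

/-- The bias of words of half weight, at even arguments. -/
lemma abs_krawtchouk_half {w v : ℕ} (hv : v ≤ w) :
    |krawtchouk (2 * w) w (2 * v)| * ((2 * w).choose (2 * v) : ℤ) =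
      (2 * w).choose w * w.choose v := by
  induction v with
  | zero => rw [mul_zero, krawtchouk_zero_right]; simp
  | succ v ih =>
    -- At half weight the middle coefficient n − 2 w vanishes, so the recurrence links even
    -- arguments directly and the values have a closed form.
    have hr := krawtchouk_recurrence (n := 2 * w) (u := 2 * v + 1) w (by omega)
    rw [Nat.add_sub_cancel] at hr
    push_cast at hr
    rw [sub_self, zero_mul, zero_sub] at hr
    have hr2 : ((2 * w : ℤ) - (2 * v + 1)) * |krawtchouk (2 * w) w (2 * v + 1 + 1)| =
        (2 * v + 1) * |krawtchouk (2 * w) w (2 * v)| := by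
      have := congrArg abs hr
      rw [abs_neg, abs_mul, abs_mul, abs_of_nonneg (by omega : (0 : ℤ) ≤ 2 * w - (2 * v + 1)),
        abs_of_nonneg (by positivity : (0 : ℤ) ≤ 2 * (v : ℤ) + 1)] at this
      exact this
    have ih := ih (by omega)
    have c1 := Nat.choose_succ_right_eq (2 * w) (2 * v + 1)
    have c2 := Nat.choose_succ_right_eq (2 * w) (2 * v)
    have c3 := Nat.choose_succ_right_eq w v
    zify [show 2 * v + 1 ≤ 2 * w by omega, show 2 * v ≤ 2 * w by omega, show v ≤ w by omega] at c1 c2 c3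
    rw [show 2 * (v + 1) = 2 * v + 1 + 1 by ring]
    have hne : ((2 * w : ℤ) - (2 * v + 1)) * ((2 * v + 1 + 1) * (2 * v + 1)) ≠ 0 := by
      have : (2 * w : ℤ) - (2 * v + 1) ≠ 0 := by omega
      positivity
    refine mul_left_cancel₀ hne ?_
    set K0 := |krawtchouk (2 * w) w (2 * v)|
    set K2 := |krawtchouk (2 * w) w (2 * v + 1 + 1)|
    set A0 := ((2 * w).choose (2 * v) : ℤ)
    set A1 := ((2 * w).choose (2 * v + 1) : ℤ)
    set A2 := ((2 * w).choose (2 * v + 1 + 1) : ℤ)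
    set B := ((2 * w).choose w : ℤ)
    calc ((2 * w : ℤ) - (2 * v + 1)) * ((2 * v + 1 + 1) * (2 * v + 1)) * (K2 * A2) =
        (((2 * w : ℤ) - (2 * v + 1)) * K2) * (A2 * (2 * v + 1 + 1)) * (2 * v + 1) := by ring
      _ = (2 * v + 1) * K0 * (A1 * (2 * w - (2 * v + 1))) * (2 * v + 1) := by rw [hr2, c1]
      _ = (2 * v + 1) * K0 * (2 * w - (2 * v + 1)) * (A1 * (2 * v + 1)) := by ring
      _ = (2 * v + 1) * (2 * w - (2 * v + 1)) * (2 * w - 2 * v) * (K0 * A0) := by rw [c2]; ring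
      _ = (2 * v + 1) * (2 * w - (2 * v + 1)) * 2 * B * (w.choose v * (w - v)) := by rw [ih]; ring
      _ = _ := by rw [← c3]; ring

lemma bias_half_sq {w v : ℕ} (hv : v ≤ w) :
    bias (2 * w) w (2 * v) ^ 2 = (w.choose v : ℝ) * w.choose v *
      (((2 * w).choose (2 * v) : ℝ)⁻¹ * ((2 * w).choose (2 * v) : ℝ)⁻¹) := by
  have h1 := abs_krawtchouk_half hv
  have h2 : |(krawtchouk (2 * w) w (2 * v) : ℝ)| * ((2 * w).choose (2 * v) : ℝ) =
      (2 * w).choose w * w.choose v := by exact_mod_cast h1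
  have hcw : (0 : ℝ) < (2 * w).choose w := by exact_mod_cast Nat.choose_pos (by omega)
  have hcu : (0 : ℝ) < (2 * w).choose (2 * v) := by exact_mod_cast Nat.choose_pos (by omega)
  rw [bias, div_pow, ← sq_abs, eq_div_of_mul_eq hcu.ne' h2]
  field_simp

end bias

/-! ### Growth rate of the bias for families. -/

section bias

lemma tendsto_logb_pow {a : ℝ} {u : ℕ → ℕ} {ν : ℝ}
    (hu : Tendsto (fun n => (u n : ℝ) / n) atTop (𝓝 ν)) :
    Tendsto (fun n => Real.logb 2 (a ^ u n) / n) atTop (𝓝 (ν * Real.logb 2 a)) := by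
  refine (hu.mul_const _).congr fun n => ?_
  rw [Real.logb_pow]; ring

lemma expLE_pow {a : ℝ} (ha : 0 < a) {u : ℕ → ℕ} {ν : ℝ}
    (hu : Tendsto (fun n => (u n : ℝ) / n) atTop (𝓝 ν)) :
    ExpLE (fun n => a ^ u n) (ν * Real.logb 2 a) :=
  expLE_of_tendsto (Eventually.of_forall fun _ => by positivity) (tendsto_logb_pow hu)

/-- The large biases are constructed for every length, whereas the decoder uses length m ~ μ n; the
exponent is rescaled by μ. -/
lemma ExpGE.comp {f : ℕ → ℝ} {a μ : ℝ} {M : ℕ → ℕ} (hf : ExpGE f a) (hμ : 0 < μ)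
    (hM : Tendsto (fun n => (M n : ℝ) / n) atTop (𝓝 μ)) (hM' : Tendsto M atTop atTop) :
    ExpGE (fun n => f (M n)) (μ * a) := by
  intro ε hε
  have h1 := hM'.eventually (hf (ε / (2 * μ)) (by positivity))
  have h2 : Tendsto (fun n => (M n : ℝ) / n * (a - ε / (2 * μ))) atTop
      (𝓝 (μ * (a - ε / (2 * μ)))) := hM.mul_const _
  have h3 : μ * a - ε < μ * (a - ε / (2 * μ)) := by
    have : μ * (a - ε / (2 * μ)) = μ * a - ε / 2 := by field_simp
    rw [this]; linarith
  filter_upwards [h1, h2.eventually_const_lt h3, eventually_gt_atTop 0] with n e1 e2 hn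
  refine le_trans ?_ e1
  have hn' : (0 : ℝ) < n := by exact_mod_cast hn
  refine Real.rpow_le_rpow_of_exponent_le one_le_two ?_
  calc (μ * a - ε) * n ≤ ((M n : ℝ) / n * (a - ε / (2 * μ))) * n := by gcongr
    _ = _ := by field_simp

lemma tendsto_natCast_sub {a b : ℕ → ℕ} {α β : ℝ}
    (ha : Tendsto (fun n => (a n : ℝ) / n) atTop (𝓝 α))
    (hb : Tendsto (fun n => (b n : ℝ) / n) atTop (𝓝 β)) (hab : ∀ᶠ n in atTop, b n ≤ a n) :
    Tendsto (fun n => ((a n - b n : ℕ) : ℝ) / n) atTop (𝓝 (α - β)) := by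
  refine (ha.sub hb).congr' ?_
  filter_upwards [hab] with n hn
  rw [Nat.cast_sub hn, sub_div]

/-- Upper bound for the bias by orthogonality. -/
lemma expLE_bias_sq_of_orthogonality {m w u : ℕ → ℕ} {μ ω ν : ℝ}
    (hm : Tendsto (fun n => (m n : ℝ) / n) atTop (𝓝 μ))
    (hw : Tendsto (fun n => (w n : ℝ) / n) atTop (𝓝 ω))
    (hu : Tendsto (fun n => (u n : ℝ) / n) atTop (𝓝 ν))
    (hwm : ∀ᶠ n in atTop, w n ≤ m n) (hum : ∀ᶠ n in atTop, u n ≤ m n) :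
    ExpLE (fun n => bias (m n) (w n) (u n) ^ 2) (μ - ent μ ν - ent μ ω) := by
  have h1 := expLE_two_pow hm
  have h2 := (expGE_choose hm hu hum).inv
  have h3 := (expGE_choose hm hw hwm).inv
  have h4 := (h1.mul h2 (Eventually.of_forall fun _ => by positivity)
    (Eventually.of_forall fun _ => by positivity)).mul h3
    (Eventually.of_forall fun _ => by positivity) (Eventually.of_forall fun _ => by positivity)
  refine h4.mono ?_ (le_of_eq (by ring))
  filter_upwards [hwm, hum] with n a b
  exact bias_sq_le b a

lemma expLE_bias_half_sq {r w u : ℕ → ℕ} {ϱ ν : ℝ}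
    (hr : Tendsto (fun n => (r n : ℝ) / n) atTop (𝓝 ϱ))
    (hu : Tendsto (fun n => (u n : ℝ) / n) atTop (𝓝 ν))
    (hw : ∀ᶠ n in atTop, 2 * w n = r n) (hur : ∀ᶠ n in atTop, u n ≤ r n) :
    ExpLE (fun n => bias (r n) (w n) (u n) ^ 2) (-ent ϱ ν) := by
  have hw' : Tendsto (fun n => (w n : ℝ) / n) atTop (𝓝 (ϱ / 2)) := by
    refine (hr.div_const 2).congr' ?_
    filter_upwards [hw] with n hn
    rw [← hn]; push_cast; ring
  have := expLE_bias_sq_of_orthogonality hr hw' hu (by filter_upwards [hw] with n hn; omega) hur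
  rwa [ent_half, show ϱ - ent ϱ ν - ϱ = -ent ϱ ν by ring] at this

/-- Evenness of u cannot be dropped: the Krawtchouk polynomial of half degree vanishes at odd
arguments. -/
lemma expGE_bias_half_sq {r w u : ℕ → ℕ} {ϱ ν : ℝ}
    (hr : Tendsto (fun n => (r n : ℝ) / n) atTop (𝓝 ϱ))
    (hu : Tendsto (fun n => (u n : ℝ) / n) atTop (𝓝 ν))
    (hw : ∀ᶠ n in atTop, 2 * w n = r n) (hur : ∀ᶠ n in atTop, u n ≤ r n)
    (heven : ∀ᶠ n in atTop, Even (u n)) :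
    ExpGE (fun n => bias (r n) (w n) (u n) ^ 2) (-ent ϱ ν) := by
  have hw' : Tendsto (fun n => (w n : ℝ) / n) atTop (𝓝 (1 / 2 * ϱ)) := by
    refine (hr.const_mul (1 / 2)).congr' ?_
    filter_upwards [hw] with n hn
    rw [← hn]; push_cast; ring
  have hv : Tendsto (fun n => ((u n / 2 : ℕ) : ℝ) / n) atTop (𝓝 (1 / 2 * ν)) := by
    refine (hu.const_mul (1 / 2)).congr' ?_
    filter_upwards [heven] with n hn
    rw [Nat.cast_div hn.two_dvd two_ne_zero]; push_cast; ring
  have h1 := expGE_choose hw' hv (by filter_upwards [hw, hur] with n a b; omega)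
  have h2 := (expLE_choose hr hu hur).inv (eventually_choose_pos hur)
  refine ((h1.mul h1).mul (h2.mul h2)).mono ?_ (le_of_eq ?_)
  · filter_upwards [hw, hur, heven] with n a b c
    obtain ⟨v, hv⟩ := c
    rw [hv, ← a, ← two_mul, bias_half_sq (by omega), show 2 * v / 2 = v by omega]
  · rw [ent_mul]; ring

lemma mul_biasExponent_of_osc {μ ν ω : ℝ} (hν0 : 0 ≤ ν) (hν : ν ≤ μ / 2) (hω0 : 0 < ω)
    (hω1 : ω < μ) (hD : (μ - 2 * ν) ^ 2 ≤ 4 * ω * (μ - ω)) :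
    μ * biasExponent (ν / μ) (ω / μ) = μ - ent μ ν - ent μ ω := by
  have hμ : 0 < μ := by linarith
  rw [biasExponent_of_osc (by positivity) ((div_le_iff₀ hμ).2 (by linarith)) (by positivity)
    ((div_lt_one hμ).2 hω1), ← mul_h_div, ← mul_h_div]
  · ring
  · have e1 : 1 - 2 * (ν / μ) = (μ - 2 * ν) / μ := by field_simp
    have e2 : 4 * (ω / μ) * (1 - ω / μ) = 4 * ω * (μ - ω) / μ ^ 2 := by field_simp
    rw [e1, e2, div_pow]
    gcongr

/-- The exponent in the exponential regime, for small weights. -/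
lemma mul_biasExponent_of_exp {μ ν ω : ℝ} (hν : ν ≤ μ / 2) (hω0 : 0 < ω)
    (hω1 : ω ≤ μ / 2) (hD : 4 * ω * (μ - ω) ≤ (μ - 2 * ν) ^ 2) :
    μ * biasExponent (ν / μ) (ω / μ) = 2 * (ν * Real.logb 2 (1 - saddle (ν / μ) (ω / μ)) +
      (μ - ν) * Real.logb 2 (1 + saddle (ν / μ) (ω / μ)) -
      ω * Real.logb 2 (saddle (ν / μ) (ω / μ)) - ent μ ω) := by
  have hμ : 0 < μ := by linarith
  rw [biasExponent_of_exp ((div_le_iff₀ hμ).2 (by linarith)) ((div_le_iff₀ hμ).2 (by linarith)),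
    ← mul_h_div, phase, Real.logb, Real.logb, Real.logb]
  · field_simp
  · have e1 : 1 - 2 * (ν / μ) = (μ - 2 * ν) / μ := by field_simp
    have e2 : 4 * (ω / μ) * (1 - ω / μ) = 4 * ω * (μ - ω) / μ ^ 2 := by field_simp
    rw [e1, e2, div_pow]
    gcongr

/-- The saddle point bound is applied with the saddle z of the limiting ratios for all n. Because
the regime is strict, the condition on u and z holds strictly in the limit, hence eventually. -/
lemma expLE_bias_sq_of_exp {m w u : ℕ → ℕ} {μ ω ν : ℝ}
    (hm : Tendsto (fun n => (m n : ℝ) / n) atTop (𝓝 μ))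
    (hw : Tendsto (fun n => (w n : ℝ) / n) atTop (𝓝 ω))
    (hu : Tendsto (fun n => (u n : ℝ) / n) atTop (𝓝 ν))
    (hwm : ∀ᶠ n in atTop, w n ≤ m n) (hum : ∀ᶠ n in atTop, u n ≤ m n)
    (hν : ν < μ / 2) (hω0 : 0 < ω) (hω1 : ω < μ / 2)
    (hD : 4 * ω * (μ - ω) < (μ - 2 * ν) ^ 2) :
    ExpLE (fun n => bias (m n) (w n) (u n) ^ 2) (μ * biasExponent (ν / μ) (ω / μ)) := by
  have hμ : 0 < μ := by linarith
  rw [mul_biasExponent_of_exp hν.le hω0 hω1.le hD.le]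
  have e1 : 1 - 2 * (ν / μ) = (μ - 2 * ν) / μ := by field_simp
  have e2 : 4 * (ω / μ) * (1 - ω / μ) = 4 * ω * (μ - ω) / μ ^ 2 := by field_simp
  have hD' : 4 * (ω / μ) * (1 - ω / μ) < (1 - 2 * (ν / μ)) ^ 2 := by
    rw [e1, e2, div_pow]
    gcongr
  have a0 : 0 < ω / μ := by positivity
  have a1 : ω / μ < 1 / 2 := (div_lt_iff₀ hμ).2 (by linarith)
  have a2 : ν / μ < 1 / 2 := (div_lt_iff₀ hμ).2 (by linarith)
  have z0 := saddle_pos a0 (by linarith) a2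
  have z1 := saddle_lt_one a0 a1 a2.le hD'.le
  have zq := saddle_eq (by linarith : ω / μ < 1) hD'.le
  have zl := mul_saddle_sq_lt a0 (by linarith) a2.le hD'
  set z := saddle (ν / μ) (ω / μ)
  have hcond : (ν / μ) * (1 + z) ^ 2 < (1 - ν / μ) * (1 - z) ^ 2 := by
    have h1 : z * ((1 - ν / μ) * (1 - z) ^ 2 - (ν / μ) * (1 + z) ^ 2) =
        (1 - z ^ 2) * (ω / μ - (1 - ω / μ) * z ^ 2) := by
      linear_combination -(1 + z ^ 2) * zq
    have h2 : 0 < (1 - z ^ 2) * (ω / μ - (1 - ω / μ) * z ^ 2) :=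
      mul_pos (by nlinarith) (by linarith)
    rw [← h1] at h2
    have := pos_of_mul_pos_right h2 z0.le
    linarith
  have hcond' : ν * (1 + z) ^ 2 < (μ - ν) * (1 - z) ^ 2 := by
    have := mul_lt_mul_of_pos_left hcond hμ
    have b1 : μ * (ν / μ * (1 + z) ^ 2) = ν * (1 + z) ^ 2 := by field_simp
    have b2 : μ * ((1 - ν / μ) * (1 - z) ^ 2) = (μ - ν) * (1 - z) ^ 2 := by field_simp
    rwa [b1, b2] at this
  have hev : ∀ᶠ n : ℕ in atTop, (u n : ℝ) / n * (1 + z) ^ 2 < ((m n : ℝ) / n - u n / n) * (1 - z) ^ 2 :=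
    (hu.mul_const _).eventually_lt ((hm.sub hu).mul_const _) hcond'
  have hmu := tendsto_natCast_sub hm hu hum
  have hp : ∀ f : ℕ → ℝ, (∀ n, 0 ≤ f n) → ∀ᶠ n in atTop, 0 ≤ f n := fun f hf =>
    Eventually.of_forall hf
  have hz1' : 0 < 1 - z := by linarith
  have b1 := expLE_pow hz1' hu
  have b2 := expLE_pow (by linarith : 0 < 1 + z) hmu
  have b3 := expLE_pow (inv_pos.2 z0) hw
  have b4 := (expGE_choose hm hw hwm).inv
  have b5 := ((b1.mul b2 (hp _ fun n => by positivity) (hp _ fun n => by positivity)).mul b3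
    (hp _ fun n => by positivity) (hp _ fun n => by positivity)).mul b4
    (hp _ fun n => by positivity) (hp _ fun n => by positivity)
  refine (b5.mul b5 (hp _ fun n => by positivity) (hp _ fun n => by positivity)).mono ?_
    (le_of_eq ?_)
  · filter_upwards [hev, hwm, hum, eventually_gt_atTop 0] with n c1 c2 c3 c4
    have hn' : (0 : ℝ) < n := by exact_mod_cast c4
    have c5 : (u n : ℝ) * (1 + z) ^ 2 ≤ ((m n : ℝ) - u n) * (1 - z) ^ 2 := by
      rw [← sub_div, div_mul_eq_mul_div, div_mul_eq_mul_div, div_lt_div_iff_of_pos_right hn'] at c1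
      exact c1.le
    have c6 := abs_krawtchouk_mul_pow_le (w := w n) c3 z0 z1 c5
    have hcw : (0 : ℝ) < (m n).choose (w n) := by exact_mod_cast Nat.choose_pos c2
    rw [← sq, ← sq_abs, bias, abs_div, abs_of_pos hcw]
    refine pow_le_pow_left₀ (by positivity) ?_ 2
    rw [div_eq_mul_inv]
    refine mul_le_mul_of_nonneg_right ?_ (by positivity)
    rw [inv_pow, ← div_eq_mul_inv, le_div_iff₀ (by positivity)]
    exact c6
  · rw [Real.logb_inv]; ring

lemma expLE_bias_sq {m w u : ℕ → ℕ} {μ ω ν : ℝ}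
    (hm : Tendsto (fun n => (m n : ℝ) / n) atTop (𝓝 μ))
    (hw : Tendsto (fun n => (w n : ℝ) / n) atTop (𝓝 ω))
    (hu : Tendsto (fun n => (u n : ℝ) / n) atTop (𝓝 ν))
    (hwm : ∀ᶠ n in atTop, w n ≤ m n) (hum : ∀ᶠ n in atTop, u n ≤ m n)
    (hν0 : 0 ≤ ν) (hν : ν < μ / 2) (hω0 : 0 < ω) (hω1 : ω < μ) :
    ExpLE (fun n => bias (m n) (w n) (u n) ^ 2) (μ * biasExponent (ν / μ) (ω / μ)) := by
  have hμ : 0 < μ := by linarith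
  rcases le_or_gt ((μ - 2 * ν) ^ 2) (4 * ω * (μ - ω)) with hD | hD
  · rw [mul_biasExponent_of_osc hν0 hν.le hω0 hω1 hD]
    exact expLE_bias_sq_of_orthogonality hm hw hu hwm hum
  rcases lt_trichotomy ω (μ / 2) with h | h | h
  · exact expLE_bias_sq_of_exp hm hw hu hwm hum hν hω0 h hD
  -- For ω = μ/2 the hypothesis would read μ² < (μ − 2ν)², impossible for 0 ≤ ν < μ/2.
  · exfalso; subst h; nlinarith
  · have hb : biasExponent (ν / μ) (ω / μ) = biasExponent (ν / μ) ((μ - ω) / μ) := by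
      rw [sub_div, div_self hμ.ne', biasExponent_one_sub_right]
    rw [hb]
    refine (expLE_bias_sq_of_exp hm (tendsto_natCast_sub hm hw hwm) hu
      (Eventually.of_forall fun n => Nat.sub_le _ _) hum hν (by linarith) (by linarith)
      (by rw [sub_sub_cancel]; linarith)).mono ?_ le_rfl
    filter_upwards [hwm, hum] with n a b
    rw [bias_sub_left_sq b a]

lemma tendsto_even_floor {ω : ℝ} (hω : 0 ≤ ω) :
    Tendsto (fun n : ℕ => ((2 * ⌊ω / 2 * n⌋₊ : ℕ) : ℝ) / n) atTop (𝓝 ω) := by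
  have h1 : Tendsto (fun n : ℕ => (⌊ω / 2 * n⌋₊ : ℝ) / n) atTop (𝓝 (ω / 2)) :=
    (tendsto_nat_floor_mul_div_atTop (by positivity)).comp tendsto_natCast_atTop_atTop
  have h2 := h1.const_mul 2
  rw [mul_div_cancel₀ _ two_ne_zero] at h2
  refine h2.congr fun n => ?_
  push_cast; ring

lemma eventually_le_of_tendsto_lt {a b : ℕ → ℕ} {α β : ℝ}
    (ha : Tendsto (fun n => (a n : ℝ) / n) atTop (𝓝 α))
    (hb : Tendsto (fun n => (b n : ℝ) / n) atTop (𝓝 β)) (h : α < β) :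
    ∀ᶠ n in atTop, a n < b n := by
  filter_upwards [ha.eventually_lt hb h, eventually_gt_atTop 0] with n h1 h2
  have hn' : (0 : ℝ) < n := by exact_mod_cast h2
  rw [div_lt_div_iff_of_pos_right hn'] at h1
  exact_mod_cast h1

lemma tendsto_self_div : Tendsto (fun n : ℕ => (n : ℝ) / n) atTop (𝓝 1) := by
  refine tendsto_const_nhds.congr' ?_
  filter_upwards [eventually_gt_atTop 0] with n hn
  rw [div_self (Nat.cast_ne_zero.2 (Nat.pos_iff_ne_zero.1 hn))]

/-- Large biases in the exponential regime. -/
lemma expGE_bias_sq_of_exp {w u : ℕ → ℕ} {ω x : ℝ}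
    (hw : Tendsto (fun n => (w n : ℝ) / n) atTop (𝓝 ω))
    (hu : Tendsto (fun n => (u n : ℝ) / n) atTop (𝓝 x))
    (hx : x < 1 / 2) (hω0 : 0 < ω) (hω1 : ω < 1 / 2)
    (hD : 4 * ω * (1 - ω) < (1 - 2 * x) ^ 2) :
    ExpGE (fun n => bias n (w n) (u n) ^ 2) (biasExponent x ω) := by
  have hcont := continuousAt_phase_saddle (p := (x, ω)) hω0 hω1 hx.le hD.le
  have hlim : Tendsto (fun n : ℕ => phase ((u n : ℝ) / n) ((w n : ℝ) / n)
      (saddle ((u n : ℝ) / n) ((w n : ℝ) / n))) atTop (𝓝 (phase x ω (saddle x ω))) :=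
    hcont.tendsto.comp (hu.prodMk_nhds hw)
  have hh : Tendsto (fun n : ℕ => h ((w n : ℝ) / n)) atTop (𝓝 (h ω)) :=
    (continuous_h.tendsto ω).comp hw
  have hlim2 := ((hlim.sub (hh.mul_const (Real.log 2))).mul_const (2 / Real.log 2))
  have hl := log_two_pos.ne'
  have hG : ExpGE (fun n : ℕ => Real.exp (n * (phase ((u n : ℝ) / n) ((w n : ℝ) / n)
      (saddle ((u n : ℝ) / n) ((w n : ℝ) / n)) - h ((w n : ℝ) / n) * Real.log 2)) ^ 2)
      (biasExponent x ω) := by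
    refine expGE_of_tendsto (Eventually.of_forall fun _ => by positivity) ?_
    rw [biasExponent_of_exp hx.le hω1.le hD.le]
    have e : 2 * (phase x ω (saddle x ω) / Real.log 2 - h ω) =
        (phase x ω (saddle x ω) - h ω * Real.log 2) * (2 / Real.log 2) := by field_simp
    rw [e]
    refine hlim2.congr' ?_
    filter_upwards [eventually_gt_atTop 0] with n hn
    have hn' : (n : ℝ) ≠ 0 := by exact_mod_cast hn.ne'
    rw [Real.logb, Real.log_pow, Real.log_exp]
    field_simp
    push_cast
    ring
  refine hG.mono ?_ le_rfl
  have hone : Tendsto (fun n : ℕ => ((2 * w n : ℕ) : ℝ) / n) atTop (𝓝 (2 * ω)) := by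
    refine (hw.const_mul 2).congr fun n => by push_cast; ring
  have htwo : Tendsto (fun n : ℕ => ((2 * u n : ℕ) : ℝ) / n) atTop (𝓝 (2 * x)) := by
    refine (hu.const_mul 2).congr fun n => by push_cast; ring
  have hzero : Tendsto (fun n : ℕ => ((0 : ℕ) : ℝ) / n) atTop (𝓝 0) := by simp
  filter_upwards [eventually_le_of_tendsto_lt hone tendsto_self_div (by linarith),
    eventually_le_of_tendsto_lt htwo tendsto_self_div (by linarith),
    eventually_le_of_tendsto_lt hzero hw hω0,
    ((hw.const_mul 4).mul (hw.const_sub 1)).eventually_lt (((hu.const_mul 2).const_sub 1).pow 2) hD]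
    with n h1 h2 h3 h4
  exact pow_le_pow_left₀ (Real.exp_pos _).le (exp_phase_le_bias h3 h1 h2.le h4.le) 2

/-- Because of the zeros in the oscillatory regime, both sequences are chosen rather than given. The
degrees are even, as required of w₂. -/
lemma exists_expGE_bias_sq {x ω : ℝ} (hx0 : 0 < x) (hx : x < 1 / 2) (hω0 : 0 < ω) (hω1 : ω < 1) :
    ∃ U W : ℕ → ℕ, Tendsto (fun n => (U n : ℝ) / n) atTop (𝓝 x) ∧
      Tendsto (fun n => (W n : ℝ) / n) atTop (𝓝 ω) ∧ (∀ᶠ n in atTop, Even (W n)) ∧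
      ExpGE (fun n => bias n (W n) (U n) ^ 2) (biasExponent x ω) := by
  rcases le_or_gt ((1 - 2 * x) ^ 2) (4 * ω * (1 - ω)) with hD | hD
  · obtain ⟨U, W, hU, hW, hUW⟩ := exists_seq_of_forall_near
      (P := fun n u w => u ≤ n ∧ w ≤ n ∧ Even w ∧ 1 ≤ 4 * ((n : ℝ) + 1) ^ 2 * kfun n w u ^ 2)
      (fun η hη => exists_kfun_near (ω := ω) hx0 hx (by nlinarith) hη)
    refine ⟨U, W, hU, hW, hUW.mono fun n h => h.2.2.1, ?_⟩
    have hUn : ∀ᶠ n in atTop, U n ≤ n := hUW.mono fun n h => h.1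
    have hWn : ∀ᶠ n in atTop, W n ≤ n := hUW.mono fun n h => h.2.1
    have h1 : ExpGE (fun n => (2 : ℝ) ^ n) 1 := expGE_two_pow tendsto_self_div
    have h2 := (expLE_choose tendsto_self_div hU hUn).inv (eventually_choose_pos hUn)
    have h3 := (expLE_choose tendsto_self_div hW hWn).inv (eventually_choose_pos hWn)
    have h4 := (expLE_poly 16 2).inv (by
      filter_upwards [eventually_gt_atTop 0] with n hn
      have hn' : (0 : ℝ) < n := by exact_mod_cast hn
      positivity)
    refine (h4.mul ((h1.mul h2).mul h3)).mono ?_ (le_of_eq ?_)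
    · filter_upwards [hUW, eventually_gt_atTop 0] with n ⟨a1, a2, _, a4⟩ hn
      have hn' : (1 : ℝ) ≤ n := by exact_mod_cast hn
      rw [bias_sq_eq_kfun a1 a2]
      refine mul_le_mul_of_nonneg_right ?_ (by positivity)
      rw [inv_le_iff_one_le_mul₀ (by positivity)]
      refine a4.trans ?_
      have : 4 * ((n : ℝ) + 1) ^ 2 ≤ 16 * n ^ 2 := by nlinarith
      rw [mul_comm (kfun n (W n) (U n) ^ 2)]
      gcongr
    · rw [biasExponent_of_osc hx0.le hx.le hω0 hω1 hD, ent_one, ent_one]; ring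
  · set U : ℕ → ℕ := fun n => 2 * ⌊x / 2 * n⌋₊
    set W : ℕ → ℕ := fun n => 2 * ⌊ω / 2 * n⌋₊
    have hU : Tendsto (fun n => (U n : ℝ) / n) atTop (𝓝 x) := tendsto_even_floor hx0.le
    have hW : Tendsto (fun n => (W n : ℝ) / n) atTop (𝓝 ω) := tendsto_even_floor hω0.le
    refine ⟨U, W, hU, hW, Eventually.of_forall fun n => even_two_mul _, ?_⟩
    rcases lt_trichotomy ω (1 / 2) with h | h | h
    · exact expGE_bias_sq_of_exp hW hU hx hω0 h hD
    · exfalso; subst h; nlinarith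
    · have hWn : ∀ᶠ n in atTop, W n ≤ n :=
        (eventually_le_of_tendsto_lt hW tendsto_self_div hω1).mono fun n h => h.le
      have hUn : ∀ᶠ n in atTop, U n ≤ n :=
        (eventually_le_of_tendsto_lt hU tendsto_self_div (by linarith)).mono fun n h => h.le
      rw [← biasExponent_one_sub_right]
      refine (expGE_bias_sq_of_exp (tendsto_natCast_sub tendsto_self_div hW hWn) hU hx
        (by linarith) (by linarith) (by linarith)).mono ?_ le_rfl
      filter_upwards [hWn, hUn] with n a b
      rw [bias_sub_left_sq b a]

end bias

/-! ### Families of parameters with limiting ratios -/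

section family

/-- A family of valid parameters with limiting ratios in the non-degenerate regime. -/
structure Regime (R : ℝ) (k t : ℕ → ℕ) (θ : ℕ → Params) (x : RelParams) : Prop where
  R_pos : 0 < R
  R_lt : R < 1
  tendsto_k : Tendsto (fun n => (k n : ℝ) / n) atTop (𝓝 R)
  tendsto_t : Tendsto (fun n => (t n : ℝ) / n) atTop (𝓝 (deltaGV R))
  valid : ∀ᶠ n in atTop, (θ n).Valid n (k n) (t n)
  ratios : HasRatios θ x
  π₂_lt : x.π₂ < x.lam₁
  ω₂_lt : x.ω₂ < x.lam₂
  π₁_lt : x.π₁ < 1 - R + x.lam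

lemma le_of_tendsto_natCast {a b : ℕ → ℕ} {α β : ℝ}
    (ha : Tendsto (fun n => (a n : ℝ) / n) atTop (𝓝 α))
    (hb : Tendsto (fun n => (b n : ℝ) / n) atTop (𝓝 β)) (hab : ∀ᶠ n in atTop, a n ≤ b n) :
    α ≤ β := by
  refine le_of_tendsto_of_tendsto ha hb ?_
  filter_upwards [hab] with n hn
  gcongr

lemma tendsto_natCast_add {a b : ℕ → ℕ} {α β : ℝ}
    (ha : Tendsto (fun n => (a n : ℝ) / n) atTop (𝓝 α))
    (hb : Tendsto (fun n => (b n : ℝ) / n) atTop (𝓝 β)) :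
    Tendsto (fun n => ((a n + b n : ℕ) : ℝ) / n) atTop (𝓝 (α + β)) := by
  refine (ha.add hb).congr fun n => ?_
  push_cast; ring

lemma tendsto_natCast_mul {a : ℕ → ℕ} {α : ℝ} (c : ℕ)
    (ha : Tendsto (fun n => (a n : ℝ) / n) atTop (𝓝 α)) :
    Tendsto (fun n => ((c * a n : ℕ) : ℝ) / n) atTop (𝓝 (c * α)) := by
  refine (ha.const_mul (c : ℝ)).congr fun n => ?_
  push_cast; ring

lemma tendsto_natCast_div {a : ℕ → ℕ} {α : ℝ} {c : ℕ} (hc : 0 < c)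
    (ha : Tendsto (fun n => (a n : ℝ) / n) atTop (𝓝 α)) :
    Tendsto (fun n => ((a n / c : ℕ) : ℝ) / n) atTop (𝓝 (α / c)) := by
  have hone : Tendsto (fun n : ℕ => (1 : ℝ) / n) atTop (𝓝 0) := tendsto_one_div_atTop_nhds_zero_nat
  have hc' : (0 : ℝ) < c := by exact_mod_cast hc
  have hlow : Tendsto (fun n => (a n : ℝ) / n / c - 1 / n) atTop (𝓝 (α / c)) := by
    simpa using (ha.div_const (c : ℝ)).sub hone
  refine tendsto_of_tendsto_of_tendsto_of_le_of_le hlow (ha.div_const (c : ℝ)) (fun n => ?_)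
    (fun n => ?_)
  · change (a n : ℝ) / n / c - 1 / n ≤ ((a n / c : ℕ) : ℝ) / n
    have h1 : (a n : ℝ) / c - 1 ≤ ((a n / c : ℕ) : ℝ) := by
      have h2 := Nat.lt_div_mul_add (a := a n) hc
      have h3 : (a n : ℝ) < ((a n / c : ℕ) : ℝ) * c + c := by exact_mod_cast h2
      rw [sub_le_iff_le_add, div_le_iff₀ hc']
      linarith
    calc (a n : ℝ) / n / c - 1 / n = ((a n : ℝ) / c - 1) / n := by ring
      _ ≤ _ := by gcongr
  · change ((a n / c : ℕ) : ℝ) / n ≤ (a n : ℝ) / n / c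
    calc ((a n / c : ℕ) : ℝ) / n ≤ ((a n : ℝ) / c) / n := by
          gcongr
          exact Nat.cast_div_le
      _ = _ := by ring

lemma tendsto_min {a b : ℕ → ℕ} {α β : ℝ}
    (ha : Tendsto (fun n => (a n : ℝ) / n) atTop (𝓝 α))
    (hb : Tendsto (fun n => (b n : ℝ) / n) atTop (𝓝 β)) :
    Tendsto (fun n => ((min (a n) (b n) : ℕ) : ℝ) / n) atTop (𝓝 (min α β)) := by
  refine (ha.min hb).congr fun n => ?_
  rw [Nat.cast_min]
  exact (min_div_div_right (by positivity) _ _)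

lemma eventually_pos_of_tendsto {a : ℕ → ℕ} {α : ℝ}
    (ha : Tendsto (fun n => (a n : ℝ) / n) atTop (𝓝 α)) (h : 0 < α) (c : ℕ) :
    ∀ᶠ n in atTop, c < a n := by
  have hc : Tendsto (fun n : ℕ => (c : ℝ) / n) atTop (𝓝 0) := tendsto_const_div_atTop_nhds_zero_nat _
  exact eventually_le_of_tendsto_lt (a := fun _ => c) hc ha h

/-- The rounded logarithm of a product of two binomial coefficients. -/
lemma tendsto_natLog_choose {a b c d : ℕ → ℕ} {α β γ δ : ℝ}
    (ha : Tendsto (fun n => (a n : ℝ) / n) atTop (𝓝 α))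
    (hb : Tendsto (fun n => (b n : ℝ) / n) atTop (𝓝 β))
    (hc : Tendsto (fun n => (c n : ℝ) / n) atTop (𝓝 γ))
    (hd : Tendsto (fun n => (d n : ℝ) / n) atTop (𝓝 δ))
    (hba : ∀ᶠ n in atTop, b n ≤ a n) (hdc : ∀ᶠ n in atTop, d n ≤ c n) :
    Tendsto (fun n => (Nat.log 2 ((a n).choose (b n) * (c n).choose (d n)) : ℝ) / n) atTop
      (𝓝 (ent α β + ent γ δ)) := by
  have h1 := (tendsto_log_choose_div ha hb hba).add (tendsto_log_choose_div hc hd hdc)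
  have hone : Tendsto (fun n : ℕ => (1 : ℝ) / n) atTop (𝓝 0) := tendsto_one_div_atTop_nhds_zero_nat
  have hlow := h1.sub hone
  rw [sub_zero] at hlow
  have hrel : ∀ᶠ n in atTop, Real.logb 2 ((a n).choose (b n)) / n +
      Real.logb 2 ((c n).choose (d n)) / n =
      Real.logb 2 (((a n).choose (b n) * (c n).choose (d n) : ℕ)) / n := by
    filter_upwards [hba, hdc] with n e1 e2
    have p1 : (0 : ℝ) < (a n).choose (b n) := by exact_mod_cast Nat.choose_pos e1
    have p2 : (0 : ℝ) < (c n).choose (d n) := by exact_mod_cast Nat.choose_pos e2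
    rw [Nat.cast_mul, Real.logb_mul p1.ne' p2.ne', add_div]
  refine tendsto_of_tendsto_of_tendsto_of_le_of_le' hlow h1 ?_ ?_
  · filter_upwards [hrel, hba, hdc] with n e0 e1 e2
    rw [e0, ← sub_div]
    gcongr
    rw [sub_le_iff_le_add, ← Real.natFloor_logb_natCast]
    have : ((⌊Real.logb ((2 : ℕ) : ℝ) (((a n).choose (b n) * (c n).choose (d n) : ℕ) : ℝ)⌋₊ : ℕ) : ℝ) + 1 ≥
      Real.logb ((2 : ℕ) : ℝ) (((a n).choose (b n) * (c n).choose (d n) : ℕ) : ℝ) := (Nat.lt_floor_add_one _).le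
    exact_mod_cast this
  · filter_upwards [hrel, hba, hdc] with n e0 e1 e2
    rw [e0]
    gcongr
    rw [← Real.natFloor_logb_natCast]
    refine (Nat.floor_le ?_).trans (le_of_eq (by norm_cast))
    refine Real.logb_nonneg (by norm_num) ?_
    exact_mod_cast Nat.mul_pos (Nat.choose_pos e1) (Nat.choose_pos e2)

variable {R : ℝ} {k t : ℕ → ℕ} {θ : ℕ → Params} {x : RelParams}

namespace Regime

lemma tendsto_m (H : Regime R k t θ x) :
    Tendsto (fun n => ((θ n).m n (k n) : ℝ) / n) atTop (𝓝 (1 - R + x.lam)) :=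
  tendsto_natCast_add (tendsto_natCast_sub tendsto_self_div H.tendsto_k
    (H.valid.mono fun _ h => h.k_le)) H.ratios.lam

lemma tendsto_r (H : Regime R k t θ x) :
    Tendsto (fun n => ((θ n).r (k n) : ℝ) / n) atTop (𝓝 (R - x.lam - x.σ)) :=
  tendsto_natCast_sub (tendsto_natCast_sub H.tendsto_k H.ratios.lam
    (H.valid.mono fun _ h => by have := h.s_le; omega)) H.ratios.σ
    (H.valid.mono fun _ h => by have := h.s_le; omega)

lemma π₁_le (H : Regime R k t θ x) : x.π₁ ≤ x.π₂ :=
  le_of_tendsto_natCast H.ratios.π₁ H.ratios.π₂ (H.valid.mono fun _ h => h.p₁_le)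

lemma π₂_le (H : Regime R k t θ x) : x.π₂ ≤ x.ω₂ :=
  le_of_tendsto_natCast H.ratios.π₂ H.ratios.ω₂ (H.valid.mono fun _ h => h.p₂_le)

lemma lam₁_le (H : Regime R k t θ x) : x.lam₁ ≤ x.lam₂ :=
  le_of_tendsto_natCast H.ratios.lam₁ H.ratios.lam₂ (H.valid.mono fun _ h => h.ell₁_le)

lemma lam₂_le (H : Regime R k t θ x) : x.lam₂ ≤ x.lam :=
  le_of_tendsto_natCast H.ratios.lam₂ H.ratios.lam (H.valid.mono fun _ h => h.ell₂_le)

lemma le_π₁ (H : Regime R k t θ x) : x.π₂ ≤ 2 * x.π₁ := by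
  simpa using le_of_tendsto_natCast H.ratios.π₂ (tendsto_natCast_mul 2 H.ratios.π₁)
    (H.valid.mono fun _ h => h.le_p₁)

lemma le_π₂ (H : Regime R k t θ x) : x.ω₂ ≤ 2 * x.π₂ := by
  simpa using le_of_tendsto_natCast H.ratios.ω₂ (tendsto_natCast_mul 2 H.ratios.π₂)
    (H.valid.mono fun _ h => h.le_p₂)

lemma π₁_nonneg (H : Regime R k t θ x) : 0 ≤ x.π₁ :=
  ge_of_tendsto H.ratios.π₁ (Eventually.of_forall fun _ => by positivity)

lemma ω₂_lt_mu (H : Regime R k t θ x) : x.ω₂ < 1 - R + x.lam := by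
  have := H.ω₂_lt; have := H.lam₂_le; have := H.R_lt; linarith

lemma π₂_lt_mu (H : Regime R k t θ x) : x.π₂ < 1 - R + x.lam := H.π₂_le.trans_lt H.ω₂_lt_mu

/-- Otherwise the second binomial in the representation constraint would be 0 and ℓ₁ would be log 0
= 0, whereas λ₁ > π₂ ≥ 0. -/
lemma rep₁_le (H : Regime R k t θ x) : ∀ᶠ n in atTop,
    (θ n).p₁ - (θ n).p₂ / 2 ≤ (θ n).m n (k n) - (θ n).p₂ := by
  have h0 : 0 < x.lam₁ := by have := H.π₂_lt; have := H.π₁_le; have := H.π₁_nonneg; linarith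
  filter_upwards [H.valid, eventually_pos_of_tendsto H.ratios.lam₁ h0 0] with n hv hp
  by_contra! hcon
  rw [hv.ell₁_eq, Nat.choose_eq_zero_of_lt hcon] at hp
  simp at hp

lemma rep₂_le (H : Regime R k t θ x) : ∀ᶠ n in atTop,
    (θ n).p₂ - (θ n).w₂ / 2 ≤ (θ n).m n (k n) - (θ n).w₂ := by
  have h0 : 0 < x.lam₂ := by
    have := H.π₂_lt; have := H.π₁_le; have := H.π₁_nonneg; have := H.lam₁_le; linarith
  filter_upwards [H.valid, eventually_pos_of_tendsto H.ratios.lam₂ h0 0] with n hv hp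
  by_contra! hcon
  rw [hv.ell₂_eq, Nat.choose_eq_zero_of_lt hcon] at hp
  simp at hp

lemma tendsto_rep (H : Regime R k t θ x) :
    Tendsto (fun n => (((θ n).p₁ - (θ n).p₂ / 2 : ℕ) : ℝ) / n) atTop (𝓝 (x.π₁ - x.π₂ / 2)) := by
  have := tendsto_natCast_sub H.ratios.π₁ (tendsto_natCast_div two_pos H.ratios.π₂)
    (H.valid.mono fun n h => by have := h.le_p₁; omega)
  simpa using this

lemma tendsto_rep' (H : Regime R k t θ x) :
    Tendsto (fun n => (((θ n).p₂ - (θ n).w₂ / 2 : ℕ) : ℝ) / n) atTop (𝓝 (x.π₂ - x.ω₂ / 2)) := by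
  have := tendsto_natCast_sub H.ratios.π₂ (tendsto_natCast_div two_pos H.ratios.ω₂)
    (H.valid.mono fun n h => by have := h.le_p₂; omega)
  simpa using this

lemma lam₁_eq (H : Regime R k t θ x) :
    x.lam₁ = x.π₂ + ent (1 - R + x.lam - x.π₂) (x.π₁ - x.π₂ / 2) := by
  have hm := tendsto_natCast_sub H.tendsto_m H.ratios.π₂
    (H.valid.mono fun n h => h.p₂_le.trans h.w₂_le)
  have h1 := tendsto_natLog_choose H.ratios.π₂ (tendsto_natCast_div two_pos H.ratios.π₂) hm
    H.tendsto_rep (Eventually.of_forall fun n => Nat.div_le_self _ _) H.rep₁_le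
  have h2 := tendsto_nhds_unique (H.ratios.lam₁.congr' (by
    filter_upwards [H.valid] with n hn
    rw [hn.ell₁_eq])) h1
  rw [h2]
  congr 1
  exact ent_half _

lemma lam₂_eq (H : Regime R k t θ x) :
    x.lam₂ = x.ω₂ + ent (1 - R + x.lam - x.ω₂) (x.π₂ - x.ω₂ / 2) := by
  have hm := tendsto_natCast_sub H.tendsto_m H.ratios.ω₂ (H.valid.mono fun n h => h.w₂_le)
  have h1 := tendsto_natLog_choose H.ratios.ω₂ (tendsto_natCast_div two_pos H.ratios.ω₂) hm
    H.tendsto_rep' (Eventually.of_forall fun n => Nat.div_le_self _ _) H.rep₂_le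
  have h2 := tendsto_nhds_unique (H.ratios.lam₂.congr' (by
    filter_upwards [H.valid] with n hn
    rw [hn.ell₂_eq])) h1
  rw [h2]
  congr 1
  exact ent_half _

lemma π₁_pos (H : Regime R k t θ x) : 0 < x.π₁ := by
  refine lt_of_le_of_ne H.π₁_nonneg fun h => ?_
  have h1 := H.lam₁_eq
  have h2 := H.le_π₁
  have h3 := H.π₁_le
  have h4 : x.π₂ = 0 := by linarith
  have h5 := H.π₂_lt
  rw [h1, h4, ← h] at h5
  simp at h5

lemma π₂_pos (H : Regime R k t θ x) : 0 < x.π₂ := H.π₁_pos.trans_le H.π₁_le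

lemma ω₂_pos (H : Regime R k t θ x) : 0 < x.ω₂ := H.π₂_pos.trans_le H.π₂_le

/-- Equality would make the entropy term of λ₁ vanish, contradicting π₂ < λ₁. The strict inequality
leaves room for the representations inside each half of the positions. -/
lemma rep₁_lt (H : Regime R k t θ x) : x.π₁ + x.π₂ / 2 < 1 - R + x.lam := by
  have h1 := le_of_tendsto_natCast H.tendsto_rep (tendsto_natCast_sub H.tendsto_m H.ratios.π₂
    (H.valid.mono fun n h => h.p₂_le.trans h.w₂_le)) H.rep₁_le
  refine lt_of_le_of_ne (by linarith) fun h => ?_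
  have h2 := H.lam₁_eq
  rw [show x.π₁ - x.π₂ / 2 = 1 - R + x.lam - x.π₂ by linarith, ent_self] at h2
  have := H.π₂_lt
  linarith

lemma rep₂_lt (H : Regime R k t θ x) : x.π₂ + x.ω₂ / 2 < 1 - R + x.lam := by
  have h1 := le_of_tendsto_natCast H.tendsto_rep' (tendsto_natCast_sub H.tendsto_m H.ratios.ω₂
    (H.valid.mono fun n h => h.w₂_le)) H.rep₂_le
  refine lt_of_le_of_ne (by linarith) fun h => ?_
  have h2 := H.lam₂_eq
  rw [show x.π₂ - x.ω₂ / 2 = 1 - R + x.lam - x.ω₂ by linarith, ent_self] at h2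
  have := H.ω₂_lt
  linarith

end Regime

end family

/-! ### Asymptotics of the list construction -/

section family

lemma tendsto_half {m : ℕ → ℕ} {μ : ℝ} (hm : Tendsto (fun n => (m n : ℝ) / n) atTop (𝓝 μ)) :
    Tendsto (fun n => ((m n / 2 : ℕ) : ℝ) / n) atTop (𝓝 (μ / 2)) := by
  simpa using tendsto_natCast_div two_pos hm

lemma tendsto_half' {m : ℕ → ℕ} {μ : ℝ} (hm : Tendsto (fun n => (m n : ℝ) / n) atTop (𝓝 μ)) :
    Tendsto (fun n => ((m n - m n / 2 : ℕ) : ℝ) / n) atTop (𝓝 (μ / 2)) := by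
  have := tendsto_natCast_sub hm (tendsto_half hm)
    (Eventually.of_forall fun n => Nat.div_le_self _ _)
  rwa [sub_half] at this

/-- Both halves contribute the same exponent, and by homogeneity of `ent` they add up to that of all
representations: fixing balanced half weights costs nothing on the exponential scale. -/
lemma expGE_repCount {m j j' q q' : ℕ → ℕ} {μ a b : ℝ}
    (hm : Tendsto (fun n => (m n : ℝ) / n) atTop (𝓝 μ))
    (hj : Tendsto (fun n => (j n : ℝ) / n) atTop (𝓝 a))
    (hj' : Tendsto (fun n => (j' n : ℝ) / n) atTop (𝓝 a))
    (hq : Tendsto (fun n => (q n : ℝ) / n) atTop (𝓝 b))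
    (hq' : Tendsto (fun n => (q' n : ℝ) / n) atTop (𝓝 b))
    (hjq : ∀ᶠ n in atTop, j n ≤ q n) (hjq' : ∀ᶠ n in atTop, j' n ≤ q' n)
    (hab : a ≤ b) (hlt : b + a < μ / 2) :
    ExpGE (fun n => (repCount (m n) (j n) (j' n) (q n) (q' n) : ℝ))
      (4 * a + ent (μ - 4 * a) (2 * b - 2 * a)) := by
  have m1 := tendsto_half hm
  have m2 := tendsto_half' hm
  have e1 : ∀ᶠ n in atTop, 2 * j n ≤ m n / 2 :=
    (eventually_le_of_tendsto_lt (tendsto_natCast_mul 2 hj) m1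
      (by push_cast; linarith)).mono fun _ h => h.le
  have e2 : ∀ᶠ n in atTop, 2 * j' n ≤ m n - m n / 2 :=
    (eventually_le_of_tendsto_lt (tendsto_natCast_mul 2 hj') m2
      (by push_cast; linarith)).mono fun _ h => h.le
  have s1 := tendsto_natCast_sub m1 (tendsto_natCast_mul 2 hj) e1
  have s2 := tendsto_natCast_sub m2 (tendsto_natCast_mul 2 hj') e2
  have d1 := tendsto_natCast_sub hq hj hjq
  have d2 := tendsto_natCast_sub hq' hj' hjq'
  have f1 := (eventually_le_of_tendsto_lt d1 s1 (by push_cast; linarith)).mono fun _ h => h.le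
  have f2 := (eventually_le_of_tendsto_lt d2 s2 (by push_cast; linarith)).mono fun _ h => h.le
  have c1 := expGE_choose (tendsto_natCast_mul 2 hj) hj
    (Eventually.of_forall fun n => by omega)
  have c2 := expGE_choose s1 d1 f1
  have c3 := expGE_choose (tendsto_natCast_mul 2 hj') hj'
    (Eventually.of_forall fun n => by omega)
  have c4 := expGE_choose s2 d2 f2
  refine ((c1.mul c2).mul (c3.mul c4)).mono (Eventually.of_forall fun n => ?_) (le_of_eq ?_)
  · rw [repCount]; push_cast; exact le_rfl
  · have g1 : ent (((2 : ℕ) : ℝ) * a) a = 2 * a := by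
      have := ent_half (2 * a)
      rw [mul_div_cancel_left₀ _ two_ne_zero] at this
      exact_mod_cast this
    have g2 : ent (μ / 2 - ((2 : ℕ) : ℝ) * a) (b - a) = 1 / 2 * ent (μ - 4 * a) (2 * b - 2 * a) := by
      rw [← ent_mul]
      congr 1 <;> push_cast <;> ring
    rw [g1, g2]; ring

lemma expGE_card_halves {m j j' : ℕ → ℕ} {μ a : ℝ}
    (hm : Tendsto (fun n => (m n : ℝ) / n) atTop (𝓝 μ))
    (hj : Tendsto (fun n => (j n : ℝ) / n) atTop (𝓝 a))
    (hj' : Tendsto (fun n => (j' n : ℝ) / n) atTop (𝓝 a)) (hlt : a < μ / 2) :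
    ExpGE (fun n => ((halves (m n) (j n) (j' n)).card : ℝ)) (ent μ (2 * a)) := by
  have m1 := tendsto_half hm
  have m2 := tendsto_half' hm
  have c1 := expGE_choose m1 hj ((eventually_le_of_tendsto_lt hj m1 hlt).mono fun _ h => h.le)
  have c2 := expGE_choose m2 hj' ((eventually_le_of_tendsto_lt hj' m2 hlt).mono fun _ h => h.le)
  refine (c1.mul c2).mono (Eventually.of_forall fun n => ?_) (le_of_eq ?_)
  · rw [card_halves]; push_cast; exact le_rfl
  · have g2 : ent (μ / 2) a = 1 / 2 * ent μ (2 * a) := by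
      rw [← ent_mul]; congr 1 <;> ring
    rw [g2]; ring

lemma halves_nonempty {m j j' : ℕ → ℕ} {μ a : ℝ}
    (hm : Tendsto (fun n => (m n : ℝ) / n) atTop (𝓝 μ))
    (hj : Tendsto (fun n => (j n : ℝ) / n) atTop (𝓝 a))
    (hj' : Tendsto (fun n => (j' n : ℝ) / n) atTop (𝓝 a)) (hlt : a < μ / 2) :
    ∀ᶠ n in atTop, (halves (m n) (j n) (j' n)).Nonempty := by
  filter_upwards [(expGE_card_halves hm hj hj' hlt).pos] with n hn
  rw [← Finset.card_pos]
  exact_mod_cast hn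

/-- `f (f - 1)` grows like `f ^ 2` if `f` grows exponentially. -/
lemma ExpGE.mul_sub_one {f : ℕ → ℝ} {a : ℝ} (hf : ExpGE f a) (ha : 0 < a) :
    ExpGE (fun n => f n * (f n - 1)) (a + a) := by
  have h2 : ∀ᶠ n in atTop, 2 ≤ f n := by
    filter_upwards [hf (a / 2) (by positivity), (tendsto_natCast_atTop_atTop.eventually_ge_atTop
      (2 / a) : ∀ᶠ n : ℕ in atTop, 2 / a ≤ (n : ℝ))] with n h1 h3
    refine le_trans ?_ h1
    calc (2 : ℝ) = 2 ^ (1 : ℝ) := by simp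
      _ ≤ _ := by
        refine Real.rpow_le_rpow_of_exponent_le one_le_two ?_
        rw [div_le_iff₀ ha] at h3
        linarith
  have h3 := (expGE_const (by norm_num : (0 : ℝ) < 1 / 2)).mul (hf.mul hf)
  refine h3.mono ?_ (by linarith)
  filter_upwards [h2] with n hn
  nlinarith

lemma expLE_half_pow {a : ℕ → ℕ} {α : ℝ} (ha : Tendsto (fun n => (a n : ℝ) / n) atTop (𝓝 α)) :
    ExpLE (fun n => (1 / 2 : ℝ) ^ a n) (-α) := by
  refine (expGE_two_pow ha).inv.mono (Eventually.of_forall fun n => ?_) le_rfl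
  rw [one_div, inv_pow]

lemma expGE_half_pow {a : ℕ → ℕ} {α : ℝ} (ha : Tendsto (fun n => (a n : ℝ) / n) atTop (𝓝 α)) :
    ExpGE (fun n => (1 / 2 : ℝ) ^ a n) (-α) := by
  refine ((expLE_two_pow ha).inv (Eventually.of_forall fun _ => by positivity)).mono
    (Eventually.of_forall fun n => ?_) le_rfl
  rw [one_div, inv_pow]

lemma ExpGE.pow {f : ℕ → ℝ} {a : ℝ} (hf : ExpGE f a) (j : ℕ) :
    ExpGE (fun n => f n ^ j) (j * a) := by
  induction j with
  | zero => simpa using expGE_const one_pos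
  | succ j ih =>
    refine (ih.mul hf).mono (Eventually.of_forall fun n => ?_) (le_of_eq ?_)
    · rw [pow_succ]
    · push_cast; ring

variable {R : ℝ} {k t : ℕ → ℕ} {θ : ℕ → Params} {x : RelParams}

lemma gamma₁_eq (R : ℝ) (x : RelParams) : gamma₁ R x =
    max (1 / 2 * ent (1 - R + x.lam) x.π₁) (ent (1 - R + x.lam) x.π₁ - x.lam₁) := by
  rw [gamma₁, ← mul_h_div]; congr 1; ring

lemma gamma₂_eq (R : ℝ) (x : RelParams) : gamma₂ R x =
    2 * ent (1 - R + x.lam) x.π₁ - x.lam₁ - x.lam₂ := by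
  rw [gamma₂, ← mul_h_div]; ring

lemma gamma₃_eq (R : ℝ) (x : RelParams) : gamma₃ R x =
    2 * ent (1 - R + x.lam) x.π₂ - x.lam - x.lam₂ := by
  rw [gamma₃, ← mul_h_div]; ring

lemma rho_eq (R : ℝ) (x : RelParams) : rho R x =
    1 - R - ent x.σ (deltaGV R - x.ν₁ - x.ν₂) - ent (R - x.lam - x.σ) x.ν₁
      - ent (1 - R + x.lam) x.ν₂ := by
  rw [rho, mul_h_div, mul_h_div, mul_h_div]

namespace Regime

lemma createTime_eq (H : Regime R k t θ x) : ∀ᶠ n in atTop, (θ n).createTime n (k n) =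
    𝔼 H : Triple (θ n).ell₁ ((θ n).ell₂ - (θ n).ell₁) ((θ n).ell - (θ n).ell₂) ((θ n).m n (k n)),
      (listSteps (2 * ((θ n).p₁ / 2)) (θ n).p₂ H.1 H.2.1 H.2.2 : ℝ) := by
  filter_upwards [H.valid] with n hn
  rw [Nat.two_mul_div_two_of_even hn.even_p₁]
  rfl

lemma tendsto_q (H : Regime R k t θ x) :
    Tendsto (fun n => (((θ n).p₁ / 2 : ℕ) : ℝ) / n) atTop (𝓝 (x.π₁ / 2)) := tendsto_half H.ratios.π₁

lemma tendsto_ell_diff (H : Regime R k t θ x) :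
    Tendsto (fun n => (((θ n).ell₂ - (θ n).ell₁ : ℕ) : ℝ) / n) atTop (𝓝 (x.lam₂ - x.lam₁)) :=
  tendsto_natCast_sub H.ratios.lam₂ H.ratios.lam₁ (H.valid.mono fun _ h => h.ell₁_le)

lemma tendsto_ell_diff' (H : Regime R k t θ x) :
    Tendsto (fun n => (((θ n).ell - (θ n).ell₂ : ℕ) : ℝ) / n) atTop (𝓝 (x.lam - x.lam₂)) :=
  tendsto_natCast_sub H.ratios.lam H.ratios.lam₂ (H.valid.mono fun _ h => h.ell₂_le)

lemma tendsto_ells (H : Regime R k t θ x) (a b c : ℕ) :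
    Tendsto (fun n => ((a * (θ n).ell₁ + b * ((θ n).ell₂ - (θ n).ell₁)
      + c * ((θ n).ell - (θ n).ell₂) : ℕ) : ℝ) / n) atTop
      (𝓝 (a * x.lam₁ + b * (x.lam₂ - x.lam₁) + c * (x.lam - x.lam₂))) :=
  tendsto_natCast_add (tendsto_natCast_add (tendsto_natCast_mul a H.ratios.lam₁)
    (tendsto_natCast_mul b H.tendsto_ell_diff)) (tendsto_natCast_mul c H.tendsto_ell_diff')

lemma q_lt (H : Regime R k t θ x) : x.π₁ / 2 < (1 - R + x.lam) / 2 := by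
  have := H.π₁_lt; linarith

lemma half_ent (μ a : ℝ) : ent (μ / 2) (a / 2) = 1 / 2 * ent μ a := by
  rw [← ent_mul]; congr 1 <;> ring

lemma expLE_leftList (H : Regime R k t θ x) :
    ExpLE (fun n => ((leftList ((θ n).m n (k n)) ((θ n).p₁ / 2)).card : ℝ))
      (1 / 2 * ent (1 - R + x.lam) x.π₁) := by
  have m1 := tendsto_half H.tendsto_m
  rw [← half_ent]
  refine (expLE_choose m1 H.tendsto_q ((eventually_le_of_tendsto_lt H.tendsto_q m1
    H.q_lt).mono fun _ h => h.le)).mono (Eventually.of_forall fun n => ?_) le_rfl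
  rw [leftList_eq, card_halves]; simp

lemma expGE_leftList (H : Regime R k t θ x) :
    ExpGE (fun n => ((leftList ((θ n).m n (k n)) ((θ n).p₁ / 2)).card : ℝ))
      (1 / 2 * ent (1 - R + x.lam) x.π₁) := by
  have m1 := tendsto_half H.tendsto_m
  rw [← half_ent]
  refine (expGE_choose m1 H.tendsto_q ((eventually_le_of_tendsto_lt H.tendsto_q m1
    H.q_lt).mono fun _ h => h.le)).mono (Eventually.of_forall fun n => ?_) le_rfl
  rw [leftList_eq, card_halves]; simp

lemma expLE_rightList (H : Regime R k t θ x) :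
    ExpLE (fun n => ((rightList ((θ n).m n (k n)) ((θ n).p₁ / 2)).card : ℝ))
      (1 / 2 * ent (1 - R + x.lam) x.π₁) := by
  have m1 := tendsto_half' H.tendsto_m
  rw [← half_ent]
  refine (expLE_choose m1 H.tendsto_q ((eventually_le_of_tendsto_lt H.tendsto_q m1
    H.q_lt).mono fun _ h => h.le)).mono (Eventually.of_forall fun n => ?_) le_rfl
  rw [rightList_eq, card_halves]; simp

lemma expGE_rightList (H : Regime R k t θ x) :
    ExpGE (fun n => ((rightList ((θ n).m n (k n)) ((θ n).p₁ / 2)).card : ℝ))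
      (1 / 2 * ent (1 - R + x.lam) x.π₁) := by
  have m1 := tendsto_half' H.tendsto_m
  rw [← half_ent]
  refine (expGE_choose m1 H.tendsto_q ((eventually_le_of_tendsto_lt H.tendsto_q m1
    H.q_lt).mono fun _ h => h.le)).mono (Eventually.of_forall fun n => ?_) le_rfl
  rw [rightList_eq, card_halves]; simp

lemma q_pos (H : Regime R k t θ x) : ∀ᶠ n in atTop, 0 < (θ n).p₁ / 2 :=
  eventually_pos_of_tendsto H.tendsto_q (by have := H.π₁_pos; linarith) 0

lemma expLE_createTime (H : Regime R k t θ x) :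
    ExpLE (fun n => (θ n).createTime n (k n)) (nu R x) := by
  have hp : ∀ f : ℕ → ℝ, (∀ n, 0 ≤ f n) → ∀ᶠ n in atTop, 0 ≤ f n := fun f hf =>
    Eventually.of_forall hf
  have b3 := (H.expLE_leftList.mul H.expLE_rightList (hp _ fun n => by positivity)
    (hp _ fun n => by positivity)).mul (expLE_half_pow H.ratios.lam₁) (hp _ fun n => by positivity)
    (hp _ fun n => by positivity)
  have c1 := expLE_choose H.tendsto_m H.ratios.π₁
    (H.valid.mono fun n h => h.p₁_le.trans (h.p₂_le.trans h.w₂_le))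
  have c2 := expLE_choose H.tendsto_m H.ratios.π₂ (H.valid.mono fun n h => h.p₂_le.trans h.w₂_le)
  -- The syndrome conditions have exponents 2λ₁ + (λ₂ − λ₁) = λ₁ + λ₂ here and 2λ₁ + 2(λ₂ − λ₁) + (λ
  -- − λ₂) = λ + λ₂ in `b5`.
  have b4 := (c1.mul c1 (hp _ fun n => by positivity) (hp _ fun n => by positivity)).mul
    (expLE_half_pow (H.tendsto_ells 2 1 0)) (hp _ fun n => by positivity)
    (hp _ fun n => by positivity)
  have b5 := (c2.mul c2 (hp _ fun n => by positivity) (hp _ fun n => by positivity)).mul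
    (expLE_half_pow (H.tendsto_ells 2 2 1)) (hp _ fun n => by positivity)
    (hp _ fun n => by positivity)
  have b6 := (expLE_const 12).mul ((((H.expLE_leftList.add H.expLE_rightList).add b3).add b4).add b5)
    (hp _ fun n => by positivity) (hp _ fun n => by positivity)
  refine b6.mono ?_ ?_
  · filter_upwards [H.createTime_eq, H.q_pos, H.valid,
      eventually_pos_of_tendsto H.ratios.π₂ H.π₂_pos 0] with n e1 e2 e3 e4
    rw [e1]
    refine (expect_listSteps_le e2 e4).trans (le_of_eq ?_)
    rw [Nat.two_mul_div_two_of_even e3.even_p₁]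
    ring_nf
  · rw [nu, gamma₁_eq, gamma₂_eq, gamma₃_eq, max_self, zero_add]
    set E := ent (1 - R + x.lam) x.π₁
    refine max_le (max_le (max_le ?_ ?_) ?_) ?_
    · exact le_max_of_le_left (le_max_left _ _)
    · exact le_max_of_le_left (le_max_of_le_right (le_of_eq (by ring)))
    · exact le_max_of_le_right (le_max_of_le_left (le_of_eq (by push_cast; ring)))
    · exact le_max_of_le_right (le_max_of_le_right (le_of_eq (by push_cast; ring)))

/-- The number p₂ is even but need not be divisible by 4. The half weights are 2 ⌊p₂/4⌋ and 2 (p₂/2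
− ⌊p₂/4⌋): both are even, as halving in representations requires, and they sum to p₂. -/
lemma tendsto_j (H : Regime R k t θ x) :
    Tendsto (fun n => (((θ n).p₂ / 4 : ℕ) : ℝ) / n) atTop (𝓝 (x.π₂ / 4)) := by
  simpa using tendsto_natCast_div (c := 4) (by norm_num) H.ratios.π₂

lemma tendsto_j' (H : Regime R k t θ x) :
    Tendsto (fun n => (((θ n).p₂ / 2 - (θ n).p₂ / 4 : ℕ) : ℝ) / n) atTop (𝓝 (x.π₂ / 4)) := by
  have := tendsto_natCast_sub (tendsto_half H.ratios.π₂) H.tendsto_j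
    (Eventually.of_forall fun n => by omega)
  rwa [show x.π₂ / 2 - x.π₂ / 4 = x.π₂ / 4 by ring] at this

lemma two_mul_tendsto {a : ℕ → ℕ} {α : ℝ} (ha : Tendsto (fun n => (a n : ℝ) / n) atTop (𝓝 (α / 4))) :
    Tendsto (fun n => ((2 * a n : ℕ) : ℝ) / n) atTop (𝓝 (α / 2)) := by
  have := tendsto_natCast_mul 2 ha
  rwa [show ((2 : ℕ) : ℝ) * (α / 4) = α / 2 by push_cast; ring] at this

lemma expGE_repCount₁ (H : Regime R k t θ x) :
    ExpGE (fun n => (repCount ((θ n).m n (k n)) ((θ n).p₂ / 4) ((θ n).p₂ / 2 - (θ n).p₂ / 4)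
      ((θ n).p₁ / 2) ((θ n).p₁ / 2) : ℝ)) x.lam₁ := by
  refine (expGE_repCount H.tendsto_m H.tendsto_j H.tendsto_j' H.tendsto_q H.tendsto_q ?_ ?_ ?_
    ?_).mono (Eventually.of_forall fun n => le_rfl) (le_of_eq ?_)
  · filter_upwards [H.valid] with n hn
    have := hn.le_p₁; omega
  · filter_upwards [H.valid] with n hn
    have h1 := hn.le_p₁
    obtain ⟨a, ha⟩ := hn.even_p₁
    obtain ⟨b, hb⟩ := hn.even_p₂
    omega
  · have := H.le_π₁; linarith
  · have := H.rep₁_lt; linarith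
  · rw [H.lam₁_eq]
    congr 1
    · ring
    · congr 1 <;> ring

/-- The factor 2 compensates for rounding down the logarithm in the definition of ℓ₁. -/
lemma repCount₁_le (H : Regime R k t θ x) : ∀ᶠ n in atTop,
    (repCount ((θ n).m n (k n)) ((θ n).p₂ / 4) ((θ n).p₂ / 2 - (θ n).p₂ / 4)
      ((θ n).p₁ / 2) ((θ n).p₁ / 2) : ℝ) ≤ 2 * 2 ^ (θ n).ell₁ := by
  filter_upwards [H.valid, halves_nonempty H.tendsto_m (two_mul_tendsto H.tendsto_j)
    (two_mul_tendsto H.tendsto_j') (by have := H.π₂_lt_mu; linarith)] with n hn hne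
  obtain ⟨a, ha⟩ := hn.even_p₁
  obtain ⟨b, hb⟩ := hn.even_p₂
  have h1 := hn.le_p₁
  have h2 := repCount_le (q := (θ n).p₁ / 2) hne (q' := (θ n).p₁ / 2) (by omega) (by omega)
  have h3 := Nat.lt_pow_succ_log_self (b := 2) (by norm_num)
    ((θ n).p₂.choose ((θ n).p₂ / 2) *
      ((θ n).m n (k n) - (θ n).p₂).choose ((θ n).p₁ - (θ n).p₂ / 2))
  rw [← hn.ell₁_eq] at h3
  rw [show (θ n).p₂ / 4 + ((θ n).p₂ / 2 - (θ n).p₂ / 4) = (θ n).p₂ / 2 by omega,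
    Nat.two_mul_div_two_of_even hn.even_p₂,
    show (θ n).p₁ / 2 + (θ n).p₁ / 2 - (θ n).p₂ / 2 = (θ n).p₁ - (θ n).p₂ / 2 by omega] at h2
  have h4 := h2.trans h3.le
  rw [pow_succ, mul_comm] at h4
  exact_mod_cast h4

lemma expGE_createTime (H : Regime R k t θ x) :
    ExpGE (fun n => (θ n).createTime n (k n)) (nu R x) := by
  have hE1 : 0 < ent (1 - R + x.lam) x.π₁ := ent_pos H.π₁_pos H.π₁_lt
  have hE2 : 0 < ent (1 - R + x.lam) x.π₂ := ent_pos H.π₂_pos H.π₂_lt_mu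
  have g0 : ExpGE (fun n => (θ n).createTime n (k n)) (1 / 2 * ent (1 - R + x.lam) x.π₁) := by
    refine H.expGE_leftList.mono ?_ le_rfl
    filter_upwards [H.createTime_eq] with n e1
    rw [e1]
    exact le_expect_listSteps_left
  have g1 : ExpGE (fun n => (θ n).createTime n (k n)) (ent (1 - R + x.lam) x.π₁ - x.lam₁) := by
    refine ((H.expGE_leftList.mul H.expGE_rightList).mul (expGE_half_pow H.ratios.lam₁)).mono ?_
      (by linarith)
    filter_upwards [H.createTime_eq, H.q_pos] with n e1 e2
    rw [e1, ← expect_collisions_zero (a₂ := (θ n).ell₂ - (θ n).ell₁) (a₃ := (θ n).ell - (θ n).ell₂) e2]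
    exact expect_le_expect_listSteps fun H => Or.inl rfl
  have g2 : ExpGE (fun n => (θ n).createTime n (k n))
      (2 * ent (1 - R + x.lam) x.π₁ - x.lam₁ - x.lam₂) := by
    have hh := expGE_card_halves H.tendsto_m H.tendsto_q H.tendsto_q H.q_lt
    rw [mul_div_cancel₀ _ two_ne_zero] at hh
    refine ((hh.mul_sub_one hE1).mul (expGE_half_pow (H.tendsto_ells 2 1 0))).mono ?_
      (by push_cast; linarith)
    filter_upwards [H.createTime_eq, H.q_pos] with n e1 e2
    have := le_expect_collisions_one (m := (θ n).m n (k n)) (a₁ := (θ n).ell₁)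
      (a₂ := (θ n).ell₂ - (θ n).ell₁) (a₃ := (θ n).ell - (θ n).ell₂) e2
    rw [e1]
    rw [one_mul, zero_mul, add_zero]
    exact this.trans (expect_le_expect_listSteps fun H => Or.inr (Or.inl rfl))
  have g3 : ExpGE (fun n => (θ n).createTime n (k n))
      (2 * ent (1 - R + x.lam) x.π₂ - x.lam - x.lam₂) := by
    have hh := expGE_card_halves H.tendsto_m (two_mul_tendsto H.tendsto_j)
      (two_mul_tendsto H.tendsto_j') (by have := H.π₂_lt_mu; linarith)
    rw [mul_div_cancel₀ _ two_ne_zero] at hh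
    -- The fourth power contributes 4λ₁ and the probability −(6λ₁ + 2(λ₂ − λ₁) + (λ − λ₂)). The sum
    -- is −(λ + λ₂), the exponent of the first moment.
    refine ((hh.mul_sub_one hE2).mul ((H.expGE_repCount₁.pow 4).mul ((expGE_half_pow
      (H.tendsto_ells 6 2 1)).mul (expGE_const (by norm_num : (0 : ℝ) < 1 / 36720))))).mono ?_
      (by push_cast; linarith)
    filter_upwards [H.createTime_eq, H.valid, H.repCount₁_le,
      eventually_pos_of_tendsto H.tendsto_j (by have := H.π₂_pos; linarith) 0] with n e1 hn e3 e4
    obtain ⟨a, ha⟩ := hn.even_p₁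
    obtain ⟨b, hb⟩ := hn.even_p₂
    have h1 := hn.le_p₁
    have := le_expect_collisions_two (a₂ := (θ n).ell₂ - (θ n).ell₁) (a₃ := (θ n).ell - (θ n).ell₂)
      (p₂ := (θ n).p₂) e4 (by omega : (θ n).p₂ / 4 ≤ (θ n).p₁ / 2)
      (by omega : (θ n).p₂ / 2 - (θ n).p₂ / 4 ≤ (θ n).p₁ / 2) (by omega) e3
    rw [e1]
    refine le_trans (le_of_eq ?_)
      (this.trans (expect_le_expect_listSteps fun H => Or.inr (Or.inr rfl)))
    ring_nf
  rw [nu, gamma₁_eq, gamma₂_eq, gamma₃_eq]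
  refine (ExpGE.max (ExpGE.max g0 g1 (Eventually.of_forall fun _ => le_rfl)
    (Eventually.of_forall fun _ => le_rfl)) (ExpGE.max g2 g3 (Eventually.of_forall fun _ => le_rfl)
    (Eventually.of_forall fun _ => le_rfl)) (Eventually.of_forall fun _ => le_rfl)
    (Eventually.of_forall fun _ => le_rfl))

end Regime

end family

/-! ### Growth rate of the number of parity-checks. -/

section family

variable {R : ℝ} {k t : ℕ → ℕ} {θ : ℕ → Params} {x : RelParams}

namespace Regime

lemma numChecks_eq (H : Regime R k t θ x) : ∀ᶠ n in atTop, (θ n).numChecks n (k n) =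
    (((θ n).r (k n)).choose (θ n).w₁ : ℝ) / 2 ^ (θ n).r (k n) *
    𝔼 H : Triple (θ n).ell₁ ((θ n).ell₂ - (θ n).ell₁) ((θ n).ell - (θ n).ell₂) ((θ n).m n (k n)),
      ((list₃ (2 * ((θ n).p₁ / 2)) (θ n).p₂ (θ n).w₂ H.1 H.2.1 H.2.2).card : ℝ) := by
  filter_upwards [H.valid, eventually_pos_of_tendsto H.ratios.ω₂ H.ω₂_pos 0] with n hn h0
  rw [← expect_createdChecks (s := (θ n).s) h0, Nat.two_mul_div_two_of_even hn.even_p₁]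
  rfl

lemma tendsto_w₁ (H : Regime R k t θ x) :
    Tendsto (fun n => ((θ n).w₁ : ℝ) / n) atTop (𝓝 ((R - x.lam - x.σ) / 2)) := by
  refine (H.tendsto_r.div_const 2).congr' ?_
  filter_upwards [H.valid] with n hn
  rw [← hn.w₁_eq]; push_cast; ring

lemma ω₁_eq (H : Regime R k t θ x) : x.ω₁ = (R - x.lam - x.σ) / 2 :=
  tendsto_nhds_unique H.ratios.ω₁ H.tendsto_w₁

lemma expLE_numChecks (H : Regime R k t θ x) :
    ExpLE (fun n => (θ n).numChecks n (k n)) (ent (1 - R + x.lam) x.ω₂ - x.lam) := by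
  have hp : ∀ f : ℕ → ℝ, (∀ n, 0 ≤ f n) → ∀ᶠ n in atTop, 0 ≤ f n := fun f hf =>
    Eventually.of_forall hf
  have c1 := expLE_choose H.tendsto_m H.ratios.ω₂ (H.valid.mono fun n h => h.w₂_le)
  refine (c1.mul (expLE_half_pow (H.tendsto_ells 1 1 1)) (hp _ fun n => by positivity)
    (hp _ fun n => by positivity)).mono ?_ (le_of_eq (by push_cast; ring))
  filter_upwards [H.numChecks_eq, eventually_pos_of_tendsto H.ratios.ω₂ H.ω₂_pos 0] with n e1 e2
  rw [e1, one_mul, one_mul, one_mul]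
  refine le_trans (mul_le_of_le_one_left ?_ ?_) (expect_list₃_le e2)
  · exact Finset.expect_nonneg fun _ _ => by positivity
  · rw [div_le_one (by positivity)]
    exact_mod_cast Nat.choose_le_two_pow _ _

/-- The minimum guards against rounding when w₂ is close to 2 p₂: a word with first half weight 2 i
must be a sum of two words with first half weight 2 ⌊p₂/4⌋, so i cannot exceed the latter. -/
lemma tendsto_i (H : Regime R k t θ x) :
    Tendsto (fun n => ((min ((θ n).w₂ / 4) (2 * ((θ n).p₂ / 4)) : ℕ) : ℝ) / n) atTop
      (𝓝 (x.ω₂ / 4)) := by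
  have h1 : Tendsto (fun n => (((θ n).w₂ / 4 : ℕ) : ℝ) / n) atTop (𝓝 (x.ω₂ / 4)) := by
    simpa using tendsto_natCast_div (c := 4) (by norm_num) H.ratios.ω₂
  have := tendsto_min h1 (two_mul_tendsto H.tendsto_j)
  rwa [min_eq_left (by have := H.le_π₂; linarith)] at this

lemma tendsto_i' (H : Regime R k t θ x) :
    Tendsto (fun n => (((θ n).w₂ / 2 - min ((θ n).w₂ / 4) (2 * ((θ n).p₂ / 4)) : ℕ) : ℝ) / n) atTop
      (𝓝 (x.ω₂ / 4)) := by
  have := tendsto_natCast_sub (tendsto_half H.ratios.ω₂) H.tendsto_i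
    (Eventually.of_forall fun n => by omega)
  rwa [show x.ω₂ / 2 - x.ω₂ / 4 = x.ω₂ / 4 by ring] at this

lemma splitting_le (H : Regime R k t θ x) : ∀ᶠ n in atTop,
    min ((θ n).w₂ / 4) (2 * ((θ n).p₂ / 4)) ≤ 2 * ((θ n).p₂ / 4) ∧
    (θ n).w₂ / 2 - min ((θ n).w₂ / 4) (2 * ((θ n).p₂ / 4)) ≤
      2 * ((θ n).p₂ / 2 - (θ n).p₂ / 4) := by
  filter_upwards [H.valid] with n hn
  have h1 := hn.le_p₂
  obtain ⟨a, ha⟩ := hn.even_w₂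
  obtain ⟨b, hb⟩ := hn.even_p₂
  omega

lemma expGE_repCount₂ (H : Regime R k t θ x) :
    ExpGE (fun n => (repCount ((θ n).m n (k n)) (min ((θ n).w₂ / 4) (2 * ((θ n).p₂ / 4)))
      ((θ n).w₂ / 2 - min ((θ n).w₂ / 4) (2 * ((θ n).p₂ / 4)))
      (2 * ((θ n).p₂ / 4)) (2 * ((θ n).p₂ / 2 - (θ n).p₂ / 4)) : ℝ)) x.lam₂ := by
  refine (expGE_repCount H.tendsto_m H.tendsto_i H.tendsto_i' (two_mul_tendsto H.tendsto_j)
    (two_mul_tendsto H.tendsto_j') (H.splitting_le.mono fun _ h => h.1)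
    (H.splitting_le.mono fun _ h => h.2) ?_ ?_).mono (Eventually.of_forall fun n => le_rfl)
    (le_of_eq ?_)
  · have := H.le_π₂; linarith
  · have := H.rep₂_lt; linarith
  · rw [H.lam₂_eq]
    congr 1
    · ring
    · congr 1 <;> ring

lemma repCount₂_le (H : Regime R k t θ x) : ∀ᶠ n in atTop,
    (repCount ((θ n).m n (k n)) (min ((θ n).w₂ / 4) (2 * ((θ n).p₂ / 4)))
      ((θ n).w₂ / 2 - min ((θ n).w₂ / 4) (2 * ((θ n).p₂ / 4)))
      (2 * ((θ n).p₂ / 4)) (2 * ((θ n).p₂ / 2 - (θ n).p₂ / 4)) : ℝ) ≤ 2 * 2 ^ (θ n).ell₂ := by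
  filter_upwards [H.valid, H.splitting_le, halves_nonempty H.tendsto_m
    (two_mul_tendsto H.tendsto_i) (two_mul_tendsto H.tendsto_i')
    (by have := H.ω₂_lt_mu; linarith)] with n hn hs hne
  obtain ⟨a, ha⟩ := hn.even_p₂
  have h2 := repCount_le (q := 2 * ((θ n).p₂ / 4)) hne (q' := 2 * ((θ n).p₂ / 2 - (θ n).p₂ / 4))
    hs.1 hs.2
  have h3 := Nat.lt_pow_succ_log_self (b := 2) (by norm_num)
    ((θ n).w₂.choose ((θ n).w₂ / 2) *
      ((θ n).m n (k n) - (θ n).w₂).choose ((θ n).p₂ - (θ n).w₂ / 2))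
  rw [← hn.ell₂_eq] at h3
  rw [show min ((θ n).w₂ / 4) (2 * ((θ n).p₂ / 4)) +
      ((θ n).w₂ / 2 - min ((θ n).w₂ / 4) (2 * ((θ n).p₂ / 4))) = (θ n).w₂ / 2 by omega,
    Nat.two_mul_div_two_of_even hn.even_w₂,
    show 2 * ((θ n).p₂ / 4) + 2 * ((θ n).p₂ / 2 - (θ n).p₂ / 4) - (θ n).w₂ / 2 =
      (θ n).p₂ - (θ n).w₂ / 2 by omega] at h2
  have h4 := h2.trans h3.le
  rw [pow_succ'] at h4
  exact_mod_cast h4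

lemma expGE_numChecks (H : Regime R k t θ x) :
    ExpGE (fun n => (θ n).numChecks n (k n)) (ent (1 - R + x.lam) x.ω₂ - x.lam) := by
  have hh := expGE_card_halves H.tendsto_m (two_mul_tendsto H.tendsto_i)
      (two_mul_tendsto H.tendsto_i') (by have := H.ω₂_lt_mu; linarith)
  rw [mul_div_cancel₀ _ two_ne_zero] at hh
  have c0 := (expGE_choose H.tendsto_r H.tendsto_w₁ (H.valid.mono fun n h => by
    have := h.w₁_eq; omega)).mul (expGE_half_pow H.tendsto_r)
  rw [ent_half, add_neg_cancel] at c0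
  -- The exponents are 2 (λ₂ + 4λ₁) from the representations and −(11λ₁ + 3(λ₂ − λ₁) + (λ − λ₂))
  -- from the probability, in total −λ.
  have c1 := hh.mul ((((H.expGE_repCount₂.mul (H.expGE_repCount₁.pow 4)).pow 2).mul
    (expGE_half_pow (H.tendsto_ells 11 3 1))).mul
    (expGE_const (by norm_num : (0 : ℝ) < 1 / 36720 ^ 2 / 24)))
  refine (c0.mul c1).mono ?_ (by push_cast; linarith)
  filter_upwards [H.numChecks_eq, H.valid, H.repCount₁_le, H.repCount₂_le, H.splitting_le,
    eventually_pos_of_tendsto H.tendsto_j (by have := H.π₂_pos; linarith) 0,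
    eventually_pos_of_tendsto H.tendsto_i (by have := H.ω₂_pos; linarith) 0]
    with n e1 hn e3 e4 e5 e6 e7
  obtain ⟨a, ha⟩ := hn.even_p₁
  obtain ⟨b, hb⟩ := hn.even_p₂
  obtain ⟨c, hc⟩ := hn.even_w₂
  have h1 := hn.le_p₁
  have := le_expect_list₃ (a₂ := (θ n).ell₂ - (θ n).ell₁) (a₃ := (θ n).ell - (θ n).ell₂)
    (p₂ := (θ n).p₂) (w := (θ n).w₂) e7 e5.1 e5.2 e6 (by omega : (θ n).p₂ / 4 ≤ (θ n).p₁ / 2)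
    (by omega : (θ n).p₂ / 2 - (θ n).p₂ / 4 ≤ (θ n).p₁ / 2) (by omega) (by omega) e3
    (by rwa [Nat.add_sub_cancel' hn.ell₁_le])
  rw [e1]
  refine mul_le_mul (le_of_eq ?_) (le_trans (le_of_eq ?_) this) (by positivity) (by positivity)
  · rw [one_div, inv_pow]; rfl
  · ring_nf

end Regime

/-! ### The probability of a successful bet -/

/-- The set 𝒩₁ is chosen first; whichever it is, the numbers of free positions inside and outside E
are the same, so the number of choices for 𝒩₂ is constant. -/
lemma card_splitting_success {n : ℕ} (E : Finset (Fin n)) {r m u₁ u₂ : ℕ} (hu₁ : u₁ ≤ r)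
    (hu₂ : u₂ ≤ m) :
    (Finset.univ.filter fun N : Finset (Fin n) × Finset (Fin n) =>
      (Disjoint N.1 N.2 ∧ N.1.card = r ∧ N.2.card = m) ∧
      (N.1.filter fun i => i ∈ E).card = u₁ ∧ (N.2.filter fun i => i ∈ E).card = u₂).card =
    (E.card.choose u₁ * (n - E.card).choose (r - u₁)) *
      ((E.card - u₁).choose u₂ * (n - E.card - (r - u₁)).choose (m - u₂)) := by
  classical
  have hcompl : (Finset.univ.filter fun i : Fin n => i ∉ E).card = n - E.card := by
    have : (Finset.univ.filter fun i : Fin n => i ∉ E) = Eᶜ := by ext; simp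
    rw [this, Finset.card_compl, Fintype.card_fin]
  have hA : (Finset.univ.filter fun A : Finset (Fin n) =>
      A.card = r ∧ (A.filter fun i => i ∈ E).card = u₁).card =
      E.card.choose u₁ * (n - E.card).choose (r - u₁) := by
    have h := card_finsets_blocks (fun i : Fin n => decide (i ∈ E)) (fun b => cond b u₁ (r - u₁))
    rw [Fintype.prod_bool] at h
    simp only [Bool.forall_bool, decide_eq_true_eq, decide_eq_false_iff_not, cond_true, cond_false,
      Finset.filter_univ_mem] at h
    rw [hcompl] at h
    rw [← h]
    congr 1
    ext A
    simp only [Finset.mem_filter, Finset.mem_univ, true_and]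
    have := Finset.card_filter_add_card_filter_not (s := A) (fun i => i ∈ E)
    omega
  have hB : ∀ A : Finset (Fin n), A.card = r → (A.filter fun i => i ∈ E).card = u₁ →
      (Finset.univ.filter fun B : Finset (Fin n) =>
        Disjoint A B ∧ B.card = m ∧ (B.filter fun i => i ∈ E).card = u₂).card =
      (E.card - u₁).choose u₂ * (n - E.card - (r - u₁)).choose (m - u₂) := by
    intro A hAr hAu
    have h := card_finsets_blocks
      (fun i : Fin n => if i ∈ A then (0 : Fin 3) else if i ∈ E then 1 else 2) ![0, u₂, m - u₂]
    rw [Fin.prod_univ_three] at h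
    have q0 : ∀ i, ((if i ∈ A then (0 : Fin 3) else if i ∈ E then 1 else 2) = 0) ↔ i ∈ A := by
      intro i; split_ifs <;> simp_all
    have q1 : ∀ i, ((if i ∈ A then (0 : Fin 3) else if i ∈ E then 1 else 2) = 1) ↔
        i ∉ A ∧ i ∈ E := by
      intro i; split_ifs <;> simp_all
    have q2 : ∀ i, ((if i ∈ A then (0 : Fin 3) else if i ∈ E then 1 else 2) = 2) ↔
        i ∉ A ∧ i ∉ E := by
      intro i; split_ifs <;> simp_all
    simp only [Fin.forall_fin_succ, Fin.succ_zero_eq_one, Fin.succ_one_eq_two, q0, q1, q2,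
      Matrix.cons_val_zero, Matrix.cons_val_one, Matrix.cons_val_two, Nat.choose_zero_right,
      one_mul, IsEmpty.forall_iff, and_true] at h
    have k1 : (Finset.univ.filter fun i : Fin n => i ∉ A ∧ i ∈ E).card = E.card - u₁ := by
      have e : (Finset.univ.filter fun i : Fin n => i ∉ A ∧ i ∈ E) = E \ (A.filter fun i => i ∈ E) := by
        ext i; simp only [Finset.mem_filter, Finset.mem_univ, true_and, Finset.mem_sdiff]; tauto
      rw [e, Finset.card_sdiff_of_subset (by intro i hi; exact (Finset.mem_filter.1 hi).2), hAu]
    have k2 : (Finset.univ.filter fun i : Fin n => i ∉ A ∧ i ∉ E).card = n - E.card - (r - u₁) := by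
      have e : (Finset.univ.filter fun i : Fin n => i ∉ A ∧ i ∉ E) =
          (Finset.univ.filter fun i : Fin n => i ∉ E) \ (A.filter fun i => i ∉ E) := by
        ext i; simp only [Finset.mem_filter, Finset.mem_univ, true_and, Finset.mem_sdiff]; tauto
      have := Finset.card_filter_add_card_filter_not (s := A) (fun i => i ∈ E)
      rw [e, Finset.card_sdiff_of_subset (by
        intro i hi; simpa using (Finset.mem_filter.1 hi).2), hcompl]
      omega
    have k3 : Matrix.vecHead (Matrix.vecTail ![u₂, m - u₂]) = m - u₂ := rfl
    rw [k1, k2, k3] at h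
    rw [← h]
    congr 1
    ext B
    simp only [Finset.mem_filter, Finset.mem_univ, true_and, Finset.card_eq_zero]
    have f1 : B.filter (fun i => i ∈ A) = ∅ ↔ Disjoint A B := by
      rw [Finset.filter_eq_empty_iff, Finset.disjoint_left]
      exact ⟨fun h i hA hB => h hB hA, fun h i hB hA => h hA hB⟩
    rw [f1]
    refine and_congr_right fun hd => ?_
    have hd' : ∀ i ∈ B, i ∉ A := fun i hB hA => Finset.disjoint_left.1 hd hA hB
    have f2 : B.filter (fun i => i ∉ A ∧ i ∈ E) = B.filter fun i => i ∈ E :=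
      Finset.filter_congr fun i hi => by simp [hd' i hi]
    have f3 : B.filter (fun i => i ∉ A ∧ i ∉ E) = B.filter fun i => ¬ i ∈ E :=
      Finset.filter_congr fun i hi => by simp [hd' i hi]
    rw [f2, f3]
    have := Finset.card_filter_add_card_filter_not (s := B) (fun i => i ∈ E)
    omega
  rw [← hA]
  set SA := Finset.univ.filter fun A : Finset (Fin n) =>
      A.card = r ∧ (A.filter fun i => i ∈ E).card = u₁ with hSA
  have hsig : (Finset.univ.filter fun N : Finset (Fin n) × Finset (Fin n) =>
      (Disjoint N.1 N.2 ∧ N.1.card = r ∧ N.2.card = m) ∧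
      (N.1.filter fun i => i ∈ E).card = u₁ ∧ (N.2.filter fun i => i ∈ E).card = u₂).card =
      ∑ A ∈ SA, (Finset.univ.filter fun B : Finset (Fin n) =>
        Disjoint A B ∧ B.card = m ∧ (B.filter fun i => i ∈ E).card = u₂).card := by
    rw [← Finset.card_sigma]
    refine Finset.card_bij (fun N _ => ⟨N.1, N.2⟩) ?_ ?_ ?_
    · rintro ⟨A, B⟩ h
      simp only [Finset.mem_filter, Finset.mem_univ, true_and] at h
      simp only [Finset.mem_sigma, hSA, Finset.mem_filter, Finset.mem_univ, true_and]
      tauto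
    · rintro ⟨A, B⟩ _ ⟨A', B'⟩ _ h
      simpa using h
    · rintro ⟨A, B⟩ h
      simp only [Finset.mem_sigma, hSA, Finset.mem_filter, Finset.mem_univ, true_and] at h
      exact ⟨(A, B), by simp only [Finset.mem_filter, Finset.mem_univ, true_and]; tauto, rfl⟩
  rw [hsig, Finset.sum_congr rfl (fun A hA => hB A (Finset.mem_filter.1 hA).2.1
    (Finset.mem_filter.1 hA).2.2), Finset.sum_const, smul_eq_mul]

lemma succProb_eq {θ : Params} {n k : ℕ} {e : Word n} (hv : θ.Valid n k (hammingNorm e)) :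
    θ.succProb n k e =
      ((hammingNorm e).choose θ.u₁ : ℝ) * (n - hammingNorm e).choose (θ.r k - θ.u₁) *
      ((hammingNorm e - θ.u₁).choose θ.u₂ *
        (n - hammingNorm e - (θ.r k - θ.u₁)).choose (θ.m n k - θ.u₂)) *
      ((n.choose (θ.r k) : ℝ)⁻¹ * ((n - θ.r k).choose (θ.m n k) : ℝ)⁻¹) := by
  classical
  have h1 := card_splitting_success (Finset.univ.filter fun i => e i ≠ 0) hv.u₁_le hv.u₂_le
  -- For an empty error the same formula counts all splittings.
  have h2 := card_splitting_success (∅ : Finset (Fin n)) (Nat.zero_le (θ.r k))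
    (Nat.zero_le (θ.m n k))
  have hc : (Finset.univ.filter fun i => e i ≠ 0).card = hammingNorm e := rfl
  rw [hc] at h1
  simp only [Finset.mem_filter, Finset.mem_univ, true_and] at h1
  simp only [Finset.notMem_empty, Finset.filter_false, Finset.card_empty, and_true, Nat.sub_zero,
    Nat.choose_zero_right, one_mul] at h2
  rw [Params.succProb, Params.splittings, Finset.filter_filter, h1, h2]
  push_cast
  rw [div_eq_mul_inv, mul_inv]

/-- The two ways of counting the splittings agree. -/
lemma ent_split (τ ν₁ ν₂ ϱ μ : ℝ) :
    ent τ ν₁ + ent (1 - τ) (ϱ - ν₁) + (ent (τ - ν₁) ν₂ + ent (1 - τ - (ϱ - ν₁)) (μ - ν₂)) +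
      (-ent 1 ϱ + -ent (1 - ϱ) μ) =
    ent ϱ ν₁ + ent μ ν₂ + ent (1 - ϱ - μ) (τ - ν₁ - ν₂) - ent 1 τ := by
  simp only [ent]
  have e1 : 1 - τ - (ϱ - ν₁) - (μ - ν₂) = 1 - ϱ - μ - (τ - ν₁ - ν₂) := by ring
  rw [e1]
  ring

section

variable {e : ∀ n, Word n}

lemma Regime.exponent_succProb (H : Regime R k (fun n => hammingNorm (e n)) θ x) :
    ExpLE (fun n => (θ n).succProb n (k n) (e n)) (-rho R x) ∧
    ExpGE (fun n => (θ n).succProb n (k n) (e n)) (-rho R x) := by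
  have hp : ∀ f : ℕ → ℝ, (∀ n, 0 ≤ f n) → ∀ᶠ n in atTop, 0 ≤ f n := fun f hf =>
    Eventually.of_forall hf
  have htn : ∀ᶠ n in atTop, hammingNorm (e n) ≤ n := Eventually.of_forall fun n => by
    simpa using hammingNorm_le_card_fintype (x := e n)
  have c1 : ∀ᶠ n in atTop, (θ n).u₁ ≤ hammingNorm (e n) :=
    H.valid.mono fun n h => by have := h.u_le; omega
  have hrm : ∀ᶠ n in atTop, (θ n).r (k n) + (θ n).m n (k n) + (θ n).s = n :=
    H.valid.mono fun n h => by
      have := h.s_le; have := h.k_le; unfold Params.r Params.m; omega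
  have c2 : ∀ᶠ n in atTop, (θ n).r (k n) - (θ n).u₁ ≤ n - hammingNorm (e n) := by
    filter_upwards [H.valid, hrm, htn] with n h h2 h3
    have := h.u_le; have := h.le_u; have := h.u₁_le; have := h.u₂_le; omega
  have c3 : ∀ᶠ n in atTop, (θ n).u₂ ≤ hammingNorm (e n) - (θ n).u₁ :=
    H.valid.mono fun n h => by have := h.u_le; omega
  have c4 : ∀ᶠ n in atTop, (θ n).m n (k n) - (θ n).u₂ ≤
      n - hammingNorm (e n) - ((θ n).r (k n) - (θ n).u₁) := by
    filter_upwards [H.valid, hrm, htn] with n h h2 h3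
    have := h.u_le; have := h.le_u; have := h.u₁_le; have := h.u₂_le; omega
  have c5 : ∀ᶠ n in atTop, (θ n).r (k n) ≤ n := hrm.mono fun n h => by omega
  have c6 : ∀ᶠ n in atTop, (θ n).m n (k n) ≤ n - (θ n).r (k n) := hrm.mono fun n h => by omega
  have hu1 := H.valid.mono fun n h => h.u₁_le
  have hu2 := H.valid.mono fun n h => h.u₂_le
  have t1 := tendsto_natCast_sub tendsto_self_div H.tendsto_t htn
  have t2 := tendsto_natCast_sub H.tendsto_r H.ratios.ν₁ hu1
  have t3 := tendsto_natCast_sub H.tendsto_t H.ratios.ν₁ c1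
  have t4 := tendsto_natCast_sub t1 t2 c2
  have t5 := tendsto_natCast_sub H.tendsto_m H.ratios.ν₂ hu2
  have t6 := tendsto_natCast_sub tendsto_self_div H.tendsto_r c5
  have hexp := ent_split (deltaGV R) x.ν₁ x.ν₂ (R - x.lam - x.σ) (1 - R + x.lam)
  rw [show 1 - (R - x.lam - x.σ) - (1 - R + x.lam) = x.σ by ring, ent_one (deltaGV R),
    (deltaGV_spec H.R_pos H.R_lt).1] at hexp
  have hrho : ent (R - x.lam - x.σ) x.ν₁ + ent (1 - R + x.lam) x.ν₂ +
      ent x.σ (deltaGV R - x.ν₁ - x.ν₂) - (1 - R) = -rho R x := by rw [rho_eq]; ring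
  rw [hrho] at hexp
  constructor
  · rw [← hexp]
    refine ExpLE.mono ((((expLE_choose H.tendsto_t H.ratios.ν₁ c1).mul (expLE_choose t1 t2 c2)
      (hp _ fun n => by positivity) (hp _ fun n => by positivity)).mul
      ((expLE_choose t3 H.ratios.ν₂ c3).mul (expLE_choose t4 t5 c4)
      (hp _ fun n => by positivity) (hp _ fun n => by positivity))
      (hp _ fun n => by positivity) (hp _ fun n => by positivity)).mul
      ((expGE_choose tendsto_self_div H.tendsto_r c5).inv.mul
        (expGE_choose t6 H.tendsto_m c6).inv (hp _ fun n => by positivity)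
        (hp _ fun n => by positivity)) (hp _ fun n => by positivity) (hp _ fun n => by positivity))
      ?_ le_rfl
    filter_upwards [H.valid] with n hn
    rw [succProb_eq hn]
  · rw [← hexp]
    refine ExpGE.mono (((expGE_choose H.tendsto_t H.ratios.ν₁ c1).mul (expGE_choose t1 t2 c2)).mul
      ((expGE_choose t3 H.ratios.ν₂ c3).mul (expGE_choose t4 t5 c4)) |>.mul
      (((expLE_choose tendsto_self_div H.tendsto_r c5).inv (eventually_choose_pos c5)).mul
        ((expLE_choose t6 H.tendsto_m c6).inv (eventually_choose_pos c6))))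
      ?_ le_rfl
    filter_upwards [H.valid] with n hn
    rw [succProb_eq hn]

end

end family

/-! ### The feasible region -/

section feasible

/-- The entropy is not positive at arguments ≥ 1. So λ₁ > π₂ and λ₂ > ω₂ force strict inequalities
between the weights, although the region states only weak ones. -/
lemma lt_of_ent_pos {a b : ℝ} (ha : 0 < a) (hb : 0 ≤ b) (h0 : 0 < ent a b) : 0 < b ∧ b < a := by
  constructor
  · refine lt_of_le_of_ne hb fun h => ?_
    rw [← h] at h0; simp at h0
  · by_contra! hcon
    rw [← mul_h_div] at h0
    have h1 := pos_of_mul_pos_right h0 ha.le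
    have h2 : 1 ≤ b / a := (one_le_div ha).2 hcon
    have h3 : Real.binEntropy (b / a) ≤ 0 := by
      rcases h2.eq_or_lt with h | h
      · rw [← h]; simp
      · exact (Real.binEntropy_neg_of_one_lt h).le
    rw [h] at h1
    have := div_nonpos_of_nonpos_of_nonneg h3 log_two_pos.le
    linarith

lemma ent_lt_ent_left {a a' b : ℝ} (hb : 0 < b) (hba : b ≤ a) (haa : a < a') :
    ent a b < ent a' b := by
  have ha : 0 < a := hb.trans_le hba
  have ha' : 0 < a' := ha.trans haa
  rw [← mul_h_div, ← mul_h_div]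
  have hs := Real.strictConcave_binEntropy.2 (x := b / a) (y := 0)
    ⟨by positivity, (div_le_one ha).2 hba⟩ ⟨le_rfl, zero_le_one⟩ (by positivity)
    (by positivity : 0 < a / a') (by rw [sub_pos, div_lt_one ha']; exact haa : 0 < 1 - a / a')
    (by ring)
  simp only [smul_eq_mul, mul_zero, add_zero, Real.binEntropy_zero] at hs
  have e : a / a' * (b / a) = b / a' := by field_simp
  rw [e] at hs
  rw [h, h, ← mul_div_assoc, ← mul_div_assoc]
  refine div_lt_div_of_pos_right ?_ log_two_pos
  calc a * Real.binEntropy (b / a) = a' * (a / a' * Real.binEntropy (b / a)) := by field_simp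
    _ < _ := by gcongr

lemma ent_le_ent_left {a a' b : ℝ} (hb : 0 ≤ b) (hba : b ≤ a) (haa : a ≤ a') :
    ent a b ≤ ent a' b := by
  have := ent_add_le hb hba le_rfl (sub_nonneg.2 haa)
  simpa using this

/-- All constraints of the region but the one on the number of samples. -/
structure Feasible (R : ℝ) (x : RelParams) : Prop where
  σ_nonneg : 0 ≤ x.σ
  ν₁_nonneg : 0 ≤ x.ν₁
  ν₂_nonneg : 0 ≤ x.ν₂
  σ_le : x.σ ≤ R - x.lam
  lam₁_le : x.lam₁ ≤ x.lam₂
  lam₂_le : x.lam₂ ≤ x.lam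
  π₁_le : x.π₁ ≤ x.π₂
  π₂_le : x.π₂ ≤ x.ω₂
  ν₁_le : x.ν₁ ≤ R - x.lam - x.σ
  le_ν : deltaGV R - x.σ ≤ x.ν₁ + x.ν₂
  ν_le : x.ν₁ + x.ν₂ ≤ deltaGV R
  lt_π₁ : x.π₂ < 2 * x.π₁
  lt_π₂ : x.ω₂ < 2 * x.π₂
  rep₁_lt : x.π₁ + x.π₂ / 2 < 1 - R + x.lam
  rep₂_lt : x.π₂ + x.ω₂ / 2 < 1 - R + x.lam
  ω₁_eq : x.ω₁ = (R - x.lam - x.σ) / 2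
  lam₁_eq : x.lam₁ = x.π₂ + ent (1 - R + x.lam - x.π₂) (x.π₁ - x.π₂ / 2)
  lam₂_eq : x.lam₂ = x.ω₂ + ent (1 - R + x.lam - x.ω₂) (x.π₂ - x.ω₂ / 2)

/-- Exponent of the number of samples relative to the number that is needed. -/
noncomputable def slack (R : ℝ) (x : RelParams) : ℝ :=
  ent (1 - R + x.lam) x.ω₂ - x.lam - ent (R - x.lam - x.σ) x.ν₁ +
    (1 - R + x.lam) * biasExponent (x.ν₂ / (1 - R + x.lam)) (x.ω₂ / (1 - R + x.lam))

variable {R : ℝ} {x : RelParams}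

namespace Feasible

lemma π₂_pos (H : Feasible R x) : 0 < x.π₂ := by have := H.lt_π₁; have := H.π₁_le; linarith

lemma π₁_pos (H : Feasible R x) : 0 < x.π₁ := by have := H.lt_π₁; have := H.π₂_pos; linarith

lemma ω₂_pos (H : Feasible R x) : 0 < x.ω₂ := H.π₂_pos.trans_le H.π₂_le

lemma ω₂_lt (H : Feasible R x) : x.ω₂ < x.lam₂ := by
  have h1 := H.lt_π₂; have h2 := H.rep₂_lt
  have := ent_pos (a := 1 - R + x.lam - x.ω₂) (b := x.π₂ - x.ω₂ / 2) (by linarith) (by linarith)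
  rw [H.lam₂_eq]; linarith

lemma π₂_lt (H : Feasible R x) : x.π₂ < x.lam₁ := by
  have h1 := H.lt_π₁; have h2 := H.rep₁_lt
  have := ent_pos (a := 1 - R + x.lam - x.π₂) (b := x.π₁ - x.π₂ / 2) (by linarith) (by linarith)
  rw [H.lam₁_eq]; linarith

lemma lam_pos (H : Feasible R x) : 0 < x.lam :=
  (H.ω₂_pos.trans H.ω₂_lt).trans_le H.lam₂_le

lemma ω₂_lt_mu (H : Feasible R x) (hR₁ : R < 1) : x.ω₂ < 1 - R + x.lam := by
  have := H.ω₂_lt; have := H.lam₂_le; linarith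

lemma π₁_lt (H : Feasible R x) : x.π₁ < 1 - R + x.lam := by
  have := H.rep₁_lt; have := H.π₂_pos; linarith

lemma ν₂_lt (H : Feasible R x) (hR₀ : 0 < R) (hR₁ : R < 1) : x.ν₂ < (1 - R + x.lam) / 2 := by
  have h1 := two_mul_deltaGV_lt hR₀ hR₁
  have h2 := H.ν_le; have h3 := H.ν₁_nonneg; have h4 := H.lam_pos
  linarith

/-- Superadditivity of `ent` merges the three blocks into the whole length, where the value is `ent
1 τ` = h(τ) = 1 − R. -/
lemma rho_nonneg (H : Feasible R x) (hR₀ : 0 < R) (hR₁ : R < 1) : 0 ≤ rho R x := by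
  have h0 := H.ν₁_nonneg; have h1 := H.ν_le; have h2 := H.le_ν; have h3 := H.ν₁_le
  have h4 := H.ν₂_lt hR₀ hR₁; have h5 := H.ν₂_nonneg; have h6 := H.lam_pos
  have a1 := ent_add_le (a := x.σ) (b := deltaGV R - x.ν₁ - x.ν₂) (a' := R - x.lam - x.σ)
    (b' := x.ν₁) (by linarith) (by linarith) h0 h3
  have a2 := ent_add_le (a := x.σ + (R - x.lam - x.σ)) (b := deltaGV R - x.ν₁ - x.ν₂ + x.ν₁)
    (a' := 1 - R + x.lam) (b' := x.ν₂) (by linarith) (by linarith) h5 (by linarith)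
  have e : ent (x.σ + (R - x.lam - x.σ) + (1 - R + x.lam)) (deltaGV R - x.ν₁ - x.ν₂ + x.ν₁ + x.ν₂) =
      1 - R := by
    rw [show x.σ + (R - x.lam - x.σ) + (1 - R + x.lam) = 1 by ring,
      show deltaGV R - x.ν₁ - x.ν₂ + x.ν₁ + x.ν₂ = deltaGV R by ring, ent_one,
      (deltaGV_spec hR₀ hR₁).1]
  rw [e] at a2
  rw [rho_eq]
  linarith

lemma beta_nonneg (H : Feasible R x) (hR₀ : 0 < R) (hR₁ : R < 1) : 0 ≤ beta R x :=
  add_nonneg (le_max_of_le_left H.σ_nonneg) (H.rho_nonneg hR₀ hR₁)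

lemma nu_pos (H : Feasible R x) : 0 < nu R x := by
  rw [nu, gamma₁_eq]
  refine lt_max_of_lt_left (lt_max_of_lt_left ?_)
  have := ent_pos H.π₁_pos H.π₁_lt
  positivity

end Feasible

/-- Since ω₁ is half of the length of 𝒩₁, the exponent there is −h, so the 𝒩₁ term reduces to an
entropy. -/
lemma samples_iff (hν : 0 ≤ x.ν₁) (hν' : x.ν₁ ≤ R - x.lam - x.σ)
    (hω : x.ω₁ = (R - x.lam - x.σ) / 2) :
    ((1 - R + x.lam) * h (x.ω₂ / (1 - R + x.lam)) - x.lam =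
    -(R - x.lam - x.σ) *
        biasExponent (x.ν₁ / (R - x.lam - x.σ)) (x.ω₁ / (R - x.lam - x.σ))
      - (1 - R + x.lam) *
        biasExponent (x.ν₂ / (1 - R + x.lam)) (x.ω₂ / (1 - R + x.lam))) ↔ slack R x = 0 := by
  have key : -(R - x.lam - x.σ) *
      biasExponent (x.ν₁ / (R - x.lam - x.σ)) (x.ω₁ / (R - x.lam - x.σ)) =
      ent (R - x.lam - x.σ) x.ν₁ := by
    rcases (hν.trans hν').eq_or_lt with h0 | h0
    · rw [← h0]; simp
    · rw [hω, show (R - x.lam - x.σ) / 2 / (R - x.lam - x.σ) = 1 / 2 by field_simp,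
        biasExponent_half (by positivity) ((div_le_one h0).2 hν'), ← mul_h_div]
      ring
  rw [key, mul_h_div, slack]
  constructor <;> intro h <;> linarith

lemma inRegion_iff (hR₀ : 0 < R) (hR₁ : R < 1) :
    InRegion R x ↔ Feasible R x ∧ slack R x = 0 := by
  constructor
  · intro H
    obtain ⟨n1, n2, n3, n4, n5, n6, n7, n8, n9, n10⟩ := H.nonneg
    have e1 := H.lam₁_eq
    have e2 := H.lam₂_eq
    rw [mul_h_div] at e1 e2
    have p1 := H.π₂_lt
    have p2 := H.ω₂_lt
    have q1 := H.le_π₁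
    have q2 := H.le_π₂
    have q3 := H.lam₂_le
    have q4 := H.π₂_le
    have l1 := lt_of_ent_pos (a := 1 - R + x.lam - x.π₂) (b := x.π₁ - x.π₂ / 2) (by linarith)
      (by linarith) (by linarith)
    have l2 := lt_of_ent_pos (a := 1 - R + x.lam - x.ω₂) (b := x.π₂ - x.ω₂ / 2) (by linarith)
      (by linarith) (by linarith)
    exact ⟨⟨n1, n2, n3, H.σ_le, H.lam₁_le, q3, H.π₁_le, q4, H.ν₁_le, H.le_ν, H.ν_le,
      by linarith, by linarith, by linarith, by linarith, H.ω₁_eq, e1, e2⟩,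
      (samples_iff n2 H.ν₁_le H.ω₁_eq).1 H.samples_eq⟩
  · rintro ⟨H, hS⟩
    have s1 := H.π₁_pos
    have s2 := H.π₂_pos
    have s3 := H.ω₂_pos
    have s4 := H.π₂_lt
    have s5 := H.ω₂_lt
    have s6 := H.lt_π₁
    have s7 := H.lt_π₂
    have s8 := H.ν₁_le
    have s9 := H.ν₁_nonneg
    refine ⟨⟨H.σ_nonneg, H.ν₁_nonneg, H.ν₂_nonneg, H.lam_pos.le, by linarith, by linarith,
      s1.le, s2.le, ?_, s3.le⟩, H.σ_le, H.lam₁_le, H.lam₂_le, H.π₁_le, H.π₂_le, H.ν₁_le, ?_, H.le_ν,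
      H.ν_le, by linarith, by linarith, s4, s5, H.π₁_lt, H.ω₁_eq, ?_, ?_,
      (samples_iff H.ν₁_nonneg H.ν₁_le H.ω₁_eq).2 hS⟩
    · rw [H.ω₁_eq]; linarith
    · have := H.ν₂_lt hR₀ hR₁; have := H.ν₂_nonneg; linarith
    · rw [mul_h_div]; exact H.lam₁_eq
    · rw [mul_h_div]; exact H.lam₂_eq

/-- Move the error weights and `σ` towards given values. -/
noncomputable def shift (R : ℝ) (x : RelParams) (s v₁ v₂ t : ℝ) : RelParams :=
  { x with
    σ := (1 - t) * x.σ + t * s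
    ν₁ := (1 - t) * x.ν₁ + t * v₁
    ν₂ := (1 - t) * x.ν₂ + t * v₂
    ω₁ := (R - x.lam - ((1 - t) * x.σ + t * s)) / 2 }

lemma Feasible.shift (H : Feasible R x) {s v₁ v₂ t : ℝ} (hs : 0 ≤ s) (hv₁ : 0 ≤ v₁) (hv₂ : 0 ≤ v₂)
    (hsle : s ≤ R - x.lam) (hvle : v₁ ≤ R - x.lam - s) (hle : deltaGV R - s ≤ v₁ + v₂)
    (hle' : v₁ + v₂ ≤ deltaGV R) (ht : 0 ≤ t) (ht' : t ≤ 1) :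
    Feasible R (RLPN.shift R x s v₁ v₂ t) := by
  have ht1 : 0 ≤ 1 - t := by linarith
  have m1 := mul_nonneg ht1 H.σ_nonneg
  have m2 := mul_nonneg ht1 H.ν₁_nonneg
  have m3 := mul_nonneg ht1 H.ν₂_nonneg
  have m4 := mul_nonneg ht hs
  have m5 := mul_nonneg ht hv₁
  have m6 := mul_nonneg ht hv₂
  have m7 := mul_nonneg ht1 (sub_nonneg.2 H.σ_le)
  have m8 := mul_nonneg ht1 (sub_nonneg.2 H.ν₁_le)
  have m9 := mul_nonneg ht1 (sub_nonneg.2 H.le_ν)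
  have m10 := mul_nonneg ht1 (sub_nonneg.2 H.ν_le)
  have m11 := mul_nonneg ht (sub_nonneg.2 hsle)
  have m12 := mul_nonneg ht (sub_nonneg.2 hvle)
  have m13 := mul_nonneg ht (sub_nonneg.2 hle)
  have m14 := mul_nonneg ht (sub_nonneg.2 hle')
  refine ⟨?_, ?_, ?_, ?_, H.lam₁_le, H.lam₂_le, H.π₁_le, H.π₂_le, ?_, ?_, ?_, H.lt_π₁, H.lt_π₂,
    H.rep₁_lt, H.rep₂_lt, rfl, H.lam₁_eq, H.lam₂_eq⟩ <;> simp only [RLPN.shift] <;> linarith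

lemma continuous_ent : Continuous fun p : ℝ × ℝ => ent p.1 p.2 := by
  unfold ent
  fun_prop

@[fun_prop]
lemma Continuous.ent {X : Type*} [TopologicalSpace X] {f g : X → ℝ} (hf : Continuous f)
    (hg : Continuous g) :
    Continuous fun t => RLPN.ent (f t) (g t) :=
  continuous_ent.comp (hf.prodMk hg)

lemma continuousOn_slack_shift (H : Feasible R x) (hR₀ : 0 < R) (hR₁ : R < 1) {s v₁ v₂ : ℝ}
    (hv₂ : 0 ≤ v₂) (hv₂' : v₂ ≤ (1 - R + x.lam) / 2) :
    ContinuousOn (fun t => slack R (shift R x s v₁ v₂ t)) (Set.Icc 0 1) := by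
  have hμ : 0 < 1 - R + x.lam := by have := H.lam_pos; linarith
  have h1 : Continuous fun t => RLPN.ent (R - x.lam - ((1 - t) * x.σ + t * s))
      ((1 - t) * x.ν₁ + t * v₁) := Continuous.ent (by fun_prop) (by fun_prop)
  have h2 : ContinuousOn (fun t => biasExponent (((1 - t) * x.ν₂ + t * v₂) / (1 - R + x.lam))
      (x.ω₂ / (1 - R + x.lam))) (Set.Icc 0 1) := by
    refine ContinuousOn.comp (g := fun y => biasExponent y (x.ω₂ / (1 - R + x.lam)))
      (t := Set.Icc 0 (1 / 2)) (continuousOn_biasExponent (div_pos H.ω₂_pos hμ)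
      ((div_lt_one hμ).2 (H.ω₂_lt_mu hR₁))) (by fun_prop) ?_
    intro t ht
    have ht1 : 0 ≤ 1 - t := by linarith [ht.2]
    have m1 := mul_nonneg ht1 H.ν₂_nonneg
    have m2 := mul_nonneg ht.1 hv₂
    have m3 := mul_le_mul_of_nonneg_left (H.ν₂_lt hR₀ hR₁).le ht1
    have m4 := mul_le_mul_of_nonneg_left hv₂' ht.1
    refine ⟨by positivity, (div_le_iff₀ hμ).2 ?_⟩
    linarith
  exact (((continuousOn_const (c := ent (1 - R + x.lam) x.ω₂ - x.lam)).sub h1.continuousOn).add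
    ((continuousOn_const (c := 1 - R + x.lam)).mul h2)).congr fun t _ => rfl

/-- ρ is convex along the segment by concavity of `ent`. At the target the error is spread
proportionally over 𝒩₁ and 𝒩₂ with 𝒫 empty, the typical situation, and ρ = 0. -/
lemma rho_shift_le (H : Feasible R x) (hR₀ : 0 < R) (hR₁ : R < 1) {t : ℝ} (ht : 0 ≤ t)
    (ht' : t ≤ 1) : rho R (shift R x 0 (deltaGV R * (R - x.lam)) (deltaGV R * (1 - R + x.lam)) t) ≤
      (1 - t) * rho R x := by
  obtain ⟨hτ, hτ0, hτ1⟩ := deltaGV_spec hR₀ hR₁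
  have hσ := H.σ_nonneg
  have hσ' := H.σ_le
  have h0 := H.ν₁_nonneg; have h1 := H.ν_le; have h2 := H.le_ν; have h3 := H.ν₁_le
  have h4 := H.ν₂_lt hR₀ hR₁; have h5 := H.ν₂_nonneg; have h6 := H.lam_pos
  have hRl : 0 ≤ R - x.lam := by linarith
  have a1 := ent_convex_comb_le (a := x.σ) (b := deltaGV R - x.ν₁ - x.ν₂) (a' := 0) (b' := 0)
    (by linarith) (by linarith) le_rfl le_rfl ht ht'
  have a2 := ent_convex_comb_le (a := R - x.lam - x.σ) (b := x.ν₁) (a' := R - x.lam)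
    (b' := deltaGV R * (R - x.lam)) h0 h3 (by positivity) (by nlinarith) ht ht'
  have a3 := ent_convex_comb_le (a := 1 - R + x.lam) (b := x.ν₂) (a' := 1 - R + x.lam)
    (b' := deltaGV R * (1 - R + x.lam)) h5 (by linarith)
    (mul_nonneg hτ0.le (by linarith)) (by nlinarith) ht ht'
  have e (a : ℝ) : ent a (deltaGV R * a) = a * h (deltaGV R) := by
    rw [mul_comm (deltaGV R), ← ent_one, ← ent_mul, mul_one]
  rw [e, hτ] at a2 a3
  simp only [ent_zero_left, mul_zero, add_zero] at a1
  rw [rho_eq, rho_eq]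
  simp only [RLPN.shift]
  have b1 : (1 - t) * x.σ + t * 0 = (1 - t) * x.σ := by ring
  have b2 : deltaGV R - ((1 - t) * x.ν₁ + t * (deltaGV R * (R - x.lam))) -
      ((1 - t) * x.ν₂ + t * (deltaGV R * (1 - R + x.lam))) =
      (1 - t) * (deltaGV R - x.ν₁ - x.ν₂) := by ring
  have b3 : R - x.lam - (1 - t) * x.σ = (1 - t) * (R - x.lam - x.σ) + t * (R - x.lam) := by ring
  have b4 : (1 - t) * (1 - R + x.lam) + t * (1 - R + x.lam) = 1 - R + x.lam := by ring
  rw [b1, b2, b3]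
  rw [b4] at a3
  linarith

/-- A feasible point with enough samples dominates a point of the region. -/
lemma exists_inRegion_of_feasible (hR₀ : 0 < R) (hR₁ : R < 1) (H : Feasible R x)
    (hS : 0 ≤ slack R x) : ∃ y ∈ region R, beta R y ≤ beta R x := by
  obtain ⟨hτ, hτ0, hτ1⟩ := deltaGV_spec hR₀ hR₁
  have h6 := H.lam_pos
  have hσ := H.σ_nonneg
  have hσ' := H.σ_le
  have hRl : 0 ≤ R - x.lam := by linarith
  have hμ : 0 < 1 - R + x.lam := by linarith
  have hf : ∀ t ∈ Set.Icc (0 : ℝ) 1, Feasible R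
      (shift R x 0 (deltaGV R * (R - x.lam)) (deltaGV R * (1 - R + x.lam)) t) := fun t ht =>
    H.shift le_rfl (by positivity) (by positivity) hRl (by nlinarith)
      (le_of_eq (by ring)) (le_of_eq (by ring)) ht.1 ht.2
  have hc := continuousOn_slack_shift (s := 0) (v₁ := deltaGV R * (R - x.lam)) H hR₀ hR₁
    (v₂ := deltaGV R * (1 - R + x.lam)) (by positivity) (by nlinarith)
  have hS0 : slack R (shift R x 0 (deltaGV R * (R - x.lam)) (deltaGV R * (1 - R + x.lam)) 0) =
      slack R x := by
    simp [slack, RLPN.shift]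
  -- At the target the bound 1 − h(x) − h(ω) for the bias exponent cancels the entropy of ω₂, and
  -- the remaining terms sum to exactly 0.
  have hS1 : slack R (shift R x 0 (deltaGV R * (R - x.lam)) (deltaGV R * (1 - R + x.lam)) 1) ≤
      0 := by
    simp only [slack, RLPN.shift, sub_self, zero_mul, zero_add, one_mul, sub_zero]
    have e2 : ent (R - x.lam) (deltaGV R * (R - x.lam)) = (R - x.lam) * h (deltaGV R) := by
      rw [mul_comm (deltaGV R), ← ent_one, ← ent_mul, mul_one]
    rw [e2, mul_div_cancel_right₀ _ hμ.ne', hτ, ← mul_h_div]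
    have b := biasExponent_le hτ0.le (by linarith : deltaGV R ≤ 1) (div_pos H.ω₂_pos hμ)
      ((div_lt_one hμ).2 (H.ω₂_lt_mu hR₁))
    have := mul_le_mul_of_nonneg_left b hμ.le
    rw [hτ] at this
    nlinarith
  obtain ⟨t, ht, hSt⟩ := intermediate_value_Icc' zero_le_one hc ⟨hS1, by rw [hS0]; exact hS⟩
  refine ⟨_, (inRegion_iff hR₀ hR₁).2 ⟨hf t ht, hSt⟩, ?_⟩
  have hr := rho_shift_le H hR₀ hR₁ ht.1 ht.2
  have hr0 := H.rho_nonneg hR₀ hR₁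
  have hr' : (1 - t) * rho R x ≤ rho R x := by nlinarith [ht.1]
  unfold beta
  refine add_le_add (max_le_max ?_ le_rfl) (hr.trans hr')
  simp only [RLPN.shift]
  nlinarith [ht.1]

end feasible

/-! ### Lower bound on the complexity -/

section lower

lemma ExpGE.le_limsup {f : ℕ → ℝ} {a : ℝ} (hf : ExpGE f a) :
    (a : EReal) ≤ limsup (fun n => ((Real.logb 2 (f n) / n : ℝ) : EReal)) atTop := by
  refine EReal.ge_of_forall_gt_iff_ge.1 fun z hz => ?_
  have hz' : z < a := EReal.coe_lt_coe_iff.1 hz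
  refine le_limsup_of_frequently_le ?_
  refine Eventually.frequently ?_
  filter_upwards [hf (a - z) (by linarith), eventually_gt_atTop 0] with n h1 h2
  have h2' : (0 : ℝ) < n := by exact_mod_cast h2
  rw [EReal.coe_le_coe_iff, le_div_iff₀ h2', Real.le_logb_iff_rpow_le one_lt_two
    (lt_of_lt_of_le (by positivity) h1)]
  simpa using h1

lemma ExpLE.limsup_le {f : ℕ → ℝ} {a : ℝ} (hf : ExpLE f a) (hf0 : ∀ᶠ n in atTop, 0 < f n) :
    limsup (fun n => ((Real.logb 2 (f n) / n : ℝ) : EReal)) atTop ≤ a := by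
  refine EReal.le_of_forall_lt_iff_le.1 fun z hz => ?_
  have hz' : a < z := EReal.coe_lt_coe_iff.1 hz
  refine limsup_le_of_le ?_ ?_
  · isBoundedDefault
  filter_upwards [hf (z - a) (by linarith), hf0, eventually_gt_atTop 0] with n h1 h0 h2
  have h2' : (0 : ℝ) < n := by exact_mod_cast h2
  rw [EReal.coe_le_coe_iff, div_le_iff₀ h2', Real.logb_le_iff_le_rpow one_lt_two h0]
  simpa using h1

variable {R : ℝ} {k t : ℕ → ℕ} {θ : ℕ → Params} {x : RelParams}

lemma nonneg_of_tendsto_natCast {a : ℕ → ℕ} {α : ℝ}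
    (ha : Tendsto (fun n => (a n : ℝ) / n) atTop (𝓝 α)) : 0 ≤ α :=
  ge_of_tendsto' ha fun n => by positivity

namespace Regime

lemma feasible (H : Regime R k t θ x) : Feasible R x := by
  have e1 := H.lam₁_eq
  have e2 := H.lam₂_eq
  have p1 := H.π₂_lt
  have p2 := H.ω₂_lt
  have q1 := H.le_π₁
  have q2 := H.le_π₂
  have q3 := H.lam₂_le
  have l1 := lt_of_ent_pos (a := 1 - R + x.lam - x.π₂) (b := x.π₁ - x.π₂ / 2)
    (by have := H.π₂_lt_mu; linarith) (by linarith) (by linarith)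
  have l2 := lt_of_ent_pos (a := 1 - R + x.lam - x.ω₂) (b := x.π₂ - x.ω₂ / 2)
    (by have := H.ω₂_lt_mu; linarith) (by linarith) (by linarith)
  have r1 := le_of_tendsto_natCast (tendsto_natCast_add H.ratios.lam H.ratios.σ) H.tendsto_k
    (H.valid.mono fun n h => h.s_le)
  have r2 := le_of_tendsto_natCast H.ratios.ν₁ H.tendsto_r (H.valid.mono fun n h => h.u₁_le)
  have r3 := le_of_tendsto_natCast (tendsto_natCast_add H.ratios.ν₁ H.ratios.ν₂) H.tendsto_t
    (H.valid.mono fun n h => h.u_le)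
  have r4 := le_of_tendsto_natCast H.tendsto_t
    (tendsto_natCast_add (tendsto_natCast_add H.ratios.σ H.ratios.ν₁) H.ratios.ν₂)
    (H.valid.mono fun n h => h.le_u)
  exact ⟨nonneg_of_tendsto_natCast H.ratios.σ, nonneg_of_tendsto_natCast H.ratios.ν₁,
    nonneg_of_tendsto_natCast H.ratios.ν₂, by linarith, H.lam₁_le, q3, H.π₁_le, H.π₂_le, r2,
    by linarith, r3, by linarith, by linarith, H.rep₁_lt, H.rep₂_lt, H.ω₁_eq, e1, e2⟩

/-- N δ² exceeds n eventually, hence has nonnegative exponent; the upper bounds on N and on both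
biases show that this exponent is at most `slack`. -/
lemma slack_nonneg (H : Regime R k t θ x) (hs : Tendsto
    (fun n => (θ n).numChecks n (k n) * (θ n).lpnBias n (k n) ^ 2 / (n : ℝ)) atTop atTop) :
    0 ≤ slack R x := by
  have F := H.feasible
  have b1 := expLE_bias_half_sq H.tendsto_r H.ratios.ν₁ (H.valid.mono fun n h => h.w₁_eq)
    (H.valid.mono fun n h => h.u₁_le)
  have b2 := expLE_bias_sq H.tendsto_m H.ratios.ω₂ H.ratios.ν₂ (H.valid.mono fun n h => h.w₂_le)
    (H.valid.mono fun n h => h.u₂_le) F.ν₂_nonneg (F.ν₂_lt H.R_pos H.R_lt) F.ω₂_pos H.ω₂_lt_mu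
  have b3 := b1.mul b2 (Eventually.of_forall fun _ => by positivity)
    (Eventually.of_forall fun _ => by positivity)
  have b4 := H.expLE_numChecks.mul b3 (H.expGE_numChecks.pos.mono fun n h => h.le)
    (Eventually.of_forall fun _ => by positivity)
  have g : ExpGE (fun n => (θ n).numChecks n (k n) * (bias ((θ n).r (k n)) (θ n).w₁ (θ n).u₁ ^ 2 *
      bias ((θ n).m n (k n)) (θ n).w₂ (θ n).u₂ ^ 2)) 0 := by
    refine (expGE_const one_pos).mono ?_ le_rfl
    filter_upwards [hs.eventually_ge_atTop 1, eventually_ge_atTop 1] with n h1 h2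
    have h2' : (1 : ℝ) ≤ n := by exact_mod_cast h2
    rw [le_div_iff₀ (by linarith), Params.lpnBias, mul_pow] at h1
    linarith
  have := b4.le_of_expGE g
  rw [slack]
  linarith

lemma expGE_iter {e : ∀ n, Word n} (H : Regime R k (fun n => hammingNorm (e n)) θ x)
    (hi : Tendsto (fun n => ((θ n).iter : ℝ) * (θ n).succProb n (k n) (e n)) atTop atTop) :
    ExpGE (fun n => ((θ n).iter : ℝ)) (rho R x) := by
  obtain ⟨h1, h2⟩ := H.exponent_succProb
  have h3 := h1.inv h2.pos
  rw [neg_neg] at h3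
  refine h3.mono ?_ le_rfl
  filter_upwards [hi.eventually_ge_atTop 1, h2.pos] with n a1 a2
  rw [inv_le_iff_one_le_mul₀ a2]
  exact a1

lemma expGE_step (H : Regime R k t θ x) :
    ExpGE (fun n => (θ n).createTime n (k n) + (θ n).s * 2 ^ (θ n).s) (max x.σ (nu R x)) := by
  have F := H.feasible
  have c := H.expGE_createTime
  have c' : ExpGE (fun n => (θ n).createTime n (k n) + (θ n).s * 2 ^ (θ n).s) (nu R x) :=
    c.mono (Eventually.of_forall fun n => le_add_of_nonneg_right (by positivity)) le_rfl
  -- For σ = 0 the integer s may be 0 and the term s 2^s may vanish, but then the list construction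
  -- dominates because `nu` is positive.
  rcases F.σ_nonneg.eq_or_lt with h0 | h0
  · rw [← h0, max_eq_right F.nu_pos.le]
    exact c'
  · refine (expGE_two_pow H.ratios.σ).max c' ?_ (Eventually.of_forall fun _ => le_rfl)
    filter_upwards [c.pos, eventually_pos_of_tendsto H.ratios.σ h0 0] with n a1 a2
    have a2' : (1 : ℝ) ≤ (θ n).s := by exact_mod_cast a2
    have : (0 : ℝ) < 2 ^ (θ n).s := by positivity
    nlinarith

lemma expLE_step (H : Regime R k t θ x) :
    ExpLE (fun n => (θ n).createTime n (k n) + (θ n).s * 2 ^ (θ n).s) (max x.σ (nu R x)) := by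
  rw [max_comm]
  refine H.expLE_createTime.add ?_
  have h1 := (expLE_poly 1 1).mul (expLE_two_pow H.ratios.σ)
    (Eventually.of_forall fun _ => by positivity) (Eventually.of_forall fun _ => by positivity)
  rw [zero_add] at h1
  refine h1.mono ?_ le_rfl
  filter_upwards [H.valid] with n hv
  have : (θ n).s ≤ n := by have := hv.s_le; have := hv.k_le; omega
  have : ((θ n).s : ℝ) ≤ n := by exact_mod_cast this
  simp only [one_mul, pow_one]
  gcongr

end Regime

lemma exists_inRegion_of_admissible (hR₀ : 0 < R) (hR₁ : R < 1) {e : ∀ n, Word n}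
    (hk : Tendsto (fun n => (k n : ℝ) / n) atTop (𝓝 R))
    (ht : Tendsto (fun n => (hammingNorm (e n) : ℝ) / n) atTop (𝓝 (deltaGV R)))
    (H : Admissible R k e θ) : ∃ y ∈ region R, (beta R y : EReal) ≤
      limsup (fun n => ((Real.logb 2 ((θ n).time n (k n)) / n : ℝ) : EReal)) atTop := by
  obtain ⟨x, hx, h1, h2, h3⟩ := H.regime
  have G : Regime R k (fun n => hammingNorm (e n)) θ x := ⟨hR₀, hR₁, hk, ht, H.valid, hx, h1, h2, h3⟩
  obtain ⟨y, hy, hyx⟩ := exists_inRegion_of_feasible hR₀ hR₁ G.feasible (G.slack_nonneg H.samples)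
  refine ⟨y, hy, (EReal.coe_le_coe_iff.2 hyx).trans (ExpGE.le_limsup ?_)⟩
  have := (G.expGE_iter H.iterations).mul G.expGE_step
  rw [add_comm] at this
  exact this

end lower

/-! ### Families of parameters with given limits -/

section upper

/-- Points of the feasible region that satisfy all inequalities strictly, with a surplus of
samples. -/
structure Interior (R : ℝ) (x : RelParams) : Prop extends Feasible R x where
  σ_lt : x.σ < R - x.lam
  lam₁_lt : x.lam₁ < x.lam₂
  lam₂_lt : x.lam₂ < x.lam
  π₁_lt_π₂ : x.π₁ < x.π₂
  π₂_lt_ω₂ : x.π₂ < x.ω₂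
  ν₂_pos : 0 < x.ν₂
  ν₁_lt : x.ν₁ < R - x.lam - x.σ
  lt_ν : deltaGV R - x.σ < x.ν₁ + x.ν₂
  ν_lt : x.ν₁ + x.ν₂ < deltaGV R
  slack_pos : 0 < slack R x

variable {R : ℝ} {x : RelParams} {k : ℕ → ℕ} {e : ∀ n, Word n}

lemma tendsto_floor {a : ℝ} (ha : 0 ≤ a) :
    Tendsto (fun n : ℕ => ((⌊a * n⌋₊ : ℕ) : ℝ) / n) atTop (𝓝 a) :=
  (tendsto_nat_floor_mul_div_atTop ha).comp tendsto_natCast_atTop_atTop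

lemma tendsto_atTop_of_ratio {M : ℕ → ℕ} {μ : ℝ} (hμ : 0 < μ)
    (hM : Tendsto (fun n => (M n : ℝ) / n) atTop (𝓝 μ)) : Tendsto M atTop atTop :=
  tendsto_atTop.2 fun c => (eventually_pos_of_tendsto hM hμ c).mono fun _ h => h.le

lemma tendsto_comp_ratio {U M : ℕ → ℕ} {a μ : ℝ} (hμ : 0 < μ)
    (hU : Tendsto (fun n => (U n : ℝ) / n) atTop (𝓝 a))
    (hM : Tendsto (fun n => (M n : ℝ) / n) atTop (𝓝 μ)) :
    Tendsto (fun n => (U (M n) : ℝ) / n) atTop (𝓝 (a * μ)) := by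
  have hM' := tendsto_atTop_of_ratio hμ hM
  refine ((hU.comp hM').mul hM).congr' ?_
  filter_upwards [hM'.eventually_gt_atTop 0] with n hn
  have : (M n : ℝ) ≠ 0 := by exact_mod_cast hn.ne'
  simp only [Function.comp]
  field_simp

/-- An interior point is the limit of parameters that satisfy all conditions but the one on the
number of iterations. -/
lemma Interior.exists_regime (H : Interior R x) (hR₀ : 0 < R) (hR₁ : R < 1) {t : ℕ → ℕ}
    (hk : Tendsto (fun n => (k n : ℝ) / n) atTop (𝓝 R))
    (ht : Tendsto (fun n => (t n : ℝ) / n) atTop (𝓝 (deltaGV R))) :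
    ∃ θ : ℕ → Params, Regime R k t θ x ∧ ExpGE (fun n => (θ n).lpnBias n (k n) ^ 2)
      (-ent (R - x.lam - x.σ) x.ν₁ +
        (1 - R + x.lam) * biasExponent (x.ν₂ / (1 - R + x.lam)) (x.ω₂ / (1 - R + x.lam))) := by
  have hlam := H.lam_pos
  have hμ : 0 < 1 - R + x.lam := by linarith
  obtain ⟨U, W, hU, hW, hWe, hUW⟩ := exists_expGE_bias_sq (div_pos H.ν₂_pos hμ)
    (by rw [div_lt_iff₀ hμ]; have := H.ν₂_lt hR₀ hR₁; linarith :
      x.ν₂ / (1 - R + x.lam) < 1 / 2) (div_pos H.ω₂_pos hμ) ((div_lt_one hμ).2 (H.ω₂_lt_mu hR₁))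
  set ell : ℕ → ℕ := fun n => ⌊x.lam * n⌋₊ with hell
  -- The parity correction makes k − ℓ − s even, so that w₁ can be exactly half of it.
  set s : ℕ → ℕ := fun n => ⌊x.σ * n⌋₊ + (k n + ell n + ⌊x.σ * n⌋₊) % 2 with hs
  set m : ℕ → ℕ := fun n => n - k n + ell n with hm
  set r : ℕ → ℕ := fun n => k n - ell n - s n with hr
  set p₁ : ℕ → ℕ := fun n => 2 * ⌊x.π₁ / 2 * n⌋₊ with hp₁
  set p₂ : ℕ → ℕ := fun n => 2 * ⌊x.π₂ / 2 * n⌋₊ with hp₂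
  -- An even value, since the bias on 𝒩₁ vanishes at odd ones. On 𝒩₂ the sequences U and W are
  -- evaluated at the actual length m n.
  set u₁ : ℕ → ℕ := fun n => 2 * ⌊x.ν₁ / 2 * n⌋₊ with hu₁
  have lell : Tendsto (fun n => (ell n : ℝ) / n) atTop (𝓝 x.lam) := tendsto_floor hlam.le
  have ls : Tendsto (fun n => (s n : ℝ) / n) atTop (𝓝 x.σ) := by
    have h2 : Tendsto (fun n : ℕ => (((k n + ell n + ⌊x.σ * n⌋₊) % 2 : ℕ) : ℝ) / n) atTop (𝓝 0) := by
      refine tendsto_of_tendsto_of_tendsto_of_le_of_le tendsto_const_nhds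
        (tendsto_const_div_atTop_nhds_zero_nat 1) (fun n => by positivity) fun n => ?_
      have : (k n + ell n + ⌊x.σ * n⌋₊) % 2 ≤ 1 := by omega
      have : (((k n + ell n + ⌊x.σ * n⌋₊) % 2 : ℕ) : ℝ) ≤ 1 := by exact_mod_cast this
      change (((k n + ell n + ⌊x.σ * n⌋₊) % 2 : ℕ) : ℝ) / n ≤ 1 / n
      gcongr
    have h3 := tendsto_natCast_add (tendsto_floor H.σ_nonneg) h2
    rw [add_zero] at h3
    exact h3
  have lp₁ : Tendsto (fun n => (p₁ n : ℝ) / n) atTop (𝓝 x.π₁) := tendsto_even_floor H.π₁_pos.le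
  have lp₂ : Tendsto (fun n => (p₂ n : ℝ) / n) atTop (𝓝 x.π₂) := tendsto_even_floor H.π₂_pos.le
  have lu₁ : Tendsto (fun n => (u₁ n : ℝ) / n) atTop (𝓝 x.ν₁) := tendsto_even_floor H.ν₁_nonneg
  have hkn : ∀ᶠ n in atTop, k n < n := eventually_le_of_tendsto_lt hk tendsto_self_div hR₁
  have hsk : ∀ᶠ n in atTop, ell n + s n < k n :=
    eventually_le_of_tendsto_lt (tendsto_natCast_add lell ls) hk (by have := H.σ_lt; linarith)
  have lm : Tendsto (fun n => (m n : ℝ) / n) atTop (𝓝 (1 - R + x.lam)) :=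
    tendsto_natCast_add (tendsto_natCast_sub tendsto_self_div hk (hkn.mono fun _ h => h.le)) lell
  have lr : Tendsto (fun n => (r n : ℝ) / n) atTop (𝓝 (R - x.lam - x.σ)) :=
    tendsto_natCast_sub (tendsto_natCast_sub hk lell (hsk.mono fun _ h => by omega)) ls
      (hsk.mono fun _ h => by omega)
  have lm' := tendsto_atTop_of_ratio hμ lm
  have lu₂ : Tendsto (fun n => (U (m n) : ℝ) / n) atTop (𝓝 x.ν₂) := by
    simpa [div_mul_cancel₀ _ hμ.ne'] using tendsto_comp_ratio hμ hU lm
  have lw₂ : Tendsto (fun n => (W (m n) : ℝ) / n) atTop (𝓝 x.ω₂) := by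
    simpa [div_mul_cancel₀ _ hμ.ne'] using tendsto_comp_ratio hμ hW lm
  have hw₂e : ∀ᶠ n in atTop, Even (W (m n)) := lm'.eventually hWe
  have hreven : ∀ᶠ n in atTop, 2 * (r n / 2) = r n := by
    filter_upwards [hsk] with n h
    simp only [hr, hs] at h ⊢
    omega
  have hwm : ∀ᶠ n in atTop, W (m n) < m n := eventually_le_of_tendsto_lt lw₂ lm (H.ω₂_lt_mu hR₁)
  have hpw : ∀ᶠ n in atTop, p₂ n < W (m n) := eventually_le_of_tendsto_lt lp₂ lw₂ H.π₂_lt_ω₂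
  have hpp : ∀ᶠ n in atTop, p₁ n < p₂ n := eventually_le_of_tendsto_lt lp₁ lp₂ H.π₁_lt_π₂
  have hpp' : ∀ᶠ n in atTop, p₂ n < 2 * p₁ n :=
    eventually_le_of_tendsto_lt lp₂ (tendsto_natCast_mul 2 lp₁) (by have := H.lt_π₁; push_cast; linarith)
  have hpw' : ∀ᶠ n in atTop, W (m n) < 2 * p₂ n :=
    eventually_le_of_tendsto_lt lw₂ (tendsto_natCast_mul 2 lp₂) (by have := H.lt_π₂; push_cast; linarith)
  have hhalf (a : ℕ → ℕ) {α : ℝ} (ha : Tendsto (fun n => (a n : ℝ) / n) atTop (𝓝 α)) :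
      Tendsto (fun n => ((a n / 2 : ℕ) : ℝ) / n) atTop (𝓝 (α / 2)) := by
    simpa using tendsto_natCast_div two_pos ha
  have lrep₁ := tendsto_natCast_sub lp₁ (hhalf _ lp₂) (hpp'.mono fun n h => by omega)
  have lrep₂ := tendsto_natCast_sub lp₂ (hhalf _ lw₂) (hpw'.mono fun n h => by omega)
  have lmp := tendsto_natCast_sub lm lp₂ (by filter_upwards [hwm, hpw] with n a b; omega)
  have lmw := tendsto_natCast_sub lm lw₂ (hwm.mono fun _ h => h.le)
  have hrep₁ : ∀ᶠ n in atTop, p₁ n - p₂ n / 2 < m n - p₂ n :=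
    eventually_le_of_tendsto_lt lrep₁ lmp (by have := H.rep₁_lt; linarith)
  have hrep₂ : ∀ᶠ n in atTop, p₂ n - W (m n) / 2 < m n - W (m n) :=
    eventually_le_of_tendsto_lt lrep₂ lmw (by have := H.rep₂_lt; linarith)
  set ell₁ : ℕ → ℕ := fun n => Nat.log 2
    ((p₂ n).choose (p₂ n / 2) * (m n - p₂ n).choose (p₁ n - p₂ n / 2)) with hell₁
  set ell₂ : ℕ → ℕ := fun n => Nat.log 2
    ((W (m n)).choose (W (m n) / 2) * (m n - W (m n)).choose (p₂ n - W (m n) / 2)) with hell₂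
  have lell₁ : Tendsto (fun n => (ell₁ n : ℝ) / n) atTop (𝓝 x.lam₁) := by
    have := tendsto_natLog_choose lp₂ (hhalf _ lp₂) lmp lrep₁
      (Eventually.of_forall fun n => Nat.div_le_self _ _) (hrep₁.mono fun _ h => h.le)
    rwa [ent_half, ← H.lam₁_eq] at this
  have lell₂ : Tendsto (fun n => (ell₂ n : ℝ) / n) atTop (𝓝 x.lam₂) := by
    have := tendsto_natLog_choose lw₂ (hhalf _ lw₂) lmw lrep₂
      (Eventually.of_forall fun n => Nat.div_le_self _ _) (hrep₂.mono fun _ h => h.le)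
    rwa [ent_half, ← H.lam₂_eq] at this
  have hu₁r : ∀ᶠ n in atTop, u₁ n < r n := eventually_le_of_tendsto_lt lu₁ lr H.ν₁_lt
  have hu₂m : ∀ᶠ n in atTop, U (m n) < m n := eventually_le_of_tendsto_lt lu₂ lm
    (by have := H.ν₂_lt hR₀ hR₁; have := H.ν₂_pos; linarith)
  refine ⟨fun n => ⟨s n, ell n, ell₁ n, ell₂ n, p₁ n, p₂ n, r n / 2, W (m n), u₁ n, U (m n), 0⟩,
    ⟨hR₀, hR₁, hk, ht, ?_, ⟨ls, lu₁, lu₂, lell, lell₁, lell₂, lp₁, lp₂, ?_, lw₂⟩, H.π₂_lt, H.ω₂_lt,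
    H.π₁_lt⟩, ?_⟩
  · filter_upwards [hkn, hsk, eventually_le_of_tendsto_lt lell₁ lell₂ H.lam₁_lt,
      eventually_le_of_tendsto_lt lell₂ lell H.lam₂_lt, hreven, hw₂e, hwm, hpw, hpp, hpp', hpw',
      hu₁r, hu₂m, eventually_le_of_tendsto_lt (tendsto_natCast_add lu₁ lu₂) ht H.ν_lt,
      eventually_le_of_tendsto_lt ht (tendsto_natCast_add (tendsto_natCast_add ls lu₁) lu₂)
        (by have := H.lt_ν; linarith)]
      with n a1 a2 a3 a4 a5 a6 a7 a8 a9 a10 a11 a12 a13 a14 a15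
    exact ⟨a1.le, a2.le, a3.le, a4.le, a5, even_two_mul _, even_two_mul _, a6, a9.le, a8.le,
      a10.le, a11.le, a7.le, a12.le, a13.le, a14.le, a15.le, rfl, rfl⟩
  · rw [H.ω₁_eq]
    exact hhalf _ lr
  · have b1 := expGE_bias_half_sq lr lu₁ hreven (hu₁r.mono fun _ h => h.le)
      (Eventually.of_forall fun n => even_two_mul _)
    have b2 := hUW.comp hμ lm lm'
    refine (b1.mul b2).mono (Eventually.of_forall fun n => ?_) le_rfl
    rw [Params.lpnBias, mul_pow]
    exact le_rfl

lemma Interior.exists_admissible (H : Interior R x) (hR₀ : 0 < R) (hR₁ : R < 1)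
    (hk : Tendsto (fun n => (k n : ℝ) / n) atTop (𝓝 R))
    (ht : Tendsto (fun n => (hammingNorm (e n) : ℝ) / n) atTop (𝓝 (deltaGV R))) :
    ∃ θ : ℕ → Params, Admissible R k e θ ∧
      limsup (fun n => ((Real.logb 2 ((θ n).time n (k n)) / n : ℝ) : EReal)) atTop ≤ beta R x := by
  obtain ⟨θ, G, hb⟩ := H.exists_regime hR₀ hR₁ hk ht
  have hN := G.expGE_numChecks.mul hb
  have hslack := H.slack_pos
  obtain ⟨hP, hP'⟩ := G.exponent_succProb
  -- The factor n makes the number of iterations ω(1/P) without changing its exponent.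
  set θ' : ℕ → Params := fun n =>
    { θ n with iter := ⌈(n : ℝ) / (θ n).succProb n (k n) (e n)⌉₊ } with hθ'
  have hiter : ExpLE (fun n => ((θ' n).iter : ℝ)) (rho R x) := by
    have h1 := ((expLE_poly 1 1).mul hP'.inv (Eventually.of_forall fun _ => by positivity)
      (hP'.pos.mono fun n h => by positivity)).add (expLE_const 1)
    refine h1.mono ?_ ?_
    · filter_upwards [hP'.pos] with n h
      have := (Nat.ceil_lt_add_one (show 0 ≤ (n : ℝ) / (θ n).succProb n (k n) (e n) by
        positivity)).le
      rw [one_mul, pow_one, ← div_eq_mul_inv]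
      exact this
    · rw [zero_add, neg_neg, max_eq_left (H.rho_nonneg hR₀ hR₁)]
  refine ⟨θ', ⟨?_, ⟨x, ?_, G.π₂_lt, G.ω₂_lt, G.π₁_lt⟩, ?_, ?_⟩, ?_⟩
  · filter_upwards [G.valid] with n h
    exact ⟨h.k_le, h.s_le, h.ell₁_le, h.ell₂_le, h.w₁_eq, h.even_p₁, h.even_p₂, h.even_w₂, h.p₁_le,
      h.p₂_le, h.le_p₁, h.le_p₂, h.w₂_le, h.u₁_le, h.u₂_le, h.u_le, h.le_u, h.ell₁_eq, h.ell₂_eq⟩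
  · have := G.ratios
    exact ⟨this.σ, this.ν₁, this.ν₂, this.lam, this.lam₁, this.lam₂, this.π₁, this.π₂, this.ω₁,
      this.ω₂⟩
  · change Tendsto (fun n => (θ n).numChecks n (k n) * (θ n).lpnBias n (k n) ^ 2 / (n : ℝ)) atTop atTop
    refine tendsto_atTop_mono' atTop ?_ tendsto_natCast_atTop_atTop
    -- N δ² is at least 2^(n · slack/2), which eventually exceeds n²; so N δ²/n exceeds n.
    filter_upwards [hN (slack R x / 2) (by linarith), eventually_gt_atTop 0,
      eventually_mul_pow_le 1 2 (half_pos hslack)] with n h1 h2 h3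
    have h2' : (0 : ℝ) < n := by exact_mod_cast h2
    rw [le_div_iff₀ h2']
    calc (n : ℝ) * n = 1 * (n : ℝ) ^ 2 := by ring
      _ ≤ _ := h3
      _ = _ := by rw [slack]; ring_nf
      _ ≤ _ := h1
  · refine tendsto_atTop_mono' atTop ?_ tendsto_natCast_atTop_atTop
    filter_upwards [hP'.pos] with n h
    have : (n : ℝ) / (θ n).succProb n (k n) (e n) ≤
      ⌈(n : ℝ) / (θ n).succProb n (k n) (e n)⌉₊ := Nat.le_ceil _
    exact (div_le_iff₀ h).1 this
  · have h1 := hiter.mul G.expLE_step (Eventually.of_forall fun _ => by positivity)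
      (G.expGE_step.pos.mono fun n h => h.le)
    have h2 : ExpLE (fun n => (θ' n).time n (k n)) (beta R x) := by
      rw [beta, add_comm]; exact h1
    refine h2.limsup_le ?_
    filter_upwards [G.expGE_step.pos, hP'.pos, eventually_gt_atTop 0] with n a1 a2 a3
    have a3' : (0 : ℝ) < n := by exact_mod_cast a3
    have : 0 < ⌈(n : ℝ) / (θ n).succProb n (k n) (e n)⌉₊ := Nat.ceil_pos.2 (by positivity)
    have : (0 : ℝ) < ⌈(n : ℝ) / (θ n).succProb n (k n) (e n)⌉₊ := by exact_mod_cast this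
    exact mul_pos this a1

end upper

/-! ### Perturbation of points of the region -/

section perturb

variable {R : ℝ} {x : RelParams}

/-- The point with given free coordinates; the others are determined by the constraints. -/
noncomputable def RelParams.ofFree (R σ ν₁ ν₂ lam π₁ π₂ ω₂ : ℝ) : RelParams where
  σ := σ
  ν₁ := ν₁
  ν₂ := ν₂
  lam := lam
  lam₁ := π₂ + ent (1 - R + lam - π₂) (π₁ - π₂ / 2)
  lam₂ := ω₂ + ent (1 - R + lam - ω₂) (π₂ - ω₂ / 2)
  π₁ := π₁
  π₂ := π₂
  ω₁ := (R - lam - σ) / 2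
  ω₂ := ω₂

lemma Feasible.ofFree_eq (H : Feasible R x) :
    .ofFree R x.σ x.ν₁ x.ν₂ x.lam x.π₁ x.π₂ x.ω₂ = x := by
  have e1 := H.lam₁_eq
  have e2 := H.lam₂_eq
  have e3 := H.ω₁_eq
  cases x
  simp only [RelParams.ofFree, RelParams.mk.injEq, true_and, and_true]
  exact ⟨e1.symm, e2.symm, e3.symm⟩

lemma continuous_beta_ofFree {σ ν₁ ν₂ lam π₁ π₂ ω₂ : ℝ → ℝ} (h1 : Continuous σ) (h2 : Continuous ν₁)
    (h3 : Continuous ν₂) (h4 : Continuous lam) (h5 : Continuous π₁) (h6 : Continuous π₂)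
    (h7 : Continuous ω₂) : Continuous fun t =>
      beta R (.ofFree R (σ t) (ν₁ t) (ν₂ t) (lam t) (π₁ t) (π₂ t) (ω₂ t)) := by
  simp only [beta, nu, gamma₁_eq, gamma₂_eq, gamma₃_eq, rho_eq, RelParams.ofFree]
  fun_prop

lemma eventually_lt_nhdsGT {f g : ℝ → ℝ} (hf : Continuous f) (hg : Continuous g) (h : f 0 < g 0) :
    ∀ᶠ t in 𝓝[>] 0, f t < g t :=
  ((hf.tendsto 0).eventually_lt (hg.tendsto 0) h).filter_mono nhdsWithin_le_nhds

/-- Feasible points that satisfy the constraints on the lists strictly. -/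
structure Strict (R : ℝ) (x : RelParams) : Prop extends Feasible R x where
  lam₁_lt : x.lam₁ < x.lam₂
  lam₂_lt : x.lam₂ < x.lam
  π₁_lt_π₂ : x.π₁ < x.π₂
  π₂_lt_ω₂ : x.π₂ < x.ω₂

/-- Lowering π₁ by η makes λ₁ < λ₂. Then a decrease of π₂ by a much smaller d makes π₂ < ω₂ and λ₂ <
λ without spoiling what was gained. The bound on π₂ keeps both entropy terms on their increasing
branch. `slack` does not involve π₁ and π₂. -/
lemma Feasible.exists_strict (H : Feasible R x) (hπ : x.π₂ ≤ (1 - R + x.lam) / 2) {ε : ℝ}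
    (hε : 0 < ε) : ∃ y, Strict R y ∧ slack R y = slack R x ∧ beta R y < beta R x + ε := by
  have s0 := H.lt_π₁
  have s1 := H.lt_π₂
  have s2 := H.rep₁_lt
  have s3 := H.rep₂_lt
  have s4 := H.π₁_le
  have s5 := H.π₂_le
  have s6 := H.lam₁_le
  have s7 := H.lam₂_le
  set μ := 1 - R + x.lam with hμ
  set P : ℝ → ℝ → RelParams := fun η d =>
    .ofFree R x.σ x.ν₁ x.ν₂ x.lam (x.π₁ - η) (x.π₂ - d) x.ω₂ with hP
  have hP0 : P 0 0 = x := by simp only [hP, sub_zero]; exact H.ofFree_eq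
  obtain ⟨η, hη0, hη1, hη2⟩ : ∃ η > 0, x.π₂ < 2 * (x.π₁ - η) ∧ beta R (P η 0) < beta R x + ε := by
    have c : Continuous fun η => beta R (P η 0) := by
      refine continuous_beta_ofFree ?_ ?_ ?_ ?_ ?_ ?_ ?_ <;> fun_prop
    obtain ⟨η, h1, h2, h3⟩ := ((eventually_lt_nhdsGT (f := fun _ => x.π₂)
      (g := fun η => 2 * (x.π₁ - η)) (by fun_prop) (by fun_prop) (by simpa using s0)).and
      ((eventually_lt_nhdsGT c (g := fun _ => beta R x + ε) continuous_const
        (by rw [hP0]; linarith)).and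
        self_mem_nhdsWithin)).exists
    exact ⟨η, h3, h1, h2⟩
  have hl1 : x.π₂ + ent (μ - x.π₂) (x.π₁ - η - x.π₂ / 2) < x.lam₁ := by
    rw [H.lam₁_eq]
    have := ent_strictMonoOn (a := μ - x.π₂) (b := x.π₁ - η - x.π₂ / 2) (b' := x.π₁ - x.π₂ / 2)
      (by linarith) (by linarith) (by linarith)
    linarith
  have c : Continuous fun d => beta R (P η d) := by
    refine continuous_beta_ofFree ?_ ?_ ?_ ?_ ?_ ?_ ?_ <;> fun_prop
  obtain ⟨d, h1, h2, h3, h4, h5, h6, hd⟩ := ((eventually_lt_nhdsGT c continuous_const hη2).and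
    ((eventually_lt_nhdsGT (f := fun d => x.π₂ - d + ent (μ - (x.π₂ - d)) (x.π₁ - η - (x.π₂ - d) / 2))
      (g := fun d => x.ω₂ + ent (μ - x.ω₂) (x.π₂ - d - x.ω₂ / 2)) (by fun_prop) (by fun_prop)
      (by simp only [sub_zero]; rw [← H.lam₂_eq]; linarith)).and
    ((eventually_lt_nhdsGT (f := fun _ => x.π₁ - η) (g := fun d => x.π₂ - d) (by fun_prop)
      (by fun_prop) (by linarith)).and
    ((eventually_lt_nhdsGT (f := fun _ => x.ω₂) (g := fun d => 2 * (x.π₂ - d)) (by fun_prop)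
      (by fun_prop) (by linarith)).and
    ((eventually_lt_nhdsGT (f := fun d => x.π₁ - η + (x.π₂ - d) / 2) (g := fun _ => μ) (by fun_prop)
      (by fun_prop) (by linarith)).and
    ((eventually_lt_nhdsGT (f := fun d => x.π₂ - d) (g := fun _ => 2 * (x.π₁ - η)) (by fun_prop)
      (by fun_prop) (by linarith)).and self_mem_nhdsWithin)))))).exists
  have hd0 : 0 < d := hd
  have hl2 : x.ω₂ + ent (μ - x.ω₂) (x.π₂ - d - x.ω₂ / 2) < x.lam₂ := by
    rw [H.lam₂_eq]
    have := ent_strictMonoOn (a := μ - x.ω₂) (b := x.π₂ - d - x.ω₂ / 2) (b' := x.π₂ - x.ω₂ / 2)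
      (by linarith) (by linarith) (by linarith)
    linarith
  refine ⟨P η d, ⟨⟨H.σ_nonneg, H.ν₁_nonneg, H.ν₂_nonneg, H.σ_le, h2.le, hl2.le.trans s7, h3.le, ?_,
    H.ν₁_le, H.le_ν, H.ν_le, h6, h4, h5, ?_, rfl, rfl, rfl⟩, h2, hl2.trans_le s7, h3, ?_⟩, rfl, h1⟩
  · change x.π₂ - d ≤ x.ω₂; linarith
  · change x.π₂ - d + x.ω₂ / 2 < μ; linarith
  · change x.π₂ - d < x.ω₂; linarith

/-- Exchange `a t` between `λ` and `σ` and add `b t` to `ω₂`. -/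
noncomputable def move (R : ℝ) (x : RelParams) (a b t : ℝ) : RelParams :=
  .ofFree R (x.σ + a * t) x.ν₁ x.ν₂ (x.lam - a * t) x.π₁ x.π₂ (x.ω₂ + b * t)

lemma Strict.eventually_move (H : Strict R x) {a b ε : ℝ} (ha : 0 ≤ a) (hε : 0 < ε) :
    ∀ᶠ t in 𝓝[>] 0, Strict R (move R x a b t) ∧ beta R (move R x a b t) < beta R x + ε := by
  have c : Continuous fun t => beta R (move R x a b t) := by
    refine continuous_beta_ofFree ?_ ?_ ?_ ?_ ?_ ?_ ?_ <;> fun_prop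
  have h0 : move R x a b 0 = x := by
    simp only [move, mul_zero, add_zero, sub_zero]; exact H.ofFree_eq
  have cl₁ : Continuous fun t => (move R x a b t).lam₁ := by
    simp only [move, RelParams.ofFree]; fun_prop
  have cl₂ : Continuous fun t => (move R x a b t).lam₂ := by
    simp only [move, RelParams.ofFree]; fun_prop
  have cl : Continuous fun t => (move R x a b t).lam := by
    simp only [move, RelParams.ofFree]; fun_prop
  have cω : Continuous fun t => (move R x a b t).ω₂ := by
    simp only [move, RelParams.ofFree]; fun_prop
  filter_upwards [eventually_lt_nhdsGT c (g := fun _ => beta R x + ε) continuous_const (by rw [h0]; linarith),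
    eventually_lt_nhdsGT cl₁ cl₂ (by rw [h0]; exact H.lam₁_lt),
    eventually_lt_nhdsGT cl₂ cl (by rw [h0]; exact H.lam₂_lt),
    eventually_lt_nhdsGT continuous_const cω (by rw [h0]; exact H.π₂_lt_ω₂),
    eventually_lt_nhdsGT cω continuous_const (by rw [h0]; exact H.lt_π₂),
    eventually_lt_nhdsGT (f := fun _ => x.π₁ + x.π₂ / 2)
      (g := fun t => 1 - R + (move R x a b t).lam) (by fun_prop) (by fun_prop)
      (by rw [h0]; exact H.rep₁_lt),
    eventually_lt_nhdsGT (f := fun t => x.π₂ + (move R x a b t).ω₂ / 2)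
      (g := fun t => 1 - R + (move R x a b t).lam) (by fun_prop) (by fun_prop)
      (by rw [h0]; exact H.rep₂_lt), self_mem_nhdsWithin] with t h1 h2 h3 h4 h5 h6 h7 ht
  have hat : 0 ≤ a * t := mul_nonneg ha (le_of_lt ht)
  refine ⟨⟨⟨?_, H.ν₁_nonneg, H.ν₂_nonneg, ?_, h2.le, h3.le, H.π₁_le, h4.le, ?_, ?_, H.ν_le, H.lt_π₁,
    h5, h6, h7, rfl, rfl, rfl⟩, h2, h3, H.π₁_lt_π₂, h4⟩, h1⟩ <;>
  simp only [move, RelParams.ofFree]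
  · have := H.σ_nonneg; linarith
  · have := H.σ_le; linarith
  · have := H.ν₁_le; linarith
  · have := H.le_ν; linarith

/-- In the exponential regime more balanced parity-checks are worth more. -/
lemma eventually_h_add_biasExponent_lt {y ω : ℝ} (hy : y ≤ 1 / 2) (hω0 : 0 < ω) (hω1 : ω < 1 / 2)
    (hD : 4 * ω * (1 - ω) < (1 - 2 * y) ^ 2) :
    ∀ᶠ t in 𝓝[>] 0, h ω + biasExponent y ω < h (ω + t) + biasExponent y (ω + t) := by
  have hc : ContinuousAt (fun t => (1 - ω) * saddle y (ω + t) ^ 2) 0 := by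
    have h1 := continuousAt_saddle (p := (y, ω + 0)) (by simp only [add_zero]; linarith)
    have h2 : ContinuousAt (fun t : ℝ => (y, ω + t)) 0 := by fun_prop
    have h3 : ContinuousAt (fun t : ℝ => saddle y (ω + t)) 0 :=
      ContinuousAt.comp (g := fun p : ℝ × ℝ => saddle p.1 p.2) (f := fun t : ℝ => (y, ω + t)) h1 h2
    fun_prop
  have hlt := mul_saddle_sq_lt hω0 (by linarith) hy hD
  have e1 : ∀ᶠ t in 𝓝[>] 0, (1 - ω) * saddle y (ω + t) ^ 2 < ω :=
    (hc.tendsto.eventually_lt_const (by simpa using hlt)).filter_mono nhdsWithin_le_nhds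
  filter_upwards [e1, eventually_lt_nhdsGT (f := fun t => ω + t) (g := fun _ => 1 / 2) (by fun_prop)
    (by fun_prop) (by simpa using hω1), eventually_lt_nhdsGT (f := fun t => 4 * (ω + t) * (1 - (ω + t)))
    (g := fun _ => (1 - 2 * y) ^ 2) (by fun_prop) (by fun_prop) (by simpa using hD),
    self_mem_nhdsWithin] with t a1 a2 a3 ht
  have ht0 : 0 < t := ht
  have hl := log_two_pos
  rw [biasExponent_of_exp hy hω1.le hD.le, biasExponent_of_exp hy a2.le a3.le]
  have hy' := one_sub_two_mul_pos (by linarith : 0 < ω + t) (by linarith) hy a3.le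
  have hz0 : 0 < saddle y (ω + t) := saddle_pos (by linarith) (by linarith) (by linarith)
  set z := saddle y (ω + t) with hz
  -- Both exponents are compared at z, the saddle for ω + t: for ω the phase is smallest at its own
  -- saddle, and `a1` keeps z in the range where this holds. The rest is the tangent of h at ω and
  -- (1 − ω) z² < ω.
  have hmin : phase y ω (saddle y ω) ≤ phase y ω z := by
    rcases le_total z (saddle y ω) with hle | hle
    · exact phase_saddle_le_of_le hω0 hω1 hy hD.le hz0 hle
    · exact phase_saddle_le_of_ge hω0 hω1 hy hD.le hle a1.le
  have hph : phase y (ω + t) z = phase y ω z - t * Real.log z := by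
    simp only [phase]; ring
  have htan := h_le_tangent (x := ω + t) (by linarith) (by linarith) hω0 (by linarith : ω < 1)
  have hω := h_eq_log ω
  have hlog : Real.log (1 - ω) + 2 * Real.log z < Real.log ω := by
    have := Real.log_lt_log (by have : 0 < 1 - ω := by linarith
                                positivity) a1
    rwa [Real.log_mul (by linarith) (by positivity), Real.log_pow, Nat.cast_ofNat] at this
  rw [hph]
  have k1 : h (ω + t) * Real.log 2 ≤ -((ω + t) * Real.log ω) - (1 - (ω + t)) * Real.log (1 - ω) := by
    rw [← le_div_iff₀ hl]
    refine htan.trans (le_of_eq ?_)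
    simp only [Real.logb]; ring
  have k2 : h ω * Real.log 2 = -(ω * Real.log ω) - (1 - ω) * Real.log (1 - ω) := by
    rw [hω]; field_simp
  have k3 : t * (Real.log (1 - ω) + 2 * Real.log z) < t * Real.log ω :=
    mul_lt_mul_of_pos_left hlog ht0
  refine lt_of_mul_lt_mul_right ?_ hl.le
  have m1 : (h ω + 2 * (phase y ω (saddle y ω) / Real.log 2 - h ω)) * Real.log 2 =
      2 * phase y ω (saddle y ω) - h ω * Real.log 2 := by field_simp; ring
  have m2 : (h (ω + t) + 2 * ((phase y ω z - t * Real.log z) / Real.log 2 - h (ω + t))) * Real.log 2 =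
      2 * (phase y ω z - t * Real.log z) - h (ω + t) * Real.log 2 := by field_simp; ring
  rw [m1, m2, k2]
  linarith

lemma slack_eq_mul (R : ℝ) (x : RelParams) : slack R x =
    (1 - R + x.lam) * (h (x.ω₂ / (1 - R + x.lam)) +
      biasExponent (x.ν₂ / (1 - R + x.lam)) (x.ω₂ / (1 - R + x.lam))) - x.lam -
      ent (R - x.lam - x.σ) x.ν₁ := by
  rw [slack, ← mul_h_div]; ring

lemma slack_of_osc (hR₀ : 0 < R) (hR₁ : R < 1) (H : Feasible R x)
    (hD : (1 - R + x.lam - 2 * x.ν₂) ^ 2 ≤ 4 * x.ω₂ * (1 - R + x.lam - x.ω₂)) :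
    slack R x = 1 - R - ent (1 - R + x.lam) x.ν₂ - ent (R - x.lam - x.σ) x.ν₁ := by
  rw [slack, mul_biasExponent_of_osc H.ν₂_nonneg (H.ν₂_lt hR₀ hR₁).le H.ω₂_pos (H.ω₂_lt_mu hR₁) hD]
  ring

/-- In the exponential regime the number of samples can be increased by a change of `ω₂`. -/
lemma Strict.exists_slack_pos_of_exp (hR₀ : 0 < R) (hR₁ : R < 1) (H : Strict R x)
    (hS : 0 ≤ slack R x)
    (hD : 4 * x.ω₂ * (1 - R + x.lam - x.ω₂) < (1 - R + x.lam - 2 * x.ν₂) ^ 2) {ε : ℝ} (hε : 0 < ε) :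
    ∃ y, Strict R y ∧ 0 < slack R y ∧ beta R y < beta R x + ε := by
  have hμ : 0 < 1 - R + x.lam := by have := H.lam_pos; linarith
  have hν : x.ν₂ / (1 - R + x.lam) ≤ 1 / 2 :=
    (div_le_iff₀ hμ).2 (by have := H.ν₂_lt hR₀ hR₁; linarith)
  have hω1 : x.ω₂ / (1 - R + x.lam) < 1 := (div_lt_one hμ).2 (H.ω₂_lt_mu hR₁)
  have hω0 := div_pos H.ω₂_pos hμ
  have hne : x.ω₂ / (1 - R + x.lam) ≠ 1 / 2 := by
    intro h0
    rw [div_eq_iff hμ.ne'] at h0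
    have h1 := H.ν₂_lt hR₀ hR₁
    have h2 := H.ν₂_nonneg
    nlinarith
  have hD' : 4 * (x.ω₂ / (1 - R + x.lam)) * (1 - x.ω₂ / (1 - R + x.lam)) <
      (1 - 2 * (x.ν₂ / (1 - R + x.lam))) ^ 2 := by
    have e1 : 1 - 2 * (x.ν₂ / (1 - R + x.lam)) = (1 - R + x.lam - 2 * x.ν₂) / (1 - R + x.lam) := by
      field_simp
    have e2 : 4 * (x.ω₂ / (1 - R + x.lam)) * (1 - x.ω₂ / (1 - R + x.lam)) =
        4 * x.ω₂ * (1 - R + x.lam - x.ω₂) / (1 - R + x.lam) ^ 2 := by field_simp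
    rw [e1, e2, div_pow]
    gcongr
  obtain ⟨b, hb⟩ : ∃ b, ∀ᶠ t in 𝓝[>] (0 : ℝ), h (x.ω₂ / (1 - R + x.lam)) +
      biasExponent (x.ν₂ / (1 - R + x.lam)) (x.ω₂ / (1 - R + x.lam)) <
      h ((x.ω₂ + b * t) / (1 - R + x.lam)) +
      biasExponent (x.ν₂ / (1 - R + x.lam)) ((x.ω₂ + b * t) / (1 - R + x.lam)) := by
    -- In either case ω₂/μ moves towards 1/2; the case above 1/2 is reflected.
    rcases hne.lt_or_gt with hlt | hlt
    · refine ⟨1 - R + x.lam, ?_⟩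
      filter_upwards [eventually_h_add_biasExponent_lt hν hω0 hlt hD'] with t ht
      rwa [add_div, mul_div_cancel_left₀ _ hμ.ne']
    · refine ⟨-(1 - R + x.lam), ?_⟩
      filter_upwards [eventually_h_add_biasExponent_lt (ω := 1 - x.ω₂ / (1 - R + x.lam)) hν
        (by linarith) (by linarith) (by linarith)] with t ht
      have e : 1 - x.ω₂ / (1 - R + x.lam) + t =
        1 - (x.ω₂ + -(1 - R + x.lam) * t) / (1 - R + x.lam) := by field_simp; ring
      rw [e] at ht
      simpa only [h_one_sub, biasExponent_one_sub_right] using ht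
  obtain ⟨t, h1, h2, h3⟩ := (hb.and (H.eventually_move (a := 0) (b := b) le_rfl hε)).exists
  refine ⟨_, h2, ?_, h3⟩
  have hs : slack R (move R x 0 b t) = (1 - R + x.lam) * (h ((x.ω₂ + b * t) / (1 - R + x.lam)) +
      biasExponent (x.ν₂ / (1 - R + x.lam)) ((x.ω₂ + b * t) / (1 - R + x.lam))) - x.lam -
      ent (R - x.lam - x.σ) x.ν₁ := by
    have := slack_eq_mul R (move R x 0 b t)
    simpa [move, RelParams.ofFree] using this
  rw [slack_eq_mul R x] at hS
  rw [hs]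
  have := mul_lt_mul_of_pos_left h1 hμ
  linarith

/-- In the oscillatory regime the number of samples can be increased by a decrease of `λ`. -/
lemma Strict.exists_slack_pos_of_osc (hR₀ : 0 < R) (hR₁ : R < 1) (H : Strict R x)
    (hS : 0 ≤ slack R x)
    (hD : (1 - R + x.lam - 2 * x.ν₂) ^ 2 ≤ 4 * x.ω₂ * (1 - R + x.lam - x.ω₂)) {ε : ℝ} (hε : 0 < ε) :
    ∃ y, Strict R y ∧ 0 < slack R y ∧ beta R y < beta R x + ε := by
  obtain ⟨hτ, hτ0, hτ1⟩ := deltaGV_spec hR₀ hR₁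
  have hlam := H.lam_pos
  have hμ : 0 < 1 - R + x.lam := by linarith
  have hν := H.ν₂_lt hR₀ hR₁
  have hω0 := H.ω₂_pos
  have hω1 := H.ω₂_lt_mu hR₁
  -- In this regime `slack` is 1 − R − ent(μ, ν₂) − ent(R − λ − σ, ν₁). For ν₂ = 0 it is positive
  -- already. Otherwise lowering λ and raising σ by the same amount keeps the last term and strictly
  -- decreases ent(μ, ν₂).
  rcases H.ν₂_nonneg.eq_or_lt with h0 | h0
  · refine ⟨x, H, ?_, by linarith⟩
    rw [slack_of_osc hR₀ hR₁ H.toFeasible hD, ← h0, ent_zero_right]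
    rcases H.ν₁_nonneg.eq_or_lt with h1 | h1
    · rw [← h1, ent_zero_right]; linarith
    · have h2 := ent_lt_ent_left h1 H.ν₁_le (by have := H.σ_nonneg; linarith : R - x.lam - x.σ < 1)
      have h3 : ent 1 x.ν₁ ≤ ent 1 (deltaGV R) := by
        have h4 := H.ν_le
        rw [← h0, add_zero] at h4
        rcases h4.eq_or_lt with h5 | h5
        · rw [h5]
        · exact (ent_strictMonoOn h1.le h5 hτ1.le).le
      rw [ent_one (deltaGV R), hτ] at h3
      linarith
  -- The move must stay oscillatory. The smaller one, c, of ω₂ and μ − ω₂ is kept fixed, which means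
  -- b = 0 or b = −1. On the boundary of the regime 2c < μ − 2ν₂, so the left side decreases faster
  -- than the right side.
  · obtain ⟨b, hb⟩ : ∃ b : ℝ, ∀ᶠ t in 𝓝[>] (0 : ℝ), (1 - R + (x.lam - 1 * t) - 2 * x.ν₂) ^ 2 ≤
        4 * (x.ω₂ + b * t) * (1 - R + (x.lam - 1 * t) - (x.ω₂ + b * t)) := by
      have key : ∀ c, 0 < c → c ≤ (1 - R + x.lam) / 2 →
          (1 - R + x.lam - 2 * x.ν₂) ^ 2 ≤ 4 * c * (1 - R + x.lam - c) →
          ∀ᶠ t in 𝓝[>] (0 : ℝ), (1 - R + x.lam - t - 2 * x.ν₂) ^ 2 ≤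
            4 * c * (1 - R + x.lam - t - c) := by
        intro c hc0 hc1 hc
        rcases hc.eq_or_lt with h1 | h1
        · have h2 : 2 * c < 1 - R + x.lam - 2 * x.ν₂ := by
            by_contra! h3
            nlinarith
          filter_upwards [eventually_lt_nhdsGT (f := fun t => t)
            (g := fun _ => 2 * (1 - R + x.lam - 2 * x.ν₂ - 2 * c)) (by fun_prop) (by fun_prop)
            (by linarith), self_mem_nhdsWithin] with t ht ht0
          have ht0 : 0 < t := ht0
          nlinarith
        · filter_upwards [eventually_lt_nhdsGT (f := fun t => (1 - R + x.lam - t - 2 * x.ν₂) ^ 2)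
            (g := fun t => 4 * c * (1 - R + x.lam - t - c)) (by fun_prop) (by fun_prop)
            (by simpa using h1)] with t ht
          exact ht.le
      rcases le_total x.ω₂ ((1 - R + x.lam) / 2) with h1 | h1
      · refine ⟨0, ?_⟩
        filter_upwards [key x.ω₂ hω0 h1 hD] with t ht
        calc _ = (1 - R + x.lam - t - 2 * x.ν₂) ^ 2 := by ring
          _ ≤ _ := ht
          _ = _ := by ring
      · refine ⟨-1, ?_⟩
        filter_upwards [key (1 - R + x.lam - x.ω₂) (by linarith) (by linarith) (by linarith)]
          with t ht
        calc _ = (1 - R + x.lam - t - 2 * x.ν₂) ^ 2 := by ring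
          _ ≤ _ := ht
          _ = _ := by ring
    obtain ⟨t, h1, ⟨h2, h3⟩, h4, ht⟩ := (hb.and ((H.eventually_move (a := 1) (b := b) zero_le_one
      hε).and ((eventually_lt_nhdsGT (f := fun _ => x.ν₂) (g := fun t => 1 - R + (x.lam - 1 * t))
        (by fun_prop) (by fun_prop) (by simp only [mul_zero, sub_zero]; linarith)).and
        self_mem_nhdsWithin))).exists
    have ht : 0 < t := ht
    refine ⟨_, h2, ?_, h3⟩
    rw [slack_of_osc hR₀ hR₁ h2.toFeasible h1]
    rw [slack_of_osc hR₀ hR₁ H.toFeasible hD] at hS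
    have := ent_lt_ent_left h0 h4.le (by linarith : 1 - R + (x.lam - 1 * t) < 1 - R + x.lam)
    simp only [move, RelParams.ofFree]
    rw [show R - (x.lam - 1 * t) - (x.σ + 1 * t) = R - x.lam - x.σ by ring]
    linarith

/-- A strictly feasible point with a surplus of samples is close to an interior point. -/
lemma Strict.exists_interior (hR₀ : 0 < R) (hR₁ : R < 1) (H : Strict R x) (hS : 0 < slack R x)
    {ε : ℝ} (hε : 0 < ε) : ∃ y, Interior R y ∧ beta R y < beta R x + ε := by
  obtain ⟨hτ, hτ0, hτ1⟩ := deltaGV_spec hR₀ hR₁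
  have hlam := H.lam_pos
  have hμ : 0 < 1 - R + x.lam := by linarith
  have hσ := H.σ_nonneg
  have hσ' := H.σ_le
  have hν₁ := H.ν₁_le
  have hν₁' := H.ν₁_nonneg
  have hν₂ := H.ν₂_nonneg
  have hle := H.le_ν
  have hle' := H.ν_le
  -- For λ = R there is no room for 𝒫 and 𝒩₁; then μ = 1 and ν₂ = τ, and the bound on the bias
  -- exponent gives `slack` ≤ 0.
  have hlt : x.lam < R := by
    by_contra! hcon
    have e1 : x.lam = R := by linarith
    have e2 : x.σ = 0 := by linarith
    have e3 : x.ν₁ = 0 := by linarith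
    have e4 : x.ν₂ = deltaGV R := by linarith
    have b := biasExponent_le hτ0.le (by linarith : deltaGV R ≤ 1) H.ω₂_pos
      (by have := H.ω₂_lt_mu hR₁; linarith)
    rw [slack_eq_mul R x, e1, e2, e3, e4, ent_zero_right, sub_add_cancel, div_one, div_one,
      one_mul] at hS
    linarith
  have hd : 0 < R - x.lam := by linarith
  -- The target divides the positions outside 𝒩₂ equally between 𝒫 and 𝒩₁ and spreads the error
  -- proportionally, so it satisfies all remaining inequalities strictly, and so does every point
  -- after the start of the segment.
  set p : ℝ → RelParams := shift R x ((R - x.lam) / 2) (deltaGV R * ((R - x.lam) / 2))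
    (deltaGV R * (1 - R + x.lam)) with hp
  have hc := continuousOn_slack_shift (s := (R - x.lam) / 2) (v₁ := deltaGV R * ((R - x.lam) / 2))
    H.toFeasible hR₀ hR₁ (v₂ := deltaGV R * (1 - R + x.lam)) (by positivity) (by nlinarith)
  have hp0 : slack R (p 0) = slack R x := by simp [slack, hp, RLPN.shift]
  have hb0 : beta R (p 0) = beta R x := by
    simp [hp, RLPN.shift, beta, nu, rho, gamma₁, gamma₂, gamma₃]
  have hcb : Continuous fun t => beta R (p t) := by
    simp only [beta, nu, gamma₁_eq, gamma₂_eq, gamma₃_eq, rho_eq, hp, RLPN.shift]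
    fun_prop
  have e1 : ∀ᶠ t in 𝓝[>] 0, 0 < slack R (p t) := by
    have h1 : ContinuousWithinAt (fun t => slack R (p t)) (Set.Icc 0 1) 0 := hc 0 ⟨le_rfl, zero_le_one⟩
    have h2 := h1.tendsto.eventually_const_lt (u := 0) (by rw [hp0]; exact hS)
    refine h2.filter_mono ?_
    rw [← nhdsWithin_Ioc_eq_nhdsGT one_pos]
    exact nhdsWithin_mono _ Set.Ioc_subset_Icc_self
  obtain ⟨t, h1, h2, ht1, ht0⟩ := (e1.and ((eventually_lt_nhdsGT hcb continuous_const
    (by rw [hb0]; linarith : beta R (p 0) < beta R x + ε)).and ((eventually_lt_nhdsGT (f := fun t => t)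
    (g := fun _ => 1) (by fun_prop) (by fun_prop) one_pos).and self_mem_nhdsWithin))).exists
  have ht0 : 0 < t := ht0
  have hτd : deltaGV R * ((R - x.lam) / 2) < (R - x.lam) / 2 := by nlinarith
  have hF : Feasible R (p t) := H.toFeasible.shift (by positivity) (by positivity) (by positivity)
    (by linarith) (by linarith) (by nlinarith) (by nlinarith) ht0.le ht1.le
  have ht1' : 0 ≤ 1 - t := by linarith
  have m1 := mul_nonneg ht1' (sub_nonneg.2 hσ')
  have m2 := mul_nonneg ht1' (sub_nonneg.2 hν₁)
  have m3 := mul_nonneg ht1' hν₂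
  have m4 := mul_nonneg ht1' (sub_nonneg.2 hle)
  have m5 := mul_nonneg ht1' (sub_nonneg.2 hle')
  have n1 := mul_pos ht0 hd
  have n2 := mul_pos ht0 (sub_pos.2 hτd)
  have n3 := mul_pos ht0 (mul_pos hτ0 hμ)
  have n4 := mul_pos hτ0 n1
  have n5 : 0 < (1 - deltaGV R) * (t * (R - x.lam)) := mul_pos (by linarith) n1
  refine ⟨p t, ⟨hF, ?_, H.lam₁_lt, H.lam₂_lt, H.π₁_lt_π₂, H.π₂_lt_ω₂, ?_, ?_, ?_, ?_, h1⟩, h2⟩ <;>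
  simp only [hp, RLPN.shift] <;> nlinarith

lemma Feasible.exists_interior (hR₀ : 0 < R) (hR₁ : R < 1) (H : Feasible R x)
    (hπ : x.π₂ ≤ (1 - R + x.lam) / 2) (hS : 0 ≤ slack R x)
    {ε : ℝ} (hε : 0 < ε) : ∃ y, Interior R y ∧ beta R y < beta R x + ε := by
  obtain ⟨y, hy, hyS, hyb⟩ := H.exists_strict hπ (by positivity : 0 < ε / 3)
  obtain ⟨z, hz, hzS, hzb⟩ : ∃ z, Strict R z ∧ 0 < slack R z ∧ beta R z < beta R y + ε / 3 := by
    rcases lt_or_ge (4 * y.ω₂ * (1 - R + y.lam - y.ω₂)) ((1 - R + y.lam - 2 * y.ν₂) ^ 2) with hD | hD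
    · exact hy.exists_slack_pos_of_exp hR₀ hR₁ (hyS ▸ hS) hD (by positivity)
    · exact hy.exists_slack_pos_of_osc hR₀ hR₁ (hyS ▸ hS) hD (by positivity)
  obtain ⟨w, hw, hwb⟩ := hz.exists_interior hR₀ hR₁ hzS (by positivity : 0 < ε / 3)
  exact ⟨w, hw, by linarith⟩

end perturb

/-! ### Reduction to light intermediate words -/

section reduce

variable {R : ℝ} {x : RelParams}

lemma two_mul_le_ent {a b : ℝ} (hb : 0 ≤ b) (hba : b ≤ a / 2) : 2 * b ≤ ent a b := by
  have := ent_add_le (a := 2 * b) (b := b) (a' := a - 2 * b) (b' := 0) hb (by linarith) le_rfl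
    (by linarith)
  have e : ent (2 * b) b = 2 * b := by simpa using ent_half (2 * b)
  rw [e, ent_zero_right, add_zero, add_zero, add_sub_cancel] at this
  exact this

lemma ent_le_of_mem_Icc {a b b' : ℝ} (hb : 0 ≤ b) (h1 : b ≤ b') (h2 : b' ≤ a - b) :
    ent a b ≤ ent a b' := by
  rcases le_total b' (a / 2) with h3 | h3
  · rcases h1.eq_or_lt with h | h
    · rw [h]
    · exact (ent_strictMonoOn hb h h3).le
  · rw [← ent_sub a b']
    rcases (show b ≤ a - b' by linarith).eq_or_lt with h | h
    · rw [← h]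
    · exact (ent_strictMonoOn hb h (by linarith)).le

/-- The maximum of h(x) − 2x is log₂(5/4), attained at 1/5, where the tangent is taken. The bound
1/3 amounts to 5³ ≤ 2⁷. -/
lemma ent_sub_two_mul_le {a b : ℝ} (ha : 0 < a) (hb : 0 ≤ b) (hba : b ≤ a) :
    ent a b - 2 * b ≤ a / 3 := by
  have h1 := h_le_tangent (x := b / a) (by positivity) ((div_le_one ha).2 hba)
    (y := 1 / 5) (by norm_num) (by norm_num)
  have e1 : Real.logb 2 (1 / 5) = -Real.logb 2 5 := by rw [one_div, Real.logb_inv]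
  have e2 : Real.logb 2 (1 - 1 / 5) = 2 - Real.logb 2 5 := by
    rw [show (1 - 1 / 5 : ℝ) = 2 ^ 2 / 5 by norm_num, Real.logb_div (by norm_num) (by norm_num),
      Real.logb_pow, Real.logb_self_eq_one one_lt_two]
    norm_num
  have e3 : Real.logb 2 5 ≤ 7 / 3 := by
    have : Real.logb 2 ((5 : ℝ) ^ 3) ≤ Real.logb 2 ((2 : ℝ) ^ 7) :=
      Real.logb_le_logb_of_le one_lt_two (by norm_num) (by norm_num)
    rw [Real.logb_pow, Real.logb_pow, Real.logb_self_eq_one one_lt_two] at this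
    norm_num at this
    linarith
  rw [e1, e2] at h1
  rw [← mul_h_div]
  have h2 : h (b / a) ≤ 1 / 3 + 2 * (b / a) := by nlinarith
  have h3 := mul_le_mul_of_nonneg_left h2 ha.le
  have h4 : a * (1 / 3 + 2 * (b / a)) = a / 3 + 2 * b := by field_simp
  linarith

/-- For `π₂ > μ / 2` the weight `μ - π₂` is at least as good at the second level, with a suitable
weight `p` at the first level. -/
lemma Feasible.exists_first_weight (H : Feasible R x)
    (hπ : (1 - R + x.lam) / 2 < x.π₂) :
    ∃ p, 1 - R + x.lam - x.π₂ < 2 * p ∧ p ≤ 1 - R + x.lam - x.π₂ ∧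
      1 - R + x.lam - x.π₂ + ent x.π₂ (p - (1 - R + x.lam - x.π₂) / 2) ≤ x.lam₂ ∧
      ent (1 - R + x.lam) p ≤ ent (1 - R + x.lam) x.π₁ ∧
      (x.lam₁ ≤ 1 - R + x.lam - x.π₂ + ent x.π₂ (p - (1 - R + x.lam - x.π₂) / 2) ∨
        (ent (1 - R + x.lam) p - (1 - R + x.lam - x.π₂ +
          ent x.π₂ (p - (1 - R + x.lam - x.π₂) / 2)) ≤ 1 / 2 * ent (1 - R + x.lam) x.π₁ ∧
        2 * ent (1 - R + x.lam) p - (1 - R + x.lam - x.π₂ +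
          ent x.π₂ (p - (1 - R + x.lam - x.π₂) / 2)) - x.lam₂ ≤
          1 / 2 * ent (1 - R + x.lam) x.π₁)) := by
  have s0 := H.lt_π₁
  have s1 := H.lt_π₂
  have s2 := H.rep₁_lt
  have s3 := H.rep₂_lt
  have s4 := H.π₁_le
  have s5 := H.π₂_le
  have s6 := H.lam₁_le
  have s7 := H.ω₂_lt
  have hμ : 0 < 1 - R + x.lam := by linarith [H.ω₂_pos]
  have hlam₁ := H.lam₁_eq
  set μ := 1 - R + x.lam with hμd
  obtain ⟨c, hc⟩ : ∃ c, c = μ - x.π₂ := ⟨_, rfl⟩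
  have hc0 : 0 < c := by linarith [H.ω₂_pos]
  rw [← hc]
  rw [← hc] at hlam₁
  have hE : ent μ (min x.π₁ c) ≤ ent μ x.π₁ := by
    rcases le_total x.π₁ c with h1 | h1
    · rw [min_eq_left h1]
    · rw [min_eq_right h1]
      exact ent_le_of_mem_Icc hc0.le h1 (by linarith)
  have hmin : c < 2 * min x.π₁ c := by
    rcases le_total x.π₁ c with h1 | h1
    · rw [min_eq_left h1]; linarith
    · rw [min_eq_right h1]; linarith
  -- The candidate is min(π₁, c). If its λ₁ would exceed λ₂, a smaller p with λ₁ = λ₂ is taken by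
  -- continuity.
  rcases lt_or_ge x.lam₂ (c + ent x.π₂ (min x.π₁ c - c / 2)) with hΛ | hΛ
  · have hcont : Continuous fun p => c + ent x.π₂ (p - c / 2) := by fun_prop
    obtain ⟨p, ⟨hp1, hp2⟩, hp⟩ := intermediate_value_Icc (by linarith : c / 2 ≤ min x.π₁ c)
      hcont.continuousOn (show x.lam₂ ∈ Set.Icc _ _ by
        refine ⟨?_, hΛ.le⟩
        simp only [sub_self, ent_zero_right, add_zero]
        linarith)
    simp only at hp
    have hp3 : c / 2 < p := by
      refine lt_of_le_of_ne hp1 fun h0 => ?_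
      rw [← h0, sub_self, ent_zero_right, add_zero] at hp
      linarith
    refine ⟨p, by linarith, hp2.trans (min_le_right _ _), hp.le, ?_, .inl (by linarith)⟩
    refine (ent_le_of_mem_Icc (by linarith) hp2 ?_).trans hE
    have := min_le_right x.π₁ c
    linarith
  · refine ⟨min x.π₁ c, hmin, min_le_right _ _, hΛ, hE, ?_⟩
    rcases le_or_gt x.π₁ c with h1 | h1
    · left
      rw [min_eq_left h1, hlam₁]
      -- Superadditivity, with a second block of length π₂ − c at half weight, shows that the new λ₁
      -- is not below the old one.
      have := ent_add_le (a := c) (b := x.π₁ - x.π₂ / 2) (a' := x.π₂ - c) (b' := (x.π₂ - c) / 2)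
        (by linarith) (by linarith) (by linarith) (by linarith)
      rw [ent_half, show c + (x.π₂ - c) = x.π₂ by ring,
        show x.π₁ - x.π₂ / 2 + (x.π₂ - c) / 2 = x.π₁ - c / 2 by ring] at this
      linarith
    -- Here p = c and the new λ₁ may be smaller than the old one. All costs are nevertheless below
    -- that of the initial lists: π₁ lies in [μ/3, 2μ/3], so ent(μ, π₁) ≥ 2μ/3, while ent(μ, c) − 2c
    -- ≤ μ/3.
    · right
      rw [min_eq_right h1.le, sub_half] at hΛ ⊢
      rw [min_eq_right h1.le] at hE
      have k1 : 1 / 2 * ent μ c ≤ ent x.π₂ (c / 2) := by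
        rw [← ent_mul]
        have := ent_le_ent_left (b := c / 2) (a := μ / 2) (a' := x.π₂) (by linarith) (by linarith)
          hπ.le
        convert this using 2 <;> ring
      have k2 := ent_sub_two_mul_le hμ hc0.le (by linarith : c ≤ μ)
      have k3 : 2 * (μ / 3) ≤ ent μ x.π₁ := by
        refine (two_mul_le_ent (by linarith) (by linarith)).trans
          (ent_le_of_mem_Icc (by linarith) ?_ ?_)
        · rcases le_total x.π₂ (2 * μ / 3) with h | h <;> linarith
        · rcases le_total x.π₂ (2 * μ / 3) with h | h <;> linarith
      constructor <;> linarith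

/-- Replacing π₂ by μ − π₂ changes neither λ₂ nor γ₃, by the symmetry of the entropy, nor `slack`.
The lemma on the first weight controls γ₁ and γ₂. -/
lemma Feasible.exists_light (H : Feasible R x) :
    ∃ y, Feasible R y ∧ y.π₂ ≤ (1 - R + y.lam) / 2 ∧ slack R y = slack R x ∧ beta R y ≤ beta R x := by
  rcases le_or_gt x.π₂ ((1 - R + x.lam) / 2) with hπ | hπ
  · exact ⟨x, H, hπ, rfl, le_rfl⟩
  obtain ⟨p, hp1, hp2, hp3, hp4, hp5⟩ := H.exists_first_weight hπ
  have s1 := H.lt_π₂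
  have s3 := H.rep₂_lt
  have s5 := H.π₂_le
  set y : RelParams := { x with
    π₁ := p
    π₂ := 1 - R + x.lam - x.π₂
    lam₁ := 1 - R + x.lam - x.π₂ + ent x.π₂ (p - (1 - R + x.lam - x.π₂) / 2) } with hy
  have hF : Feasible R y := by
    refine ⟨H.σ_nonneg, H.ν₁_nonneg, H.ν₂_nonneg, H.σ_le, hp3, H.lam₂_le, hp2, ?_, H.ν₁_le, H.le_ν,
      H.ν_le, hp1, ?_, ?_, ?_, H.ω₁_eq, ?_, ?_⟩ <;> simp only [hy]
    · linarith
    · linarith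
    · linarith
    · linarith
    · rw [sub_sub_cancel]
    · rw [H.lam₂_eq, ← ent_sub, show 1 - R + x.lam - x.ω₂ - (x.π₂ - x.ω₂ / 2) =
        1 - R + x.lam - x.π₂ - x.ω₂ / 2 by ring]
  refine ⟨y, hF, ?_, rfl, ?_⟩
  · simp only [hy]; linarith
  · have hnu : nu R y ≤ nu R x := by
      simp only [nu, gamma₁_eq, gamma₂_eq, gamma₃_eq, hy, ent_sub]
      set E := ent (1 - R + x.lam) x.π₁
      set L := 1 - R + x.lam - x.π₂ + ent x.π₂ (p - (1 - R + x.lam - x.π₂) / 2)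
      refine max_le (max_le ?_ ?_) (max_le ?_ ?_)
      · exact le_max_of_le_left (le_max_of_le_left (by linarith))
      · rcases hp5 with h | h
        · exact le_max_of_le_left (le_max_of_le_right (by linarith))
        · exact le_max_of_le_left (le_max_of_le_left h.1)
      · rcases hp5 with h | h
        · exact le_max_of_le_right (le_max_of_le_left (by linarith))
        · exact le_max_of_le_left (le_max_of_le_left h.2)
      · exact le_max_of_le_right (le_max_right _ _)
    exact add_le_add (max_le_max le_rfl hnu) le_rfl

lemma exists_interior_of_inRegion (hR₀ : 0 < R) (hR₁ : R < 1) (hx : x ∈ region R) {ε : ℝ}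
    (hε : 0 < ε) : ∃ y, Interior R y ∧ beta R y < beta R x + ε := by
  obtain ⟨H, hS⟩ := (inRegion_iff hR₀ hR₁).1 hx
  obtain ⟨y, hy, hyπ, hyS, hyb⟩ := H.exists_light
  obtain ⟨z, hz, hzb⟩ := hy.exists_interior hR₀ hR₁ hyπ (hyS.trans hS).ge hε
  exact ⟨z, hz, by linarith⟩

/-- With λ = R, σ = ν₁ = 0 and ν₂ = τ one has μ = 1. The choice ω₂ = 1/2 − √(τ(1 − τ)) lies on the
boundary of the oscillatory regime, so `slack` = 1 − R − h(τ) = 0. The estimate h(τ) < 1/2 + √(τ(1 −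
τ)) says ω₂ < R, which leaves room for ω₂ < λ₂ ≤ λ. -/
lemma region_nonempty (hR₀ : 0 < R) (hR₁ : R < 1) : (region R).Nonempty := by
  obtain ⟨hτ, hτ0, hτ1⟩ := deltaGV_spec hR₀ hR₁
  have hl := h_lt_half_add_sqrt hτ0 hτ1
  set q := √(deltaGV R * (1 - deltaGV R)) with hq
  have hq2 : q ^ 2 = deltaGV R * (1 - deltaGV R) :=
    Real.sq_sqrt (mul_nonneg hτ0.le (by linarith))
  have hq0 : 0 < q := Real.sqrt_pos.2 (mul_pos hτ0 (by linarith))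
  have hq1 : q < 1 / 2 := by nlinarith
  obtain ⟨ω, hω⟩ : ∃ ω, ω = 1 / 2 - q := ⟨_, rfl⟩
  have hωR : ω < R := by linarith
  -- The weights are π₂ = ω₂/2 + a and π₁ = π₂/2 + b. For a, b → 0 the entropy terms of λ₂ and λ₁
  -- vanish, so small values give λ₂ < R and then λ₁ < λ₂.
  obtain ⟨a, a1, a2, ha⟩ := ((eventually_lt_nhdsGT
    (f := fun t => ω + ent (1 - R + R - ω) (ω / 2 + t - ω / 2)) (g := fun _ => R) (by fun_prop)
    (by fun_prop) (by simpa using hωR)).and ((eventually_lt_nhdsGT (f := fun t => ω / 2 + t)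
    (g := fun _ => ω) (by fun_prop) (by fun_prop) (by linarith)).and self_mem_nhdsWithin)).exists
  have ha : 0 < a := ha
  have hpos : 0 < ent (1 - R + R - ω) (ω / 2 + a - ω / 2) := ent_pos (by linarith) (by linarith)
  obtain ⟨b, b1, b2, hb⟩ := ((eventually_lt_nhdsGT
    (f := fun t => ω / 2 + a + ent (1 - R + R - (ω / 2 + a)) ((ω / 2 + a) / 2 + t - (ω / 2 + a) / 2))
    (g := fun _ => ω + ent (1 - R + R - ω) (ω / 2 + a - ω / 2)) (by fun_prop)
    (by fun_prop) (by simp only [add_zero, sub_self, ent_zero_right]; linarith)).and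
    ((eventually_lt_nhdsGT (f := fun t => (ω / 2 + a) / 2 + t)
    (g := fun _ => ω / 2 + a) (by fun_prop) (by fun_prop) (by linarith)).and
    self_mem_nhdsWithin)).exists
  have hb : 0 < b := hb
  have hF : Feasible R (.ofFree R 0 0 (deltaGV R) R ((ω / 2 + a) / 2 + b) (ω / 2 + a) ω) := by
    refine ⟨le_rfl, le_rfl, hτ0.le, ?_, b1.le, a1.le, b2.le, a2.le, ?_, ?_, ?_, ?_, ?_, ?_, ?_, rfl,
      rfl, rfl⟩ <;> simp only [RelParams.ofFree] <;> linarith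
  refine ⟨_, (inRegion_iff hR₀ hR₁).2 ⟨hF, ?_⟩⟩
  rw [slack_of_osc hR₀ hR₁ hF (by simp only [RelParams.ofFree]; nlinarith)]
  simp [RelParams.ofFree, ent_one, hτ]

end reduce

end RLPN

/-! ### The complexity exponent as the infimum of β over the region. -/

theorem mainTheorem10 (R : ℝ) (hR₀ : 0 < R) (hR₁ : R < 1)
    (k : ℕ → ℕ) (e : ∀ n, RLPN.Word n)
    (hk : Filter.Tendsto (fun n => (k n : ℝ) / n) Filter.atTop (nhds R))
    (ht : Filter.Tendsto (fun n => (hammingNorm (e n) : ℝ) / n) Filter.atTop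
      (nhds (RLPN.deltaGV R))) :
    ∃ α : ℝ, IsGLB (RLPN.beta R '' RLPN.region R) α ∧
      RLPN.complexityExponent R k e = (α : EReal) := by
  have hne : (RLPN.beta R '' RLPN.region R).Nonempty := (RLPN.region_nonempty hR₀ hR₁).image _
  have hbdd : BddBelow (RLPN.beta R '' RLPN.region R) := by
    refine ⟨0, ?_⟩
    rintro _ ⟨x, hx, rfl⟩
    exact ((RLPN.inRegion_iff hR₀ hR₁).1 hx).1.beta_nonneg hR₀ hR₁
  have hglb := isGLB_csInf hne hbdd
  refine ⟨_, hglb, le_antisymm ?_ ?_⟩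
  -- Upper bound: a point of the region with β < z is replaced by an interior point whose β is still
  -- below z.
  · refine EReal.le_of_forall_lt_iff_le.1 fun z hz => ?_
    obtain ⟨_, ⟨x, hx, rfl⟩, hxz⟩ := (csInf_lt_iff hbdd hne).1 (EReal.coe_lt_coe_iff.1 hz)
    obtain ⟨y, hy, hyb⟩ := RLPN.exists_interior_of_inRegion hR₀ hR₁ hx (sub_pos.2 hxz)
    obtain ⟨θ, hθ, hlim⟩ := hy.exists_admissible hR₀ hR₁ hk ht
    refine le_trans ?_ (hlim.trans (EReal.coe_le_coe_iff.2 (by linarith)))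
    exact sInf_le ⟨θ, hθ, rfl⟩
  -- Lower bound: the exponent of every admissible family dominates β at some point of the region.
  · refine le_sInf ?_
    rintro _ ⟨θ, hθ, rfl⟩
    obtain ⟨y, hy, hle⟩ := RLPN.exists_inRegion_of_admissible hR₀ hR₁ hk ht hθ
    exact (EReal.coe_le_coe_iff.2 (hglb.1 ⟨y, hy, rfl⟩)).trans hle
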